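/- **Setting.** Let $q$ be a real function in $W_2^1[0,1]$ (absolutely continuous with derivative in $L^2(0,1)$) and $h\in\mathbb R$. A number $\lambda\in\mathbb C$ is a *transmission eigenvalue* of $R(q,h)$ if there are nontrivial solutions $\psi,\psi_0$ on $[0,1]$ of $$-\psi''+q\psi=\lambda\psi,\quad -\psi_0''=\lambda\psi_0,\quad \psi'(0)=h\psi(0),\quad \psi_0'(0)=h\psi_0(0),\quad \psi_0(1)=\psi(1),\quad \psi_0'(1)=\psi'(1).$$ Let $f(k,\cdot)$ solve $-f''+qf=k^2f$ on $[0,1]$ with $f(k,1)=e^{ik}$, $f'(k,1)=ike^{ik}$, put $F(k)=-i[f'(k,0)-hf(k,0)]$ and $$D(k)=\tfrac1{2i}[F(k)+F(-k)]-\tfrac h{2k}[F(k)-F(-k)]\qquad(\text{with its limit as value at } k=0).$$ $D$ is even, and $\Delta(k^2):=D(k)$ is the characteristic function; the multiplicity of a transmission eigenvalue is its order as a zero of $\Delta$. Let $\omega=\int_0^1q(t)\,dt$ and $$g_1(k)=4ik\omega+q(1)(e^{2ik}-e^{-2ik}),\qquad Q_1=q'(1)-q(1)\omega-4hq(1),$$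 $$Q_2=-q'(0)+\int_0^1q^2(t)\,dt+q(0)\omega-\frac{\omega^3}6+4h[q(0)+\omega h]$$ ($Q_1$ and $Q_2$ are used only if $q\in W_2^2[0,1]$, i.e. $q'\in W_2^1[0,1]$, and $Q_2$ only if $\omega=0$). Zeros and eigenvalues are counted with multiplicity, and $\sqrt{\cdot}$ is the principal square root. **Theorem.** Let $q\in W_2^1[0,1]$ and $q(1)\neq0$. (i) Let $\omega\ne0$, and put $m=1$ if $q(1)/\omega<0$, $m=0$ if $q(1)/\omega>0$. The zeros of $g_1(k)/k$ can be numbered as $\{\pm\mu_n\}_{n\ge0}\cup\{\pm\mu_n^*\}_{n\ge m}$ with ${\rm Re}\,\mu_n\ge0$, ${\rm Im}\,\mu_n\ge0$, where $\mu_n^*$ is the complex conjugate of $\mu_n$ unless both $\mu_n$ and $\mu_n^*$ lie on the coordinate axes, so that, as $n\to\infty$, $${\rm Re}\,\mu_n=(n+\theta)\pi-\frac{\log(2n\pi)-\log a}{4n\pi}+O\Big(\frac{\log^2n}{n^2}\Big),\qquad {\rm Im}\,\mu_n=\frac12\Big[\log(2n\pi)-\log a+\frac{\theta}{n}\Big]+O\Big(\frac{\log^2n}{n^2}\Big),$$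 where $\theta=\frac14$, $a=-\frac{q(1)}{2\omega}$ if $q(1)/\omega<0$, and $\theta=\frac34$, $a=\frac{q(1)}{2\omega}$ if $q(1)/\omega>0$. The transmission eigenvalues of $R(q,h)$ can be numbered as $\{\lambda_n\}_{n\ge0}\cup\{\lambda_n^*\}_{n\ge m}$, where $\lambda_n^*$ is the complex conjugate of $\lambda_n$ unless both $\lambda_n$ and $\lambda_n^*$ are real, so that $$\sqrt{\lambda_n}=\mu_n+\varepsilon_n\quad(n\ge0),\qquad \{\varepsilon_n\}\in l^2,$$ and, if moreover $q\in W_2^2[0,1]$, for the same numbering $$\sqrt{\lambda_n}=\mu_n-\frac{Q_1}{4n\pi q(1)}+\frac{\beta_n}{n}\quad(n\ge1),\qquad \{\beta_n\}\in l^2.$$ (ii) Let $\omega=0$. The transmission eigenvalues of $R(q,h)$ can be numbered as $\{\lambda_n\}_{n\ge1}$ so that $$\sqrt{\lambda_n}=\frac{n\pi}2+\alpha_n\quad(n\ge1),\qquad \{\alpha_n\}\in l^2,$$ and, if moreover $q\in W_2^2[0,1]$, for the same numbering $$\sqrt{\lambda_n}=\frac{n\pi}2-\frac{Q_1+(-1)^nQ_2}{2q(1)n\pi}+\frac{\kappa_n}{n}\quad(n\ge1),\qquad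 \{\kappa_n\}\in l^2.$$ -/

import Mathlib

open MeasureTheory Filter Topology Asymptotics

noncomputable section

namespace TransmissionProblem

/-- `q` belongs to `W_2^1[0,1]` (in its continuous representative): on `[0,1]` it is a primitive
of a square integrable function. Values of `q` outside `[0,1]` play no role. -/
def SobolevOne (q : ℝ → ℝ) : Prop :=
  ∃ p : ℝ → ℝ, MemLp p 2 (volume.restrict (Set.Icc (0 : ℝ) 1)) ∧
    ∀ x ∈ Set.Icc (0 : ℝ) 1, q x = q 0 + ∫ t in (0 : ℝ)..x, p t

/-- `q` belongs to `W_2^2[0,1]`: on `[0,1]` it is a primitive of a function in `W_2^1[0,1]`. -/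
def SobolevTwo (q : ℝ → ℝ) : Prop :=
  ∃ p : ℝ → ℝ, SobolevOne p ∧
    ∀ x ∈ Set.Icc (0 : ℝ) 1, q x = q 0 + ∫ t in (0 : ℝ)..x, p t

/-- `ψ` solves `-ψ'' + q ψ = lam ψ` on `[0,1]` and `dψ` is its derivative: `ψ` and `dψ` are
(absolutely) continuous on `[0,1]` with `ψ' = dψ` and `dψ' = (q - lam) ψ`, in integrated form. -/
structure IsSolution (q : ℝ → ℝ) (lam : ℂ) (ψ dψ : ℝ → ℂ) : Prop where
  cont : ContinuousOn ψ (Set.Icc 0 1)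
  cont_deriv : ContinuousOn dψ (Set.Icc 0 1)
  eq_integral : ∀ x ∈ Set.Icc (0 : ℝ) 1, ψ x = ψ 0 + ∫ t in (0 : ℝ)..x, dψ t
  eq_integral_deriv : ∀ x ∈ Set.Icc (0 : ℝ) 1,
    dψ x = dψ 0 + ∫ t in (0 : ℝ)..x, ((q t : ℂ) - lam) * ψ t

/-- `lam` is a transmission eigenvalue of the problem `R(q,h)`: there is a pair of nontrivial
solutions of the perturbed and of the free equation which satisfy the boundary condition
`ψ'(0) = h ψ(0)` and have the same Cauchy data at `x = 1`. -/
def IsTransmissionEigenvalue (q : ℝ → ℝ) (h : ℝ) (lam : ℂ) : Prop :=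
  ∃ ψ dψ ψ₀ dψ₀ : ℝ → ℂ,
    IsSolution q lam ψ dψ ∧ IsSolution (fun _ => 0) lam ψ₀ dψ₀ ∧
    dψ 0 - h * ψ 0 = 0 ∧ dψ₀ 0 - h * ψ₀ 0 = 0 ∧
    ψ₀ 1 = ψ 1 ∧ dψ₀ 1 = dψ 1 ∧
    (∃ x ∈ Set.Icc (0 : ℝ) 1, ψ x ≠ 0) ∧ (∃ x ∈ Set.Icc (0 : ℝ) 1, ψ₀ x ≠ 0)

/-- The Jost solution `f(k,·)` together with its derivative: the solution of
`-f'' + q f = k² f` on `[0,1]` with `f(k,1) = e^{ik}` and `f'(k,1) = i k e^{ik}`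
(determined uniquely on `[0,1]`). -/
def jost (q : ℝ → ℝ) (k : ℂ) : (ℝ → ℂ) × (ℝ → ℂ) :=
  Classical.epsilon fun p : (ℝ → ℂ) × (ℝ → ℂ) =>
    IsSolution q (k ^ 2) p.1 p.2 ∧
      p.1 1 = Complex.exp (Complex.I * k) ∧
      p.2 1 = Complex.I * k * Complex.exp (Complex.I * k)

/-- `F(k) = -i [f'(k,0) - h f(k,0)]`. -/
def jostF (q : ℝ → ℝ) (h : ℝ) (k : ℂ) : ℂ :=
  -Complex.I * ((jost q k).2 0 - h * (jost q k).1 0)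

/-- `D(k) = (1/2i) [F(k) + F(-k)] - (h/2k) [F(k) - F(-k)]`, where for `k = 0` the quotient
`[F(k) - F(-k)] / (2k)` is read as its limit `F'(0)`: `dslope F (-k) k` is the difference
quotient of `F` between `-k` and `k`, and `F'(0)` for `k = 0`. -/
def charD (q : ℝ → ℝ) (h : ℝ) (k : ℂ) : ℂ :=
  1 / (2 * Complex.I) * (jostF q h k + jostF q h (-k)) - h * dslope (jostF q h) (-k) k

/-- The principal square root: real part `≥ 0`, and imaginary part `≥ 0` if the real part is `0`. -/
def csqrt (z : ℂ) : ℂ := z ^ (1 / 2 : ℂ)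

/-- The characteristic function `Δ(λ) = D(k)`, `λ = k²` (`D` is even, so the choice of the root
does not matter). -/
def charDelta (q : ℝ → ℝ) (h : ℝ) (lam : ℂ) : ℂ := charD q h (csqrt lam)

/-- The number of indices `n ∈ s` with `u n = z`. -/
def count (s : Set ℕ) (u : ℕ → ℂ) (z : ℂ) : ℕ∞ := {n | n ∈ s ∧ u n = z}.encard

/-- `ω = ∫₀¹ q`. -/
def omega (q : ℝ → ℝ) : ℝ := ∫ t in (0 : ℝ)..1, q t

/-- `q'(x)`, one-sided at the end points of `[0,1]`. -/
def dq (q : ℝ → ℝ) (x : ℝ) : ℝ := derivWithin q (Set.Icc 0 1) x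

/-- `Q₁ = q'(1) - q(1) ω - 4 h q(1)`. -/
def Q₁ (q : ℝ → ℝ) (h : ℝ) : ℝ := dq q 1 - q 1 * omega q - 4 * h * q 1

/-- `Q₂ = -q'(0) + ∫₀¹ q² + q(0) ω - ω³/6 + 4 h [q(0) + ω h]`
(used only for potentials with `ω = 0`). -/
def Q₂ (q : ℝ → ℝ) (h : ℝ) : ℝ :=
  -dq q 0 + (∫ t in (0 : ℝ)..1, q t ^ 2) + q 0 * omega q - omega q ^ 3 / 6
    + 4 * h * (q 0 + omega q * h)

/-- The leading function `g₁(k) = 4 i k ω + q(1) (e^{2ik} - e^{-2ik})`. -/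
def g₁ (q : ℝ → ℝ) (k : ℂ) : ℂ :=
  4 * Complex.I * k * omega q
    + q 1 * (Complex.exp (2 * Complex.I * k) - Complex.exp (-2 * Complex.I * k))

/-- The index set of the starred families: `n ≥ 1` if `q(1)/ω < 0` and `n ≥ 0` otherwise. -/
def starIndices (q : ℝ → ℝ) : Set ℕ := {n | q 1 / omega q < 0 → 1 ≤ n}

/-- The asymptotics
`Re μ_n = (n + θ) π - (log (2nπ) - log a) / (4nπ) + O(log² n / n²)`,
`Im μ_n = (1/2) [log (2nπ) - log a + θ / n] + O(log² n / n²)`. -/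
def LogAsymptotics (θ a : ℝ) (μ : ℕ → ℂ) : Prop :=
  ((fun n : ℕ => (μ n).re - ((n + θ) * Real.pi
      - (Real.log (2 * n * Real.pi) - Real.log a) / (4 * n * Real.pi)))
    =O[atTop] fun n : ℕ => Real.log n ^ 2 / (n : ℝ) ^ 2) ∧
  ((fun n : ℕ => (μ n).im - 1 / 2 * (Real.log (2 * n * Real.pi) - Real.log a + θ / n))
    =O[atTop] fun n : ℕ => Real.log n ^ 2 / (n : ℝ) ^ 2)

/-- `μ` and `μs` (the latter with indices in `starIndices q`) number the zeros of `g₁(k) / k`, with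
multiplicities, as `{±μ_n} ∪ {±μ_n^*}`, where `μ_n` lies in the closed first quadrant and `μ_n^*`
is its complex conjugate, unless both numbers lie on the coordinate axes. The zeros of `g₁` are
those of `g₁(k) / k` together with one more zero `0`. -/
structure NumbersLeadingZeros (q : ℝ → ℝ) (μ μs : ℕ → ℂ) : Prop where
  multiplicity : ∀ z : ℂ, analyticOrderAt (g₁ q) z =
    count Set.univ μ z + count Set.univ (fun n => -μ n) z
      + count (starIndices q) μs z + count (starIndices q) (fun n => -μs n) z
      + (if z = 0 then 1 else 0)
  quadrant : ∀ n, 0 ≤ (μ n).re ∧ 0 ≤ (μ n).im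
  conjugate : ∀ n ∈ starIndices q, μs n = (starRingEnd ℂ) (μ n) ∨
    ((μ n ^ 2).im = 0 ∧ (μs n ^ 2).im = 0)

/-- `lam` (indices in `s`) and `lams` (indices in `t`) together number all transmission
eigenvalues of `R(q,h)`, each one as often as its multiplicity, which is its order as a zero of
the characteristic function. -/
structure NumbersEigenvalues (q : ℝ → ℝ) (h : ℝ) (s t : Set ℕ) (lam lams : ℕ → ℂ) : Prop where
  range_eq : ∀ z : ℂ, IsTransmissionEigenvalue q h z ↔
    (∃ n ∈ s, lam n = z) ∨ (∃ n ∈ t, lams n = z)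
  multiplicity : ∀ z : ℂ, analyticOrderAt (charDelta q h) z = count s lam z + count t lams z

end TransmissionProblem

end

/-!
With `z = 2 k` and `λ = z ^ 2 / 4`, the characteristic function is the Wronskian at `1` of the
solutions of the perturbed and the free equation with the Robin conditions at `0` (`charD_eq`). Hence
`Δ` is entire and real on the real axis (`differentiable_charDelta`, `charDelta_conj`), and its zeros
are the transmission eigenvalues (`isTransmissionEigenvalue_iff`). The Wronskian is the integral of `q`
times the product of the two solutions. The product satisfies a third order equation (`IsProduct`), and
integrations by parts yield the asymptotics of `Δ` for `q` with one derivative (`isBigO_charDelta`) and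
with two derivatives (`isBigO_charDelta_sub`). After normalisation by `2 / q(1)`, they read

  `z Φ(z ^ 2 / 4) = sin z - c z + E(z)`,  `c = -ω / q(1)`,

where `E` is bounded by exponential integrals of an `L²` function and `exp |Im z| / |z|`
(`SobolevOne.exists_norm_sinError_le`, `SobolevTwo.exists_norm_sinError_sub_le`). The function `g₁` has
the same form with `E = 0` (`g₁_eq`), so that both families are treated at once.

*Numbering.* Comparison with `sin z - c z` by Rouché's theorem on large circles gives the number of
zeros of `Φ` in large discs. For `c ≠ 0`, there is one zero near each large `leadApprox c n`, an
approximate root of `sin z = c z` on a logarithmic curve in the upper half plane. Together with the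
complex conjugates, and with the finitely many remaining zeros, which are real or occur in conjugate
pairs, this is the numbering (`SinAsymptotics.exists_numbering`). For `c = 0` the zeros are near `π n`
(`SinAsymptotics.exists_numbering_zero`).

*Asymptotics for `ω ≠ 0`.* The equation is solved for the growing exponential `exp (-I z)` and compared
with its value at `leadApprox c n`. This bounds the correction of a zero and, to first order, the
influence of `E` on it (`SolvesSin.exists_norm_le`, `SolvesSin.exists_norm_sub_le`); for `E = 0` it
gives the logarithmic asymptotics of `μ` (`SolvesSin.logAsymptotics`). The error terms are in `ℓ²`
because exponential integrals of an `L²` function are square summable along the logarithmic curve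
(`summable_sq_norm_integral_leadApprox`): the decaying factor `e^{-y x}` has a Fourier series on `[0, 1]`
with nonnegative coefficients of sum `1`, and for `y = log (A n)`, after a shift by `2 n`, the sums of
the coefficients over `n` are bounded. So the values on the curve are averages of Fourier coefficients.

*Asymptotics for `ω = 0`.* Here `sin` of the correction equals the error up to the sign, and the
exponential integrals near `π n` are controlled by Bessel's inequality
(`SobolevOne.memlp_of_sin_add_eq_zero`, `SobolevTwo.memlp_natCast_mul_of_sin_add_eq_zero`).
-/

namespace TransmissionProblem

/-! ### Zeros of entire functions and Rouché's theorem on circles -/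

/-- `M` lists the zeros of `f` in the open disc `|z| < R`, each one as often as its order, and there
are no zeros on the bounding circle. -/
structure IsZeroMultiset (f : ℂ → ℂ) (R : ℝ) (M : Multiset ℂ) : Prop where
  norm_lt : ∀ a ∈ M, ‖a‖ < R
  order_eq : ∀ z : ℂ, ‖z‖ ≤ R → analyticOrderAt f z = M.count z

lemma differentiable_dslope {f : ℂ → ℂ} (hf : Differentiable ℂ f) (a : ℂ) :
    Differentiable ℂ (dslope f a) := by
  have := (Complex.differentiableOn_dslope (f := f) (c := a) (s := Set.univ) Filter.univ_mem).2
    hf.differentiableOn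
  exact differentiableOn_univ.1 this

lemma eq_sub_mul_dslope {f : ℂ → ℂ} {a : ℂ} (h : f a = 0) (z : ℂ) :
    f z = (z - a) * dslope f a z := by
  have := sub_smul_dslope f a z
  rw [h, sub_zero, smul_eq_mul] at this
  exact this.symm

lemma analyticOrderAt_sub_self_eq (a : ℂ) : analyticOrderAt (fun z : ℂ => z - a) a = 1 := by
  exact analyticOrderAt_id_sub_const_self

lemma IsZeroMultiset.ne_zero_of_norm_eq {f : ℂ → ℂ} (hf : Differentiable ℂ f) {R : ℝ}
    {M : Multiset ℂ} (h : IsZeroMultiset f R M) {z : ℂ} (hz : ‖z‖ = R) : f z ≠ 0 := by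
  have h1 := h.order_eq z hz.le
  have h2 : z ∉ M := fun hm => (h.norm_lt z hm).ne hz
  rw [Multiset.count_eq_zero_of_notMem h2, Nat.cast_zero,
    (hf.analyticAt z).analyticOrderAt_eq_zero] at h1
  exact h1

/-- The argument principle for a circle around `0`. -/
lemma IsZeroMultiset.circleIntegral_logDeriv {R : ℝ} (hR : 0 < R) {M : Multiset ℂ} :
    ∀ {f : ℂ → ℂ}, Differentiable ℂ f → IsZeroMultiset f R M →
      (∮ z in C(0, R), logDeriv f z) = 2 * Real.pi * Complex.I * Multiset.card M := by
  -- Zeros are split off one at a time: `f = (z - a) g`, where `g = dslope f a` has the zeros listed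
  -- in `M`.
  induction M using Multiset.induction with
  | empty =>
    intro f hf h
    have hne : ∀ z ∈ Metric.closedBall (0 : ℂ) R, f z ≠ 0 := by
      intro z hz
      have h1 := h.order_eq z (by simpa using hz)
      rw [Multiset.count_zero, Nat.cast_zero, (hf.analyticAt z).analyticOrderAt_eq_zero] at h1
      exact h1
    simp only [Multiset.card_zero, Nat.cast_zero, mul_zero]
    refine Complex.circleIntegral_eq_zero_of_differentiable_on_off_countable hR.le
      Set.countable_empty ?_ ?_
    · intro z hz
      exact ((hf.contDiff (n := 1).continuous_deriv le_rfl).continuousAt.div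
        hf.continuous.continuousAt (hne z hz)).continuousWithinAt
    · intro z hz
      exact ((hf.deriv z).div (hf z) (hne z (Metric.ball_subset_closedBall hz.1)))
  | cons a M ih =>
    intro f hf h
    have ha : ‖a‖ < R := h.norm_lt a (Multiset.mem_cons_self a M)
    have hfa : f a = 0 := by
      have h1 := h.order_eq a ha.le
      apply apply_eq_zero_of_analyticOrderAt_ne_zero
      rw [h1, Multiset.count_cons_self]
      exact_mod_cast Nat.succ_ne_zero (M.count a)
    set g := dslope f a with hg
    have hgd : Differentiable ℂ g := differentiable_dslope hf a
    have hfg : f = (fun z => z - a) * g := by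
      ext z; exact eq_sub_mul_dslope hfa z
    have hgM : IsZeroMultiset g R M := by
      refine ⟨fun b hb => h.norm_lt b (Multiset.mem_cons_of_mem hb), fun z hz => ?_⟩
      have h1 := h.order_eq z hz
      rw [hfg, analyticOrderAt_mul (by fun_prop) (hgd.analyticAt z)] at h1
      by_cases hza : z = a
      · subst hza
        rw [analyticOrderAt_sub_self_eq, Multiset.count_cons_self, Nat.cast_succ, add_comm] at h1
        exact (ENat.add_left_injective_of_ne_top ENat.one_ne_top) h1
      · have h3 : analyticOrderAt (fun z : ℂ => z - a) z = 0 :=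
          (AnalyticAt.analyticOrderAt_eq_zero (by fun_prop)).2 (sub_ne_zero.2 hza)
        rwa [Multiset.count_cons_of_ne hza, h3, zero_add] at h1
    have hsub : ∀ z ∈ Metric.sphere (0 : ℂ) R, z - a ≠ 0 := by
      intro z hz h0
      rw [sub_eq_zero] at h0
      subst h0
      exact ha.ne (by simpa using hz)
    have hgne : ∀ z ∈ Metric.sphere (0 : ℂ) R, g z ≠ 0 := fun z hz =>
      hgM.ne_zero_of_norm_eq hgd (by simpa using hz)
    have hcongr : (∮ z in C(0, R), logDeriv f z) = ∮ z in C(0, R), ((z - a)⁻¹ + logDeriv g z) := by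
      refine circleIntegral.integral_congr hR.le fun z hz => ?_
      have h2 : logDeriv (fun z : ℂ => z - a) z = (z - a)⁻¹ := by
        simp [logDeriv_apply]
      have h3 := logDeriv_mul (f := fun z : ℂ => z - a) (g := g) z (hsub z hz) (hgne z hz)
        (by fun_prop) (hgd z)
      rw [h2] at h3
      rw [hfg]
      exact h3
    rw [hcongr, circleIntegral.integral_add, ih hgd hgM,
      circleIntegral.integral_sub_inv_of_mem_ball (by simpa using ha)]
    · rw [Multiset.card_cons]; push_cast; ring
    · refine ContinuousOn.circleIntegrable hR.le fun z hz => ?_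
      exact ((continuous_id.sub continuous_const).continuousAt.inv₀
        (hsub z hz)).continuousWithinAt
    · refine ContinuousOn.circleIntegrable hR.le fun z hz => ?_
      exact ((hgd.contDiff (n := 1).continuous_deriv le_rfl).continuousAt.div
        hgd.continuous.continuousAt (hgne z hz)).continuousWithinAt

/-- Rouché's theorem: if the quotient of two entire functions avoids the negative real axis on a
circle, it has a logarithm there, so both functions have equally many zeros inside. -/
lemma IsZeroMultiset.card_eq_of_div_mem_slitPlane {f g : ℂ → ℂ} {R : ℝ} {M N : Multiset ℂ}
    (hR : 0 < R) (hf : Differentiable ℂ f) (hg : Differentiable ℂ g) (hM : IsZeroMultiset f R M)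
    (hN : IsZeroMultiset g R N) (h : ∀ z : ℂ, ‖z‖ = R → f z / g z ∈ Complex.slitPlane) :
    Multiset.card M = Multiset.card N := by
  have hsph : ∀ z ∈ Metric.sphere (0 : ℂ) R, ‖z‖ = R := fun z hz => by simpa using hz
  have hfc := hf.contDiff (n := 1).continuous_deriv le_rfl
  have hgc := hg.contDiff (n := 1).continuous_deriv le_rfl
  have h0 : (∮ z in C(0, R), (logDeriv f z - logDeriv g z)) = 0 := by
    refine circleIntegral.integral_eq_zero_of_hasDerivWithinAt (f := fun z => Complex.log (f z / g z))
      hR.le fun z hz => ?_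
    have hz' := hsph z hz
    have hfz := hM.ne_zero_of_norm_eq hf hz'
    have hgz := hN.ne_zero_of_norm_eq hg hz'
    have h1 := ((hf z).hasDerivAt.div (hg z).hasDerivAt hgz).clog (h z hz')
    refine (h1.congr_deriv ?_).hasDerivWithinAt
    simp only [Pi.div_apply, logDeriv_apply]
    field_simp
  rw [circleIntegral.integral_sub, hM.circleIntegral_logDeriv hR hf,
    hN.circleIntegral_logDeriv hR hg, sub_eq_zero] at h0
  · have h2 : (2 * Real.pi * Complex.I : ℂ) ≠ 0 := Complex.two_pi_I_ne_zero
    exact_mod_cast mul_left_cancel₀ h2 h0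
  · refine ContinuousOn.circleIntegrable hR.le fun z hz => ?_
    exact (hfc.continuousAt.div hf.continuous.continuousAt
      (hM.ne_zero_of_norm_eq hf (hsph z hz))).continuousWithinAt
  · refine ContinuousOn.circleIntegrable hR.le fun z hz => ?_
    exact (hgc.continuousAt.div hg.continuous.continuousAt
      (hN.ne_zero_of_norm_eq hg (hsph z hz))).continuousWithinAt

/-- An entire function without zeros on a circle has only finitely many zeros inside, as its zeros
are isolated. -/
lemma exists_isZeroMultiset {f : ℂ → ℂ} (hf : Differentiable ℂ f) {R : ℝ}
    (hR : 0 < R) (hne : ∀ z : ℂ, ‖z‖ = R → f z ≠ 0) : ∃ M, IsZeroMultiset f R M := by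
  have han : AnalyticOnNhd ℂ f Set.univ := fun z _ => hf.analyticAt z
  have hnz : f R ≠ 0 := hne R (by simp [abs_of_pos hR])
  have hcod := han.preimage_zero_mem_codiscrete hnz
  have hfin : (Metric.closedBall (0 : ℂ) R ∩ f ⁻¹' {0}).Finite := by
    have := (isCompact_closedBall (0 : ℂ) R).finite_sdiff_of_mem_codiscreteWithin
      (Filter.codiscreteWithin_mono (Set.subset_univ _) hcod)
    convert this using 1
    ext z
    simp
  have hord : ∀ z, analyticOrderAt f z ≠ ⊤ := by
    intro z hz
    rw [AnalyticOnNhd.analyticOrderAt_eq_top_iff_eq_zero z hf.analyticAt] at hz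
    exact hnz (by rw [hz]; rfl)
  refine ⟨∑ a ∈ hfin.toFinset, analyticOrderNatAt f a • {a}, ?_, ?_⟩
  · intro a ha
    rw [Multiset.mem_sum] at ha
    obtain ⟨b, hb, hab⟩ := ha
    have hab' := Multiset.mem_of_mem_nsmul hab
    rw [Multiset.mem_singleton] at hab'
    subst hab'
    rw [Set.Finite.mem_toFinset] at hb
    have h1 : ‖a‖ ≤ R := by simpa using hb.1
    exact lt_of_le_of_ne h1 fun h2 => hne a h2 hb.2
  · intro z hz
    rw [← Nat.cast_analyticOrderNatAt (hord z)]
    congr 1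
    rw [Multiset.count_sum']
    simp only [Multiset.count_nsmul, Multiset.count_singleton]
    by_cases h0 : f z = 0
    · rw [Finset.sum_eq_single z]
      · simp
      · intro b _ hb; simp [hb.symm]
      · intro hz'; exact absurd (hfin.mem_toFinset.2 ⟨by simpa using hz, h0⟩) hz'
    · have h1 : analyticOrderNatAt f z = 0 := by
        have := (hf.analyticAt z).analyticOrderAt_eq_zero.2 h0
        rw [← Nat.cast_analyticOrderNatAt (hord z)] at this
        exact_mod_cast this
      rw [h1, eq_comm]
      refine Finset.sum_eq_zero fun b hb => ?_
      rw [Set.Finite.mem_toFinset] at hb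
      have : z ≠ b := fun h => h0 (h ▸ hb.2)
      simp [this]

/-! ### Counting zeros of perturbations of `sin z - c z` -/

lemma norm_exp_I_mul (z : ℂ) : ‖Complex.exp (Complex.I * z)‖ = Real.exp (-z.im) := by
  rw [Complex.norm_exp]; simp

lemma norm_exp_neg_I_mul (z : ℂ) : ‖Complex.exp (-(Complex.I * z))‖ = Real.exp z.im := by
  rw [Complex.norm_exp]; simp

lemma sin_eq_exp (z : ℂ) : Complex.sin z =
    (Complex.I / 2) * (Complex.exp (-(Complex.I * z)) - Complex.exp (Complex.I * z)) := by
  rw [Complex.sin]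
  have h1 : -z * Complex.I = -(Complex.I * z) := by ring
  have h2 : z * Complex.I = Complex.I * z := by ring
  rw [h1, h2]; ring

lemma exp_abs_im_sub_one_le_norm_sin (z : ℂ) :
    (Real.exp |z.im| - 1) / 2 ≤ ‖Complex.sin z‖ := by
  have h1 : ‖Complex.sin z‖ =
      1 / 2 * ‖Complex.exp (-(Complex.I * z)) - Complex.exp (Complex.I * z)‖ := by
    rw [sin_eq_exp, norm_mul]; simp
  rw [h1]
  rcases le_total 0 z.im with h | h
  · have h2 := norm_sub_norm_le (Complex.exp (-(Complex.I * z))) (Complex.exp (Complex.I * z))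
    rw [norm_exp_I_mul, norm_exp_neg_I_mul] at h2
    have h3 : Real.exp (-z.im) ≤ 1 := Real.exp_le_one_iff.2 (by linarith)
    rw [abs_of_nonneg h]; linarith
  · have h2 := norm_sub_norm_le (Complex.exp (Complex.I * z)) (Complex.exp (-(Complex.I * z)))
    rw [norm_exp_I_mul, norm_exp_neg_I_mul, norm_sub_rev] at h2
    have h3 : Real.exp (z.im) ≤ 1 := Real.exp_le_one_iff.2 (by linarith)
    rw [abs_of_nonpos h]; linarith

/-- A point whose imaginary part is only logarithmic in its modulus is close to its modulus. -/
lemma norm_sub_re_le_half {C : ℝ} {z : ℂ} (hz : 1152 * C ^ 2 + 1 ≤ ‖z‖)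
    (hre : 0 ≤ z.re) (hexp : Real.exp |z.im| ≤ 2 * C * ‖z‖) : ‖z‖ - z.re ≤ 1 / 2 := by
  by_contra hcon
  push Not at hcon
  set R := ‖z‖ with hR
  set y := |z.im| with hy
  have hy0 : 0 ≤ y := abs_nonneg _
  have hR1 : 1 ≤ R := by nlinarith [sq_nonneg C]
  have h1 : R ^ 2 = z.re ^ 2 + y ^ 2 := by
    rw [hR, Complex.sq_norm, Complex.normSq_apply, hy, sq_abs]; ring
  have h2 : R / 2 ≤ y ^ 2 := by
    have : (R - z.re) * (R + z.re) = y ^ 2 := by linarith [h1, mul_comm R z.re, (by ring : (R - z.re) * (R + z.re) = R ^ 2 - z.re ^ 2)]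
    nlinarith
  have h3 : y ^ 3 / 6 ≤ 2 * C * R := by
    have := Real.pow_div_factorial_le_exp y hy0 3
    simp only [Nat.factorial] at this
    norm_num at this
    linarith
  -- Here `y ^ 2 ≥ R / 2`, while `y ^ 3 / 6 ≤ exp y ≤ 2 C R`; comparing `y ^ 6` gives `R ≤ 8 * 144 *
  -- C ^ 2 = 1152 * C ^ 2`.
  have h4 : (y ^ 3) ^ 2 ≤ (12 * C * R) ^ 2 := by
    apply pow_le_pow_left₀ (by positivity); linarith
  have h5 : (R / 2) ^ 3 ≤ (y ^ 2) ^ 3 := pow_le_pow_left₀ (by positivity) h2 3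
  have h6 : (R / 2) ^ 3 ≤ (12 * C * R) ^ 2 := by
    calc _ ≤ _ := h5
      _ = (y ^ 3) ^ 2 := by ring
      _ ≤ _ := h4
  have h7 : R ^ 2 * R ≤ R ^ 2 * (1152 * C ^ 2) := by nlinarith
  have h8 := le_of_mul_le_mul_left h7 (by positivity)
  linarith

/-- On a circle of radius `R` with `sin R = s = ±1` and `s c ≤ 0`, no function between `sin z` and
`sin z - c z + e` vanishes: where `e^{|Im z|}` is comparable to `R`, the real parts of
`s sin z` and `s c z` have opposite signs. -/
lemma one_add_mul_sin_ne {c s R t : ℝ} {z e : ℂ} (hs : Real.sin R = s) (hs1 : s ^ 2 = 1)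
    (hsc : s * c ≤ 0) (hz : ‖z‖ = R) (hR : 1152 * (2 * (|c| + 1)) ^ 2 + 1 ≤ R)
    (hre : 0 ≤ z.re) (he : ‖e‖ ≤ 1 / 8 * Real.exp |z.im|) (ht : 0 ≤ t) :
    (1 + t) * Complex.sin z ≠ c * z - e := by
  intro heq
  have hc0 := abs_nonneg c
  have hR1 : 1 ≤ R := by nlinarith [sq_nonneg (2 * (|c| + 1))]
  have hE : 1 ≤ Real.exp |z.im| := Real.one_le_exp (abs_nonneg _)
  have hn : (1 + t) * ‖Complex.sin z‖ = ‖(c : ℂ) * z - e‖ := by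
    rw [← heq, norm_mul]
    congr 1
    rw [← Complex.ofReal_one, ← Complex.ofReal_add, Complex.norm_real, Real.norm_eq_abs,
      abs_of_nonneg (by linarith)]
  have h1 : ‖Complex.sin z‖ ≤ |c| * R + 1 / 8 * Real.exp |z.im| := by
    calc ‖Complex.sin z‖ ≤ (1 + t) * ‖Complex.sin z‖ := by nlinarith [norm_nonneg (Complex.sin z)]
      _ = _ := hn
      _ ≤ ‖(c : ℂ) * z‖ + ‖e‖ := norm_sub_le _ _
      _ ≤ _ := by
        rw [norm_mul, hz, Complex.norm_real, Real.norm_eq_abs]; linarith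
  have h2 := exp_abs_im_sub_one_le_norm_sin z
  -- A zero forces `exp |Im z| = O(R)`, so that `Re z` is within `1 / 2` of `R`.
  have h3 : Real.exp |z.im| ≤ 2 * (2 * (|c| + 1)) * ‖z‖ := by rw [hz]; nlinarith
  have h4 := norm_sub_re_le_half (hz.symm ▸ hR) hre h3
  rw [hz] at h4
  have h5 : z.re ≤ R := hz ▸ Complex.re_le_norm z
  have h6 : |Real.sin z.re - Real.sin R| ≤ 1 / 2 := by
    have h7 := Real.lipschitzWith_sin.dist_le_mul z.re R
    rw [Real.dist_eq, Real.dist_eq] at h7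
    have : |z.re - R| ≤ 1 / 2 := by rw [abs_le]; constructor <;> linarith
    simpa using h7.trans (by simpa using this)
  have hs2 : |s| = 1 := by
    have : s = 1 ∨ s = -1 := by simpa using sq_eq_one_iff.1 hs1
    rcases this with h | h <;> simp [h]
  have h8 : 1 / 2 ≤ s * Real.sin z.re := by
    rw [hs] at h6
    have : |s * (Real.sin z.re - s)| ≤ 1 / 2 := by rw [abs_mul, hs2, one_mul]; exact h6
    have := (abs_le.1 this).1
    nlinarith
  have h9 : s * (Complex.sin z).re = s * Real.sin z.re * Real.cosh z.im := by
    conv_lhs => rw [← Complex.re_add_im z, Complex.sin_add_mul_I]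
    rw [← Complex.ofReal_sin, ← Complex.ofReal_cosh, ← Complex.ofReal_cos, ← Complex.ofReal_sinh]
    simp only [Complex.add_re, Complex.ofReal_re, Complex.mul_re,
      Complex.I_re, Complex.I_im, Complex.ofReal_im, Complex.im_ofReal_mul]
    ring
  have h10 : Real.exp |z.im| / 2 ≤ Real.cosh z.im := by
    rw [← Real.cosh_abs, Real.cosh_eq]
    have := Real.exp_pos (-|z.im|)
    linarith
  -- The real part of `s sin z` is at least `exp |Im z| / 4`, more than the error, while `s c z` has
  -- nonpositive real part.
  have h11 : Real.exp |z.im| / 4 ≤ s * (Complex.sin z).re := by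
    rw [h9]; nlinarith
  have h12 : s * ((1 + t) * (Complex.sin z).re) = s * (c * z.re - e.re) := by
    have := congrArg Complex.re heq
    have h13 : (((1 : ℂ) + t) * Complex.sin z).re = (1 + t) * (Complex.sin z).re := by
      rw [← Complex.ofReal_one, ← Complex.ofReal_add, Complex.re_ofReal_mul]
    rw [h13] at this
    rw [this]; simp
  have h13 : -(s * e.re) ≤ 1 / 8 * Real.exp |z.im| := by
    have : |s * e.re| ≤ ‖e‖ := by rw [abs_mul, hs2, one_mul]; exact Complex.abs_re_le_norm e
    linarith [(abs_le.1 this).1]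
  have h14 : s * c * z.re ≤ 0 := mul_nonpos_of_nonpos_of_nonneg hsc hre
  nlinarith [Real.exp_pos |z.im|]

/-- The entire function `S` with `z S(z² / 4) = sin z`. -/
def IsSinc (S : ℂ → ℂ) : Prop := Differentiable ℂ S ∧ ∀ z : ℂ, z * S (z ^ 2 / 4) = Complex.sin z

lemma exists_sq_div_four_eq (l : ℂ) : ∃ z : ℂ, z ^ 2 / 4 = l := by
  obtain ⟨w, hw⟩ := IsAlgClosed.exists_pow_nat_eq l two_pos
  exact ⟨2 * w, by rw [← hw]; ring⟩

lemma IsSinc.deriv_eq {S : ℂ → ℂ} (hS : IsSinc S) (z : ℂ) :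
    S (z ^ 2 / 4) + z ^ 2 / 2 * deriv S (z ^ 2 / 4) = Complex.cos z := by
  have h1 : HasDerivAt (fun z : ℂ => z ^ 2 / 4) (z / 2) z := by
    have := (hasDerivAt_pow 2 z).div_const 4
    refine this.congr_deriv ?_
    simp; ring
  have h2 := (hasDerivAt_id z).mul ((hS.1 (z ^ 2 / 4)).hasDerivAt.comp z h1)
  have h3 : (fun z : ℂ => z) * (S ∘ fun z => z ^ 2 / 4) = Complex.sin := by
    ext z; exact hS.2 z
  have h4 := h2.unique (by
    have : (id * (S ∘ fun z => z ^ 2 / 4) : ℂ → ℂ) = Complex.sin := h3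
    rw [this]; exact Complex.hasDerivAt_sin z)
  rw [← h4]
  simp
  ring

/-- The zeros of `S` are the simple zeros `(π (n + 1)) ^ 2 / 4`; the point `0` is not among them. -/
lemma IsSinc.isZeroMultiset {S : ℂ → ℂ} (hS : IsSinc S) (j : ℕ) :
    IsZeroMultiset S ((Real.pi / 2 + Real.pi * j) ^ 2 / 4)
      ((Multiset.range j).map fun n : ℕ => ((Real.pi * (n + 1) : ℝ) : ℂ) ^ 2 / 4) := by
  have hpi := Real.pi_pos
  have hinj : Function.Injective fun n : ℕ => ((Real.pi * (n + 1) : ℝ) : ℂ) ^ 2 / 4 := by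
    intro a b hab
    have h1 : (Real.pi * (a + 1) : ℝ) ^ 2 = (Real.pi * (b + 1) : ℝ) ^ 2 := by
      have : ((Real.pi * (a + 1) : ℝ) : ℂ) ^ 2 = ((Real.pi * (b + 1) : ℝ) : ℂ) ^ 2 := by
        linear_combination 4 * hab
      exact_mod_cast this
    have h2 := (pow_left_inj₀ (by positivity) (by positivity) two_ne_zero).1 h1
    have h3 := mul_left_cancel₀ hpi.ne' h2
    exact_mod_cast add_right_cancel h3
  refine ⟨?_, fun l hl => ?_⟩
  · intro a ha
    obtain ⟨n, hn, rfl⟩ := Multiset.mem_map.1 ha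
    rw [Multiset.mem_range] at hn
    rw [norm_div, norm_pow, Complex.norm_real, Real.norm_eq_abs, abs_of_pos (by positivity)]
    simp only [Complex.norm_ofNat]
    have : (n : ℝ) + 1 ≤ j := by exact_mod_cast hn
    have h2 : Real.pi * (n + 1) < Real.pi / 2 + Real.pi * j := by nlinarith
    gcongr
  · obtain ⟨z, rfl⟩ := exists_sq_div_four_eq l
    have hnorm : ‖z‖ ≤ Real.pi / 2 + Real.pi * j := by
      rw [norm_div, norm_pow] at hl
      simp only [Complex.norm_ofNat] at hl
      exact (pow_le_pow_iff_left₀ (norm_nonneg _) (by positivity) two_ne_zero).1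
        (by linarith)
    have hd := hS.deriv_eq z
    by_cases hsin : S (z ^ 2 / 4) = 0
    · have hz0 : z ≠ 0 := by
        rintro rfl
        simp only [ne_eq, OfNat.ofNat_ne_zero, not_false_eq_true, zero_pow, zero_div, zero_mul,
          add_zero, Complex.cos_zero] at hd hsin
        rw [hsin] at hd
        exact zero_ne_one hd
      have h0 : Complex.sin z = 0 := by rw [← hS.2 z, hsin, mul_zero]
      have hder : deriv S (z ^ 2 / 4) ≠ 0 := by
        intro h
        rw [h, hsin] at hd
        have := Complex.sin_sq_add_cos_sq z
        rw [h0, ← hd] at this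
        simp at this
      rw [(hS.1.analyticAt _).analyticOrderAt_eq_one_of_zero_deriv_ne_zero hsin hder]
      obtain ⟨k, rfl⟩ := Complex.sin_eq_zero_iff.1 h0
      have hk0 : k ≠ 0 := by rintro rfl; simp at hz0
      obtain ⟨n, hn⟩ : ∃ n : ℕ, k.natAbs = n + 1 :=
        ⟨k.natAbs - 1, by have := Int.natAbs_pos.2 hk0; omega⟩
      have hkn : ((k : ℂ) * Real.pi) ^ 2 / 4 = ((Real.pi * (n + 1) : ℝ) : ℂ) ^ 2 / 4 := by
        have h1 : (k : ℤ) ^ 2 = ((n : ℤ) + 1) ^ 2 := by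
          rw [← Int.natAbs_sq, hn]; push_cast; ring
        have h2 : (k : ℂ) ^ 2 = ((n : ℂ) + 1) ^ 2 := by exact_mod_cast h1
        push_cast
        linear_combination (Real.pi : ℂ) ^ 2 / 4 * h2
      have hnj : n < j := by
        have h1 : ‖(k : ℂ) * Real.pi‖ = Real.pi * (n + 1) := by
          rw [norm_mul, Complex.norm_real, Complex.norm_intCast, Real.norm_eq_abs,
            abs_of_pos hpi]
          have : |(k : ℝ)| = (n : ℝ) + 1 := by
            rw [← Int.cast_abs, Int.abs_eq_natAbs, hn]; push_cast; ring
          rw [this]; ring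
        rw [h1] at hnorm
        have h2 : (n : ℝ) + 1 ≤ 1 / 2 + j := by
          by_contra hcon
          push Not at hcon
          nlinarith
        have h3 : (n : ℝ) < j := by linarith
        exact_mod_cast h3
      rw [hkn, Multiset.count_map_eq_count' _ _ hinj,
        Multiset.count_eq_one_of_mem (Multiset.nodup_range j) (Multiset.mem_range.2 hnj)]
      rfl
    · rw [(hS.1.analyticAt _).analyticOrderAt_eq_zero.2 hsin, Multiset.count_eq_zero_of_notMem]
      · rfl
      · intro hm
        obtain ⟨n, hn, hn'⟩ := Multiset.mem_map.1 hm
        apply hsin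
        rw [← hn']
        have h1 := hS.2 ((Real.pi * (n + 1) : ℝ) : ℂ)
        have h2 : Complex.sin ((Real.pi * (n + 1) : ℝ) : ℂ) = 0 := by
          rw [Complex.sin_eq_zero_iff]
          exact ⟨n + 1, by push_cast; ring⟩
        rw [h2] at h1
        refine (mul_eq_zero.1 h1).resolve_left ?_
        exact_mod_cast (by positivity : Real.pi * ((n : ℝ) + 1) ≠ 0)

/-- `z Φ(z² / 4) = sin z - c z + o(e^{|Im z|})` as `|z| → ∞`. -/
def SinAsymptotics (Φ : ℂ → ℂ) (c : ℝ) : Prop :=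
  ∀ ε > 0, ∃ K, ∀ z : ℂ, K ≤ ‖z‖ →
    ‖z * Φ (z ^ 2 / 4) - (Complex.sin z - c * z)‖ ≤ ε * Real.exp |z.im|

/-- Rouché's theorem for `Φ` and `S` on the circles `|z| = R = π / 2 + π j` in the variable `l = z ^
2 / 4`. Although `c z` is not small against `sin z` on all of the circle, the condition `c sin R ≤
0` keeps the quotient `Φ / S` away from the negative real axis. Hence `Φ` has as many zeros inside
as `S`, namely `j`. -/
lemma SinAsymptotics.exists_card_eq {Φ S : ℂ → ℂ} {c : ℝ} (hS : IsSinc S)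
    (hΦ : Differentiable ℂ Φ) (H : SinAsymptotics Φ c) :
    ∃ K, ∀ j : ℕ, K ≤ Real.pi / 2 + Real.pi * j → Real.sin (Real.pi / 2 + Real.pi * j) * c ≤ 0 →
      ∃ M, IsZeroMultiset Φ ((Real.pi / 2 + Real.pi * j) ^ 2 / 4) M ∧ Multiset.card M = j := by
  obtain ⟨K, hK⟩ := H (1 / 8) (by norm_num)
  refine ⟨max K (1152 * (2 * (|c| + 1)) ^ 2 + 1), fun j hj hsc => ?_⟩
  set R := Real.pi / 2 + Real.pi * j with hRdef
  have hRpos : 0 < R := by have := Real.pi_pos; positivity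
  have hs1 : Real.sin R ^ 2 = 1 := by
    have : Real.cos R = 0 := by
      rw [Real.cos_eq_zero_iff]; exact ⟨j, by rw [hRdef]; push_cast; ring⟩
    have h2 := Real.sin_sq_add_cos_sq R
    rw [this] at h2; linarith
  -- `Φ = -t S` with `t ≥ 0` is impossible. Both sides depend on `z ^ 2` only, so that it is enough
  -- to consider the half plane `Re z ≥ 0`.
  have key : ∀ z : ℂ, ‖z‖ = R → 0 ≤ z.re → ∀ t : ℝ, 0 ≤ t →
      z * Φ (z ^ 2 / 4) ≠ -(t * Complex.sin z) := by
    intro z hz hre t ht heq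
    refine one_add_mul_sin_ne (c := c) (t := t) (z := z)
      (e := z * Φ (z ^ 2 / 4) - (Complex.sin z - c * z)) rfl hs1 hsc hz
      ((le_max_right _ _).trans hj) hre (hK z (hz.symm ▸ (le_max_left _ _).trans hj)) ht ?_
    rw [heq]; ring
  have key' : ∀ l : ℂ, ‖l‖ = R ^ 2 / 4 → ∃ z : ℂ, z ^ 2 / 4 = l ∧ ‖z‖ = R ∧ 0 ≤ z.re := by
    intro l hl
    obtain ⟨z, rfl⟩ := exists_sq_div_four_eq l
    have hz : ‖z‖ = R := by
      rw [norm_div, norm_pow] at hl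
      simp only [Complex.norm_ofNat] at hl
      exact (pow_left_inj₀ (norm_nonneg _) hRpos.le two_ne_zero).1 (by linarith)
    rcases le_total 0 z.re with h | h
    · exact ⟨z, rfl, hz, h⟩
    · exact ⟨-z, by ring, by rwa [norm_neg], by simpa using h⟩
  have hR4 : 0 < R ^ 2 / 4 := by positivity
  obtain ⟨M, hM⟩ := exists_isZeroMultiset hΦ hR4 (by
    intro l hl h0
    obtain ⟨z, rfl, hz, hre⟩ := key' l hl
    exact key z hz hre 0 le_rfl (by rw [h0]; simp))
  refine ⟨M, hM, ?_⟩
  have hN := hS.isZeroMultiset j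
  rw [hM.card_eq_of_div_mem_slitPlane hR4 hΦ hS.1 hN, Multiset.card_map, Multiset.card_range]
  intro l hl
  have hSl : S l ≠ 0 := hN.ne_zero_of_norm_eq hS.1 hl
  obtain ⟨z, rfl, hz, hre⟩ := key' l hl
  by_contra hcon
  rw [Complex.mem_slitPlane_iff_not_le_zero, not_not] at hcon
  obtain ⟨h1, h2⟩ := Complex.le_def.1 hcon
  refine key z hz hre (-(Φ (z ^ 2 / 4) / S (z ^ 2 / 4)).re) (by simpa using h1) ?_
  have h3 : Φ (z ^ 2 / 4) / S (z ^ 2 / 4) = ((Φ (z ^ 2 / 4) / S (z ^ 2 / 4)).re : ℂ) := by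
    apply Complex.ext <;> simp [h2]
  have h4 : Φ (z ^ 2 / 4) = ((Φ (z ^ 2 / 4) / S (z ^ 2 / 4)).re : ℂ) * S (z ^ 2 / 4) := by
    rw [← h3]; field_simp
  rw [← hS.2 z]
  push_cast
  linear_combination z * h4

/-! ### Numbering the zeros of a real entire function -/

open scoped ComplexConjugate

lemma analyticOrderAt_conj {f : ℂ → ℂ} (hf : Differentiable ℂ f) (hc : ∀ z, f (conj z) = conj (f z))
    (z : ℂ) : analyticOrderAt f (conj z) = analyticOrderAt f z := by
  have key : ∀ z : ℂ, ∀ n : ℕ, analyticOrderAt f z = n → analyticOrderAt f (conj z) = n := by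
    intro z n hn
    obtain ⟨g, hg, hg0, hfg⟩ := ((hf.analyticAt z).analyticOrderAt_eq_natCast).1 hn
    refine ((hf.analyticAt _).analyticOrderAt_eq_natCast).2 ⟨conj ∘ g ∘ conj, ?_, ?_, ?_⟩
    · rw [Complex.analyticAt_iff_eventually_differentiableAt] at hg ⊢
      have h1 : Tendsto (conj : ℂ → ℂ) (𝓝 (conj z)) (𝓝 z) := by
        simpa using (Complex.continuous_conj.tendsto (conj z))
      filter_upwards [h1.eventually hg] with w hw
      simpa using hw.conj_conj
    · simpa using hg0
    · have h1 : Tendsto (conj : ℂ → ℂ) (𝓝 (conj z)) (𝓝 z) := by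
        simpa using (Complex.continuous_conj.tendsto (conj z))
      filter_upwards [h1.eventually hfg] with w hw
      have h2 := hc (conj w)
      rw [Complex.conj_conj, hw] at h2
      rw [h2]; simp
  have key2 : ∀ z : ℂ, analyticOrderAt f z ≠ ⊤ → analyticOrderAt f (conj z) = analyticOrderAt f z := by
    intro z hz
    obtain ⟨n, hn⟩ := ENat.ne_top_iff_exists.1 hz
    rw [← hn]; exact key z n hn.symm
  by_cases h : analyticOrderAt f z = ⊤
  · by_contra hcon
    rw [h] at hcon
    have := key2 _ hcon
    rw [Complex.conj_conj, h] at this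
    exact hcon this.symm
  · exact key2 z h

lemma IsZeroMultiset.map_conj {f : ℂ → ℂ} (hf : Differentiable ℂ f)
    (hc : ∀ z, f (conj z) = conj (f z)) {R : ℝ} {M : Multiset ℂ} (h : IsZeroMultiset f R M) :
    M.map conj = M := by
  have hinj : Function.Injective (conj : ℂ → ℂ) := star_injective
  ext z
  have h1 : (M.map conj).count z = M.count (conj z) := by
    conv_lhs => rw [← Complex.conj_conj z]
    exact Multiset.count_map_eq_count' _ _ hinj _
  rw [h1]
  by_cases hz : ‖z‖ ≤ R
  · have h2 := h.order_eq z hz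
    have h3 := h.order_eq (conj z) (by simpa using hz)
    rw [analyticOrderAt_conj hf hc, h2] at h3
    exact_mod_cast h3.symm
  · rw [Multiset.count_eq_zero_of_notMem, Multiset.count_eq_zero_of_notMem]
    · exact fun hm => hz (h.norm_lt z hm).le
    · exact fun hm => hz (by simpa using (h.norm_lt _ hm).le)

/-- A multiset invariant under conjugation with at least two elements contains a pair consisting of
conjugate numbers or of two real numbers. -/
lemma exists_conj_pair {M : Multiset ℂ} (hM : M.map conj = M) (hcard : 2 ≤ Multiset.card M) :
    ∃ a b : ℂ, ∃ M' : Multiset ℂ, M = a ::ₘ b ::ₘ M' ∧ M'.map conj = M' ∧ 0 ≤ a.im ∧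
      (b = conj a ∨ (a.im = 0 ∧ b.im = 0)) := by
  by_cases hreal : ∀ z ∈ M, z.im = 0
  · obtain ⟨a, ha⟩ := Multiset.card_pos_iff_exists_mem.1 (by omega : 0 < Multiset.card M)
    obtain ⟨M1, rfl⟩ := Multiset.exists_cons_of_mem ha
    rw [Multiset.card_cons] at hcard
    obtain ⟨b, hb⟩ := Multiset.card_pos_iff_exists_mem.1 (by omega : 0 < Multiset.card M1)
    obtain ⟨M2, rfl⟩ := Multiset.exists_cons_of_mem hb
    have h0 : ∀ z ∈ M2, z.im = 0 := fun z hz => hreal z (by simp [hz])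
    refine ⟨a, b, M2, rfl, ?_, (hreal a (by simp)).ge, Or.inr ⟨hreal a (by simp), hreal b (by simp)⟩⟩
    conv_rhs => rw [← Multiset.map_id M2]
    exact Multiset.map_congr rfl fun z hz => Complex.conj_eq_iff_im.2 (h0 z hz)
  · push Not at hreal
    obtain ⟨z, hz, hzim⟩ := hreal
    obtain ⟨a, ha, haim⟩ : ∃ a ∈ M, 0 < a.im := by
      rcases lt_or_gt_of_ne hzim with h | h
      · refine ⟨conj z, ?_, by simpa using h⟩
        rw [← hM]; exact Multiset.mem_map_of_mem _ hz
      · exact ⟨z, hz, h⟩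
    have hca : conj a ∈ M := by rw [← hM]; exact Multiset.mem_map_of_mem _ ha
    have hne : conj a ≠ a := fun h => haim.ne' (Complex.conj_eq_iff_im.1 h)
    obtain ⟨M1, rfl⟩ := Multiset.exists_cons_of_mem ha
    obtain ⟨M2, rfl⟩ := Multiset.exists_cons_of_mem ((Multiset.mem_cons.1 hca).resolve_left hne)
    refine ⟨a, conj a, M2, rfl, ?_, haim.le, Or.inl rfl⟩
    rw [Multiset.map_cons, Multiset.map_cons, Complex.conj_conj, Multiset.cons_swap] at hM
    exact (Multiset.cons_inj_right _).1 ((Multiset.cons_inj_right _).1 hM)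

/-- A multiset invariant under conjugation is split into pairs as in `exists_conj_pair`. If the
number of its elements is odd (`m = 1`), the index `0` has a real number without partner. -/
lemma exists_conj_pairing (m : ℕ) (hm : m ≤ 1) (k : ℕ) (hk : m ≤ k) :
    ∀ M : Multiset ℂ, M.map conj = M → Multiset.card M = k + (k - m) →
    ∃ a b : ℕ → ℂ, M = (Multiset.range k).map a + (Finset.Ico m k).val.map b ∧
      (∀ n, 0 ≤ (a n).im) ∧ ∀ n, b n = conj (a n) ∨ ((a n).im = 0 ∧ (b n).im = 0) := by
  induction k, hk using Nat.le_induction with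
  | base =>
    intro M hM hcard
    rw [Nat.sub_self, add_zero] at hcard
    interval_cases m
    · refine ⟨fun _ => 0, fun _ => 0, ?_, by simp, by simp⟩
      rw [Multiset.card_eq_zero] at hcard
      simp [hcard]
    · obtain ⟨x, rfl⟩ := Multiset.card_eq_one.1 hcard
      have hx : x.im = 0 := by
        rw [Multiset.map_singleton, Multiset.singleton_inj] at hM
        exact Complex.conj_eq_iff_im.1 hM
      exact ⟨fun _ => x, fun _ => x, by simp [Multiset.range_succ], by simp [hx], by simp [hx]⟩
  | succ k hk ih =>
    intro M hM hcard
    obtain ⟨x, y, M', rfl, hM', hx, hxy⟩ := exists_conj_pair hM (by omega)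
    rw [Multiset.card_cons, Multiset.card_cons] at hcard
    obtain ⟨a, b, hab, ha, hb⟩ := ih M' hM' (by omega)
    refine ⟨Function.update a k x, Function.update b k y, ?_, ?_, ?_⟩
    · have h1 : (Multiset.range k).map (Function.update a k x) = (Multiset.range k).map a :=
        Multiset.map_congr rfl fun n hn => by
          rw [Function.update_of_ne]; exact (Multiset.mem_range.1 hn).ne
      have h2 : (Finset.Ico m k).val.map (Function.update b k y) = (Finset.Ico m k).val.map b :=
        Multiset.map_congr rfl fun n hn => by
          rw [Function.update_of_ne]; exact (Finset.mem_Ico.1 hn).2.ne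
      rw [← Finset.insert_Ico_right_eq_Ico_add_one hk, Finset.insert_val_of_notMem (by simp),
        Multiset.range_succ, Multiset.map_cons, Multiset.map_cons, h1, h2, hab]
      simp only [Function.update_self]
      rw [Multiset.cons_add, Multiset.add_cons]
    · intro n
      by_cases h : n = k
      · subst h; simpa using hx
      · simpa [h] using ha n
    · intro n
      by_cases h : n = k
      · subst h; simpa using hxy
      · simpa [h] using hb n

lemma count_eq_count_map (k : ℕ) (s : Set ℕ) [DecidablePred (· ∈ s)] (u : ℕ → ℂ) (z : ℂ)
    (h : ∀ n ∈ s, k ≤ n → u n ≠ z) :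
    count s u z = (((Finset.range k).filter (· ∈ s)).val.map u).count z := by
  rw [count, Multiset.count_map]
  have : {n | n ∈ s ∧ u n = z} = (((Finset.range k).filter (· ∈ s)).filter (fun n => z = u n) :
      Finset ℕ) := by
    ext n
    simp only [Set.mem_ofPred_eq, Finset.coe_filter, Finset.mem_filter, Finset.mem_range]
    constructor
    · rintro ⟨hn, hu⟩
      exact ⟨⟨lt_of_not_ge fun hk => h n hn hk hu, hn⟩, hu.symm⟩
    · rintro ⟨⟨_, hn⟩, hu⟩
      exact ⟨hn, hu.symm⟩
  rw [this, Set.encard_coe_eq_coe_finsetCard]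
  rfl

/-- If the discs of radii `r n` contain exactly the numbers with indices `≤ n`, then the numbering is
complete. -/
lemma analyticOrderAt_eq_count {f : ℂ → ℂ} {r : ℕ → ℝ} (hr : Tendsto r atTop atTop) {N : ℕ}
    (s t : Set ℕ) [DecidablePred (· ∈ s)] [DecidablePred (· ∈ t)] {u v : ℕ → ℂ}
    (h : ∀ n, N ≤ n → IsZeroMultiset f (r n)
      (((Finset.range (n + 1)).filter (· ∈ s)).val.map u +
        ((Finset.range (n + 1)).filter (· ∈ t)).val.map v)) (z : ℂ) :
    analyticOrderAt f z = count s u z + count t v z := by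
  obtain ⟨n, hn, hnz⟩ := ((hr.eventually_gt_atTop ‖z‖).and (eventually_ge_atTop N)).exists
  -- An index beyond `n` with value `z` would give a larger count in a larger disc.
  have hmono : ∀ m, n ≤ m → ‖z‖ ≤ r m →
      (((Finset.range (m + 1)).filter (· ∈ s)).val.map u).count z +
        (((Finset.range (m + 1)).filter (· ∈ t)).val.map v).count z =
      (((Finset.range (n + 1)).filter (· ∈ s)).val.map u).count z +
        (((Finset.range (n + 1)).filter (· ∈ t)).val.map v).count z := by
    intro m hm hzm
    have h1 := (h m (by omega)).order_eq z hzm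
    have h2 := (h n hnz).order_eq z hn.le
    rw [h1] at h2
    rw [Multiset.count_add, Multiset.count_add] at h2
    exact_mod_cast h2
  have hlt : ∀ (w : Set ℕ) [DecidablePred (· ∈ w)] (a : ℕ → ℂ) (m k : ℕ), n ≤ m → k ∈ w → n < k →
      k ≤ m → a k = z → (((Finset.range (n + 1)).filter (· ∈ w)).val.map a).count z <
        (((Finset.range (m + 1)).filter (· ∈ w)).val.map a).count z := by
    intro w _ a m k hnm hk hnk hkm hak
    rw [Multiset.count_map, Multiset.count_map]
    have : (((Finset.range (n + 1)).filter (· ∈ w)).filter fun i => z = a i) ⊂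
        (((Finset.range (m + 1)).filter (· ∈ w)).filter fun i => z = a i) := by
      refine Finset.ssubset_iff_of_subset ?_ |>.2 ⟨k, ?_, ?_⟩
      · exact Finset.filter_subset_filter _ (Finset.filter_subset_filter _
          (Finset.range_subset_range.2 (by omega)))
      · simp [hk, hak]; omega
      · simp; omega
    exact Finset.card_lt_card this
  have hle : ∀ (w : Set ℕ) [DecidablePred (· ∈ w)] (a : ℕ → ℂ) (m : ℕ), n ≤ m →
      (((Finset.range (n + 1)).filter (· ∈ w)).val.map a).count z ≤
        (((Finset.range (m + 1)).filter (· ∈ w)).val.map a).count z := by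
    intro w _ a m hnm
    refine Multiset.count_le_of_le _ (Multiset.map_le_map ?_)
    exact Finset.val_le_iff.2 (Finset.filter_subset_filter _
          (Finset.range_subset_range.2 (by omega)))
  have hbig : ∀ k, ∃ m, k ≤ m ∧ n ≤ m ∧ ‖z‖ ≤ r m := fun k => by
    obtain ⟨m, h1, h2, h3⟩ := ((hr.eventually_ge_atTop ‖z‖).and
      ((eventually_ge_atTop n).and (eventually_ge_atTop k))).exists
    exact ⟨m, h3, h2, h1⟩
  rw [count_eq_count_map (n + 1) s u z, count_eq_count_map (n + 1) t v z,
    (h n hnz).order_eq z hn.le, Multiset.count_add]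
  · push_cast; rfl
  · intro k hk hnk hvk
    obtain ⟨m, h1, h2, h3⟩ := hbig k
    have h4 := hmono m h2 h3
    have h5 := hlt t v m k h2 hk (by omega) h1 hvk
    have h6 := hle s u m h2
    omega
  · intro k hk hnk hvk
    obtain ⟨m, h1, h2, h3⟩ := hbig k
    have h4 := hmono m h2 h3
    have h5 := hlt s u m k h2 hk (by omega) h1 hvk
    have h6 := hle t v m h2
    omega

/-- If a larger disc contains as many more zeros as are known in the annulus, these are all. -/
lemma IsZeroMultiset.eq_add {f : ℂ → ℂ} (hf : Differentiable ℂ f) {r R : ℝ} {M N A : Multiset ℂ}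
    (hM : IsZeroMultiset f r M) (hN : IsZeroMultiset f R N) (hrR : r ≤ R) (hA : A.Nodup)
    (hAz : ∀ z ∈ A, f z = 0 ∧ r < ‖z‖ ∧ ‖z‖ < R)
    (hcard : Multiset.card N = Multiset.card M + Multiset.card A) : N = M + A := by
  symm
  refine Multiset.eq_of_le_of_card_le ?_ (by rw [hcard, Multiset.card_add])
  rw [Multiset.le_iff_count]
  intro z
  rw [Multiset.count_add]
  by_cases hz : ‖z‖ ≤ r
  · have h1 : Multiset.count z A = 0 :=
      Multiset.count_eq_zero_of_notMem fun hm => absurd (hAz z hm).2.1 (not_lt.2 hz)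
    have h2 := hM.order_eq z hz
    rw [hN.order_eq z (hz.trans hrR)] at h2
    rw [h1, add_zero]
    exact (by exact_mod_cast h2 : N.count z = M.count z).ge
  · have h1 : Multiset.count z M = 0 :=
      Multiset.count_eq_zero_of_notMem fun hm => hz (hM.norm_lt z hm).le
    rw [h1, zero_add]
    by_cases hzA : z ∈ A
    · rw [Multiset.count_eq_one_of_mem hA hzA]
      have h2 := hN.order_eq z (hAz z hzA).2.2.le
      have h3 := (hf.analyticAt z).analyticOrderAt_ne_zero.2 (hAz z hzA).1
      rw [h2] at h3
      exact Nat.one_le_iff_ne_zero.2 (by exact_mod_cast h3)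
    · rw [Multiset.count_eq_zero_of_notMem hzA]; exact Nat.zero_le _

/-- The zeros in the first disc, of radius `r N`, are paired abstractly. Each further annulus `r n <
|z| < r (n + 1)` contains two zeros by the count, hence exactly the known zero `ν (n + 1)` and its
conjugate. -/
lemma exists_numbering_pairs {f : ℂ → ℂ} (hf : Differentiable ℂ f)
    (hc : ∀ z, f (conj z) = conj (f z)) (m : ℕ) (hm : m ≤ 1) {r : ℕ → ℝ}
    (hr : Tendsto r atTop atTop) (hrm : Monotone r) {N : ℕ} (hN : 1 ≤ N)
    (hM : ∀ n, N ≤ n → ∃ M, IsZeroMultiset f (r n) M ∧ Multiset.card M = (n + 1) + (n + 1 - m))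
    {ν : ℕ → ℂ} (hν : ∀ n, N ≤ n → f (ν (n + 1)) = 0 ∧ r n < ‖ν (n + 1)‖ ∧
      ‖ν (n + 1)‖ < r (n + 1) ∧ 0 < (ν (n + 1)).im) :
    ∃ u v : ℕ → ℂ, (∀ z, analyticOrderAt f z = count Set.univ u z + count {n | m ≤ n} v z) ∧
      (∀ n, 0 ≤ (u n).im) ∧ (∀ n, v n = conj (u n) ∨ ((u n).im = 0 ∧ (v n).im = 0)) ∧
      ∀ n, N ≤ n → u (n + 1) = ν (n + 1) := by
  obtain ⟨M, hM0, hMc⟩ := hM N le_rfl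
  obtain ⟨a, b, hab, ha, hb⟩ := exists_conj_pairing m hm (N + 1) (by omega) M (hM0.map_conj hf hc) hMc
  let u : ℕ → ℂ := fun n => if n ≤ N then a n else ν n
  let v : ℕ → ℂ := fun n => if n ≤ N then b n else conj (ν n)
  have hIco : ∀ n, (Finset.range (n + 1)).filter (· ∈ {n | m ≤ n}) = Finset.Ico m (n + 1) := by
    intro n; ext k; simp [and_comm]
  have huniv : ∀ n, (Finset.range (n + 1)).filter (· ∈ (Set.univ : Set ℕ)) = Finset.range (n + 1) := by
    intro n; ext k; simp
  have key : ∀ n, N ≤ n → IsZeroMultiset f (r n)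
      ((Multiset.range (n + 1)).map u + (Finset.Ico m (n + 1)).val.map v) := by
    intro n hn
    induction n, hn using Nat.le_induction with
    | base =>
      have h1 : (Multiset.range (N + 1)).map u = (Multiset.range (N + 1)).map a :=
        Multiset.map_congr rfl fun n hn => if_pos (by have := Multiset.mem_range.1 hn; omega)
      have h2 : (Finset.Ico m (N + 1)).val.map v = (Finset.Ico m (N + 1)).val.map b :=
        Multiset.map_congr rfl fun n hn => if_pos (by have := (Finset.mem_Ico.1 (show n ∈ Finset.Ico m (N + 1) from hn)).2; omega)
      rw [h1, h2, ← hab]; exact hM0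
    | succ n hn ih =>
      obtain ⟨M', hM', hMc'⟩ := hM (n + 1) (by omega)
      obtain ⟨h0, h1, h2, h3⟩ := hν n hn
      have hne : ν (n + 1) ≠ conj (ν (n + 1)) := fun h =>
        h3.ne' (Complex.conj_eq_iff_im.1 h.symm)
      have hadd := ih.eq_add hf hM' (hrm (Nat.le_succ n)) (A := {ν (n + 1), conj (ν (n + 1))})
        (by simpa using hne) (by
          intro z hz
          simp only [Multiset.insert_eq_cons, Multiset.mem_cons, Multiset.mem_singleton] at hz
          rcases hz with rfl | rfl
          · exact ⟨h0, h1, h2⟩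
          · refine ⟨by rw [hc, h0, map_zero], ?_, ?_⟩ <;> simpa) (by
          rw [hMc']; simp; omega)
      have hu : u (n + 1) = ν (n + 1) := if_neg (by omega)
      have hv : v (n + 1) = conj (ν (n + 1)) := if_neg (by omega)
      rw [Multiset.range_succ, ← Finset.insert_Ico_right_eq_Ico_add_one (by omega : m ≤ n + 1),
        Finset.insert_val_of_notMem (by simp), Multiset.map_cons, Multiset.map_cons, hu, hv]
      convert hM' using 1
      rw [hadd, Multiset.insert_eq_cons, ← Multiset.singleton_add, ← Multiset.singleton_add,
        ← Multiset.singleton_add]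
      abel
  refine ⟨u, v, ?_, ?_, ?_, fun n hn => if_neg (by omega)⟩
  · refine analyticOrderAt_eq_count hr (N := N) Set.univ {n | m ≤ n} fun n hn => ?_
    rw [hIco, huniv]; exact key n hn
  · intro n
    by_cases h : n ≤ N
    · simpa [u, h] using ha n
    · simp only [u, h, if_false]
      obtain ⟨k, rfl⟩ : ∃ k, n = k + 1 := ⟨n - 1, by omega⟩
      exact (hν k (by omega)).2.2.2.le
  · intro n
    by_cases h : n ≤ N
    · simpa [u, v, h] using hb n
    · simp [u, v, h]

/-- The zeros in the first disc are listed in any order, and every further annulus contains exactly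
one zero, the known `ν (n + 1)`. -/
lemma exists_numbering_single {f : ℂ → ℂ} (hf : Differentiable ℂ f) {r : ℕ → ℝ}
    (hr : Tendsto r atTop atTop) (hrm : Monotone r) {N : ℕ}
    (hM : ∀ n, N ≤ n → ∃ M, IsZeroMultiset f (r n) M ∧ Multiset.card M = n)
    {ν : ℕ → ℂ} (hν : ∀ n, N ≤ n → f (ν (n + 1)) = 0 ∧ r n < ‖ν (n + 1)‖ ∧
      ‖ν (n + 1)‖ < r (n + 1)) :
    ∃ u : ℕ → ℂ, (∀ z, analyticOrderAt f z = count {n | 1 ≤ n} u z) ∧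
      ∀ n, N ≤ n → u (n + 1) = ν (n + 1) := by
  obtain ⟨M, hM0, hMc⟩ := hM N le_rfl
  obtain ⟨l, rfl⟩ := Quot.exists_rep M
  let u : ℕ → ℂ := fun n => if n ≤ N then l.getD (n - 1) 0 else ν n
  have hIco : ∀ n, (Finset.range (n + 1)).filter (· ∈ {n | 1 ≤ n}) = Finset.Ico 1 (n + 1) := by
    intro n; ext k; simp [and_comm]
  have key : ∀ n, N ≤ n → IsZeroMultiset f (r n) ((Finset.Ico 1 (n + 1)).val.map u) := by
    intro n hn
    induction n, hn using Nat.le_induction with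
    | base =>
      have h1 : (Finset.Ico 1 (N + 1)).val.map u = (l : Multiset ℂ) := by
        have h2 : l.length = N := hMc
        have h3 : Finset.Ico 1 (N + 1) = (Finset.range N).map ⟨Nat.succ, Nat.succ_injective⟩ := by
          ext k
          simp only [Finset.mem_Ico, Finset.mem_map, Finset.mem_range, Function.Embedding.coeFn_mk]
          constructor
          · rintro ⟨h1, h2⟩; exact ⟨k - 1, by omega, by omega⟩
          · rintro ⟨a, ha, rfl⟩; omega
        rw [h3, Finset.map_val, Multiset.map_map, Finset.range_val]
        change Multiset.map _ (List.range N : Multiset ℕ) = _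
        rw [Multiset.map_coe]
        congr 1
        apply List.ext_getElem
        · simp [h2]
        · intro i h4 h5
          have h6 : i + 1 ≤ N := by omega
          simp [u, h6, h5]
      rw [h1]; exact hM0
    | succ n hn ih =>
      obtain ⟨M', hM', hMc'⟩ := hM (n + 1) (by omega)
      obtain ⟨h0, h1, h2⟩ := hν n hn
      have hadd := ih.eq_add hf hM' (hrm (Nat.le_succ n)) (A := {ν (n + 1)})
        (by simp) (by
          intro z hz
          rw [Multiset.mem_singleton] at hz
          subst hz
          exact ⟨h0, h1, h2⟩) (by
          rw [hMc']; simp)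
      have hu : u (n + 1) = ν (n + 1) := if_neg (by omega)
      rw [← Finset.insert_Ico_right_eq_Ico_add_one (by omega : 1 ≤ n + 1),
        Finset.insert_val_of_notMem (by simp), Multiset.map_cons, hu]
      convert hM' using 1
      rw [hadd, ← Multiset.singleton_add, add_comm]
  refine ⟨u, ?_, fun n hn => if_neg (by omega)⟩
  intro z
  have := analyticOrderAt_eq_count (v := fun _ => 0) hr (N := N) {n | 1 ≤ n} ∅ (fun n hn => by
    rw [hIco]; simpa using key n hn) z
  simpa [count] using this

/-! ### Location of the large zeros -/

lemma csqrt_sq (l : ℂ) : csqrt l ^ 2 = l := by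
  rw [csqrt]; simp

lemma csqrt_sq_div_four {z : ℂ} (hz : 0 < z.re) : csqrt (z ^ 2 / 4) = z / 2 := by
  have := Complex.sq_cpow_two_inv (x := z / 2) (by simpa using hz)
  rw [csqrt]
  convert this using 2
  · ring
  · norm_num

/-- The value `2 π θ`: `π / 2` for `c > 0` and `3 π / 2` for `c < 0`. -/
noncomputable def leadShift (c : ℝ) : ℝ := if 0 < c then Real.pi / 2 else 3 * Real.pi / 2

/-- The first approximation `2 π n + 2 π θ + i log (4 π n |c|)` of a root of `sin z = c z`. -/
noncomputable def leadApprox (c : ℝ) (n : ℕ) : ℂ :=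
  ((2 * Real.pi * n + leadShift c : ℝ) : ℂ) + Complex.I * (Real.log (4 * Real.pi * n * |c|) : ℝ)

lemma leadShift_bounds (c : ℝ) : 1 ≤ leadShift c ∧ leadShift c ≤ 5 := by
  have h1 := Real.pi_gt_three
  have h2 := Real.pi_lt_d2
  unfold leadShift
  split_ifs <;> constructor <;> linarith

@[simp] lemma leadApprox_re (c : ℝ) (n : ℕ) :
    (leadApprox c n).re = 2 * Real.pi * n + leadShift c := by
  simp only [leadApprox, Complex.add_re, Complex.ofReal_re, Complex.mul_re, Complex.I_re,
    Complex.I_im, Complex.ofReal_im]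
  ring

@[simp] lemma leadApprox_im (c : ℝ) (n : ℕ) :
    (leadApprox c n).im = Real.log (4 * Real.pi * n * |c|) := by
  simp only [leadApprox, Complex.add_im, Complex.ofReal_re, Complex.mul_im, Complex.I_re,
    Complex.I_im, Complex.ofReal_im]
  ring

lemma half_I_mul_exp_leadApprox {c : ℝ} (hc : c ≠ 0) {n : ℕ} (hn : n ≠ 0) :
    Complex.I / 2 * Complex.exp (-(Complex.I * leadApprox c n)) = 2 * Real.pi * n * c := by
  have hpos : 0 < 4 * Real.pi * n * |c| := by
    have := Real.pi_pos; have := abs_pos.2 hc; positivity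
  have h1 : -(Complex.I * leadApprox c n) = -(Complex.I * leadShift c) +
      (Real.log (4 * Real.pi * n * |c|) : ℝ) - (n : ℕ) * (2 * Real.pi * Complex.I) := by
    rw [leadApprox]; push_cast
    linear_combination -(Real.log (4 * Real.pi * n * |c|) : ℂ) * Complex.I_mul_I
  rw [h1, Complex.exp_sub, Complex.exp_nat_mul_two_pi_mul_I, div_one, Complex.exp_add,
    ← Complex.ofReal_exp, Real.exp_log hpos]
  unfold leadShift
  split_ifs with h
  · have h2 : -(Complex.I * ((Real.pi / 2 : ℝ) : ℂ)) = -Real.pi / 2 * Complex.I := by push_cast; ring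
    rw [h2, Complex.exp_neg_pi_div_two_mul_I, abs_of_pos h]
    push_cast
    linear_combination (-2 * Real.pi * n * c : ℂ) * Complex.I_mul_I
  · have h2 : -(Complex.I * ((3 * Real.pi / 2 : ℝ) : ℂ)) =
        Real.pi / 2 * Complex.I - 2 * Real.pi * Complex.I := by push_cast; ring
    rw [h2, Complex.exp_sub, Complex.exp_two_pi_mul_I, div_one, Complex.exp_pi_div_two_mul_I,
      abs_of_neg (lt_of_le_of_ne (not_lt.1 h) hc)]
    push_cast
    linear_combination (-2 * Real.pi * n * c : ℂ) * Complex.I_mul_I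

lemma half_I_mul_exp_leadApprox_add {c : ℝ} (hc : c ≠ 0) {n : ℕ} (hn : n ≠ 0) (w : ℂ) :
    Complex.I / 2 * Complex.exp (-(Complex.I * (leadApprox c n + w))) =
      2 * Real.pi * n * c * Complex.exp (-(Complex.I * w)) := by
  rw [mul_add, neg_add, Complex.exp_add, ← mul_assoc, half_I_mul_exp_leadApprox hc hn]

lemma exp_im_leadApprox {c : ℝ} (hc : c ≠ 0) {n : ℕ} (hn : n ≠ 0) :
    Real.exp (leadApprox c n).im = 4 * Real.pi * n * |c| := by
  have hpos : 0 < 4 * Real.pi * n * |c| := by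
    have := Real.pi_pos; have := abs_pos.2 hc; positivity
  rw [leadApprox_im, Real.exp_log hpos]

lemma tendsto_const_mul_natCast {A : ℝ} (hA : 0 < A) :
    Tendsto (fun n : ℕ => A * n) atTop atTop :=
  tendsto_natCast_atTop_atTop.const_mul_atTop hA

lemma tendsto_log_pow_div {A : ℝ} (hA : 0 < A) (k : ℕ) :
    Tendsto (fun n : ℕ => Real.log (A * n) ^ k / n) atTop (𝓝 0) := by
  have h1 := (Real.isLittleO_pow_log_id_atTop (n := k)).comp_tendsto (tendsto_const_mul_natCast hA)
  have h2 := h1.tendsto_div_nhds_zero.const_mul A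
  rw [mul_zero] at h2
  refine h2.congr' ?_
  filter_upwards [eventually_gt_atTop 0] with n hn
  have : (n : ℝ) ≠ 0 := by positivity
  simp only [Function.comp, id]
  field_simp

lemma leadApprox_im_eq (c : ℝ) (n : ℕ) :
    (leadApprox c n).im = Real.log (4 * Real.pi * |c| * n) := by
  rw [leadApprox_im]; congr 1; ring

lemma tendsto_leadApprox_im {c : ℝ} (hc : c ≠ 0) :
    Tendsto (fun n : ℕ => (leadApprox c n).im) atTop atTop := by
  have hA : 0 < 4 * Real.pi * |c| := by have := Real.pi_pos; have := abs_pos.2 hc; positivity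
  simp only [leadApprox_im_eq]
  exact Real.tendsto_log_atTop.comp (tendsto_const_mul_natCast hA)

lemma eventually_leadApprox_im_le {c : ℝ} (hc : c ≠ 0) {δ : ℝ} (hδ : 0 < δ) :
    ∀ᶠ n : ℕ in atTop, (leadApprox c n).im ^ 2 ≤ δ * n ∧ (leadApprox c n).im ≤ δ * n := by
  have hA : 0 < 4 * Real.pi * |c| := by have := Real.pi_pos; have := abs_pos.2 hc; positivity
  filter_upwards [(tendsto_log_pow_div hA 2).eventually_lt_const hδ,
    (tendsto_log_pow_div hA 1).eventually_lt_const hδ, eventually_gt_atTop 0] with n h1 h2 hn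
  have hn' : (0 : ℝ) < n := by exact_mod_cast hn
  rw [div_lt_iff₀ hn'] at h1 h2
  rw [leadApprox_im_eq]
  exact ⟨h1.le, by simpa using h2.le⟩

/-- A quantitative open mapping argument: a value at the centre that is small compared with the
variation on the bounding circle forces a zero. -/
lemma exists_zero_of_le_norm_sub {f : ℂ → ℂ} (hf : Differentiable ℂ f) {a : ℂ} {r δ : ℝ}
    (hr : 0 < r) (hδ : 0 < δ) (h : ∀ w : ℂ, ‖w‖ = r → δ ≤ ‖f (a + w) - f a‖)
    (ha : ‖f a‖ < δ / 2) : ∃ w : ℂ, ‖w‖ ≤ r ∧ f (a + w) = 0 := by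
  have h1 := DiffContOnCl.ball_subset_image_closedBall (f := f) (z₀ := a) (r := r) (ε := δ)
    hf.diffContOnCl hr (by
      intro z hz
      have := h (z - a) (by simpa [dist_eq_norm] using hz)
      simpa using this) (by
      intro hcon
      have h2 : f =ᶠ[𝓝 a] fun _ => f a := by
        filter_upwards [hcon] with z hz; simpa using hz
      have h3 := AnalyticOnNhd.eq_of_eventuallyEq (fun z _ => hf.analyticAt z)
        (fun z _ => analyticAt_const) h2
      have h4 := h (r : ℂ) (by simp [abs_of_pos hr])
      rw [h3] at h4
      simp at h4
      linarith)
  obtain ⟨z, hz, hz0⟩ := h1 (show (0 : ℂ) ∈ Metric.ball (f a) (δ / 2) by simpa using ha)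
  refine ⟨z - a, by simpa [dist_eq_norm] using hz, by simpa using hz0⟩

lemma differentiable_mul_comp_sq {Φ : ℂ → ℂ} (hΦ : Differentiable ℂ Φ) :
    Differentiable ℂ fun z : ℂ => z * Φ (z ^ 2 / 4) := by
  fun_prop

lemma norm_exp_sub_one_ge {w : ℂ} (hw : ‖w‖ ≤ 1) : ‖w‖ - ‖w‖ ^ 2 ≤ ‖Complex.exp w - 1‖ := by
  have h1 := Complex.norm_exp_sub_one_sub_id_le hw
  have h2 := norm_sub_norm_le w (-(Complex.exp w - 1 - w))
  rw [norm_neg, sub_neg_eq_add, add_sub_cancel] at h2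
  linarith

lemma exp_quarter_le_two : Real.exp (1 / 4) ≤ 2 := by
  have h1 : Real.exp (1 / 4) ≤ Real.exp (Real.log 2) :=
    Real.exp_le_exp.2 (by have := Real.log_two_gt_d9; linarith)
  rwa [Real.exp_log two_pos] at h1

/-- Near `leadApprox c n` the function `sin z - c z` is `2 π n c (exp (-I w) - 1)` up to `O(log n)`,
because the growing part of `sin z` and `c z` cancel to leading order at `w = 0`. So it is small at
the centre compared with its size on the circle `|w| = 1 / 4`. -/
lemma exists_zero_near_leadApprox {Φ : ℂ → ℂ} {c : ℝ} (hΦ : Differentiable ℂ Φ)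
    (H : SinAsymptotics Φ c) (hc : c ≠ 0) :
    ∀ᶠ n : ℕ in atTop, ∃ w : ℂ, ‖w‖ ≤ 1 / 4 ∧ Φ ((leadApprox c n + w) ^ 2 / 4) = 0 := by
  -- On the disc `exp |Im z| ≤ 8 π n |c|`, so that the error is at most `π n |c| / 32`.
  obtain ⟨K, hK⟩ := H (1 / 256) (by norm_num)
  have hc0 := abs_pos.2 hc
  have hpi := Real.pi_gt_three
  filter_upwards [eventually_ne_atTop 0, (tendsto_leadApprox_im hc).eventually_ge_atTop 1,
    eventually_leadApprox_im_le hc (δ := 1 / 8) (by norm_num),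
    (tendsto_const_mul_natCast Real.two_pi_pos).eventually_ge_atTop K,
    (tendsto_const_mul_natCast (by positivity : 0 < |c|)).eventually_ge_atTop (4 * (6 * |c| + 1))]
    with n hn hL1 hL2 hK' hbig
  have hLn := hL2.2
  have hn1 : (1 : ℝ) ≤ n := by exact_mod_cast Nat.one_le_iff_ne_zero.2 hn
  have hsh := leadShift_bounds c
  set ζ := leadApprox c n with hζ
  set L := ζ.im with hL
  set f : ℂ → ℂ := fun z => z * Φ (z ^ 2 / 4) with hf
  have hexpL : Real.exp L = 4 * Real.pi * n * |c| := exp_im_leadApprox hc hn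
  have hre : ∀ w : ℂ, ‖w‖ ≤ 1 / 4 → 2 * Real.pi * n ≤ (ζ + w).re := by
    intro w hw
    have h1 := (abs_le.1 ((Complex.abs_re_le_norm w).trans hw)).1
    rw [Complex.add_re, hζ, leadApprox_re]; linarith
  have him : ∀ w : ℂ, ‖w‖ ≤ 1 / 4 → 0 ≤ (ζ + w).im ∧ (ζ + w).im ≤ L + 1 / 4 := by
    intro w hw
    have h1 := abs_le.1 ((Complex.abs_im_le_norm w).trans hw)
    rw [Complex.add_im]; constructor <;> linarith [h1.1, h1.2]
  have he : ∀ w : ℂ, ‖w‖ ≤ 1 / 4 → ‖f (ζ + w) - (Complex.sin (ζ + w) - c * (ζ + w))‖ ≤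
      Real.pi * n * |c| / 32 := by
    intro w hw
    have h1 := hK (ζ + w) (hK'.trans ((hre w hw).trans (Complex.re_le_norm _)))
    rw [abs_of_nonneg (him w hw).1] at h1
    have h2 : Real.exp (ζ + w).im ≤ 4 * Real.pi * n * |c| * 2 := by
      calc Real.exp (ζ + w).im ≤ Real.exp (L + 1 / 4) := Real.exp_le_exp.2 (him w hw).2
        _ = Real.exp L * Real.exp (1 / 4) := Real.exp_add _ _
        _ ≤ _ := by rw [hexpL]; gcongr; exact exp_quarter_le_two
    linarith
  have hsmall : ∀ w : ℂ, ‖w‖ ≤ 1 / 4 → ‖Complex.I / 2 * Complex.exp (Complex.I * (ζ + w))‖ ≤ 1 / 2 := by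
    intro w hw
    rw [norm_mul, norm_exp_I_mul]
    have : Real.exp (-(ζ + w).im) ≤ 1 := Real.exp_le_one_iff.2 (by linarith [(him w hw).1])
    simp only [norm_div, Complex.norm_I, Complex.norm_ofNat]
    linarith
  have hsin : ∀ w : ℂ, Complex.sin (ζ + w) = 2 * Real.pi * n * c * Complex.exp (-(Complex.I * w)) -
      Complex.I / 2 * Complex.exp (Complex.I * (ζ + w)) := by
    intro w
    rw [sin_eq_exp, mul_sub, half_I_mul_exp_leadApprox_add hc hn]
  have h00 : ‖(0 : ℂ)‖ ≤ 1 / 4 := by simp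
  have hf0 : ‖f ζ‖ ≤ |c| * (5 + L) + 1 / 2 + Real.pi * n * |c| / 32 := by
    have e0 := he 0 h00
    have s0 := hsmall 0 h00
    have q0 := hsin 0
    rw [add_zero] at e0 s0 q0
    have h1 : f ζ = (f ζ - (Complex.sin ζ - c * ζ)) - Complex.I / 2 * Complex.exp (Complex.I * ζ)
        - c * ((leadShift c : ℂ) + Complex.I * L) := by
      have : ζ = 2 * Real.pi * n + leadShift c + Complex.I * L := by
        rw [hL, hζ, leadApprox_im, leadApprox]; push_cast; ring
      rw [q0]
      simp only [mul_zero, neg_zero, Complex.exp_zero, mul_one]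
      linear_combination -(c : ℂ) * this
    have h2 : ‖(c : ℂ) * ((leadShift c : ℂ) + Complex.I * L)‖ ≤ |c| * (5 + L) := by
      rw [norm_mul, Complex.norm_real, Real.norm_eq_abs]
      gcongr
      refine (norm_add_le _ _).trans ?_
      rw [norm_mul, Complex.norm_I, one_mul, Complex.norm_real, Complex.norm_real,
        Real.norm_eq_abs, Real.norm_eq_abs, abs_of_nonneg (by linarith : 0 ≤ leadShift c),
        abs_of_nonneg (by linarith : 0 ≤ L)]
      linarith
    rw [h1]
    refine (norm_sub_le _ _).trans ?_
    have := norm_sub_le (f ζ - (Complex.sin ζ - c * ζ)) (Complex.I / 2 * Complex.exp (Complex.I * ζ))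
    linarith
  have hsph : ∀ w : ℂ, ‖w‖ = 1 / 4 →
      Real.pi * n * |c| * (5 / 16) - |c| / 4 - 1 ≤ ‖f (ζ + w) - f ζ‖ := by
    intro w hw
    have e0 := he 0 h00
    have s0 := hsmall 0 h00
    have q0 := hsin 0
    rw [add_zero] at e0 s0 q0
    have e1 := he w hw.le
    have s1 := hsmall w hw.le
    have q1 := hsin w
    have h1 : 2 * Real.pi * n * c * (Complex.exp (-(Complex.I * w)) - 1) =
        (f (ζ + w) - f ζ) - (f (ζ + w) - (Complex.sin (ζ + w) - c * (ζ + w)))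
        + (f ζ - (Complex.sin ζ - c * ζ)) + Complex.I / 2 * Complex.exp (Complex.I * (ζ + w))
        - Complex.I / 2 * Complex.exp (Complex.I * ζ) + c * w := by
      rw [q1, q0]
      simp only [mul_zero, neg_zero, Complex.exp_zero, mul_one]
      ring
    have h2 : 2 * Real.pi * n * |c| * (3 / 16) ≤
        ‖2 * Real.pi * n * c * (Complex.exp (-(Complex.I * w)) - 1)‖ := by
      have h3 := norm_exp_sub_one_ge (w := -(Complex.I * w)) (by simp [hw]; norm_num)
      have h4 : ‖-(Complex.I * w)‖ = 1 / 4 := by simp [hw]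
      rw [h4] at h3
      rw [norm_mul]
      have h5 : ‖(2 * Real.pi * n * c : ℂ)‖ = 2 * Real.pi * n * |c| := by
        simp [abs_of_pos Real.pi_pos]
      rw [h5]
      gcongr
      linarith
    have h6 : ‖(c : ℂ) * w‖ = |c| / 4 := by
      rw [norm_mul, hw, Complex.norm_real, Real.norm_eq_abs]; ring
    rw [h1] at h2
    have t1 := norm_add_le ((f (ζ + w) - f ζ) - (f (ζ + w) - (Complex.sin (ζ + w) - c * (ζ + w)))
        + (f ζ - (Complex.sin ζ - c * ζ)) + Complex.I / 2 * Complex.exp (Complex.I * (ζ + w))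
        - Complex.I / 2 * Complex.exp (Complex.I * ζ)) (c * w)
    have t2 := norm_sub_le ((f (ζ + w) - f ζ) - (f (ζ + w) - (Complex.sin (ζ + w) - c * (ζ + w)))
        + (f ζ - (Complex.sin ζ - c * ζ)) + Complex.I / 2 * Complex.exp (Complex.I * (ζ + w)))
        (Complex.I / 2 * Complex.exp (Complex.I * ζ))
    have t3 := norm_add_le ((f (ζ + w) - f ζ) - (f (ζ + w) - (Complex.sin (ζ + w) - c * (ζ + w)))
        + (f ζ - (Complex.sin ζ - c * ζ))) (Complex.I / 2 * Complex.exp (Complex.I * (ζ + w)))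
    have t4 := norm_add_le ((f (ζ + w) - f ζ) - (f (ζ + w) - (Complex.sin (ζ + w) - c * (ζ + w))))
        (f ζ - (Complex.sin ζ - c * ζ))
    have t5 := norm_sub_le (f (ζ + w) - f ζ) (f (ζ + w) - (Complex.sin (ζ + w) - c * (ζ + w)))
    linarith
  have hnum : |c| * (5 + L) + 1 / 2 + Real.pi * n * |c| / 32 <
      (Real.pi * n * |c| * (5 / 16) - |c| / 4 - 1) / 2 := by
    have h1 : |c| * L ≤ |c| * (1 / 8 * n) := by gcongr
    have h2 : 3 * (|c| * n) ≤ Real.pi * n * |c| := by nlinarith [mul_pos hc0 (by linarith : (0:ℝ) < n)]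
    nlinarith
  have hδ : 0 < Real.pi * n * |c| * (5 / 16) - |c| / 4 - 1 := by
    have := (norm_nonneg _).trans_lt (hf0.trans_lt hnum); linarith
  obtain ⟨w, hw, hw0⟩ := exists_zero_of_le_norm_sub (differentiable_mul_comp_sq hΦ)
    (by norm_num : (0 : ℝ) < 1 / 4) hδ hsph (hf0.trans_lt hnum)
  refine ⟨w, hw, (mul_eq_zero.1 hw0).resolve_left fun h0 => ?_⟩
  have := hre w hw
  rw [h0, Complex.zero_re] at this
  nlinarith

lemma norm_sin_ge {w : ℂ} (hw : ‖w‖ ≤ 1) : 3 / 4 * ‖w‖ ≤ ‖Complex.sin w‖ := by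
  have h1 := Complex.sin_bound hw
  have h2 := norm_sub_norm_le w (-(Complex.sin w - (w - w ^ 3 / 6)) + w ^ 3 / 6)
  have h3 : w - (-(Complex.sin w - (w - w ^ 3 / 6)) + w ^ 3 / 6) = Complex.sin w := by ring
  rw [h3] at h2
  have h4 := norm_add_le (-(Complex.sin w - (w - w ^ 3 / 6))) (w ^ 3 / 6)
  rw [norm_neg, norm_div, norm_pow, Complex.norm_ofNat] at h4
  have h0 := norm_nonneg w
  have h5 : ‖w‖ ^ 3 ≤ ‖w‖ := by
    calc ‖w‖ ^ 3 ≤ ‖w‖ ^ 1 := pow_le_pow_of_le_one h0 hw (by norm_num)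
      _ = _ := pow_one _
  have h6 : ‖w‖ ^ 5 ≤ ‖w‖ := by
    calc ‖w‖ ^ 5 ≤ ‖w‖ ^ 1 := pow_le_pow_of_le_one h0 hw (by norm_num)
      _ = _ := pow_one _
  linarith

lemma sin_pi_mul_add (n : ℕ) (w : ℂ) :
    Complex.sin (((Real.pi * n : ℝ) : ℂ) + w) = (-1) ^ n * Complex.sin w := by
  rw [add_comm]; push_cast
  rw [mul_comm (Real.pi : ℂ)]
  exact Complex.sin_antiperiodic.add_nat_mul_eq n

lemma cos_pi_mul_add (n : ℕ) (w : ℂ) :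
    Complex.cos (((Real.pi * n : ℝ) : ℂ) + w) = (-1) ^ n * Complex.cos w := by
  rw [add_comm]; push_cast
  rw [mul_comm (Real.pi : ℂ)]
  exact Complex.cos_antiperiodic.add_nat_mul_eq n

/-- For `c = 0` the function is close to `sin z = (-1) ^ n sin w` near `π n`. -/
lemma exists_zero_near_pi_mul {Φ : ℂ → ℂ} (hΦ : Differentiable ℂ Φ) (H : SinAsymptotics Φ 0) :
    ∀ᶠ n : ℕ in atTop, ∃ w : ℂ, ‖w‖ ≤ 1 / 4 ∧
      Φ ((((Real.pi * n : ℝ) : ℂ) + w) ^ 2 / 4) = 0 := by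
  obtain ⟨K, hK⟩ := H (1 / 100) (by norm_num)
  have hpi := Real.pi_gt_three
  filter_upwards [eventually_ne_atTop 0,
    (tendsto_natCast_atTop_atTop (R := ℝ)).eventually_ge_atTop K] with n hn hK'
  have hn1 : (1 : ℝ) ≤ n := by exact_mod_cast Nat.one_le_iff_ne_zero.2 hn
  set ζ : ℂ := ((Real.pi * n : ℝ) : ℂ) with hζ
  set f : ℂ → ℂ := fun z => z * Φ (z ^ 2 / 4) with hf
  have hre : ∀ w : ℂ, ‖w‖ ≤ 1 / 4 → (n : ℝ) ≤ (ζ + w).re := by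
    intro w hw
    have h1 := (abs_le.1 ((Complex.abs_re_le_norm w).trans hw)).1
    rw [Complex.add_re, hζ, Complex.ofReal_re]; nlinarith
  have he : ∀ w : ℂ, ‖w‖ ≤ 1 / 4 → ‖f (ζ + w) - Complex.sin (ζ + w)‖ ≤ 1 / 50 := by
    intro w hw
    have h1 := hK (ζ + w) (hK'.trans ((hre w hw).trans (Complex.re_le_norm _)))
    rw [Complex.ofReal_zero, zero_mul, sub_zero] at h1
    have h2 : Real.exp |(ζ + w).im| ≤ 2 := by
      refine le_trans (Real.exp_le_exp.2 ?_) exp_quarter_le_two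
      rw [Complex.add_im, hζ, Complex.ofReal_im, zero_add]
      exact (Complex.abs_im_le_norm w).trans hw
    linarith
  have hsin : ∀ w : ℂ, ‖Complex.sin (ζ + w)‖ = ‖Complex.sin w‖ := by
    intro w
    rw [hζ, sin_pi_mul_add, norm_mul]; simp
  have e0 := he 0 (by simp)
  have s0 := hsin 0
  rw [add_zero] at e0 s0
  rw [Complex.sin_zero, norm_zero] at s0
  have hz0 : Complex.sin ζ = 0 := norm_eq_zero.1 s0
  rw [hz0, sub_zero] at e0
  obtain ⟨w, hw, hw0⟩ := exists_zero_of_le_norm_sub (f := f) (a := ζ) (differentiable_mul_comp_sq hΦ)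
    (by norm_num : (0 : ℝ) < 1 / 4) (by norm_num : (0 : ℝ) < 1 / 10) (by
      intro w hw
      have h1 := norm_sin_ge (w := w) (by rw [hw]; norm_num)
      rw [← hsin w] at h1
      have h2 := he w hw.le
      have h3 : Complex.sin (ζ + w) = (f (ζ + w) - f ζ) - (f (ζ + w) - Complex.sin (ζ + w)) + f ζ := by
        ring
      rw [h3] at h1
      have t1 := norm_add_le ((f (ζ + w) - f ζ) - (f (ζ + w) - Complex.sin (ζ + w))) (f ζ)
      have t2 := norm_sub_le (f (ζ + w) - f ζ) (f (ζ + w) - Complex.sin (ζ + w))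
      rw [hw] at h1
      linarith) (e0.trans_lt (by norm_num))
  refine ⟨w, hw, (mul_eq_zero.1 hw0).resolve_left fun h0 => ?_⟩
  have := hre w hw
  rw [h0, Complex.zero_re] at this
  linarith

/-- The number of indices `n ≥ 0` for which the zero `u n` has no partner `v n`: the partners are the
`v n` with `n ≥ unpaired c`. -/
noncomputable def unpaired (c : ℝ) : ℕ := if 0 < c then 1 else 0

lemma unpaired_le_one (c : ℝ) : unpaired c ≤ 1 := by
  unfold unpaired; split_ifs <;> omega

lemma sin_half_pi_add (j : ℕ) : Real.sin (Real.pi / 2 + Real.pi * j) = (-1) ^ j := by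
  rw [add_comm, Real.sin_add_pi_div_two, mul_comm, Real.cos_nat_mul_pi]

/-- For `c ≠ 0`, the zeros of `Φ` are numbered by `u` and the conjugates `v`, where `2 √(u n)` is
within distance `1 / 4` of `leadApprox c n`. -/
theorem SinAsymptotics.exists_numbering {Φ S : ℂ → ℂ} {c : ℝ} (hS : IsSinc S)
    (hΦ : Differentiable ℂ Φ) (hconj : ∀ z, Φ (conj z) = conj (Φ z)) (H : SinAsymptotics Φ c)
    (hc : c ≠ 0) :
    ∃ u v w : ℕ → ℂ,
      (∀ z, analyticOrderAt Φ z = count Set.univ u z + count {n | unpaired c ≤ n} v z) ∧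
      (∀ n, 0 ≤ (u n).im) ∧ (∀ n, v n = conj (u n) ∨ ((u n).im = 0 ∧ (v n).im = 0)) ∧
      ∀ᶠ n : ℕ in atTop, Φ (u n) = 0 ∧ ‖w n‖ ≤ 1 / 4 ∧ csqrt (u n) = (leadApprox c n + w n) / 2 := by
  obtain ⟨K, hK⟩ := H.exists_card_eq hS hΦ
  have hpi := Real.pi_gt_three
  have hpi2 := Real.pi_lt_d2
  -- `R n` lies halfway between the real parts of `leadApprox c n` and `leadApprox c (n + 1)`, and
  -- `sin (R n)` has the sign that `exists_card_eq` needs.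
  set R : ℕ → ℝ := fun n => Real.pi / 2 + Real.pi * (2 * n + 2 - unpaired c : ℕ) with hR
  have hRn : ∀ n, R n = 2 * Real.pi * (n + 1) + leadShift c - Real.pi := by
    intro n
    simp only [hR, unpaired, leadShift]
    split_ifs
    · rw [show 2 * n + 2 - 1 = 2 * n + 1 by omega]; push_cast; ring
    · rw [Nat.sub_zero]; push_cast; ring
  have hRsin : ∀ n, Real.sin (R n) * c ≤ 0 := by
    intro n
    simp only [hR, sin_half_pi_add, unpaired]
    split_ifs with h
    · rw [show 2 * n + 2 - 1 = 2 * n + 1 by omega, pow_succ, pow_mul]; simp; exact h.le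
    · rw [Nat.sub_zero, show 2 * n + 2 = 2 * (n + 1) by omega, pow_mul]; simpa using h
  have hRmono : Monotone R := by
    intro a b hab
    have : (a : ℝ) ≤ b := by exact_mod_cast hab
    rw [hRn, hRn]; nlinarith
  have hRpos : ∀ n, 0 < R n := by
    intro n
    rw [hRn]
    have := leadShift_bounds c
    have h2 : (0 : ℝ) ≤ n := Nat.cast_nonneg n
    nlinarith
  have hRtop : Tendsto R atTop atTop := by
    refine tendsto_atTop_mono (fun n => ?_) (tendsto_natCast_atTop_atTop (R := ℝ))
    rw [hRn]
    have := leadShift_bounds c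
    have h2 : (0 : ℝ) ≤ n := Nat.cast_nonneg n
    nlinarith
  have hr : Tendsto (fun n => R n ^ 2 / 4) atTop atTop :=
    ((tendsto_pow_atTop two_ne_zero).comp hRtop).atTop_div_const (by norm_num)
  have hrm : Monotone fun n => R n ^ 2 / 4 := by
    intro a b hab
    have := hRmono hab
    have h2 := (hRpos a).le
    simp only
    gcongr
  have hex : ∀ n : ℕ, ∃ w : ℂ, (∃ w' : ℂ, ‖w'‖ ≤ 1 / 4 ∧ Φ ((leadApprox c n + w') ^ 2 / 4) = 0) →
      ‖w‖ ≤ 1 / 4 ∧ Φ ((leadApprox c n + w) ^ 2 / 4) = 0 := by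
    intro n
    by_cases h : ∃ w' : ℂ, ‖w'‖ ≤ 1 / 4 ∧ Φ ((leadApprox c n + w') ^ 2 / 4) = 0
    · obtain ⟨w, hw⟩ := h; exact ⟨w, fun _ => hw⟩
    · exact ⟨0, fun h' => absurd h' h⟩
  choose w hw using hex
  have hev : ∀ᶠ n : ℕ in atTop, K ≤ R n ∧ (‖w n‖ ≤ 1 / 4 ∧ Φ ((leadApprox c n + w n) ^ 2 / 4) = 0) ∧
      1 ≤ (leadApprox c n).im ∧ (leadApprox c n).im ^ 2 ≤ n ∧ 1 ≤ n := by
    filter_upwards [hRtop.eventually_ge_atTop K, exists_zero_near_leadApprox hΦ H hc,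
      (tendsto_leadApprox_im hc).eventually_ge_atTop 1,
      eventually_leadApprox_im_le hc (δ := 1) one_pos, eventually_ge_atTop 1] with n h1 h2 h3 h4 h5
    exact ⟨h1, hw n h2, h3, by simpa using h4.1, h5⟩
  obtain ⟨N, hN⟩ := eventually_atTop.1 hev
  set ν : ℕ → ℂ := fun n => (leadApprox c n + w n) ^ 2 / 4 with hν
  have hre : ∀ n, N ≤ n → 2 * Real.pi * n + leadShift c - 1 / 4 ≤ (leadApprox c n + w n).re ∧
      (leadApprox c n + w n).re ≤ 2 * Real.pi * n + leadShift c + 1 / 4 := by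
    intro n hn
    have h1 := abs_le.1 ((Complex.abs_re_le_norm (w n)).trans (hN n hn).2.1.1)
    rw [Complex.add_re, leadApprox_re]; constructor <;> linarith [h1.1, h1.2]
  have him : ∀ n, N ≤ n → 0 < (leadApprox c n + w n).im := by
    intro n hn
    have h1 := abs_le.1 ((Complex.abs_im_le_norm (w n)).trans (hN n hn).2.1.1)
    have := (hN n hn).2.2.1
    rw [Complex.add_im]; linarith [h1.1]
  have hrepos : ∀ n, N ≤ n → 0 < (leadApprox c n + w n).re := by
    intro n hn
    have := (hre n hn).1
    have := leadShift_bounds c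
    have h2 : (0 : ℝ) ≤ n := Nat.cast_nonneg n
    nlinarith
  obtain ⟨u, v, h1, h2, h3, h4⟩ := exists_numbering_pairs hΦ hconj (unpaired c) (unpaired_le_one c)
    hr hrm (N := N + 1) (by omega) (by
      intro n hn
      obtain ⟨M, hM, hMc⟩ := hK (2 * n + 2 - unpaired c) (hN n (by omega)).1 (hRsin n)
      refine ⟨M, hM, ?_⟩
      have := unpaired_le_one c
      rw [hMc]; omega) (ν := ν) (by
      intro n hn
      have hn' : N ≤ n + 1 := by omega
      obtain ⟨_, ⟨hwn, hz⟩, hL1, hL2, _⟩ := hN (n + 1) hn'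
      have hsh := leadShift_bounds c
      have hre' := hre (n + 1) hn'
      push_cast at hre' hL2
      have hn0 : (0 : ℝ) ≤ n := Nat.cast_nonneg n
      have hnorm : ‖ν (n + 1)‖ = ‖leadApprox c (n + 1) + w (n + 1)‖ ^ 2 / 4 := by
        simp [hν]
      have hup : ‖leadApprox c (n + 1) + w (n + 1)‖ ≤ 2 * Real.pi * (n + 1) + leadShift c + 5 / 4 := by
        refine (norm_add_le _ _).trans ?_
        have : ‖leadApprox c (n + 1)‖ ≤ 2 * Real.pi * (n + 1) + leadShift c + 1 := by
          refine abs_le_of_sq_le_sq' ?_ (by nlinarith) |>.2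
          rw [Complex.sq_norm, Complex.normSq_apply, leadApprox_re]
          push_cast
          nlinarith
        linarith
      refine ⟨hz, ?_, ?_, ?_⟩
      · rw [hnorm]
        have h5 := hre'.1.trans (Complex.re_le_norm _)
        have : R n < ‖leadApprox c (n + 1) + w (n + 1)‖ := by rw [hRn]; linarith
        have := (hRpos n).le
        gcongr
      · rw [hnorm]
        have : ‖leadApprox c (n + 1) + w (n + 1)‖ < R (n + 1) := by rw [hRn]; push_cast; linarith
        gcongr
      · have h5 : (ν (n + 1)).im =
            (leadApprox c (n + 1) + w (n + 1)).re * (leadApprox c (n + 1) + w (n + 1)).im / 2 := by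
          simp only [hν]
          rw [show (4 : ℂ) = ((4 : ℝ) : ℂ) by norm_num, Complex.div_ofReal_im, sq, Complex.mul_im]
          ring
        rw [h5]
        have := hrepos (n + 1) hn'
        have := him (n + 1) hn'
        positivity)
  refine ⟨u, v, w, h1, h2, h3, ?_⟩
  filter_upwards [eventually_ge_atTop (N + 2)] with n hn
  obtain ⟨k, rfl⟩ : ∃ k, n = k + 1 := ⟨n - 1, by omega⟩
  rw [h4 k (by omega)]
  obtain ⟨_, ⟨hwn, hz⟩, _⟩ := hN (k + 1) (by omega)
  exact ⟨hz, hwn, csqrt_sq_div_four (hrepos _ (by omega))⟩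

/-- For `c = 0`, the zeros of `Φ` are numbered by `u`, where `2 √(u n)` is within distance `1 / 4` of
`π n`. -/
theorem SinAsymptotics.exists_numbering_zero {Φ S : ℂ → ℂ} (hS : IsSinc S)
    (hΦ : Differentiable ℂ Φ) (H : SinAsymptotics Φ 0) :
    ∃ u w : ℕ → ℂ, (∀ z, analyticOrderAt Φ z = count {n | 1 ≤ n} u z) ∧
      ∀ᶠ n : ℕ in atTop, Φ (u n) = 0 ∧ ‖w n‖ ≤ 1 / 4 ∧
        csqrt (u n) = (((Real.pi * n : ℝ) : ℂ) + w n) / 2 := by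
  obtain ⟨K, hK⟩ := H.exists_card_eq hS hΦ
  have hpi := Real.pi_gt_three
  set R : ℕ → ℝ := fun n => Real.pi / 2 + Real.pi * n with hR
  have hRmono : Monotone R := by
    intro a b hab
    have : (a : ℝ) ≤ b := by exact_mod_cast hab
    simp only [hR]; nlinarith
  have hRpos : ∀ n, 0 < R n := fun n => by have := Real.pi_pos; simp only [hR]; positivity
  have hRtop : Tendsto R atTop atTop := by
    refine tendsto_atTop_mono (fun n => ?_) (tendsto_natCast_atTop_atTop (R := ℝ))
    have h2 : (0 : ℝ) ≤ n := Nat.cast_nonneg n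
    simp only [hR]; nlinarith
  have hr : Tendsto (fun n => R n ^ 2 / 4) atTop atTop :=
    ((tendsto_pow_atTop two_ne_zero).comp hRtop).atTop_div_const (by norm_num)
  have hrm : Monotone fun n => R n ^ 2 / 4 := by
    intro a b hab
    have := hRmono hab
    have h2 := (hRpos a).le
    simp only
    gcongr
  have hex : ∀ n : ℕ, ∃ w : ℂ,
      (∃ w' : ℂ, ‖w'‖ ≤ 1 / 4 ∧ Φ ((((Real.pi * n : ℝ) : ℂ) + w') ^ 2 / 4) = 0) →
      ‖w‖ ≤ 1 / 4 ∧ Φ ((((Real.pi * n : ℝ) : ℂ) + w) ^ 2 / 4) = 0 := by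
    intro n
    by_cases h : ∃ w' : ℂ, ‖w'‖ ≤ 1 / 4 ∧ Φ ((((Real.pi * n : ℝ) : ℂ) + w') ^ 2 / 4) = 0
    · obtain ⟨w, hw⟩ := h; exact ⟨w, fun _ => hw⟩
    · exact ⟨0, fun h' => absurd h' h⟩
  choose w hw using hex
  have hev : ∀ᶠ n : ℕ in atTop, K ≤ R n ∧
      (‖w n‖ ≤ 1 / 4 ∧ Φ ((((Real.pi * n : ℝ) : ℂ) + w n) ^ 2 / 4) = 0) ∧ 1 ≤ n := by
    filter_upwards [hRtop.eventually_ge_atTop K, exists_zero_near_pi_mul hΦ H,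
      eventually_ge_atTop 1] with n h1 h2 h5
    exact ⟨h1, hw n h2, h5⟩
  obtain ⟨N, hN⟩ := eventually_atTop.1 hev
  set ν : ℕ → ℂ := fun n => (((Real.pi * n : ℝ) : ℂ) + w n) ^ 2 / 4 with hν
  have hre : ∀ n, N ≤ n → Real.pi * n - 1 / 4 ≤ (((Real.pi * n : ℝ) : ℂ) + w n).re := by
    intro n hn
    have h1 := abs_le.1 ((Complex.abs_re_le_norm (w n)).trans (hN n hn).2.1.1)
    rw [Complex.add_re, Complex.ofReal_re]; linarith [h1.1]
  have hrepos : ∀ n, N ≤ n → 0 < (((Real.pi * n : ℝ) : ℂ) + w n).re := by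
    intro n hn
    have := (hre n hn)
    have h2 : (1 : ℝ) ≤ n := by exact_mod_cast (hN n hn).2.2
    nlinarith
  obtain ⟨u, h1, h4⟩ := exists_numbering_single hΦ hr hrm (N := N + 1) (by
      intro n hn
      obtain ⟨M, hM, hMc⟩ := hK n (hN n (by omega)).1 (by simp)
      exact ⟨M, hM, hMc⟩) (ν := ν) (by
      intro n hn
      have hn' : N ≤ n + 1 := by omega
      obtain ⟨_, ⟨hwn, hz⟩, _⟩ := hN (n + 1) hn'
      have hre' := hre (n + 1) hn'
      have hn0 : (0 : ℝ) ≤ n := Nat.cast_nonneg n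
      have hnorm : ‖ν (n + 1)‖ = ‖((Real.pi * (n + 1 : ℕ) : ℝ) : ℂ) + w (n + 1)‖ ^ 2 / 4 := by
        simp [hν]
      have hup : ‖((Real.pi * (n + 1 : ℕ) : ℝ) : ℂ) + w (n + 1)‖ ≤ Real.pi * (n + 1 : ℕ) + 1 / 4 := by
        refine (norm_add_le _ _).trans ?_
        rw [Complex.norm_real, Real.norm_eq_abs, abs_of_nonneg (by positivity)]
        linarith
      refine ⟨hz, ?_, ?_⟩
      · rw [hnorm]
        have h5 := hre'.trans (Complex.re_le_norm _)
        have : R n < ‖((Real.pi * (n + 1 : ℕ) : ℝ) : ℂ) + w (n + 1)‖ := by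
          push_cast at h5
          simp only [hR]; push_cast; linarith
        have := (hRpos n).le
        gcongr
      · rw [hnorm]
        have : ‖((Real.pi * (n + 1 : ℕ) : ℝ) : ℂ) + w (n + 1)‖ < R (n + 1) := by
          simp only [hR]; linarith
        gcongr)
  refine ⟨u, w, h1, ?_⟩
  filter_upwards [eventually_ge_atTop (N + 2)] with n hn
  obtain ⟨k, rfl⟩ : ∃ k, n = k + 1 := ⟨n - 1, by omega⟩
  rw [h4 k (by omega)]
  obtain ⟨_, ⟨hwn, hz⟩, _⟩ := hN (k + 1) (by omega)
  exact ⟨hz, hwn, csqrt_sq_div_four (hrepos _ (by omega))⟩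

open scoped unitInterval

/-! ### Solutions of the Sturm–Liouville equation -/

/-- An affine family of fixed point equations `v = v₀ + J (A - l B) v` is solved by a Neumann series
where the operators are contractions; the solution depends holomorphically on `l`. -/
lemma exists_differentiableAt_fixedPoint {E : Type*} [NormedAddCommGroup E] [NormedSpace ℂ E]
    [CompleteSpace E] (J A B : E →L[ℂ] E) {R : ℝ} (h : ‖J‖ * (‖A‖ + |R| * ‖B‖) < 1) (v₀ : E) :
    ∃ V : ℂ → E, ∀ l : ℂ, ‖l‖ < R →
      V l = v₀ + J (A (V l) - l • B (V l)) ∧ DifferentiableAt ℂ V l := by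
  let K : ℂ → (E →L[ℂ] E) := fun l => J * (A - l • B)
  refine ⟨fun l => Ring.inverse (1 - K l) v₀, fun l hl => ?_⟩
  have hK : ‖K l‖ < 1 := by
    refine lt_of_le_of_lt ((norm_mul_le _ _).trans ?_) h
    gcongr
    refine (norm_sub_le _ _).trans ?_
    rw [norm_smul]
    have : ‖l‖ ≤ |R| := hl.le.trans (le_abs_self R)
    gcongr
  have hunit : IsUnit (1 - K l) := isUnit_one_sub_of_norm_lt_one hK
  constructor
  · have h1 := Ring.mul_inverse_cancel _ hunit
    have h2 : (1 - K l) (Ring.inverse (1 - K l) v₀) = v₀ := by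
      change ((1 - K l) * Ring.inverse (1 - K l)) v₀ = v₀
      rw [h1]; rfl
    have h3 : ∀ v : E, (1 - K l) v = v₀ → v = v₀ + J (A v - l • B v) := by
      intro v hv
      have h4 : v - J (A v - l • B v) = v₀ := hv
      rw [← h4]; abel
    exact h3 _ h2
  · have h1 : Differentiable ℂ K := by
      have : Differentiable ℂ fun l : ℂ => A - l • B := by fun_prop
      exact (differentiable_const J).mul this
    have h2 : DifferentiableAt ℂ Ring.inverse (1 - K l) :=
      differentiableAt_inverse hunit
    have h3 : DifferentiableAt ℂ (fun l => Ring.inverse (1 - K l)) l :=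
      DifferentiableAt.comp (g := Ring.inverse) (f := fun l => 1 - K l) l h2
        ((differentiable_const (1 : E →L[ℂ] E)).sub h1 l)
    exact h3.clm_apply (differentiableAt_const v₀)

/-- The operator `V ↦ e^{-γ x} ∫₀ˣ e^{γ t} V(t) dt` on continuous functions. Its norm is at most
`1 / γ`, so that with a large weight `γ` Volterra equations are solved by a Neumann series. -/
noncomputable def weightedPrimitive {γ : ℝ} (hγ : 0 < γ) : C(I, ℂ × ℂ) →L[ℂ] C(I, ℂ × ℂ) :=
  have hcont : ∀ V : C(I, ℂ × ℂ), Continuous fun t : ℝ =>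
      (Real.exp (γ * t) : ℂ) • V (Set.projIcc 0 1 zero_le_one t) := fun V => by
    have := continuous_projIcc (a := (0 : ℝ)) (b := 1) (h := zero_le_one)
    fun_prop
  LinearMap.mkContinuous
    { toFun := fun V =>
        ⟨fun x => (Real.exp (-γ * x) : ℂ) • ∫ t in (0 : ℝ)..x,
          (Real.exp (γ * t) : ℂ) • V (Set.projIcc 0 1 zero_le_one t), by
          have h := intervalIntegral.continuous_primitive (μ := volume)
            (fun a b => (hcont V).intervalIntegrable a b) 0
          fun_prop⟩
      map_add' := fun V W => by
        ext1 x
        simp only [ContinuousMap.coe_mk, ContinuousMap.add_apply, smul_add]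
        rw [intervalIntegral.integral_add ((hcont V).intervalIntegrable _ _)
          ((hcont W).intervalIntegrable _ _), smul_add]
      map_smul' := fun c V => by
        ext1 x
        simp only [ContinuousMap.coe_mk, ContinuousMap.smul_apply, RingHom.id_apply]
        rw [smul_comm c, ← intervalIntegral.integral_smul c]
        simp only [smul_comm c] }
    (1 / γ) fun V => by
      rw [ContinuousMap.norm_le _ (by positivity)]
      intro x
      simp only [LinearMap.coe_mk, AddHom.coe_mk, ContinuousMap.coe_mk]
      rw [norm_smul, Complex.norm_real, Real.norm_eq_abs, Real.abs_exp]
      have hx : (0 : ℝ) ≤ x := x.2.1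
      have h1 : ‖∫ t in (0 : ℝ)..x, (Real.exp (γ * t) : ℂ) •
          V (Set.projIcc 0 1 zero_le_one t)‖ ≤ ∫ t in (0 : ℝ)..x, Real.exp (γ * t) * ‖V‖ := by
        refine intervalIntegral.norm_integral_le_of_norm_le hx ?_ ?_
        · refine Filter.Eventually.of_forall fun t _ => ?_
          rw [norm_smul, Complex.norm_real, Real.norm_eq_abs, Real.abs_exp]
          gcongr
          exact V.norm_coe_le_norm _
        · exact Continuous.intervalIntegrable (by fun_prop) _ _
      have h2 : (∫ t in (0 : ℝ)..x, Real.exp (γ * t) * ‖V‖) =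
          (Real.exp (γ * x) - 1) / γ * ‖V‖ := by
        rw [intervalIntegral.integral_mul_const]
        congr 1
        rw [intervalIntegral.integral_comp_mul_left (fun t => Real.exp t) hγ.ne', integral_exp]
        simp; ring
      rw [h2] at h1
      calc _ ≤ Real.exp (-γ * x) * ((Real.exp (γ * x) - 1) / γ * ‖V‖) := by gcongr
        _ = (Real.exp (-γ * x) * Real.exp (γ * x) - Real.exp (-γ * x)) / γ * ‖V‖ := by ring
        _ ≤ 1 / γ * ‖V‖ := by
          rw [← Real.exp_add, neg_mul, neg_add_cancel, Real.exp_zero]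
          have := Real.exp_pos (-(γ * x))
          gcongr
          linarith

lemma weightedPrimitive_apply {γ : ℝ} (hγ : 0 < γ) (V : C(I, ℂ × ℂ)) (x : I) :
    weightedPrimitive hγ V x = (Real.exp (-γ * x) : ℂ) • ∫ t in (0 : ℝ)..x,
          (Real.exp (γ * t) : ℂ) • V (Set.projIcc 0 1 zero_le_one t) := rfl

lemma norm_weightedPrimitive_le {γ : ℝ} (hγ : 0 < γ) : ‖weightedPrimitive hγ‖ ≤ 1 / γ :=
  by
  unfold weightedPrimitive
  exact LinearMap.mkContinuous_norm_le _ (by positivity) _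

/-- Multiplication of the pair `(ψ, ψ')` by the coefficient matrix of the system for `λ = 0`. -/
noncomputable def systemOp (Q : C(I, ℂ)) : C(I, ℂ × ℂ) →L[ℂ] C(I, ℂ × ℂ) :=
  LinearMap.mkContinuous
    { toFun := fun V => ⟨fun x => ((V x).2, Q x * (V x).1), by fun_prop⟩
      map_add' := fun V W => by ext x <;> simp [mul_add]
      map_smul' := fun c V => by ext x <;> simp [mul_left_comm] }
    (1 + ‖Q‖) fun V => by
      rw [ContinuousMap.norm_le _ (by positivity)]
      intro x
      have h1 := V.norm_coe_le_norm x
      have h2 := Q.norm_coe_le_norm x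
      have h3 := (norm_fst_le (V x)).trans h1
      have h4 := (norm_snd_le (V x)).trans h1
      have h5 := norm_nonneg V
      have h6 := norm_nonneg Q
      refine norm_prod_le_iff.2 ⟨?_, ?_⟩
      · simp only [LinearMap.coe_mk, AddHom.coe_mk, ContinuousMap.coe_mk]; nlinarith
      · simp only [LinearMap.coe_mk, AddHom.coe_mk, ContinuousMap.coe_mk, norm_mul]
        nlinarith [mul_le_mul h2 h3 (norm_nonneg _) (norm_nonneg _)]

/-- The map `(ψ, ψ') ↦ (0, ψ)`, the coefficient of `λ` in the system up to sign. -/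
noncomputable def shiftOp : C(I, ℂ × ℂ) →L[ℂ] C(I, ℂ × ℂ) :=
  ContinuousLinearMap.compLeftContinuous ℂ I
    ((0 : ℂ × ℂ →L[ℂ] ℂ).prod (ContinuousLinearMap.fst ℂ ℂ ℂ))

/-- The Cauchy problem at `0` for `|l| < R`. The pair `Y = (ψ, ψ')` solves a Volterra equation, and
`V = exp (-γ x) Y` solves a fixed point equation that is contractive if `γ` is large in terms of
`R`. -/
lemma exists_solution_of_norm_lt {q : ℝ → ℝ} (hq : ContinuousOn q (Set.Icc 0 1)) (a b : ℂ) (R : ℝ) :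
    ∃ ψ dψ : ℂ → ℝ → ℂ, (∀ l : ℂ, ‖l‖ < R → IsSolution q l (ψ l) (dψ l) ∧ ψ l 0 = a ∧ dψ l 0 = b) ∧
      (∀ l : ℂ, ‖l‖ < R → DifferentiableAt ℂ (fun l => ψ l 1) l ∧
        DifferentiableAt ℂ (fun l => dψ l 1) l) := by
  classical
  let Q : C(I, ℂ) := ⟨fun x => (q x : ℂ), by
    exact Complex.continuous_ofReal.comp (continuousOn_iff_continuous_domRestrict.1 hq)⟩
  obtain ⟨γ, hγ, hγR⟩ : ∃ γ : ℝ, 0 < γ ∧ ‖systemOp Q‖ + |R| * ‖shiftOp‖ < γ :=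
    ⟨‖systemOp Q‖ + |R| * ‖shiftOp‖ + 1, by positivity, by linarith⟩
  let V0 : C(I, ℂ × ℂ) := ⟨fun x => (Real.exp (-γ * x) : ℂ) • (a, b), by fun_prop⟩
  obtain ⟨V, hVV⟩ := exists_differentiableAt_fixedPoint (R := R) (weightedPrimitive hγ) (systemOp Q)
    shiftOp (by
      calc _ ≤ 1 / γ * (‖systemOp Q‖ + |R| * ‖shiftOp‖) := by
            gcongr; exact norm_weightedPrimitive_le hγ
        _ < 1 / γ * γ := by gcongr
        _ = 1 := by field_simp) V0
  have hV := fun l hl => (hVV l hl).1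
  have hVd := fun l hl => (hVV l hl).2
  let P : ℝ → I := Set.projIcc 0 1 zero_le_one
  have hPc : Continuous P := continuous_projIcc
  have hP : ∀ x (hx : x ∈ Set.Icc (0 : ℝ) 1), P x = ⟨x, hx⟩ := fun x hx => Set.projIcc_of_mem _ hx
  let Y : ℂ → ℝ → ℂ × ℂ := fun l x => (Real.exp (γ * x) : ℂ) • V l (P x)
  have hYc : ∀ l, Continuous (Y l) := fun l => by simp only [Y]; fun_prop
  let G : ℂ → ℝ → ℂ × ℂ := fun l t => ((Y l t).2, (Q (P t) - l) * (Y l t).1)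
  have hGc : ∀ l, Continuous (G l) := fun l => by
    have := hYc l
    simp only [G]; fun_prop
  have hY : ∀ l : ℂ, ‖l‖ < R → ∀ x ∈ Set.Icc (0 : ℝ) 1,
      Y l x = (a, b) + ∫ t in (0 : ℝ)..x, G l t := by
    intro l hl x hx
    have h1 := congrArg (fun W : C(I, ℂ × ℂ) => W (P x)) (hV l hl)
    simp only [ContinuousMap.add_apply] at h1
    have h2 : weightedPrimitive hγ (systemOp Q (V l) - l • shiftOp (V l)) (P x) =
        (Real.exp (-γ * x) : ℂ) • ∫ t in (0 : ℝ)..x, G l t := by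
      rw [weightedPrimitive_apply]
      have h4 : ((P x : I) : ℝ) = x := by rw [hP x hx]
      rw [h4]
      congr 2
      ext1 t
      have h3 : (systemOp Q (V l) - l • shiftOp (V l)) (P t) =
          ((V l (P t)).2, (Q (P t) - l) * (V l (P t)).1) := by
        ext
        · simp [systemOp, shiftOp]
        · simp [systemOp, shiftOp]; ring
      change _ • (systemOp Q (V l) - l • shiftOp (V l)) (P t) = _
      rw [h3]
      ext
      · simp [G, Y]
      · simp [G, Y]; ring
    have h4 : V0 (P x) = (Real.exp (-γ * x) : ℂ) • (a, b) := by
      rw [hP x hx]; rfl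
    rw [h2, h4] at h1
    simp only [Y]
    rw [h1, ← smul_add, smul_smul, ← Complex.ofReal_mul, ← Real.exp_add]
    simp
  have hfst : ∀ l : ℂ, ‖l‖ < R → ∀ x ∈ Set.Icc (0 : ℝ) 1,
      (Y l x).1 = a + ∫ t in (0 : ℝ)..x, (G l t).1 := by
    intro l hl x hx
    have h1 := ContinuousLinearMap.intervalIntegral_comp_comm (ContinuousLinearMap.fst ℂ ℂ ℂ)
      ((hGc l).intervalIntegrable (μ := volume) 0 x)
    rw [hY l hl x hx, Prod.fst_add]
    exact congrArg (a + ·) h1.symm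
  have hsnd : ∀ l : ℂ, ‖l‖ < R → ∀ x ∈ Set.Icc (0 : ℝ) 1,
      (Y l x).2 = b + ∫ t in (0 : ℝ)..x, (G l t).2 := by
    intro l hl x hx
    have h1 := ContinuousLinearMap.intervalIntegral_comp_comm (ContinuousLinearMap.snd ℂ ℂ ℂ)
      ((hGc l).intervalIntegrable (μ := volume) 0 x)
    rw [hY l hl x hx, Prod.snd_add]
    exact congrArg (b + ·) h1.symm
  refine ⟨fun l x => (Y l x).1, fun l x => (Y l x).2, ?_, ?_⟩
  · intro l hl
    have h01 : (0 : ℝ) ∈ Set.Icc (0 : ℝ) 1 := by simp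
    have h0a : (Y l 0).1 = a := by simpa using hfst l hl 0 h01
    have h0b : (Y l 0).2 = b := by simpa using hsnd l hl 0 h01
    refine ⟨⟨(hYc l).fst.continuousOn, (hYc l).snd.continuousOn, ?_, ?_⟩, h0a, h0b⟩
    · intro x hx
      simp only []
      rw [h0a]; exact hfst l hl x hx
    · intro x hx
      simp only []
      rw [h0b, hsnd l hl x hx]
      congr 1
      refine intervalIntegral.integral_congr fun t ht => ?_
      rw [Set.uIcc_of_le hx.1] at ht
      have h3 := hP t ⟨ht.1, ht.2.trans hx.2⟩
      simp only [G, h3]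
      rfl
  · intro l hl
    have h1 : DifferentiableAt ℂ (fun l => Y l 1) l := by
      have h2 : DifferentiableAt ℂ (fun l => V l (P 1)) l :=
        (ContinuousMap.evalCLM (M := ℂ × ℂ) ℂ (P 1)).differentiableAt.comp l (hVd l hl)
      exact h2.const_smul (Real.exp (γ * 1) : ℂ)
    exact ⟨h1.fst, h1.snd⟩

/-- A primitive on `[0, 1]` of a function continuous there is differentiable inside. -/
lemma hasDerivAt_of_eq_integral {u du : ℝ → ℂ} (hdu : ContinuousOn du (Set.Icc 0 1))
    (h : ∀ x ∈ Set.Icc (0 : ℝ) 1, u x = u 0 + ∫ t in (0 : ℝ)..x, du t) {x : ℝ}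
    (hx : x ∈ Set.Ioo (0 : ℝ) 1) : HasDerivAt u (du x) x := by
  have hnhds : Set.Icc (0 : ℝ) 1 ∈ 𝓝 x := Icc_mem_nhds hx.1 hx.2
  have h1 : HasDerivAt (fun y => ∫ t in (0 : ℝ)..y, du t) (du x) x := by
    refine intervalIntegral.integral_hasDerivAt_right ?_ ?_ (hdu.continuousAt hnhds)
    · refine (hdu.mono ?_).intervalIntegrable
      rw [Set.uIcc_of_le hx.1.le]
      exact Set.Icc_subset_Icc le_rfl hx.2.le
    · exact hdu.stronglyMeasurableAtFilter_nhdsWithin measurableSet_Icc x |>.filter_mono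
        (by rw [nhdsWithin_eq_nhds.2 hnhds])
  refine (h1.const_add (u 0)).congr_of_eventuallyEq ?_
  filter_upwards [hnhds] with y hy using h y hy

lemma continuousOn_ofReal {q : ℝ → ℝ} {s : Set ℝ} (hq : ContinuousOn q s) :
    ContinuousOn (fun x => (q x : ℂ)) s :=
  Complex.continuous_ofReal.comp_continuousOn hq

lemma IsSolution.hasDerivAt {q : ℝ → ℝ} {l : ℂ} {ψ dψ : ℝ → ℂ} (h : IsSolution q l ψ dψ) {x : ℝ}
    (hx : x ∈ Set.Ioo (0 : ℝ) 1) : HasDerivAt ψ (dψ x) x :=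
  hasDerivAt_of_eq_integral h.cont_deriv h.eq_integral hx

lemma IsSolution.hasDerivAt_deriv {q : ℝ → ℝ} (hq : ContinuousOn q (Set.Icc 0 1)) {l : ℂ}
    {ψ dψ : ℝ → ℂ} (h : IsSolution q l ψ dψ) {x : ℝ} (hx : x ∈ Set.Ioo (0 : ℝ) 1) :
    HasDerivAt dψ (((q x : ℂ) - l) * ψ x) x :=
  hasDerivAt_of_eq_integral (((continuousOn_ofReal hq).sub continuousOn_const).mul h.cont)
    h.eq_integral_deriv hx

/-- The fundamental theorem of calculus on `[0, x] ⊆ [0, 1]`. -/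
lemma integral_eq_sub_of_hasDerivAt_Ioo {u du : ℝ → ℂ} (hu : ContinuousOn u (Set.Icc 0 1))
    (hdu : ContinuousOn du (Set.Icc 0 1)) (h : ∀ x ∈ Set.Ioo (0 : ℝ) 1, HasDerivAt u (du x) x)
    {x : ℝ} (hx : x ∈ Set.Icc (0 : ℝ) 1) : ∫ t in (0 : ℝ)..x, du t = u x - u 0 := by
  have hsub : Set.Icc 0 x ⊆ Set.Icc (0 : ℝ) 1 := Set.Icc_subset_Icc le_rfl hx.2
  refine intervalIntegral.integral_eq_sub_of_hasDerivAt_of_le hx.1 (hu.mono hsub)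
    (fun y hy => h y ⟨hy.1, hy.2.trans_le hx.2⟩) ?_
  refine (hdu.mono ?_).intervalIntegrable
  rwa [Set.uIcc_of_le hx.1]

/-- The Wronskian identity for solutions of two equations. -/
lemma IsSolution.wronskian {q₁ q₂ : ℝ → ℝ} (h₁ : ContinuousOn q₁ (Set.Icc 0 1))
    (h₂ : ContinuousOn q₂ (Set.Icc 0 1)) {l : ℂ} {ψ dψ φ dφ : ℝ → ℂ} (hψ : IsSolution q₁ l ψ dψ)
    (hφ : IsSolution q₂ l φ dφ) {x : ℝ} (hx : x ∈ Set.Icc (0 : ℝ) 1) :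
    ∫ t in (0 : ℝ)..x, ((q₁ t : ℂ) - q₂ t) * (ψ t * φ t) =
      (dψ x * φ x - ψ x * dφ x) - (dψ 0 * φ 0 - ψ 0 * dφ 0) := by
  have hc1 := hψ.cont
  have hc2 := hψ.cont_deriv
  have hc3 := hφ.cont
  have hc4 := hφ.cont_deriv
  have hq1 := continuousOn_ofReal h₁
  have hq2 := continuousOn_ofReal h₂
  refine integral_eq_sub_of_hasDerivAt_Ioo (u := fun x => dψ x * φ x - ψ x * dφ x)
    (by fun_prop) (by fun_prop) (fun y hy => ?_) hx
  refine (((hψ.hasDerivAt_deriv h₁ hy).mul (hφ.hasDerivAt hy)).sub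
    ((hψ.hasDerivAt hy).mul (hφ.hasDerivAt_deriv h₂ hy))).congr_deriv ?_
  ring

/-- A linear combination of solutions is a solution. -/
lemma IsSolution.linear_comb {q : ℝ → ℝ} (hq : ContinuousOn q (Set.Icc 0 1)) {l : ℂ}
    {ψ dψ φ dφ : ℝ → ℂ} (hψ : IsSolution q l ψ dψ) (hφ : IsSolution q l φ dφ) (a b : ℂ) :
    IsSolution q l (fun x => a * ψ x + b * φ x) (fun x => a * dψ x + b * dφ x) := by
  have hc1 := hψ.cont
  have hc2 := hψ.cont_deriv
  have hc3 := hφ.cont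
  have hc4 := hφ.cont_deriv
  have hq1 := continuousOn_ofReal hq
  have hint : ∀ {u : ℝ → ℂ}, ContinuousOn u (Set.Icc 0 1) → ∀ x ∈ Set.Icc (0 : ℝ) 1,
      IntervalIntegrable u volume 0 x := fun hu x hx => by
    refine (hu.mono ?_).intervalIntegrable
    rw [Set.uIcc_of_le hx.1]
    exact Set.Icc_subset_Icc le_rfl hx.2
  refine ⟨by fun_prop, by fun_prop, fun x hx => ?_, fun x hx => ?_⟩
  · rw [intervalIntegral.integral_add ((hint hc2 x hx).const_mul a) ((hint hc4 x hx).const_mul b),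
      intervalIntegral.integral_const_mul, intervalIntegral.integral_const_mul,
      hψ.eq_integral x hx, hφ.eq_integral x hx]
    ring
  · have h1 : ∀ t, ((q t : ℂ) - l) * (a * ψ t + b * φ t) =
        a * (((q t : ℂ) - l) * ψ t) + b * (((q t : ℂ) - l) * φ t) := fun t => by ring
    simp only [h1]
    rw [intervalIntegral.integral_add ((hint (by fun_prop) x hx).const_mul a)
      ((hint (by fun_prop) x hx).const_mul b),
      intervalIntegral.integral_const_mul, intervalIntegral.integral_const_mul,
      hψ.eq_integral_deriv x hx, hφ.eq_integral_deriv x hx]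
    ring

/-- A solution is determined by its Cauchy data at `0`. -/
lemma IsSolution.eq_of_eq {q : ℝ → ℝ} (hq : ContinuousOn q (Set.Icc 0 1)) {l : ℂ}
    {ψ dψ φ dφ : ℝ → ℂ} (hψ : IsSolution q l ψ dψ) (hφ : IsSolution q l φ dφ) (h0 : ψ 0 = φ 0)
    (h1 : dψ 0 = dφ 0) {x : ℝ} (hx : x ∈ Set.Icc (0 : ℝ) 1) : ψ x = φ x ∧ dψ x = dφ x := by
  obtain ⟨c', dc', hc', -⟩ := exists_solution_of_norm_lt hq 1 0 (‖l‖ + 1)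
  obtain ⟨s', ds', hs', -⟩ := exists_solution_of_norm_lt hq 0 1 (‖l‖ + 1)
  obtain ⟨hc, hc0, hc1⟩ := hc' l (by linarith)
  obtain ⟨hs, hs0, hs1⟩ := hs' l (by linarith)
  generalize c' l = c, dc' l = dc, s' l = s, ds' l = ds at hc hc0 hc1 hs hs0 hs1
  have hd := hψ.linear_comb hq hφ 1 (-1)
  have w1 := hd.wronskian hq hq hc hx
  have w2 := hd.wronskian hq hq hs hx
  have w3 := hc.wronskian hq hq hs hx
  simp only [sub_self, zero_mul, intervalIntegral.integral_zero, hc0, hc1, hs0, hs1, h0, h1] at w1 w2 w3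
  have e1 : (dψ x - dφ x) * c x = (ψ x - φ x) * dc x := by linear_combination -w1
  have e2 : (dψ x - dφ x) * s x = (ψ x - φ x) * ds x := by linear_combination -w2
  have e3 : c x * ds x - dc x * s x = 1 := by linear_combination w3
  constructor
  · linear_combination s x * e1 - c x * e2 - (ψ x - φ x) * e3
  · linear_combination ds x * e1 - dc x * e2 - (dψ x - dφ x) * e3

/-- The Cauchy problem at `0` for all `l`. As solutions are unique, the families for bounded `l` fit
together, and the Cauchy data at `1` are entire functions of `l`. -/
theorem exists_solution {q : ℝ → ℝ} (hq : ContinuousOn q (Set.Icc 0 1)) (a b : ℂ) :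
    ∃ ψ dψ : ℂ → ℝ → ℂ, (∀ l : ℂ, IsSolution q l (ψ l) (dψ l) ∧ ψ l 0 = a ∧ dψ l 0 = b) ∧
      Differentiable ℂ (fun l => ψ l 1) ∧ Differentiable ℂ (fun l => dψ l 1) := by
  have hex : ∀ l : ℂ, ∃ ψ dψ : ℝ → ℂ, IsSolution q l ψ dψ ∧ ψ 0 = a ∧ dψ 0 = b := fun l => by
    obtain ⟨ψ, dψ, h, -⟩ := exists_solution_of_norm_lt hq a b (‖l‖ + 1)
    exact ⟨ψ l, dψ l, h l (by linarith)⟩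
  choose ψ dψ h using hex
  have key : ∀ l : ℂ, DifferentiableAt ℂ (fun l => ψ l 1) l ∧
      DifferentiableAt ℂ (fun l => dψ l 1) l := by
    intro l
    obtain ⟨φ, dφ, h1, h2⟩ := exists_solution_of_norm_lt hq a b (‖l‖ + 1)
    have hl : ‖l‖ < ‖l‖ + 1 := by linarith
    have hev : ∀ᶠ m in 𝓝 l, ψ m 1 = φ m 1 ∧ dψ m 1 = dφ m 1 := by
      filter_upwards [continuous_norm.continuousAt.eventually_lt_const hl] with m hm
      obtain ⟨h3, h4, h5⟩ := h1 m hm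
      obtain ⟨h6, h7, h8⟩ := h m
      exact h6.eq_of_eq hq h3 (h7.trans h4.symm) (h8.trans h5.symm) (by simp)
    exact ⟨(h2 l hl).1.congr_of_eventuallyEq (hev.mono fun _ h => h.1),
      (h2 l hl).2.congr_of_eventuallyEq (hev.mono fun _ h => h.2)⟩
  exact ⟨ψ, dψ, h, fun l => (key l).1, fun l => (key l).2⟩

/-! ### The characteristic function -/

/-- The solution with `ψ(0) = 1`, `ψ'(0) = h`. -/
structure IsRobinSolution (q : ℝ → ℝ) (h : ℝ) (l : ℂ) (ψ dψ : ℝ → ℂ) : Prop where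
  sol : IsSolution q l ψ dψ
  zero : ψ 0 = 1
  deriv_zero : dψ 0 = h

lemma isSolution_zero_of_hasDerivAt {l : ℂ} {ψ dψ : ℝ → ℂ} (h1 : ∀ x, HasDerivAt ψ (dψ x) x)
    (h2 : ∀ x, HasDerivAt dψ (-l * ψ x) x) : IsSolution (fun _ => 0) l ψ dψ := by
  have c1 : Continuous ψ := continuous_iff_continuousAt.2 fun x => (h1 x).continuousAt
  have c2 : Continuous dψ := continuous_iff_continuousAt.2 fun x => (h2 x).continuousAt
  refine ⟨c1.continuousOn, c2.continuousOn, fun x _ => ?_, fun x _ => ?_⟩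
  · rw [intervalIntegral.integral_eq_sub_of_hasDerivAt (fun y _ => h1 y) (c2.intervalIntegrable _ _)]
    ring
  · simp only [Complex.ofReal_zero, zero_sub]
    rw [intervalIntegral.integral_eq_sub_of_hasDerivAt (fun y _ => h2 y)
      ((continuous_const.mul c1).intervalIntegrable _ _)]
    ring

lemma hasDerivAt_cos_mul (k : ℂ) (x : ℝ) :
    HasDerivAt (fun x : ℝ => Complex.cos (k * x)) (-k * Complex.sin (k * x)) x := by
  have h1 : HasDerivAt (fun x : ℝ => k * (x : ℂ)) k x := by
    simpa using (Complex.ofRealCLM.hasDerivAt (x := x)).const_mul k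
  refine ((Complex.hasDerivAt_cos (k * x)).comp x h1).congr_deriv ?_
  ring

lemma hasDerivAt_sin_mul (k : ℂ) (x : ℝ) :
    HasDerivAt (fun x : ℝ => Complex.sin (k * x)) (k * Complex.cos (k * x)) x := by
  have h1 : HasDerivAt (fun x : ℝ => k * (x : ℂ)) k x := by
    simpa using (Complex.ofRealCLM.hasDerivAt (x := x)).const_mul k
  refine ((Complex.hasDerivAt_sin (k * x)).comp x h1).congr_deriv ?_
  ring

/-- `a cos kx + b sin kx` solves the free equation. -/
lemma isSolution_trig (k a b : ℂ) :
    IsSolution (fun _ => 0) (k ^ 2)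
      (fun x => a * Complex.cos (k * x) + b * Complex.sin (k * x))
      (fun x => -(a * k * Complex.sin (k * x)) + b * k * Complex.cos (k * x)) := by
  refine isSolution_zero_of_hasDerivAt (fun x => ?_) (fun x => ?_)
  · refine (((hasDerivAt_cos_mul k x).const_mul a).add
      ((hasDerivAt_sin_mul k x).const_mul b)).congr_deriv ?_
    ring
  · refine ((((hasDerivAt_sin_mul k x).const_mul (a * k)).neg).add
      ((hasDerivAt_cos_mul k x).const_mul (b * k))).congr_deriv ?_
    ring

lemma isRobinSolution_free {k : ℂ} (hk : k ≠ 0) (h : ℝ) :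
    IsRobinSolution (fun _ => 0) h (k ^ 2)
      (fun x => 1 * Complex.cos (k * x) + h / k * Complex.sin (k * x))
      (fun x => -(1 * k * Complex.sin (k * x)) + h / k * k * Complex.cos (k * x)) :=
  ⟨isSolution_trig k 1 (h / k), by simp, by simp [hk]⟩

lemma isRobinSolution_free_zero (h : ℝ) :
    IsRobinSolution (fun _ => 0) h 0 (fun x => 1 + h * x) (fun _ => h) := by
  refine ⟨isSolution_zero_of_hasDerivAt (fun x => ?_) (fun x => ?_), by simp, rfl⟩
  · simpa using ((Complex.ofRealCLM.hasDerivAt (x := x)).const_mul (h : ℂ)).const_add 1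
  · simpa using hasDerivAt_const x (h : ℂ)

/-- `S` is obtained from the solution of `-ψ'' = z ^ 2 ψ` with `ψ(0) = 0` and `ψ'(0) = 1`, which at
`1` is `sin z / z`. -/
lemma exists_isSinc : ∃ S, IsSinc S := by
  obtain ⟨ψ, dψ, h1, h2, -⟩ := exists_solution (q := fun _ => 0) continuousOn_const 0 1
  refine ⟨fun l => ψ (4 * l) 1, by fun_prop, fun z => ?_⟩
  by_cases hz : z = 0
  · simp [hz]
  · have h3 := isSolution_trig z 0 (1 / z)
    obtain ⟨h4, h5, h6⟩ := h1 (z ^ 2)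
    have h7 := (h4.eq_of_eq continuousOn_const h3 (by simp [h5]) (by simp [h6, hz])
      (x := 1) (by simp)).1
    simp only [show 4 * (z ^ 2 / 4) = z ^ 2 by ring]
    rw [h7]
    simp
    field_simp

lemma IsRobinSolution.unique {q : ℝ → ℝ} (hq : ContinuousOn q (Set.Icc 0 1)) {h : ℝ} {l : ℂ}
    {ψ dψ φ dφ : ℝ → ℂ} (h1 : IsRobinSolution q h l ψ dψ) (h2 : IsRobinSolution q h l φ dφ)
    {x : ℝ} (hx : x ∈ Set.Icc (0 : ℝ) 1) : ψ x = φ x ∧ dψ x = dφ x :=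
  h1.sol.eq_of_eq hq h2.sol (h1.zero.trans h2.zero.symm) (h1.deriv_zero.trans h2.deriv_zero.symm) hx

lemma IsRobinSolution.conj {q : ℝ → ℝ} {h : ℝ} {l : ℂ} {ψ dψ : ℝ → ℂ}
    (H : IsRobinSolution q h l ψ dψ) :
    IsRobinSolution q h (conj l) (fun x => conj (ψ x)) (fun x => conj (dψ x)) := by
  refine ⟨⟨?_, ?_, fun x hx => ?_, fun x hx => ?_⟩, by simp [H.zero], by simp [H.deriv_zero]⟩
  · exact Complex.continuous_conj.comp_continuousOn H.sol.cont
  · exact Complex.continuous_conj.comp_continuousOn H.sol.cont_deriv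
  · rw [H.sol.eq_integral x hx, map_add, ← intervalIntegral.intervalIntegral_conj]
  · rw [H.sol.eq_integral_deriv x hx, map_add, ← intervalIntegral.intervalIntegral_conj]
    simp

/-- Solutions with arbitrary Cauchy data at `1` exist. -/
lemma exists_solution_at_one {q : ℝ → ℝ} (hq : ContinuousOn q (Set.Icc 0 1)) (l a b : ℂ) :
    ∃ ψ dψ : ℝ → ℂ, IsSolution q l ψ dψ ∧ ψ 1 = a ∧ dψ 1 = b := by
  obtain ⟨c', dc', hc', -⟩ := exists_solution hq 1 0
  obtain ⟨s', ds', hs', -⟩ := exists_solution hq 0 1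
  obtain ⟨hc, hc0, hc1⟩ := hc' l
  obtain ⟨hs, hs0, hs1⟩ := hs' l
  generalize c' l = c, dc' l = dc, s' l = s, ds' l = ds at hc hc0 hc1 hs hs0 hs1
  have w := hc.wronskian hq hq hs (x := 1) (by simp)
  simp only [sub_self, zero_mul, intervalIntegral.integral_zero, hc0, hc1, hs0, hs1] at w
  refine ⟨_, _, hc.linear_comb hq hs (a * ds 1 - b * s 1) (b * c 1 - a * dc 1), ?_, ?_⟩
  · linear_combination a * w
  · linear_combination b * w

lemma jost_spec {q : ℝ → ℝ} (hq : ContinuousOn q (Set.Icc 0 1)) (k : ℂ) :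
    IsSolution q (k ^ 2) (jost q k).1 (jost q k).2 ∧
      (jost q k).1 1 = Complex.exp (Complex.I * k) ∧
      (jost q k).2 1 = Complex.I * k * Complex.exp (Complex.I * k) := by
  obtain ⟨f, df, h1, h2, h3⟩ := exists_solution_at_one hq (k ^ 2) (Complex.exp (Complex.I * k))
    (Complex.I * k * Complex.exp (Complex.I * k))
  exact Classical.epsilon_spec (p := fun p : (ℝ → ℂ) × (ℝ → ℂ) =>
    IsSolution q (k ^ 2) p.1 p.2 ∧ p.1 1 = Complex.exp (Complex.I * k) ∧
      p.2 1 = Complex.I * k * Complex.exp (Complex.I * k)) ⟨(f, df), h1, h2, h3⟩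

/-- `F` in terms of the Robin solution: both sides are Wronskians, taken at `0` and at `1`. -/
lemma jostF_eq {q : ℝ → ℝ} (hq : ContinuousOn q (Set.Icc 0 1)) {h : ℝ} {k : ℂ} {ψ dψ : ℝ → ℂ}
    (H : IsRobinSolution q h (k ^ 2) ψ dψ) :
    jostF q h k = Complex.exp (Complex.I * k) * (k * ψ 1 + Complex.I * dψ 1) := by
  obtain ⟨h1, h2, h3⟩ := jost_spec hq k
  have w := h1.wronskian hq hq H.sol (x := 1) (by simp)
  simp only [sub_self, zero_mul, intervalIntegral.integral_zero, H.zero, H.deriv_zero, h2, h3] at w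
  rw [jostF]
  linear_combination -Complex.I * w - k * ψ 1 * Complex.exp (Complex.I * k) * Complex.I_mul_I

/-- The Wronskian at `1` of the Robin solutions of the perturbed and the free equation. -/
lemma charD_eq {q : ℝ → ℝ} (hq : ContinuousOn q (Set.Icc 0 1)) {h : ℝ} {k : ℂ}
    {ψ dψ ψ₀ dψ₀ : ℝ → ℂ} (H : IsRobinSolution q h (k ^ 2) ψ dψ)
    (H₀ : IsRobinSolution (fun _ => 0) h (k ^ 2) ψ₀ dψ₀) :
    charD q h k = dψ 1 * ψ₀ 1 - ψ 1 * dψ₀ 1 := by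
  have h01 : (1 : ℝ) ∈ Set.Icc (0 : ℝ) 1 := by simp
  have hF1 := jostF_eq hq H
  have hF2 := jostF_eq hq (k := -k) (by rwa [neg_sq])
  by_cases hk : k = 0
  · subst hk
    -- At `k = 0` the difference quotient of `F` in the definition is the derivative `F' (0)`.
    obtain ⟨φ, dφ, h1, h2, h3⟩ := exists_solution hq 1 (h : ℂ)
    have hrob : ∀ l, IsRobinSolution q h l (φ l) (dφ l) := fun l =>
      ⟨(h1 l).1, (h1 l).2.1, (h1 l).2.2⟩
    have hF : jostF q h = fun k => Complex.exp (Complex.I * k) *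
        (k * φ (k ^ 2) 1 + Complex.I * dφ (k ^ 2) 1) := by
      ext k; exact jostF_eq hq (hrob _)
    have hd : HasDerivAt (jostF q h) (φ (0 ^ 2) 1 - dφ (0 ^ 2) 1) 0 := by
      rw [hF]
      have e1 : HasDerivAt (fun k : ℂ => Complex.exp (Complex.I * k)) Complex.I 0 := by
        simpa using ((hasDerivAt_id (0 : ℂ)).const_mul Complex.I).cexp
      have e2 : HasDerivAt (fun k : ℂ => k ^ 2) 0 0 := by simpa using hasDerivAt_pow 2 (0 : ℂ)
      have e3 : HasDerivAt (fun k : ℂ => φ (k ^ 2) 1) 0 0 := by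
        have := (h2 ((0 : ℂ) ^ 2)).hasDerivAt.comp (0 : ℂ) e2
        simpa [Function.comp_def] using this
      have e4 : HasDerivAt (fun k : ℂ => dφ (k ^ 2) 1) 0 0 := by
        have := (h3 ((0 : ℂ) ^ 2)).hasDerivAt.comp (0 : ℂ) e2
        simpa [Function.comp_def] using this
      refine (e1.mul (((hasDerivAt_id (0 : ℂ)).mul e3).add (e4.const_mul Complex.I))).congr_deriv ?_
      simp
      linear_combination dφ 0 1 * Complex.I_mul_I
    obtain ⟨u1, u2⟩ := (hrob (0 ^ 2)).unique hq H h01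
    have hz : (0 : ℂ) ^ 2 = 0 := by norm_num
    rw [hz] at H₀
    obtain ⟨u3, u4⟩ := H₀.unique continuousOn_const (isRobinSolution_free_zero h) h01
    rw [charD, neg_zero, dslope_same, hd.deriv, u1, u2, u3, u4, hF1]
    simp only [mul_zero, Complex.exp_zero, zero_mul, zero_add, one_mul]
    have hI := Complex.I_ne_zero
    field_simp
    push_cast
    ring
  · have hne : k ≠ -k := by
      intro hcon
      have : (2 : ℂ) * k = 0 := by linear_combination hcon
      simp [hk] at this
    obtain ⟨u3, u4⟩ := H₀.unique continuousOn_const (isRobinSolution_free hk h) h01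
    rw [charD, dslope_of_ne _ hne, slope_def_field, hF1, hF2, u3, u4]
    have e1 : Complex.exp (Complex.I * -k) = Complex.cos k - Complex.sin k * Complex.I := by
      rw [show Complex.I * -k = (-k) * Complex.I by ring, Complex.exp_mul_I, Complex.cos_neg,
        Complex.sin_neg]; ring
    have e2 : Complex.exp (Complex.I * k) = Complex.cos k + Complex.sin k * Complex.I := by
      rw [mul_comm, Complex.exp_mul_I]
    rw [e1, e2]
    have hI := Complex.I_ne_zero
    have hI2 := Complex.I_sq
    simp only [Complex.ofReal_one, mul_one, one_mul]
    field_simp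
    ring_nf
    simp only [show Complex.I ^ 3 = -Complex.I by rw [pow_succ, hI2]; ring]
    ring

/-- Robin solutions for all `l`, with Cauchy data at `1` that are entire in `l`. -/
lemma exists_robin {q : ℝ → ℝ} (hq : ContinuousOn q (Set.Icc 0 1)) (h : ℝ) :
    ∃ ψ dψ : ℂ → ℝ → ℂ, (∀ l, IsRobinSolution q h l (ψ l) (dψ l)) ∧
      Differentiable ℂ (fun l => ψ l 1) ∧ Differentiable ℂ (fun l => dψ l 1) := by
  obtain ⟨φ, dφ, h1, h2, h3⟩ := exists_solution hq 1 (h : ℂ)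
  exact ⟨φ, dφ, fun l => ⟨(h1 l).1, (h1 l).2.1, (h1 l).2.2⟩, h2, h3⟩

lemma charDelta_eq {q : ℝ → ℝ} (hq : ContinuousOn q (Set.Icc 0 1)) {h : ℝ} {l : ℂ}
    {ψ dψ ψ₀ dψ₀ : ℝ → ℂ} (H : IsRobinSolution q h l ψ dψ)
    (H₀ : IsRobinSolution (fun _ => 0) h l ψ₀ dψ₀) :
    charDelta q h l = dψ 1 * ψ₀ 1 - ψ 1 * dψ₀ 1 := by
  rw [charDelta]
  exact charD_eq hq (by rwa [csqrt_sq]) (by rwa [csqrt_sq])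

lemma differentiable_charDelta {q : ℝ → ℝ} (hq : ContinuousOn q (Set.Icc 0 1)) (h : ℝ) :
    Differentiable ℂ (charDelta q h) := by
  obtain ⟨ψ, dψ, h1, h2, h3⟩ := exists_robin hq h
  obtain ⟨ψ₀, dψ₀, h4, h5, h6⟩ := exists_robin (q := fun _ => 0) continuousOn_const h
  have : charDelta q h = fun l => dψ l 1 * ψ₀ l 1 - ψ l 1 * dψ₀ l 1 := by
    ext l; exact charDelta_eq hq (h1 l) (h4 l)
  rw [this]
  fun_prop

lemma charDelta_conj {q : ℝ → ℝ} (hq : ContinuousOn q (Set.Icc 0 1)) (h : ℝ) (l : ℂ) :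
    charDelta q h (conj l) = conj (charDelta q h l) := by
  obtain ⟨ψ, dψ, h1, -⟩ := exists_robin hq h
  obtain ⟨ψ₀, dψ₀, h4, -⟩ := exists_robin (q := fun _ => 0) continuousOn_const h
  rw [charDelta_eq hq (h1 l) (h4 l), charDelta_eq hq (h1 l).conj (h4 l).conj]
  simp

/-- The Cauchy data of a Robin solution at `1` do not vanish. -/
lemma IsRobinSolution.ne_zero_at_one {q : ℝ → ℝ} (hq : ContinuousOn q (Set.Icc 0 1)) {h : ℝ} {l : ℂ}
    {ψ dψ : ℝ → ℂ} (H : IsRobinSolution q h l ψ dψ) : ψ 1 ≠ 0 ∨ dψ 1 ≠ 0 := by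
  by_contra hcon
  push Not at hcon
  obtain ⟨s', ds', hs', -⟩ := exists_solution hq 0 1
  obtain ⟨hs, hs0, hs1⟩ := hs' l
  have w := H.sol.wronskian hq hq hs (x := 1) (by simp)
  simp [hcon.1, hcon.2, H.zero, hs0, hs1] at w

/-- The Robin conditions at `0` determine the solution of each equation up to a factor. The two
solutions have nontrivial multiples with equal Cauchy data at `1` if and only if their Wronskian
vanishes there. -/
lemma isTransmissionEigenvalue_iff {q : ℝ → ℝ} (hq : ContinuousOn q (Set.Icc 0 1)) (h : ℝ) (l : ℂ) :
    IsTransmissionEigenvalue q h l ↔ charDelta q h l = 0 := by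
  have h01 : (1 : ℝ) ∈ Set.Icc (0 : ℝ) 1 := by simp
  obtain ⟨ψ', dψ', h1', -⟩ := exists_robin hq h
  obtain ⟨ψ₀', dψ₀', h4', -⟩ := exists_robin (q := fun _ => 0) continuousOn_const h
  have h1 := h1' l
  have h4 := h4' l
  generalize ψ' l = ψ, dψ' l = dψ, ψ₀' l = ψ₀, dψ₀' l = dψ₀ at h1 h4
  rw [charDelta_eq hq h1 h4]
  have hmul : ∀ {q : ℝ → ℝ}, ContinuousOn q (Set.Icc 0 1) → ∀ {ψ dψ φ dφ : ℝ → ℂ},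
      IsRobinSolution q h l ψ dψ → IsSolution q l φ dφ → dφ 0 - h * φ 0 = 0 →
      (∃ x ∈ Set.Icc (0 : ℝ) 1, φ x ≠ 0) → ∃ a : ℂ, a ≠ 0 ∧ φ 1 = a * ψ 1 ∧ dφ 1 = a * dψ 1 := by
    intro q hq ψ dψ φ dφ hψ hφ h0 hne
    have key : ∀ x ∈ Set.Icc (0 : ℝ) 1, φ x = φ 0 * ψ x ∧ dφ x = φ 0 * dψ x := by
      intro x hx
      have := hφ.eq_of_eq hq (hψ.sol.linear_comb hq hψ.sol (φ 0) 0) (by simp [hψ.zero])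
        (by simp [hψ.deriv_zero]; linear_combination h0) hx
      simpa using this
    refine ⟨φ 0, fun h00 => ?_, key 1 h01⟩
    obtain ⟨x, hx, hx0⟩ := hne
    exact hx0 (by rw [(key x hx).1, h00, zero_mul])
  constructor
  · rintro ⟨φ, dφ, φ₀, dφ₀, s1, s2, b1, b2, m1, m2, n1, n2⟩
    obtain ⟨a, ha, a1, a2⟩ := hmul hq h1 s1 b1 n1
    obtain ⟨b, hb, b1, b2⟩ := hmul continuousOn_const h4 s2 b2 n2
    have : a * b * (dψ 1 * ψ₀ 1 - ψ 1 * dψ₀ 1) = 0 := by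
      linear_combination dψ 1 * a * m1 - ψ 1 * a * m2 - dψ 1 * a * b1 + dψ 1 * a * a1
        + ψ 1 * a * b2 - ψ 1 * a * a2
    exact (mul_eq_zero.1 this).resolve_left (mul_ne_zero ha hb)
  · intro hD
    -- Parallel nonzero vectors of Cauchy data differ by a nonzero factor.
    obtain ⟨a, ha, a1, a2⟩ : ∃ a : ℂ, a ≠ 0 ∧ a * ψ₀ 1 = ψ 1 ∧ a * dψ₀ 1 = dψ 1 := by
      have n1 := h1.ne_zero_at_one hq
      have n2 := h4.ne_zero_at_one continuousOn_const
      by_cases hz : ψ₀ 1 = 0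
      · have n3 : dψ₀ 1 ≠ 0 := by tauto
        have n4 : ψ 1 = 0 := by
          rw [hz, mul_zero, zero_sub, neg_eq_zero] at hD
          exact (mul_eq_zero.1 hD).resolve_right n3
        have n5 : dψ 1 ≠ 0 := by tauto
        exact ⟨dψ 1 / dψ₀ 1, div_ne_zero n5 n3, by rw [hz, n4, mul_zero], by field_simp⟩
      · have n3 : ψ 1 ≠ 0 := by
          intro n4
          rw [n4, zero_mul, sub_zero] at hD
          have := (mul_eq_zero.1 hD).resolve_right hz
          tauto
        refine ⟨ψ 1 / ψ₀ 1, div_ne_zero n3 hz, by field_simp, ?_⟩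
        field_simp
        linear_combination -hD
    refine ⟨ψ, dψ, _, _, h1.sol, h4.sol.linear_comb continuousOn_const h4.sol a 0, ?_, ?_, ?_, ?_,
      ⟨0, by simp, by simp [h1.zero]⟩, ⟨0, by simp, by simp [h4.zero, ha]⟩⟩
    · simp [h1.zero, h1.deriv_zero]
    · simp [h4.zero, h4.deriv_zero]; ring
    · simpa using a1
    · simpa using a2

/-! ### Products of perturbed and free solutions -/

lemma intervalIntegrable_of_continuousOn {f : ℝ → ℂ} (hf : ContinuousOn f (Set.Icc 0 1)) {x : ℝ}
    (hx : x ∈ Set.Icc (0 : ℝ) 1) : IntervalIntegrable f volume 0 x := by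
  refine (hf.mono ?_).intervalIntegrable
  rw [Set.uIcc_of_le hx.1]
  exact Set.Icc_subset_Icc le_rfl hx.2

lemma norm_integral_le_of_le {f : ℝ → ℂ} {c x : ℝ} (hx : x ∈ Set.Icc (0 : ℝ) 1)
    (h : ∀ t ∈ Set.Icc 0 x, ‖f t‖ ≤ c) : ‖∫ t in (0 : ℝ)..x, f t‖ ≤ c := by
  have h1 : ‖∫ t in (0 : ℝ)..x, f t‖ ≤ c * |x - 0| := by
    refine intervalIntegral.norm_integral_le_of_norm_le_const fun t ht => ?_
    rw [Set.uIoc_of_le hx.1] at ht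
    exact h t ⟨ht.1.le, ht.2⟩
  have hc : 0 ≤ c := (norm_nonneg _).trans (h 0 ⟨le_rfl, hx.1⟩)
  rw [sub_zero, abs_of_nonneg hx.1] at h1
  exact h1.trans (by nlinarith [hx.2])

lemma norm_integral_mul_le {p f : ℝ → ℂ} (hp : IntervalIntegrable p volume 0 1) {c x : ℝ}
    (hx : x ∈ Set.Icc (0 : ℝ) 1) (h : ∀ t ∈ Set.Icc 0 x, ‖f t‖ ≤ c) :
    ‖∫ t in (0 : ℝ)..x, p t * f t‖ ≤ c * ∫ t in (0 : ℝ)..1, ‖p t‖ := by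
  have hc : 0 ≤ c := (norm_nonneg _).trans (h 0 ⟨le_rfl, hx.1⟩)
  have hpx : IntervalIntegrable p volume 0 x := hp.mono_set (by
    rw [Set.uIcc_of_le hx.1, Set.uIcc_of_le zero_le_one]
    exact Set.Icc_subset_Icc le_rfl hx.2)
  calc ‖∫ t in (0 : ℝ)..x, p t * f t‖ ≤ ∫ t in (0 : ℝ)..x, ‖p t‖ * c := by
        refine intervalIntegral.norm_integral_le_of_norm_le hx.1 ?_ (hpx.norm.mul_const c)
        refine Filter.Eventually.of_forall fun t ht => ?_
        rw [norm_mul]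
        gcongr
        exact h t ⟨ht.1.le, ht.2⟩
    _ = c * ∫ t in (0 : ℝ)..x, ‖p t‖ := by rw [intervalIntegral.integral_mul_const, mul_comm]
    _ ≤ c * ∫ t in (0 : ℝ)..1, ‖p t‖ := by
        gcongr
        exact intervalIntegral.integral_mono_interval le_rfl hx.1 hx.2
          (Filter.Eventually.of_forall fun t => norm_nonneg _) hp.norm

/-- Integration by parts for a primitive `g` of an integrable function. -/
lemma integral_primitive_mul_deriv {g p u du : ℝ → ℂ} (hp : IntervalIntegrable p volume 0 1)
    (hg : ∀ x ∈ Set.Icc (0 : ℝ) 1, g x = g 0 + ∫ t in (0 : ℝ)..x, p t)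
    (hu : ContinuousOn u (Set.Icc 0 1)) (hdu : ContinuousOn du (Set.Icc 0 1))
    (h : ∀ x ∈ Set.Ioo (0 : ℝ) 1, HasDerivAt u (du x) x) {x : ℝ} (hx : x ∈ Set.Icc (0 : ℝ) 1) :
    ∫ t in (0 : ℝ)..x, g t * du t = g x * u x - g 0 * u 0 - ∫ t in (0 : ℝ)..x, p t * u t := by
  have hpx : IntervalIntegrable p volume 0 x := hp.mono_set (by
    rw [Set.uIcc_of_le hx.1, Set.uIcc_of_le zero_le_one]
    exact Set.Icc_subset_Icc le_rfl hx.2)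
  have hdux := intervalIntegrable_of_continuousOn hdu hx
  have hux := hu.mono (Set.Icc_subset_Icc le_rfl hx.2)
  have hpi : IntegrableOn p (Set.Ioc 0 x) := (intervalIntegrable_iff_integrableOn_Ioc_of_le hx.1).1 hpx
  have hdi : IntegrableOn du (Set.Ioc 0 x) :=
    (intervalIntegrable_iff_integrableOn_Ioc_of_le hx.1).1 hdux
  have hprod : Integrable (fun y : ℝ × ℝ => p y.1 * du y.2)
      ((volume.restrict (Set.Ioc 0 x)).prod (volume.restrict (Set.Ioc 0 x))) := hpi.mul_prod hdi
  have hswap := integral_integral_swap (μ := volume.restrict (Set.Ioc 0 x))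
    (ν := volume.restrict (Set.Ioc 0 x))
    (f := fun t s => Set.indicator {y : ℝ × ℝ | y.1 < y.2} (fun y => p y.1 * du y.2) (t, s))
    (hprod.indicator (measurableSet_lt measurable_fst measurable_snd))
  have hL : ∀ t ∈ Set.Ioc 0 x, (∫ s in Set.Ioc 0 x,
      Set.indicator {y : ℝ × ℝ | y.1 < y.2} (fun y => p y.1 * du y.2) (t, s)) =
      p t * u x - p t * u t := by
    intro t ht
    have e1 : ∀ s, Set.indicator {y : ℝ × ℝ | y.1 < y.2} (fun y => p y.1 * du y.2) (t, s) =
        Set.indicator (Set.Ioi t) (fun s => p t * du s) s := by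
      intro s; simp [Set.indicator_apply]
    simp only [e1]
    rw [setIntegral_indicator measurableSet_Ioi, Set.Ioc_inter_Ioi, max_eq_right ht.1.le,
      integral_const_mul, ← intervalIntegral.integral_of_le ht.2]
    have e2 := integral_eq_sub_of_hasDerivAt_Ioo hu hdu h hx
    have e3 := integral_eq_sub_of_hasDerivAt_Ioo hu hdu h (x := t) ⟨ht.1.le, ht.2.trans hx.2⟩
    have e4 := intervalIntegral.integral_interval_sub_left hdux
      (intervalIntegrable_of_continuousOn hdu (x := t) ⟨ht.1.le, ht.2.trans hx.2⟩)
    rw [← e4, e2, e3]; ring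
  have hR : ∀ s ∈ Set.Ioc 0 x, (∫ t in Set.Ioc 0 x,
      Set.indicator {y : ℝ × ℝ | y.1 < y.2} (fun y => p y.1 * du y.2) (t, s)) =
      g s * du s - g 0 * du s := by
    intro s hs
    have e1 : ∀ t, Set.indicator {y : ℝ × ℝ | y.1 < y.2} (fun y => p y.1 * du y.2) (t, s) =
        Set.indicator (Set.Iio s) (fun t => p t * du s) t := by
      intro t; simp [Set.indicator_apply]
    simp only [e1]
    have e5 : Set.Ioc 0 x ∩ Set.Iio s = Set.Ioo 0 s := by
      ext t
      simp only [Set.mem_inter_iff, Set.mem_Ioc, Set.mem_Iio, Set.mem_Ioo]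
      constructor
      · rintro ⟨⟨a, b⟩, c⟩; exact ⟨a, c⟩
      · rintro ⟨a, b⟩; exact ⟨⟨a, b.le.trans hs.2⟩, b⟩
    rw [setIntegral_indicator measurableSet_Iio, e5, ← integral_Ioc_eq_integral_Ioo,
      integral_mul_const, ← intervalIntegral.integral_of_le hs.1.le,
      hg s ⟨hs.1.le, hs.2.trans hx.2⟩]
    ring
  rw [setIntegral_congr_fun measurableSet_Ioc hL, setIntegral_congr_fun measurableSet_Ioc hR,
    ← intervalIntegral.integral_of_le hx.1, ← intervalIntegral.integral_of_le hx.1] at hswap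
  have hpu : IntervalIntegrable (fun t => p t * u t) volume 0 x :=
    hpx.mul_continuousOn (by rwa [Set.uIcc_of_le hx.1])
  have hgc : ContinuousOn g (Set.Icc 0 x) := by
    have h1 : ContinuousOn (fun y => g 0 + ∫ t in (0 : ℝ)..y, p t) (Set.Icc 0 x) := by
      have := intervalIntegral.continuousOn_primitive_interval' hpx Set.left_mem_uIcc
      rw [Set.uIcc_of_le hx.1] at this
      exact continuousOn_const.add this
    exact h1.congr fun y hy => hg y ⟨hy.1, hy.2.trans hx.2⟩
  have hgdu : IntervalIntegrable (fun t => g t * du t) volume 0 x :=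
    hdux.continuousOn_mul (by rwa [Set.uIcc_of_le hx.1])
  rw [intervalIntegral.integral_sub (hpx.mul_const _) hpu,
    intervalIntegral.integral_sub hgdu (hdux.const_mul _), intervalIntegral.integral_mul_const,
    intervalIntegral.integral_const_mul, integral_eq_sub_of_hasDerivAt_Ioo hu hdu h hx] at hswap
  have e6 := hg x hx
  linear_combination -hswap - u x * e6

lemma norm_sin_le (w : ℂ) : ‖Complex.sin w‖ ≤ Real.exp |w.im| := by
  have h1 : ‖Complex.sin w‖ =
      1 / 2 * ‖Complex.exp (-(Complex.I * w)) - Complex.exp (Complex.I * w)‖ := by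
    rw [sin_eq_exp, norm_mul]; simp
  have h2 := norm_sub_le (Complex.exp (-(Complex.I * w))) (Complex.exp (Complex.I * w))
  rw [norm_exp_I_mul, norm_exp_neg_I_mul] at h2
  have h3 := Real.exp_le_exp.2 (le_abs_self w.im)
  have h4 := Real.exp_le_exp.2 (neg_le_abs w.im)
  rw [h1]; linarith

lemma norm_cos_le (w : ℂ) : ‖Complex.cos w‖ ≤ Real.exp |w.im| := by
  have h1 : Complex.cos w =
      1 / 2 * (Complex.exp (-(Complex.I * w)) + Complex.exp (Complex.I * w)) := by
    rw [Complex.cos, show -w * Complex.I = -(Complex.I * w) by ring,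
      show w * Complex.I = Complex.I * w by ring]; ring
  have h2 := norm_add_le (Complex.exp (-(Complex.I * w))) (Complex.exp (Complex.I * w))
  rw [norm_exp_I_mul, norm_exp_neg_I_mul] at h2
  have h3 := Real.exp_le_exp.2 (le_abs_self w.im)
  have h4 := Real.exp_le_exp.2 (neg_le_abs w.im)
  rw [h1, norm_mul]; simp only [norm_div, norm_one, Complex.norm_ofNat]; linarith

lemma abs_im_mul_ofReal (k : ℂ) {x : ℝ} (hx : 0 ≤ x) : |(k * x).im| = |k.im| * x := by
  rw [Complex.im_mul_ofReal, abs_mul, abs_of_nonneg hx]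

lemma norm_sin_mul_le (k : ℂ) {x : ℝ} (hx : 0 ≤ x) :
    ‖Complex.sin (k * x)‖ ≤ Real.exp (|k.im| * x) := by
  have := norm_sin_le (k * x); rwa [abs_im_mul_ofReal k hx] at this

lemma norm_cos_mul_le (k : ℂ) {x : ℝ} (hx : 0 ≤ x) :
    ‖Complex.cos (k * x)‖ ≤ Real.exp (|k.im| * x) := by
  have := norm_cos_le (k * x); rwa [abs_im_mul_ofReal k hx] at this

/-- Variation of constants for a Robin solution. -/
lemma IsRobinSolution.volterra {q : ℝ → ℝ} (hq : ContinuousOn q (Set.Icc 0 1)) {h : ℝ} {k : ℂ}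
    {ψ dψ : ℝ → ℂ} (H : IsRobinSolution q h (k ^ 2) ψ dψ) {x : ℝ} (hx : x ∈ Set.Icc (0 : ℝ) 1) :
    k * ψ x = k * Complex.cos (k * x) + h * Complex.sin (k * x) +
        ∫ t in (0 : ℝ)..x, q t * (ψ t * Complex.sin (k * (x - t : ℝ))) ∧
    dψ x = h * Complex.cos (k * x) - k * Complex.sin (k * x) +
        ∫ t in (0 : ℝ)..x, q t * (ψ t * Complex.cos (k * (x - t : ℝ))) := by
  have w1 := H.sol.wronskian hq (continuousOn_const (c := (0 : ℝ)))
    (isSolution_trig k (Complex.sin (k * x)) (-Complex.cos (k * x))) hx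
  have w2 := H.sol.wronskian hq (continuousOn_const (c := (0 : ℝ)))
    (isSolution_trig k (Complex.cos (k * x)) (Complex.sin (k * x))) hx
  have e1 : ∀ t : ℝ, Complex.sin (k * (x - t : ℝ)) =
      Complex.sin (k * x) * Complex.cos (k * t) + -Complex.cos (k * x) * Complex.sin (k * t) := by
    intro t; push_cast; rw [mul_sub, Complex.sin_sub]; ring
  have e2 : ∀ t : ℝ, Complex.cos (k * (x - t : ℝ)) =
      Complex.cos (k * x) * Complex.cos (k * t) + Complex.sin (k * x) * Complex.sin (k * t) := by
    intro t; push_cast; rw [mul_sub, Complex.cos_sub]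
  have e3 := Complex.sin_sq_add_cos_sq (k * x)
  simp only [← e1, ← e2, Complex.ofReal_zero, sub_zero, sub_self, mul_zero, Complex.sin_zero,
    Complex.cos_zero, H.zero, H.deriv_zero] at w1 w2
  constructor
  · rw [w1]
    linear_combination (-k * ψ x) * e3
  · rw [w2]
    simp only [mul_one, one_mul, neg_zero, zero_add]
    ring

lemma exp_mul_exp_sub (κ : ℝ) (x t : ℝ) : Real.exp (κ * t) * Real.exp (κ * (x - t)) = Real.exp (κ * x) := by
  rw [← Real.exp_add]; congr 1; ring

/-- Robin solutions are close to `cos kx` for large `k`. The maximum `m` of `|ψ| exp (-|Im k| x)` is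
bounded by the Volterra equation, whose integral term contributes at most `B m / |k| ≤ m / 2`. -/
lemma exists_robin_bound {q : ℝ → ℝ} (hq : ContinuousOn q (Set.Icc 0 1)) (h : ℝ) :
    ∃ C K : ℝ, 0 ≤ C ∧ 1 ≤ K ∧ ∀ k : ℂ, K ≤ ‖k‖ → ∀ ψ dψ : ℝ → ℂ, IsRobinSolution q h (k ^ 2) ψ dψ →
      ∀ x ∈ Set.Icc (0 : ℝ) 1, ‖ψ x - Complex.cos (k * x)‖ ≤ C * Real.exp (|k.im| * x) / ‖k‖ ∧
        ‖dψ x + k * Complex.sin (k * x)‖ ≤ C * Real.exp (|k.im| * x) := by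
  obtain ⟨B, hB⟩ := isCompact_Icc.exists_bound_of_continuousOn hq
  have hB0 : 0 ≤ B := (norm_nonneg _).trans (hB 0 (by simp))
  refine ⟨|h| + 2 * B * (1 + |h|), 1 + 2 * B, by positivity, by linarith, ?_⟩
  intro k hk ψ dψ H
  have hk0 : 0 < ‖k‖ := by linarith
  have habs := abs_nonneg h
  obtain ⟨x₀, hx₀, hmax⟩ := isCompact_Icc.exists_isMaxOn (α := ℝ) (β := ℝ) (Set.nonempty_Icc.2 zero_le_one)
    (f := fun x : ℝ => ‖ψ x‖ * Real.exp (-(|k.im| * x))) (by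
      have := H.sol.cont
      fun_prop)
  set m := ‖ψ x₀‖ * Real.exp (-(|k.im| * x₀)) with hm
  have hm0 : 0 ≤ m := by positivity
  have hψm : ∀ t ∈ Set.Icc (0 : ℝ) 1, ‖ψ t‖ ≤ m * Real.exp (|k.im| * t) := by
    intro t ht
    have h1 : ‖ψ t‖ * Real.exp (-(|k.im| * t)) ≤ m := hmax ht
    calc ‖ψ t‖ = ‖ψ t‖ * Real.exp (-(|k.im| * t)) * Real.exp (|k.im| * t) := by
          rw [mul_assoc, ← Real.exp_add]; simp
      _ ≤ _ := by gcongr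
  have hint : ∀ (T : ℂ → ℂ), (∀ t : ℝ, 0 ≤ t → ‖T (k * t)‖ ≤ Real.exp (|k.im| * t)) →
      ∀ x ∈ Set.Icc (0 : ℝ) 1, ‖∫ t in (0 : ℝ)..x, q t * (ψ t * T (k * (x - t : ℝ)))‖ ≤
        B * m * Real.exp (|k.im| * x) := by
    intro T hT x hx
    refine norm_integral_le_of_le hx fun t ht => ?_
    have h1 := hψm t ⟨ht.1, ht.2.trans hx.2⟩
    have h2 := hT (x - t) (by linarith [ht.2])
    have h3 := hB t ⟨ht.1, ht.2.trans hx.2⟩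
    rw [norm_mul, norm_mul, Complex.norm_real]
    calc ‖q t‖ * (‖ψ t‖ * ‖T (k * (x - t : ℝ))‖) ≤
          B * (m * Real.exp (|k.im| * t) * Real.exp (|k.im| * (x - t))) := by gcongr
      _ = B * m * (Real.exp (|k.im| * t) * Real.exp (|k.im| * (x - t))) := by ring
      _ = _ := by rw [exp_mul_exp_sub]
  have hs : ∀ t : ℝ, 0 ≤ t → ‖Complex.sin (k * t)‖ ≤ Real.exp (|k.im| * t) :=
    fun t ht => norm_sin_mul_le k ht
  have hc : ∀ t : ℝ, 0 ≤ t → ‖Complex.cos (k * t)‖ ≤ Real.exp (|k.im| * t) :=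
    fun t ht => norm_cos_mul_le k ht
  have hmle : m ≤ 2 * (1 + |h|) := by
    have h1 := (H.volterra hq hx₀).1
    have h2 := hint Complex.sin hs x₀ hx₀
    have h3 : ‖k‖ * ‖ψ x₀‖ ≤ (‖k‖ + |h| + B * m) * Real.exp (|k.im| * x₀) := by
      rw [← norm_mul, h1]
      refine (norm_add_le _ _).trans ?_
      have h4 := norm_add_le (k * Complex.cos (k * x₀)) (h * Complex.sin (k * x₀))
      rw [norm_mul, norm_mul, Complex.norm_real, Real.norm_eq_abs] at h4
      have h5 := mul_le_mul_of_nonneg_left (hc x₀ hx₀.1) hk0.le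
      have h6 := mul_le_mul_of_nonneg_left (hs x₀ hx₀.1) habs
      linarith
    have h7 : ‖k‖ * m ≤ ‖k‖ + |h| + B * m := by
      calc ‖k‖ * m = ‖k‖ * ‖ψ x₀‖ * Real.exp (-(|k.im| * x₀)) := by rw [hm]; ring
        _ ≤ (‖k‖ + |h| + B * m) * Real.exp (|k.im| * x₀) * Real.exp (-(|k.im| * x₀)) := by gcongr
        _ = _ := by rw [mul_assoc, ← Real.exp_add]; simp
    by_contra hcon
    push Not at hcon
    nlinarith [mul_nonneg hB0 habs]
  intro x hx
  have hv := H.volterra hq hx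
  have hE := Real.exp_pos (|k.im| * x)
  have hBm : B * m ≤ 2 * B * (1 + |h|) := by nlinarith
  constructor
  · have h1 : ψ x - Complex.cos (k * x) = (h * Complex.sin (k * x) +
        ∫ t in (0 : ℝ)..x, q t * (ψ t * Complex.sin (k * (x - t : ℝ)))) / k := by
      have hk' : k ≠ 0 := norm_pos_iff.1 hk0
      rw [eq_div_iff hk']
      linear_combination hv.1
    rw [h1, norm_div]
    gcongr
    refine (norm_add_le _ _).trans ?_
    rw [norm_mul, Complex.norm_real, Real.norm_eq_abs]
    have h2 := hint Complex.sin hs x hx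
    have h6 := mul_le_mul_of_nonneg_left (hs x hx.1) habs
    nlinarith
  · have h1 : dψ x + k * Complex.sin (k * x) = h * Complex.cos (k * x) +
        ∫ t in (0 : ℝ)..x, q t * (ψ t * Complex.cos (k * (x - t : ℝ))) := by
      linear_combination hv.2
    rw [h1]
    refine (norm_add_le _ _).trans ?_
    rw [norm_mul, Complex.norm_real, Real.norm_eq_abs]
    have h2 := hint Complex.cos hc x hx
    have h6 := mul_le_mul_of_nonneg_left (hc x hx.1) habs
    nlinarith

/-- The products `P = ψ ψ₀` and `E = ψ' ψ₀' + k² ψ ψ₀` of Robin solutions of the perturbed and of the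
free equation, the derivative `dP` of `P` and the Wronskian `W = ψ' ψ₀ - ψ ψ₀'`, in terms of
`z = 2 k`, with the differential equations they satisfy and with their leading terms for large `z`.
The constant `C` bounds the remainders of these leading terms. -/
structure IsProduct (q : ℝ → ℝ) (h : ℝ) (z : ℂ) (C : ℝ) (P dP W E : ℝ → ℂ) : Prop where
  cont : ContinuousOn P (Set.Icc 0 1)
  cont_deriv : ContinuousOn dP (Set.Icc 0 1)
  cont_W : ContinuousOn W (Set.Icc 0 1)
  cont_E : ContinuousOn E (Set.Icc 0 1)
  hasDerivAt : ∀ x ∈ Set.Ioo (0 : ℝ) 1, HasDerivAt P (dP x) x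
  hasDerivAt_deriv : ∀ x ∈ Set.Ioo (0 : ℝ) 1, HasDerivAt dP (q x * P x + 2 * E x - z ^ 2 * P x) x
  hasDerivAt_W : ∀ x ∈ Set.Ioo (0 : ℝ) 1, HasDerivAt W (q x * P x) x
  hasDerivAt_E : ∀ x ∈ Set.Ioo (0 : ℝ) 1, HasDerivAt E (q x * (dP x - W x) / 2) x
  zero : P 0 = 1
  deriv_zero : dP 0 = 2 * h
  W_zero : W 0 = 0
  E_zero : E 0 = h ^ 2 + z ^ 2 / 4
  W_one : W 1 = charDelta q h (z ^ 2 / 4)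
  bound : ∀ x ∈ Set.Icc (0 : ℝ) 1, ‖P x - (1 / 2 + 1 / 2 * Complex.cos (z * x))‖ ≤
    C * Real.exp (|z.im| * x) / ‖z‖
  bound_deriv : ∀ x ∈ Set.Icc (0 : ℝ) 1, ‖dP x + z / 2 * Complex.sin (z * x)‖ ≤
    C * Real.exp (|z.im| * x)
  bound_W : ∀ x ∈ Set.Icc (0 : ℝ) 1, ‖W x‖ ≤ C * Real.exp (|z.im| * x)

/-- The leading terms are those of the products of `cos kx` and its derivative; the constants do not
depend on `z`. -/
lemma exists_isProduct {q : ℝ → ℝ} (hq : ContinuousOn q (Set.Icc 0 1)) (h : ℝ) :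
    ∃ C K : ℝ, 0 ≤ C ∧ 1 ≤ K ∧ ∀ z : ℂ, K ≤ ‖z‖ → ∃ P dP W E, IsProduct q h z C P dP W E := by
  obtain ⟨C₁, K₁, hC₁, hK₁, H₁⟩ := exists_robin_bound hq h
  obtain ⟨C₂, K₂, hC₂, hK₂, H₂⟩ := exists_robin_bound (continuousOn_const (c := (0 : ℝ))) h
  set C := max C₁ C₂ with hC
  have hC0 : 0 ≤ C := le_max_of_le_left hC₁
  refine ⟨8 * C * (1 + C) , 2 * max K₁ K₂, by positivity, by linarith [le_max_left K₁ K₂], ?_⟩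
  intro z hz
  set k := z / 2 with hk
  have hkn : max K₁ K₂ ≤ ‖k‖ := by rw [hk, norm_div, Complex.norm_ofNat]; linarith
  have hk1 : 1 ≤ ‖k‖ := hK₁.trans ((le_max_left _ _).trans hkn)
  have hkz : z = 2 * k := by rw [hk]; ring
  obtain ⟨ψ, dψ, hψ, -⟩ := exists_robin hq h
  obtain ⟨φ, dφ, hφ, -⟩ := exists_robin (continuousOn_const (c := (0 : ℝ))) h
  have hψ := hψ (k ^ 2)
  have hφ := hφ (k ^ 2)
  have hl : z ^ 2 / 4 = k ^ 2 := by rw [hkz]; ring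
  set ψ := ψ (k ^ 2)
  set dψ := dψ (k ^ 2)
  set φ := φ (k ^ 2)
  set dφ := dφ (k ^ 2)
  have B₁ := H₁ k ((le_max_left _ _).trans hkn) _ _ hψ
  have B₂ := H₂ k ((le_max_right _ _).trans hkn) _ _ hφ
  have c1 := hψ.sol.cont
  have c2 := hψ.sol.cont_deriv
  have c3 := hφ.sol.cont
  have c4 := hφ.sol.cont_deriv
  have d1 := fun x (hx : x ∈ Set.Ioo (0 : ℝ) 1) => hψ.sol.hasDerivAt hx
  have d2 := fun x (hx : x ∈ Set.Ioo (0 : ℝ) 1) => hψ.sol.hasDerivAt_deriv hq hx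
  have d3 := fun x (hx : x ∈ Set.Ioo (0 : ℝ) 1) => hφ.sol.hasDerivAt hx
  have d4 := fun x (hx : x ∈ Set.Ioo (0 : ℝ) 1) => hφ.sol.hasDerivAt_deriv continuousOn_const hx
  -- the leading terms and the size of the remainders
  have key : ∀ x ∈ Set.Icc (0 : ℝ) 1, ∃ a b e f : ℂ,
      ψ x = Complex.cos (k * x) + a / k ∧ dψ x = b - k * Complex.sin (k * x) ∧
      φ x = Complex.cos (k * x) + e / k ∧ dφ x = f - k * Complex.sin (k * x) ∧
      ‖a‖ ≤ C * Real.exp (|k.im| * x) ∧ ‖b‖ ≤ C * Real.exp (|k.im| * x) ∧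
      ‖e‖ ≤ C * Real.exp (|k.im| * x) ∧ ‖f‖ ≤ C * Real.exp (|k.im| * x) ∧
      ‖Complex.cos (k * x)‖ ≤ Real.exp (|k.im| * x) ∧
      ‖Complex.sin (k * x)‖ ≤ Real.exp (|k.im| * x) := by
    intro x hx
    have hk0 : k ≠ 0 := norm_pos_iff.1 (by linarith)
    refine ⟨k * (ψ x - Complex.cos (k * x)), dψ x + k * Complex.sin (k * x),
      k * (φ x - Complex.cos (k * x)), dφ x + k * Complex.sin (k * x), by field_simp; ring, by ring,
      by field_simp; ring, by ring, ?_, ?_, ?_, ?_, norm_cos_mul_le k hx.1, norm_sin_mul_le k hx.1⟩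
    · rw [norm_mul]
      refine (mul_le_mul_of_nonneg_left (B₁ x hx).1 (norm_nonneg k)).trans ?_
      rw [mul_div_cancel₀ _ (by linarith)]
      gcongr
      exact le_max_left _ _
    · refine (B₁ x hx).2.trans ?_
      gcongr
      exact le_max_left _ _
    · rw [norm_mul]
      refine (mul_le_mul_of_nonneg_left (B₂ x hx).1 (norm_nonneg k)).trans ?_
      rw [mul_div_cancel₀ _ (by linarith)]
      gcongr
      exact le_max_right _ _
    · refine (B₂ x hx).2.trans ?_
      gcongr
      exact le_max_right _ _
  have hexp : ∀ x : ℝ, Real.exp (|z.im| * x) = Real.exp (|k.im| * x) ^ 2 := by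
    intro x
    rw [← Real.exp_nat_mul]
    congr 1
    rw [hkz, Complex.mul_im]
    simp [abs_mul]; ring
  have hdbl : ∀ x : ℝ, z * x = 2 * (k * x) := fun x => by rw [hkz]; ring
  have hk0 : k ≠ 0 := norm_pos_iff.1 (by linarith)
  have hdiv : ∀ a : ℂ, ‖a / k‖ ≤ ‖a‖ := fun a => by
    rw [norm_div]; exact div_le_self (norm_nonneg _) hk1
  refine ⟨fun x => ψ x * φ x, fun x => dψ x * φ x + ψ x * dφ x, fun x => dψ x * φ x - ψ x * dφ x,
    fun x => dψ x * dφ x + k ^ 2 * (ψ x * φ x), by fun_prop, by fun_prop, by fun_prop, by fun_prop,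
    fun x hx => (d1 x hx).mul (d3 x hx), fun x hx => ?_, fun x hx => ?_, fun x hx => ?_, ?_, ?_, ?_,
    ?_, ?_, fun x hx => ?_, fun x hx => ?_, fun x hx => ?_⟩
  · refine (((d2 x hx).mul (d3 x hx)).add ((d1 x hx).mul (d4 x hx))).congr_deriv ?_
    rw [hkz]; push_cast; ring
  · refine (((d2 x hx).mul (d3 x hx)).sub ((d1 x hx).mul (d4 x hx))).congr_deriv ?_
    push_cast; ring
  · refine (((d2 x hx).mul (d4 x hx)).add
      (((d1 x hx).mul (d3 x hx)).const_mul (k ^ 2))).congr_deriv ?_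
    push_cast; ring
  · simp [hψ.zero, hφ.zero]
  · simp only [hψ.zero, hφ.zero, hψ.deriv_zero, hφ.deriv_zero]; ring
  · simp only [hψ.zero, hφ.zero, hψ.deriv_zero, hφ.deriv_zero]; ring
  · simp only [hψ.zero, hφ.zero, hψ.deriv_zero, hφ.deriv_zero, hl]; ring
  · rw [hl, charDelta_eq hq hψ hφ]
  · obtain ⟨a, b, e, f, h1, h2, h3, h4, n1, n2, n3, n4, n5, n6⟩ := key x hx
    have e1 : ψ x * φ x - (1 / 2 + 1 / 2 * Complex.cos (z * x)) =
        (a * (Complex.cos (k * x) + e / k) + Complex.cos (k * x) * e) / k := by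
      rw [h1, h3, hdbl, Complex.cos_two_mul]
      field_simp
      ring
    simp only [e1]
    have hz2 : ‖z‖ = 2 * ‖k‖ := by rw [hkz, norm_mul, Complex.norm_ofNat]
    rw [norm_div, hexp, hz2, div_le_div_iff₀ (by linarith) (by linarith)]
    set m := Real.exp (|k.im| * x)
    have hm : 0 < m := Real.exp_pos _
    have n7 : ‖Complex.cos (k * x) + e / k‖ ≤ m + C * m :=
      (norm_add_le _ _).trans (add_le_add n5 ((hdiv e).trans n3))
    have n8 : ‖a * (Complex.cos (k * x) + e / k) + Complex.cos (k * x) * e‖ ≤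
        C * m * (m + C * m) + m * (C * m) := by
      refine (norm_add_le _ _).trans ?_
      rw [norm_mul, norm_mul]
      gcongr
    have n9 : C * m * (m + C * m) + m * (C * m) ≤ 4 * (C * (1 + C) * m ^ 2) := by
      nlinarith [mul_nonneg hC0 hC0, mul_nonneg (mul_nonneg hC0 hC0) (sq_nonneg m),
        mul_nonneg hC0 (sq_nonneg m)]
    nlinarith [norm_nonneg k]
  · obtain ⟨a, b, e, f, h1, h2, h3, h4, n1, n2, n3, n4, n5, n6⟩ := key x hx
    have e1 : dψ x * φ x + ψ x * dφ x + z / 2 * Complex.sin (z * x) =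
        b * (Complex.cos (k * x) + e / k) - Complex.sin (k * x) * e +
        f * (Complex.cos (k * x) + a / k) - Complex.sin (k * x) * a := by
      rw [h1, h2, h3, h4, hdbl, Complex.sin_two_mul, hkz]
      field_simp
      ring
    simp only [e1]
    rw [hexp]
    set m := Real.exp (|k.im| * x)
    have hm : 0 < m := Real.exp_pos _
    have n7 : ‖Complex.cos (k * x) + e / k‖ ≤ m + C * m :=
      (norm_add_le _ _).trans (add_le_add n5 ((hdiv e).trans n3))
    have n7' : ‖Complex.cos (k * x) + a / k‖ ≤ m + C * m :=
      (norm_add_le _ _).trans (add_le_add n5 ((hdiv a).trans n1))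
    have n8 : ‖b * (Complex.cos (k * x) + e / k) - Complex.sin (k * x) * e +
        f * (Complex.cos (k * x) + a / k) - Complex.sin (k * x) * a‖ ≤
        C * m * (m + C * m) + m * (C * m) + C * m * (m + C * m) + m * (C * m) := by
      refine (norm_sub_le _ _).trans (add_le_add ((norm_add_le _ _).trans (add_le_add
        ((norm_sub_le _ _).trans (add_le_add ?_ ?_)) ?_)) ?_) <;>
      · rw [norm_mul]
        gcongr
    refine n8.trans ?_
    nlinarith [mul_nonneg hC0 hC0, mul_nonneg (mul_nonneg hC0 hC0) (sq_nonneg m),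
        mul_nonneg hC0 (sq_nonneg m)]
  · obtain ⟨a, b, e, f, h1, h2, h3, h4, n1, n2, n3, n4, n5, n6⟩ := key x hx
    have e1 : dψ x * φ x - ψ x * dφ x =
        b * (Complex.cos (k * x) + e / k) - Complex.sin (k * x) * e -
        (f * (Complex.cos (k * x) + a / k) - Complex.sin (k * x) * a) := by
      rw [h1, h2, h3, h4]
      field_simp
      ring
    simp only [e1]
    rw [hexp]
    set m := Real.exp (|k.im| * x)
    have hm : 0 < m := Real.exp_pos _
    have n7 : ‖Complex.cos (k * x) + e / k‖ ≤ m + C * m :=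
      (norm_add_le _ _).trans (add_le_add n5 ((hdiv e).trans n3))
    have n7' : ‖Complex.cos (k * x) + a / k‖ ≤ m + C * m :=
      (norm_add_le _ _).trans (add_le_add n5 ((hdiv a).trans n1))
    have n8 : ‖b * (Complex.cos (k * x) + e / k) - Complex.sin (k * x) * e -
        (f * (Complex.cos (k * x) + a / k) - Complex.sin (k * x) * a)‖ ≤
        C * m * (m + C * m) + m * (C * m) + (C * m * (m + C * m) + m * (C * m)) := by
      refine (norm_sub_le _ _).trans (add_le_add ((norm_sub_le _ _).trans (add_le_add ?_ ?_))
        ((norm_sub_le _ _).trans (add_le_add ?_ ?_))) <;>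
      · rw [norm_mul]
        gcongr
    refine n8.trans ?_
    nlinarith [mul_nonneg hC0 hC0, mul_nonneg (mul_nonneg hC0 hC0) (sq_nonneg m),
        mul_nonneg hC0 (sq_nonneg m)]

/-! ### Asymptotics of the characteristic function -/

lemma SobolevOne.exists_primitive {q : ℝ → ℝ} (hq : SobolevOne q) :
    ∃ p : ℝ → ℂ, MemLp p 2 (volume.restrict (Set.Icc (0 : ℝ) 1)) ∧
      ∀ x ∈ Set.Icc (0 : ℝ) 1, (q x : ℂ) = q 0 + ∫ t in (0 : ℝ)..x, p t := by
  obtain ⟨p, hp, h⟩ := hq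
  refine ⟨fun x => p x, hp.ofReal, fun x hx => ?_⟩
  rw [h x hx, intervalIntegral.integral_ofReal]
  push_cast
  rfl

lemma intervalIntegrable_of_memLp {E : Type*} [NormedAddCommGroup E] {p : ℝ → E}
    (hp : MemLp p 2 (volume.restrict (Set.Icc (0 : ℝ) 1))) : IntervalIntegrable p volume 0 1 := by
  rw [intervalIntegrable_iff_integrableOn_Icc_of_le zero_le_one]
  exact hp.integrable (by norm_num)

lemma continuousOn_of_eq_integral {E : Type*} [NormedAddCommGroup E] [NormedSpace ℝ E]
    {g p : ℝ → E} (hp : IntervalIntegrable p volume 0 1)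
    (hg : ∀ x ∈ Set.Icc (0 : ℝ) 1, g x = g 0 + ∫ t in (0 : ℝ)..x, p t) :
    ContinuousOn g (Set.Icc 0 1) := by
  have := intervalIntegral.continuousOn_primitive_interval' hp Set.left_mem_uIcc
  rw [Set.uIcc_of_le zero_le_one] at this
  exact (continuousOn_const.add this).congr hg

lemma SobolevOne.continuousOn {q : ℝ → ℝ} (hq : SobolevOne q) : ContinuousOn q (Set.Icc 0 1) := by
  obtain ⟨p, hp, h⟩ := hq
  exact continuousOn_of_eq_integral (intervalIntegrable_of_memLp hp) h

lemma ofReal_omega (q : ℝ → ℝ) : (omega q : ℂ) = ∫ t in (0 : ℝ)..1, (q t : ℂ) :=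
  intervalIntegral.integral_ofReal.symm

/-- Large spectral parameters, uniformly in `x ∈ [0,1]`. -/
noncomputable def largeFilter : Filter (ℂ × ℝ) := Bornology.cobounded ℂ ×ˢ 𝓟 (Set.Icc 0 1)

lemma eventually_largeFilter {P : ℂ → ℝ → Prop} :
    (∀ᶠ y in largeFilter, P y.1 y.2) ↔
      ∀ᶠ z in Bornology.cobounded ℂ, ∀ x ∈ Set.Icc (0 : ℝ) 1, P z x := by
  rw [largeFilter, eventually_prod_principal_iff]

lemma IsBigO.integral {p : ℝ → ℂ} (hp : IntervalIntegrable p volume 0 1) {f : ℂ → ℝ → ℂ} {b : ℂ → ℝ}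
    (h : (fun y : ℂ × ℝ => f y.1 y.2) =O[largeFilter] fun y => b y.1) :
    (fun y : ℂ × ℝ => ∫ t in (0 : ℝ)..y.2, p t * f y.1 t) =O[largeFilter] fun y => b y.1 := by
  obtain ⟨c, hc⟩ := h.bound
  refine IsBigO.of_bound (c * ∫ t in (0 : ℝ)..1, ‖p t‖) ?_
  rw [eventually_largeFilter (P := fun z x => ‖f z x‖ ≤ c * ‖b z‖)] at hc
  rw [eventually_largeFilter
    (P := fun z x => ‖∫ t in (0 : ℝ)..x, p t * f z t‖ ≤ c * (∫ t in (0 : ℝ)..1, ‖p t‖) * ‖b z‖)]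
  filter_upwards [hc] with z hz x hx
  refine (norm_integral_mul_le hp hx (c := c * ‖b z‖) fun t ht => hz t ⟨ht.1, ht.2.trans hx.2⟩).trans
    (le_of_eq (by ring))

lemma IsBigO.at_one {f : ℂ → ℝ → ℂ} {b : ℂ → ℝ}
    (h : (fun y : ℂ × ℝ => f y.1 y.2) =O[largeFilter] fun y => b y.1) :
    (fun z : ℂ => f z 1) =O[Bornology.cobounded ℂ] b := by
  have ht : Tendsto (fun z : ℂ => (z, (1 : ℝ))) (Bornology.cobounded ℂ) largeFilter :=
    tendsto_id.prodMk (tendsto_principal.2 (Eventually.of_forall fun _ => by simp))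
  exact h.comp_tendsto ht

lemma IsBigO.integral_one {p : ℝ → ℂ} (hp : IntervalIntegrable p volume 0 1) {f : ℂ → ℝ → ℂ}
    {b : ℂ → ℝ} (h : (fun y : ℂ × ℝ => f y.1 y.2) =O[largeFilter] fun y => b y.1) :
    (fun z : ℂ => ∫ t in (0 : ℝ)..1, p t * f z t) =O[Bornology.cobounded ℂ] b :=
  IsBigO.at_one (f := fun z x => ∫ t in (0 : ℝ)..x, p t * f z t) (IsBigO.integral hp h)

lemma IsBigO.comp_fst {f : ℂ → ℂ} {b : ℂ → ℝ} (h : f =O[Bornology.cobounded ℂ] b) :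
    (fun y : ℂ × ℝ => f y.1) =O[largeFilter] fun y => b y.1 :=
  h.comp_tendsto tendsto_fst

lemma eventually_one_le_norm : ∀ᶠ z : ℂ in Bornology.cobounded ℂ, 1 ≤ ‖z‖ :=
  tendsto_norm_cobounded_atTop.eventually_ge_atTop 1

lemma isBigO_cos_mul : (fun y : ℂ × ℝ => Complex.cos (y.1 * y.2)) =O[largeFilter]
    fun y => Real.exp |y.1.im| := by
  refine IsBigO.of_bound 1 ?_
  rw [eventually_largeFilter (P := fun z x => ‖Complex.cos (z * x)‖ ≤ 1 * ‖Real.exp |z.im|‖)]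
  refine Eventually.of_forall fun z x hx => (norm_cos_mul_le z hx.1).trans ?_
  rw [one_mul, Real.norm_of_nonneg (Real.exp_pos _).le, Real.exp_le_exp]
  exact mul_le_of_le_one_right (abs_nonneg _) hx.2

lemma isBigO_sin_mul : (fun y : ℂ × ℝ => Complex.sin (y.1 * y.2)) =O[largeFilter]
    fun y => Real.exp |y.1.im| := by
  refine IsBigO.of_bound 1 ?_
  rw [eventually_largeFilter (P := fun z x => ‖Complex.sin (z * x)‖ ≤ 1 * ‖Real.exp |z.im|‖)]
  refine Eventually.of_forall fun z x hx => (norm_sin_mul_le z hx.1).trans ?_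
  rw [one_mul, Real.norm_of_nonneg (Real.exp_pos _).le, Real.exp_le_exp]
  exact mul_le_of_le_one_right (abs_nonneg _) hx.2

lemma isBigO_const_exp (c : ℂ) : (fun _ : ℂ => c) =O[Bornology.cobounded ℂ]
    fun z => Real.exp |z.im| := by
  refine IsBigO.of_bound ‖c‖ (Eventually.of_forall fun z => ?_)
  rw [Real.norm_of_nonneg (Real.exp_pos _).le]
  exact le_mul_of_one_le_right (norm_nonneg _) (Real.one_le_exp (abs_nonneg _))

/-- A continuous function on `[0,1]` does not matter in the factor of a bounded order. -/
lemma IsBigO.continuousOn_mul {g : ℝ → ℂ} (hg : ContinuousOn g (Set.Icc 0 1)) {f : ℂ → ℝ → ℂ}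
    {b : ℂ → ℝ} (h : (fun y : ℂ × ℝ => f y.1 y.2) =O[largeFilter] fun y => b y.1) :
    (fun y : ℂ × ℝ => g y.2 * f y.1 y.2) =O[largeFilter] fun y => b y.1 := by
  obtain ⟨B, hB⟩ := isCompact_Icc.exists_bound_of_continuousOn hg
  have h1 : (fun y : ℂ × ℝ => g y.2) =O[largeFilter] fun _ => (1 : ℝ) := by
    refine IsBigO.of_bound B ?_
    rw [eventually_largeFilter (P := fun z x => ‖g x‖ ≤ B * ‖(1 : ℝ)‖)]
    exact Eventually.of_forall fun z x hx => by simpa using hB x hx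
  simpa using h1.mul h

section Product

variable {q : ℝ → ℝ} {h C : ℝ} {P dP W E : ℂ → ℝ → ℂ}

lemma IsProduct.isBigO_bound
    (H : ∀ᶠ z in Bornology.cobounded ℂ, IsProduct q h z C (P z) (dP z) (W z) (E z)) :
    (fun y : ℂ × ℝ => P y.1 y.2 - (1 / 2 + 1 / 2 * Complex.cos (y.1 * y.2))) =O[largeFilter]
      fun y => Real.exp |y.1.im| / ‖y.1‖ := by
  refine IsBigO.of_bound |C| ?_
  rw [eventually_largeFilter (P := fun z x => ‖P z x - (1 / 2 + 1 / 2 * Complex.cos (z * x))‖ ≤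
    |C| * ‖Real.exp |z.im| / ‖z‖‖)]
  filter_upwards [H] with z hz x hx
  refine (hz.bound x hx).trans ?_
  rw [Real.norm_of_nonneg (by positivity), mul_div_assoc]
  gcongr
  · exact le_abs_self C
  · exact mul_le_of_le_one_right (abs_nonneg _) hx.2

lemma IsProduct.isBigO_bound_deriv
    (H : ∀ᶠ z in Bornology.cobounded ℂ, IsProduct q h z C (P z) (dP z) (W z) (E z)) :
    (fun y : ℂ × ℝ => dP y.1 y.2 + y.1 / 2 * Complex.sin (y.1 * y.2)) =O[largeFilter]
      fun y => Real.exp |y.1.im| := by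
  refine IsBigO.of_bound |C| ?_
  rw [eventually_largeFilter (P := fun z x => ‖dP z x + z / 2 * Complex.sin (z * x)‖ ≤
    |C| * ‖Real.exp |z.im|‖)]
  filter_upwards [H] with z hz x hx
  refine (hz.bound_deriv x hx).trans ?_
  rw [Real.norm_of_nonneg (by positivity)]
  gcongr
  · exact le_abs_self C
  · exact mul_le_of_le_one_right (abs_nonneg _) hx.2

lemma IsProduct.isBigO_W
    (H : ∀ᶠ z in Bornology.cobounded ℂ, IsProduct q h z C (P z) (dP z) (W z) (E z)) :
    (fun y : ℂ × ℝ => W y.1 y.2) =O[largeFilter] fun y => Real.exp |y.1.im| := by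
  refine IsBigO.of_bound |C| ?_
  rw [eventually_largeFilter (P := fun z x => ‖W z x‖ ≤ |C| * ‖Real.exp |z.im|‖)]
  filter_upwards [H] with z hz x hx
  refine (hz.bound_W x hx).trans ?_
  rw [Real.norm_of_nonneg (by positivity)]
  gcongr
  · exact le_abs_self C
  · exact mul_le_of_le_one_right (abs_nonneg _) hx.2

lemma isBigO_exp_div_exp : (fun z : ℂ => Real.exp |z.im| / ‖z‖) =O[Bornology.cobounded ℂ]
    fun z => Real.exp |z.im| := by
  refine IsBigO.of_bound 1 ?_
  filter_upwards [eventually_one_le_norm] with z hz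
  rw [Real.norm_of_nonneg (by positivity), Real.norm_of_nonneg (by positivity), one_mul]
  exact div_le_self (Real.exp_pos _).le hz

lemma IsProduct.isBigO_P
    (H : ∀ᶠ z in Bornology.cobounded ℂ, IsProduct q h z C (P z) (dP z) (W z) (E z)) :
    (fun y : ℂ × ℝ => P y.1 y.2) =O[largeFilter] fun y => Real.exp |y.1.im| := by
  have h1 := (IsProduct.isBigO_bound H).trans (isBigO_exp_div_exp.comp_tendsto tendsto_fst)
  have h2 := (IsBigO.comp_fst (isBigO_const_exp (1 / 2))).add (isBigO_cos_mul.const_mul_left (1 / 2))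
  refine (h1.add h2).congr_left fun y => ?_
  ring

end Product

section Identities

variable {q : ℝ → ℝ} {h C : ℝ} {z : ℂ} {P dP W E : ℝ → ℂ}

lemma IsProduct.E_eq (hq : ContinuousOn q (Set.Icc 0 1)) (H : IsProduct q h z C P dP W E) {x : ℝ}
    (hx : x ∈ Set.Icc (0 : ℝ) 1) :
    E x = h ^ 2 + z ^ 2 / 4 + 1 / 2 * ∫ t in (0 : ℝ)..x, q t * (dP t - W t) := by
  have h1 := H.cont_deriv
  have h2 := H.cont_W
  have h3 := continuousOn_ofReal hq
  have h4 := integral_eq_sub_of_hasDerivAt_Ioo H.cont_E (by fun_prop) H.hasDerivAt_E hx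
  have h5 : ∀ t, (q t : ℂ) * (dP t - W t) / 2 = 1 / 2 * (q t * (dP t - W t)) := fun t => by ring
  simp only [h5, intervalIntegral.integral_const_mul, H.E_zero] at h4
  rw [h4]; ring

/-- The equation `W' = q P` and the equation for `P''` give `z ^ 2 W(1) = ∫ q (q P + 2 E - P'')`,
where the last term is integrated by parts. -/
lemma IsProduct.sq_mul_charDelta {p : ℝ → ℂ} (hp : IntervalIntegrable p volume 0 1)
    (hqp : ∀ x ∈ Set.Icc (0 : ℝ) 1, (q x : ℂ) = q 0 + ∫ t in (0 : ℝ)..x, p t)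
    (hq : ContinuousOn q (Set.Icc 0 1)) (H : IsProduct q h z C P dP W E) :
    z ^ 2 * charDelta q h (z ^ 2 / 4) =
      (∫ t in (0 : ℝ)..1, (q t : ℂ) ^ 2 * P t) +
      (2 * omega q * (h ^ 2 + z ^ 2 / 4) +
        ∫ x in (0 : ℝ)..1, (q x : ℂ) * ∫ t in (0 : ℝ)..x, q t * (dP t - W t)) -
      q 1 * dP 1 + 2 * h * q 0 + ∫ t in (0 : ℝ)..1, p t * dP t := by
  have h0 := H.cont
  have h1 := H.cont_deriv
  have h2 := H.cont_W
  have h3 := continuousOn_ofReal hq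
  have h4 := H.cont_E
  have h01 : (1 : ℝ) ∈ Set.Icc (0 : ℝ) 1 := by simp
  have i1 := integral_eq_sub_of_hasDerivAt_Ioo H.cont_W (by fun_prop) H.hasDerivAt_W h01
  have i2 := integral_primitive_mul_deriv hp hqp H.cont_deriv (by fun_prop) H.hasDerivAt_deriv h01
  have i3 : ∫ t in (0 : ℝ)..1, (q t : ℂ) * (2 * E t) = 2 * omega q * (h ^ 2 + z ^ 2 / 4) +
      ∫ x in (0 : ℝ)..1, (q x : ℂ) * ∫ t in (0 : ℝ)..x, q t * (dP t - W t) := by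
    have e1 : ContinuousOn (fun x => ∫ t in (0 : ℝ)..x, (q t : ℂ) * (dP t - W t)) (Set.Icc 0 1) := by
      refine continuousOn_of_eq_integral
        (p := fun t => (q t : ℂ) * (dP t - W t)) ?_ fun x _ => by simp
      exact intervalIntegrable_of_continuousOn (by fun_prop) h01
    rw [ofReal_omega]
    have e2 : ∀ a : ℂ, 2 * (∫ t in (0 : ℝ)..1, (q t : ℂ)) * a = ∫ t in (0 : ℝ)..1, 2 * a * (q t : ℂ) :=
      fun a => by rw [intervalIntegral.integral_const_mul]; ring
    rw [e2, ← intervalIntegral.integral_add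
      (intervalIntegrable_of_continuousOn (by fun_prop) h01)
      (intervalIntegrable_of_continuousOn (by fun_prop) h01)]
    refine intervalIntegral.integral_congr fun x hx => ?_
    rw [Set.uIcc_of_le zero_le_one] at hx
    simp only [H.E_eq hq hx]
    ring
  have i4 : ∫ t in (0 : ℝ)..1, (q t : ℂ) * (q t * P t + 2 * E t - z ^ 2 * P t) =
      (∫ t in (0 : ℝ)..1, (q t : ℂ) ^ 2 * P t) + (∫ t in (0 : ℝ)..1, (q t : ℂ) * (2 * E t)) -
        z ^ 2 * ∫ t in (0 : ℝ)..1, (q t : ℂ) * P t := by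
    rw [← intervalIntegral.integral_const_mul, ← intervalIntegral.integral_add
      (intervalIntegrable_of_continuousOn (by fun_prop) h01)
      (intervalIntegrable_of_continuousOn (by fun_prop) h01), ← intervalIntegral.integral_sub
      (intervalIntegrable_of_continuousOn (by fun_prop) h01)
      (intervalIntegrable_of_continuousOn (by fun_prop) h01)]
    congr 1
    ext t
    ring
  rw [H.W_zero, H.W_one] at i1
  rw [H.deriv_zero] at i2
  linear_combination -z ^ 2 * i1 + i4 - i2 + i3

end Identities

/-- The characteristic function up to relative errors `O(1/z)`. -/
lemma isBigO_charDelta {q : ℝ → ℝ} (hq : ContinuousOn q (Set.Icc 0 1)) (h : ℝ) {p : ℝ → ℂ}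
    (hp : IntervalIntegrable p volume 0 1)
    (hqp : ∀ x ∈ Set.Icc (0 : ℝ) 1, (q x : ℂ) = q 0 + ∫ t in (0 : ℝ)..x, p t) :
    (fun z : ℂ => z ^ 2 * charDelta q h (z ^ 2 / 4) - (z ^ 2 * omega q / 2 +
      q 1 * (z / 2) * Complex.sin z - z / 2 * ∫ t in (0 : ℝ)..1, p t * Complex.sin (z * t)))
      =O[Bornology.cobounded ℂ] fun z => Real.exp |z.im| := by
  obtain ⟨C, K, -, -, hex⟩ := exists_isProduct hq h
  choose! P dP W E hPP using hex
  have H : ∀ᶠ z in Bornology.cobounded ℂ, IsProduct q h z C (P z) (dP z) (W z) (E z) :=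
    (tendsto_norm_cobounded_atTop.eventually_ge_atTop K).mono hPP
  have h01 : (1 : ℝ) ∈ Set.Icc (0 : ℝ) 1 := by simp
  have hqc := continuousOn_ofReal hq
  have hqi := intervalIntegrable_of_continuousOn hqc h01
  have bP := IsProduct.isBigO_P H
  have bW := IsProduct.isBigO_W H
  have bd := IsProduct.isBigO_bound_deriv H
  have T1 := IsBigO.integral_one (p := fun t => (q t : ℂ) ^ 2) (b := fun z => Real.exp |z.im|)
    (intervalIntegrable_of_continuousOn (by fun_prop) h01) bP
  -- the integral of `q P'` is of the order of `P`
  have J : (fun y : ℂ × ℝ => ∫ t in (0 : ℝ)..y.2, (q t : ℂ) * (dP y.1 t - W y.1 t))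
      =O[largeFilter] fun y => Real.exp |y.1.im| := by
    have j1 := (((IsBigO.continuousOn_mul (b := fun z => Real.exp |z.im|) hqc bP).sub
      (IsBigO.comp_fst (isBigO_const_exp (q 0)))).sub
      (IsBigO.integral (b := fun z => Real.exp |z.im|) hp bP)).sub
      (IsBigO.integral (b := fun z => Real.exp |z.im|) hqi bW)
    refine j1.congr' ?_ EventuallyEq.rfl
    refine (eventually_largeFilter (P := fun z x => q x * P z x - q 0 -
      (∫ t in (0 : ℝ)..x, p t * P z t) - (∫ t in (0 : ℝ)..x, (q t : ℂ) * W z t) =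
        ∫ t in (0 : ℝ)..x, (q t : ℂ) * (dP z t - W z t))).2 ?_
    filter_upwards [H] with z hz x hx
    have h1 := hz.cont_deriv
    have h2 := hz.cont_W
    have i1 := integral_primitive_mul_deriv hp hqp hz.cont h1 hz.hasDerivAt hx
    rw [hz.zero, mul_one] at i1
    simp only [mul_sub]
    rw [intervalIntegral.integral_sub (intervalIntegrable_of_continuousOn (by fun_prop) hx)
      (intervalIntegrable_of_continuousOn (by fun_prop) hx), i1]
  have T3 := IsBigO.integral_one (b := fun z => Real.exp |z.im|)
    (f := fun z x => ∫ t in (0 : ℝ)..x, (q t : ℂ) * (dP z t - W z t)) hqi J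
  have T4 := (IsBigO.at_one (f := fun z x => dP z x + z / 2 * Complex.sin (z * x))
    (b := fun z => Real.exp |z.im|) bd).const_mul_left (-(q 1 : ℂ))
  have T5 := IsBigO.integral_one (f := fun z x => dP z x + z / 2 * Complex.sin (z * x))
    (b := fun z => Real.exp |z.im|) hp bd
  have T6 := isBigO_const_exp (2 * omega q * h ^ 2 + 2 * h * q 0)
  refine ((((T1.add T3).add T4).add T5).add T6).congr' ?_ EventuallyEq.rfl
  filter_upwards [H] with z hz
  rw [hz.sq_mul_charDelta hp hqp hq]
  have h1 := hz.cont_deriv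
  have i1 : ∫ t in (0 : ℝ)..1, p t * (dP z t + z / 2 * Complex.sin (z * t)) =
      (∫ t in (0 : ℝ)..1, p t * dP z t) + z / 2 * ∫ t in (0 : ℝ)..1, p t * Complex.sin (z * t) := by
    rw [← intervalIntegral.integral_const_mul, ← intervalIntegral.integral_add]
    · congr 1; ext t; ring
    · exact hp.mul_continuousOn (by rwa [Set.uIcc_of_le zero_le_one])
    · exact (hp.mul_continuousOn (g := fun t : ℝ => Complex.sin (z * t)) (by fun_prop)).const_mul _
  rw [i1]
  simp only [Complex.ofReal_one, mul_one]
  ring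

lemma isBigO_one_div_mul {f : ℂ → ℂ} {b : ℂ → ℝ} (h : f =O[Bornology.cobounded ℂ] b) :
    (fun z => 1 / z * f z) =O[Bornology.cobounded ℂ] fun z => b z / ‖z‖ := by
  have h1 : (fun z : ℂ => 1 / z) =O[Bornology.cobounded ℂ] fun z => 1 / ‖z‖ :=
    IsBigO.of_bound 1 (Eventually.of_forall fun z => by simp)
  refine (h1.mul h).congr_right fun z => ?_
  ring

/-- The growth `exp (|Im z| x)` of `f` and `exp (|Im z| (1 - x))` of the kernel add up to `exp |Im
z|`. -/
lemma isBigO_mul_kernel {f : ℂ → ℝ → ℂ} {a : ℂ → ℝ} {C : ℝ}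
    (hf : ∀ᶠ z in Bornology.cobounded ℂ, ∀ x ∈ Set.Icc (0 : ℝ) 1,
      ‖f z x‖ ≤ C * Real.exp (|z.im| * x) * a z) {T : ℂ → ℂ}
    (hT : ∀ (k : ℂ) {x : ℝ}, 0 ≤ x → ‖T (k * x)‖ ≤ Real.exp (|k.im| * x)) :
    (fun y : ℂ × ℝ => f y.1 y.2 * T (y.1 * (1 - y.2 : ℝ))) =O[largeFilter]
      fun y => Real.exp |y.1.im| * a y.1 := by
  refine IsBigO.of_bound |C| ?_
  rw [eventually_largeFilter (P := fun z x => ‖f z x * T (z * (1 - x : ℝ))‖ ≤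
    |C| * ‖Real.exp |z.im| * a z‖)]
  filter_upwards [hf] with z hz x hx
  have h1 := hz x hx
  have h2 := hT z (x := 1 - x) (by linarith [hx.2])
  have h3 := exp_mul_exp_sub |z.im| 1 x
  rw [mul_one] at h3
  rw [norm_mul]
  calc ‖f z x‖ * ‖T (z * (1 - x : ℝ))‖ ≤
      C * Real.exp (|z.im| * x) * a z * Real.exp (|z.im| * (1 - x)) :=
        mul_le_mul h1 h2 (norm_nonneg _) ((norm_nonneg _).trans h1)
    _ = C * (Real.exp |z.im| * a z) := by rw [← h3]; ring
    _ ≤ |C * (Real.exp |z.im| * a z)| := le_abs_self _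
    _ = _ := by rw [abs_mul, Real.norm_eq_abs]

lemma hasDerivAt_cos_mul_one_sub (z : ℂ) (x : ℝ) :
    HasDerivAt (fun x : ℝ => Complex.cos (z * (1 - x : ℝ))) (z * Complex.sin (z * (1 - x : ℝ))) x := by
  refine ((hasDerivAt_cos_mul z (1 - x)).comp_const_sub 1 x).congr_deriv ?_
  ring

lemma hasDerivAt_sin_mul_one_sub (z : ℂ) (x : ℝ) :
    HasDerivAt (fun x : ℝ => Complex.sin (z * (1 - x : ℝ)))
      (-(z * Complex.cos (z * (1 - x : ℝ)))) x :=
  (hasDerivAt_sin_mul z (1 - x)).comp_const_sub 1 x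

/-- Variation of constants for the derivative of the product `P`, with the term `2 E` of the equation
for `P''` integrated by parts once more. -/
lemma IsProduct.deriv_one {q : ℝ → ℝ} {h C : ℝ} {z : ℂ} {P dP W E : ℝ → ℂ}
    (hq : ContinuousOn q (Set.Icc 0 1)) (hz : z ≠ 0) (H : IsProduct q h z C P dP W E) :
    dP 1 = 2 * h * Complex.cos z - z / 2 * Complex.sin z + 1 / z * (2 * h ^ 2 * Complex.sin z) +
      ((∫ t in (0 : ℝ)..1, (q t : ℂ) * (P t * Complex.cos (z * (1 - t : ℝ)))) +
      1 / z * ∫ t in (0 : ℝ)..1, (q t : ℂ) * ((dP t - W t) * Complex.sin (z * (1 - t : ℝ)))) := by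
  have h0 := H.cont
  have h1 := H.cont_deriv
  have h2 := H.cont_W
  have h3 := continuousOn_ofReal hq
  have h4 := H.cont_E
  have h01 : (1 : ℝ) ∈ Set.Icc (0 : ℝ) 1 := by simp
  have i1 := integral_eq_sub_of_hasDerivAt_Ioo
    (u := fun t => dP t * Complex.cos (z * (1 - t : ℝ)) - z * (P t * Complex.sin (z * (1 - t : ℝ))) +
      2 / z * (E t * Complex.sin (z * (1 - t : ℝ))))
    (du := fun t => (q t : ℂ) * (P t * Complex.cos (z * (1 - t : ℝ))) +
      1 / z * ((q t : ℂ) * ((dP t - W t) * Complex.sin (z * (1 - t : ℝ))))) (by fun_prop) (by fun_prop)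
    (fun x hx => by
      refine ((((H.hasDerivAt_deriv x hx).mul (hasDerivAt_cos_mul_one_sub z x)).sub
        (((H.hasDerivAt x hx).mul (hasDerivAt_sin_mul_one_sub z x)).const_mul z)).add
        (((H.hasDerivAt_E x hx).mul (hasDerivAt_sin_mul_one_sub z x)).const_mul (2 / z))).congr_deriv ?_
      field_simp
      ring) h01
  rw [intervalIntegral.integral_add (intervalIntegrable_of_continuousOn (by fun_prop) h01)
    (intervalIntegrable_of_continuousOn (by fun_prop) h01),
    intervalIntegral.integral_const_mul] at i1
  rw [i1, H.zero, H.deriv_zero, H.E_zero]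
  simp only [sub_self, Complex.ofReal_zero, mul_zero, Complex.cos_zero, Complex.sin_zero, sub_zero,
    Complex.ofReal_one, mul_one]
  field_simp
  ring

section Product

variable {q : ℝ → ℝ} {h C : ℝ} {P dP W E : ℂ → ℝ → ℂ}

/-- The derivative of the product at `1` up to `O(1/z)`. -/
lemma IsProduct.isBigO_deriv_one {p : ℝ → ℂ} (hp : IntervalIntegrable p volume 0 1)
    (hqp : ∀ x ∈ Set.Icc (0 : ℝ) 1, (q x : ℂ) = q 0 + ∫ t in (0 : ℝ)..x, p t)
    (hq : ContinuousOn q (Set.Icc 0 1))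
    (H : ∀ᶠ z in Bornology.cobounded ℂ, IsProduct q h z C (P z) (dP z) (W z) (E z)) :
    (fun z => dP z 1 - ((2 * h + 1 / 2 * omega q) * Complex.cos z - z / 2 * Complex.sin z))
      =O[Bornology.cobounded ℂ] fun z => Real.exp |z.im| / ‖z‖ := by
  have h01 : (1 : ℝ) ∈ Set.Icc (0 : ℝ) 1 := by simp
  have hqc := continuousOn_ofReal hq
  have hqi := intervalIntegrable_of_continuousOn hqc h01
  have hsin := IsBigO.at_one (f := fun z x => Complex.sin (z * x)) (b := fun z => Real.exp |z.im|)
    isBigO_sin_mul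
  have A1 := isBigO_one_div_mul (hsin.const_mul_left (2 * h ^ 2))
  have A2 := IsBigO.integral_one (b := fun z => Real.exp |z.im| * ‖z‖⁻¹)
    (f := fun z t => (P z t - (1 / 2 + 1 / 2 * Complex.cos (z * t))) * Complex.cos (z * (1 - t : ℝ)))
    hqi (isBigO_mul_kernel (T := Complex.cos) (C := C)
    (f := fun z t => P z t - (1 / 2 + 1 / 2 * Complex.cos (z * t))) (H.mono fun z hz x hx => by
      rw [← div_eq_mul_inv]; exact hz.bound x hx) norm_cos_mul_le)
  have A3 := isBigO_one_div_mul (IsBigO.integral_one (b := fun z => Real.exp |z.im| * 1)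
    (f := fun z t => (dP z t + z / 2 * Complex.sin (z * t)) * Complex.sin (z * (1 - t : ℝ)))
    hqi (isBigO_mul_kernel (T := Complex.sin) (C := C) (a := fun _ => 1)
    (f := fun z t => dP z t + z / 2 * Complex.sin (z * t)) (H.mono fun z hz x hx => by
      rw [mul_one]; exact hz.bound_deriv x hx) norm_sin_mul_le))
  have A4 := isBigO_one_div_mul (IsBigO.integral_one (b := fun z => Real.exp |z.im| * 1)
    (f := fun z t => W z t * Complex.sin (z * (1 - t : ℝ)))
    hqi (isBigO_mul_kernel (T := Complex.sin) (C := C) (a := fun _ => 1)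
    (f := fun z t => W z t) (H.mono fun z hz x hx => by
      rw [mul_one]; exact hz.bound_W x hx) norm_sin_mul_le))
  have A5 := isBigO_one_div_mul (IsBigO.integral_one (b := fun z => Real.exp |z.im| * 1)
    (f := fun z t => 1 * Complex.sin (z * (1 - t : ℝ)))
    hp (isBigO_mul_kernel (T := Complex.sin) (C := 1) (a := fun _ => 1)
    (f := fun z t => 1) (Eventually.of_forall fun z x hx => by
      simpa using mul_nonneg (abs_nonneg z.im) hx.1) norm_sin_mul_le))
  have A6 := isBigO_one_div_mul (hsin.const_mul_left (q 0))
  simp only [mul_one, ← div_eq_mul_inv] at A1 A2 A3 A4 A5 A6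
  refine (((((A1.add A2).add A3).sub A4).add (A5.const_mul_left (1 / 2))).add
    (A6.const_mul_left (1 / 2))).congr' ?_ EventuallyEq.rfl
  filter_upwards [H, eventually_one_le_norm] with z hz hz1
  have hz0 : z ≠ 0 := norm_pos_iff.1 (by linarith)
  have h0 := hz.cont
  have h1 := hz.cont_deriv
  have h2 := hz.cont_W
  have i1 := integral_primitive_mul_deriv hp hqp
    (u := fun t => -(1 / z) * Complex.sin (z * (1 - t : ℝ)))
    (du := fun t => Complex.cos (z * (1 - t : ℝ))) (by fun_prop) (by fun_prop)
    (fun x hx => ((hasDerivAt_sin_mul_one_sub z x).const_mul (-(1 / z))).congr_deriv (by field_simp)) h01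
  have i2 : ∀ t : ℝ, p t * (-(1 / z) * Complex.sin (z * (1 - t : ℝ))) =
      -(1 / z) * (p t * (1 * Complex.sin (z * (1 - t : ℝ)))) := fun t => by ring
  simp only [i2, intervalIntegral.integral_const_mul, sub_self, sub_zero, Complex.ofReal_zero, mul_zero,
    Complex.sin_zero, Complex.ofReal_one, mul_one] at i1
  rw [hz.deriv_one hq hz0, ofReal_omega]
  have i3 : (∫ t in (0 : ℝ)..1, (q t : ℂ) * (P z t * Complex.cos (z * (1 - t : ℝ)))) +
      1 / z * (∫ t in (0 : ℝ)..1, (q t : ℂ) * ((dP z t - W z t) * Complex.sin (z * (1 - t : ℝ)))) =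
      (∫ t in (0 : ℝ)..1, (q t : ℂ) * ((P z t - (1 / 2 + 1 / 2 * Complex.cos (z * t))) *
        Complex.cos (z * (1 - t : ℝ)))) +
      1 / z * (∫ t in (0 : ℝ)..1, (q t : ℂ) * ((dP z t + z / 2 * Complex.sin (z * t)) *
        Complex.sin (z * (1 - t : ℝ)))) -
      1 / z * (∫ t in (0 : ℝ)..1, (q t : ℂ) * (W z t * Complex.sin (z * (1 - t : ℝ)))) +
      1 / 2 * (∫ t in (0 : ℝ)..1, (q t : ℂ) * Complex.cos (z * (1 - t : ℝ))) +
      1 / 2 * Complex.cos z * (∫ t in (0 : ℝ)..1, (q t : ℂ)) := by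
    have ii : ∀ f : ℝ → ℂ, ContinuousOn f (Set.Icc 0 1) → IntervalIntegrable f volume 0 1 :=
      fun f hf => intervalIntegrable_of_continuousOn hf h01
    simp only [← intervalIntegral.integral_const_mul]
    rw [← intervalIntegral.integral_add (ii _ (by fun_prop)) (ii _ (by fun_prop)),
      ← intervalIntegral.integral_add (ii _ (by fun_prop)) (ii _ (by fun_prop)),
      ← intervalIntegral.integral_sub (ii _ (by fun_prop)) (ii _ (by fun_prop)),
      ← intervalIntegral.integral_add (ii _ (by fun_prop)) (ii _ (by fun_prop)),
      ← intervalIntegral.integral_add (ii _ (by fun_prop)) (ii _ (by fun_prop))]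
    congr 1
    ext t
    have e1 : Complex.cos z = Complex.cos (z * t) * Complex.cos (z * (1 - t : ℝ)) -
        Complex.sin (z * t) * Complex.sin (z * (1 - t : ℝ)) := by
      rw [← Complex.cos_add]; congr 1; push_cast; ring
    rw [e1]
    field_simp
    ring
  rw [i3, i1]
  simp only [Complex.ofReal_one, mul_one]
  ring

/-- The Wronskian up to `O(1/z)`. -/
lemma IsProduct.isBigO_W_sub {p : ℝ → ℂ} (hp : IntervalIntegrable p volume 0 1)
    (hqp : ∀ x ∈ Set.Icc (0 : ℝ) 1, (q x : ℂ) = q 0 + ∫ t in (0 : ℝ)..x, p t)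
    (hq : ContinuousOn q (Set.Icc 0 1))
    (H : ∀ᶠ z in Bornology.cobounded ℂ, IsProduct q h z C (P z) (dP z) (W z) (E z)) :
    (fun y : ℂ × ℝ => W y.1 y.2 - 1 / 2 * ∫ t in (0 : ℝ)..y.2, (q t : ℂ)) =O[largeFilter]
      fun y => Real.exp |y.1.im| / ‖y.1‖ := by
  have h01 : (1 : ℝ) ∈ Set.Icc (0 : ℝ) 1 := by simp
  have hqc := continuousOn_ofReal hq
  have hqi := intervalIntegrable_of_continuousOn hqc h01
  have h1 : (fun y : ℂ × ℝ => 1 / y.1) =O[largeFilter] fun y => 1 / ‖y.1‖ :=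
    IsBigO.of_bound 1 (Eventually.of_forall fun z => by simp)
  have A1 := IsBigO.integral (b := fun z => Real.exp |z.im| / ‖z‖)
    (f := fun z t => P z t - (1 / 2 + 1 / 2 * Complex.cos (z * t))) hqi (IsProduct.isBigO_bound H)
  have A2 := h1.mul (IsBigO.continuousOn_mul (b := fun z => Real.exp |z.im|)
    (f := fun z x => Complex.sin (z * x)) hqc isBigO_sin_mul)
  have A3 := h1.mul (IsBigO.integral (b := fun z => Real.exp |z.im|)
    (f := fun z x => Complex.sin (z * x)) hp isBigO_sin_mul)
  simp only [one_div_mul_eq_div (‖_‖)] at A2 A3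
  refine (A1.add ((A2.sub A3).const_mul_left (1 / 2))).congr' ?_ EventuallyEq.rfl
  refine (eventually_largeFilter (P := fun z x => (∫ t in (0 : ℝ)..x, (q t : ℂ) *
    (P z t - (1 / 2 + 1 / 2 * Complex.cos (z * t)))) + 1 / 2 * (1 / z * (q x * Complex.sin (z * x)) -
      1 / z * ∫ t in (0 : ℝ)..x, p t * Complex.sin (z * t)) =
      W z x - 1 / 2 * ∫ t in (0 : ℝ)..x, (q t : ℂ))).2 ?_
  filter_upwards [H, eventually_one_le_norm] with z hz hz1 x hx
  have hz0 : z ≠ 0 := norm_pos_iff.1 (by linarith)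
  have h0 := hz.cont
  have ii : ∀ f : ℝ → ℂ, ContinuousOn f (Set.Icc 0 1) → IntervalIntegrable f volume 0 x :=
    fun f hf => intervalIntegrable_of_continuousOn hf hx
  have i1 := integral_primitive_mul_deriv hp hqp
    (u := fun t => 1 / z * Complex.sin (z * t))
    (du := fun t => Complex.cos (z * t)) (by fun_prop) (by fun_prop)
    (fun x hx => ((hasDerivAt_sin_mul z x).const_mul (1 / z)).congr_deriv (by field_simp)) hx
  have i2 : ∀ t : ℝ, p t * (1 / z * Complex.sin (z * t)) =
      1 / z * (p t * Complex.sin (z * t)) := fun t => by ring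
  simp only [i2, intervalIntegral.integral_const_mul, Complex.ofReal_zero, mul_zero,
    Complex.sin_zero] at i1
  have i3 := integral_eq_sub_of_hasDerivAt_Ioo hz.cont_W (by fun_prop) hz.hasDerivAt_W hx
  rw [hz.W_zero, sub_zero] at i3
  have i4 : (∫ t in (0 : ℝ)..x, (q t : ℂ) * (P z t - (1 / 2 + 1 / 2 * Complex.cos (z * t)))) =
      (∫ t in (0 : ℝ)..x, (q t : ℂ) * P z t) - 1 / 2 * (∫ t in (0 : ℝ)..x, (q t : ℂ)) -
      1 / 2 * ∫ t in (0 : ℝ)..x, (q t : ℂ) * Complex.cos (z * t) := by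
    simp only [← intervalIntegral.integral_const_mul]
    rw [← intervalIntegral.integral_sub (ii _ (by fun_prop)) (ii _ (by fun_prop)),
      ← intervalIntegral.integral_sub (ii _ (by fun_prop)) (ii _ (by fun_prop))]
    congr 1
    ext t
    ring
  rw [i4, i1, i3]
  ring

end Product

/-- The characteristic function up to relative errors `O(1/z²)`, for `q' = p` with a square integrable
derivative `r`: every integral of `P'` in `sq_mul_charDelta` is integrated by parts once more. -/
lemma isBigO_charDelta_sub {q : ℝ → ℝ} (hq : ContinuousOn q (Set.Icc 0 1)) (h : ℝ) {p r : ℝ → ℂ}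
    (hr : MemLp r 2 (volume.restrict (Set.Icc (0 : ℝ) 1)))
    (hpr : ∀ x ∈ Set.Icc (0 : ℝ) 1, p x = p 0 + ∫ t in (0 : ℝ)..x, r t)
    (hqp : ∀ x ∈ Set.Icc (0 : ℝ) 1, (q x : ℂ) = q 0 + ∫ t in (0 : ℝ)..x, p t) :
    ∃ (ρ : ℝ → ℂ) (K₀ : ℂ), MemLp ρ 2 (volume.restrict (Set.Icc (0 : ℝ) 1)) ∧
      (omega q = 0 → K₀ = 1 / 2 * (-p 0 + (∫ t in (0 : ℝ)..1, (q t : ℂ) ^ 2) + 4 * h * q 0)) ∧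
      (fun z : ℂ => z ^ 2 * charDelta q h (z ^ 2 / 4) - (z ^ 2 * omega q / 2 +
        q 1 * (z / 2) * Complex.sin z +
        1 / 2 * (p 1 - q 1 * omega q - 4 * h * q 1) * Complex.cos z + K₀ +
        ∫ t in (0 : ℝ)..1, ρ t * Complex.cos (z * t)))
      =O[Bornology.cobounded ℂ] fun z => Real.exp |z.im| / ‖z‖ := by
  have h01 : (1 : ℝ) ∈ Set.Icc (0 : ℝ) 1 := by simp
  have h00 : (0 : ℝ) ∈ Set.Icc (0 : ℝ) 1 := by simp
  have ii : ∀ {f : ℝ → ℂ}, ContinuousOn f (Set.Icc 0 1) → IntervalIntegrable f volume 0 1 :=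
    fun hf => intervalIntegrable_of_continuousOn hf h01
  have hri := intervalIntegrable_of_memLp hr
  have hpc := continuousOn_of_eq_integral hri hpr
  have hp := ii hpc
  have hqc := continuousOn_ofReal hq
  have hqi := ii hqc
  have hqd : ∀ x ∈ Set.Ioo (0 : ℝ) 1, HasDerivAt (fun x => (q x : ℂ)) (p x) x :=
    fun x hx => hasDerivAt_of_eq_integral hpc hqp hx
  set Q : ℝ → ℂ := fun x => ∫ t in (0 : ℝ)..x, (q t : ℂ) with hQ
  have hQ0 : Q 0 = 0 := by simp [hQ]
  have hQ1 : Q 1 = omega q := (ofReal_omega q).symm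
  have hQeq : ∀ x ∈ Set.Icc (0 : ℝ) 1, Q x = Q 0 + ∫ t in (0 : ℝ)..x, (q t : ℂ) :=
    fun x _ => by rw [hQ0, zero_add]
  have hQc : ContinuousOn Q (Set.Icc 0 1) := continuousOn_of_eq_integral hqi hQeq
  have hQd : ∀ x ∈ Set.Ioo (0 : ℝ) 1, HasDerivAt Q (q x) x :=
    fun x hx => hasDerivAt_of_eq_integral hqc hQeq hx
  -- The double integral in `sq_mul_charDelta` is `∫ g (P' - W)`. The function `s` is the derivative
  -- of `g`, and all densities multiplying `P` add up to `2 ρ`.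
  set g : ℝ → ℂ := fun x => (omega q - Q x) * q x with hg
  set s : ℝ → ℂ := fun x => (omega q - Q x) * p x - (q x : ℂ) ^ 2 with hs
  have hsc : ContinuousOn s (Set.Icc 0 1) := by fun_prop
  have hgc : ContinuousOn g (Set.Icc 0 1) := by fun_prop
  have hsi := ii hsc
  have hgs : ∀ x ∈ Set.Icc (0 : ℝ) 1, g x = g 0 + ∫ t in (0 : ℝ)..x, s t := fun x hx => by
    rw [integral_eq_sub_of_hasDerivAt_Ioo (u := g) hgc hsc (fun x hx => ?_) hx]
    · ring
    · refine (((hQd x hx).const_sub (omega q : ℂ)).mul (hqd x hx)).congr_deriv ?_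
      rw [hs]; ring
  have hg1 : g 1 = 0 := by simp [hg, hQ1]
  have hg0 : g 0 = omega q * q 0 := by simp [hg, hQ0]
  have hmem : ∀ {f : ℝ → ℂ}, ContinuousOn f (Set.Icc 0 1) →
      MemLp f 2 (volume.restrict (Set.Icc (0 : ℝ) 1)) := fun {f} hf => by
    obtain ⟨B, hB⟩ := isCompact_Icc.exists_bound_of_continuousOn hf
    refine MemLp.of_bound (hf.aestronglyMeasurable measurableSet_Icc) B ?_
    exact (ae_restrict_iff' measurableSet_Icc).2 (Eventually.of_forall hB)
  set ρ : ℝ → ℂ := fun x => 1 / 2 * ((q x : ℂ) ^ 2 - s x - r x) with hρ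
  have hρm : MemLp ρ 2 (volume.restrict (Set.Icc (0 : ℝ) 1)) :=
    (((hmem (by fun_prop : ContinuousOn (fun x => (q x : ℂ) ^ 2) (Set.Icc 0 1))).sub
      (hmem hsc)).sub hr).const_mul (1 / 2)
  have hρi := intervalIntegrable_of_memLp hρm
  refine ⟨ρ, (∫ t in (0 : ℝ)..1, ρ t) + 2 * omega q * h ^ 2 - omega q * q 0 -
    1 / 2 * (∫ t in (0 : ℝ)..1, g t * Q t) + 2 * h * q 0 + 1 / 2 * p 1 - p 0, hρm, fun hω => ?_, ?_⟩
  · have e1 : ∫ t in (0 : ℝ)..1, ρ t = 1 / 2 * ((∫ t in (0 : ℝ)..1, (q t : ℂ) ^ 2) -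
        (∫ t in (0 : ℝ)..1, s t) - ∫ t in (0 : ℝ)..1, r t) := by
      rw [hρ, intervalIntegral.integral_const_mul, intervalIntegral.integral_sub _ hri,
        intervalIntegral.integral_sub (ii (by fun_prop)) hsi]
      exact (ii (by fun_prop)).sub hsi
    have e2 := hgs 1 h01
    have e3 := hpr 1 h01
    -- For `ω = 0`, `g Q = -q Q ^ 2` is the derivative of `-Q ^ 3 / 3`, which vanishes at both ends.
    have e4 : ∫ t in (0 : ℝ)..1, g t * Q t = 0 := by
      have := integral_eq_sub_of_hasDerivAt_Ioo (u := fun x => -(Q x ^ 3 / 3))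
        (du := fun t => g t * Q t) (by fun_prop) (by fun_prop) (fun x hx => by
          refine (((hQd x hx).pow 3).div_const 3).neg.congr_deriv ?_
          simp only [hg, hω]; push_cast; ring) h01
      rw [this, hQ1, hQ0, hω]; simp
    rw [hg1, hg0] at e2
    rw [e1, e4]
    simp only [hω, Complex.ofReal_zero] at e2 ⊢
    linear_combination 1 / 2 * e2 + 1 / 2 * e3
  obtain ⟨C, K, -, -, hex⟩ := exists_isProduct hq h
  choose! P dP W E hPP using hex
  have H : ∀ᶠ z in Bornology.cobounded ℂ, IsProduct q h z C (P z) (dP z) (W z) (E z) :=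
    (tendsto_norm_cobounded_atTop.eventually_ge_atTop K).mono hPP
  have A1 := IsBigO.integral_one (b := fun z => Real.exp |z.im| / ‖z‖)
    (f := fun z t => P z t - (1 / 2 + 1 / 2 * Complex.cos (z * t))) hρi (IsProduct.isBigO_bound H)
  have A2 := IsBigO.at_one (b := fun z => Real.exp |z.im| / ‖z‖)
    (f := fun z t => P z t - (1 / 2 + 1 / 2 * Complex.cos (z * t))) (IsProduct.isBigO_bound H)
  have A3 := IsBigO.integral_one (b := fun z => Real.exp |z.im| / ‖z‖)
    (f := fun z x => W z x - 1 / 2 * Q x) (ii hgc) (IsProduct.isBigO_W_sub hp hqp hq H)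
  have A4 := IsProduct.isBigO_deriv_one hp hqp hq H
  refine ((((A1.const_mul_left 2).sub A3).sub (A4.const_mul_left (q 1))).add
    (A2.const_mul_left (p 1))).congr' ?_ EventuallyEq.rfl
  filter_upwards [H] with z hz
  have h0 := hz.cont
  have h1 := hz.cont_deriv
  have h2 := hz.cont_W
  rw [hz.sq_mul_charDelta hp hqp hq]
  have hJd : ∀ x ∈ Set.Icc (0 : ℝ) 1, ∫ t in (0 : ℝ)..x, (q t : ℂ) * (dP z t - W z t) =
      (∫ t in (0 : ℝ)..0, (q t : ℂ) * (dP z t - W z t)) +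
        ∫ t in (0 : ℝ)..x, (q t : ℂ) * (dP z t - W z t) := fun x _ => by simp
  have hJi : IntervalIntegrable (fun t => (q t : ℂ) * (dP z t - W z t)) volume 0 1 :=
    ii (by fun_prop)
  have hJc := continuousOn_of_eq_integral hJi hJd
  have i1 := integral_primitive_mul_deriv hqi hQeq hJc (by fun_prop)
    (fun x hx => hasDerivAt_of_eq_integral (by fun_prop) hJd hx) h01
  have i2 : ∫ t in (0 : ℝ)..1, Q t * ((q t : ℂ) * (dP z t - W z t)) =
      omega q * (∫ t in (0 : ℝ)..1, (q t : ℂ) * (dP z t - W z t)) -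
        ∫ t in (0 : ℝ)..1, g t * (dP z t - W z t) := by
    rw [← intervalIntegral.integral_const_mul, ← intervalIntegral.integral_sub
      (ii (by fun_prop)) (ii (by fun_prop))]
    congr 1
    ext t
    rw [hg]; ring
  have i3 := integral_primitive_mul_deriv hsi hgs h0 h1 hz.hasDerivAt h01
  have i4 := integral_primitive_mul_deriv hri hpr h0 h1 hz.hasDerivAt h01
  have i5 : ∫ t in (0 : ℝ)..1, g t * (dP z t - W z t) =
      (∫ t in (0 : ℝ)..1, g t * dP z t) - ∫ t in (0 : ℝ)..1, g t * W z t := by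
    rw [← intervalIntegral.integral_sub (ii (by fun_prop)) (ii (by fun_prop))]
    congr 1
    ext t
    ring
  have i6 : ∫ t in (0 : ℝ)..1, ρ t * P z t = 1 / 2 * ((∫ t in (0 : ℝ)..1, (q t : ℂ) ^ 2 * P z t) -
      (∫ t in (0 : ℝ)..1, s t * P z t) - ∫ t in (0 : ℝ)..1, r t * P z t) := by
    have hrP : IntervalIntegrable (fun t => r t * P z t) volume 0 1 :=
      hri.mul_continuousOn (by rwa [Set.uIcc_of_le zero_le_one])
    rw [← intervalIntegral.integral_sub (ii (by fun_prop)) (ii (by fun_prop)),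
      ← intervalIntegral.integral_sub (ii (by fun_prop)) hrP, ← intervalIntegral.integral_const_mul]
    congr 1
    ext t
    rw [hρ]; ring
  have i7 : ∫ t in (0 : ℝ)..1, ρ t * (P z t - (1 / 2 + 1 / 2 * Complex.cos (z * t))) =
      (∫ t in (0 : ℝ)..1, ρ t * P z t) - 1 / 2 * (∫ t in (0 : ℝ)..1, ρ t) -
        1 / 2 * ∫ t in (0 : ℝ)..1, ρ t * Complex.cos (z * t) := by
    have hρP : IntervalIntegrable (fun t => ρ t * P z t) volume 0 1 :=
      hρi.mul_continuousOn (by rwa [Set.uIcc_of_le zero_le_one])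
    have hρc : IntervalIntegrable (fun t => ρ t * Complex.cos (z * t)) volume 0 1 :=
      hρi.mul_continuousOn (by fun_prop)
    rw [← intervalIntegral.integral_const_mul, ← intervalIntegral.integral_const_mul,
      ← intervalIntegral.integral_sub hρP (hρi.const_mul _),
      ← intervalIntegral.integral_sub (hρP.sub (hρi.const_mul _)) (hρc.const_mul _)]
    congr 1
    ext t
    ring
  have i8 : ∫ t in (0 : ℝ)..1, g t * (W z t - 1 / 2 * Q t) =
      (∫ t in (0 : ℝ)..1, g t * W z t) - 1 / 2 * ∫ t in (0 : ℝ)..1, g t * Q t := by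
    rw [← intervalIntegral.integral_const_mul, ← intervalIntegral.integral_sub
      (ii (by fun_prop)) (ii (by fun_prop))]
    congr 1
    ext t
    ring
  rw [hz.zero, hg0, hg1] at i3
  rw [hz.zero] at i4
  simp only [intervalIntegral.integral_same, hQ0, hQ1] at i1
  rw [i7, i8]
  simp only [Complex.ofReal_one, mul_one]
  linear_combination 2 * i6 - i4 - i3 - i1 + i2 - i5

/-! ### Square summability of exponential integrals -/

lemma exp_pi_mul_int (m : ℤ) : Complex.exp (Complex.I * (Real.pi * m)) = (-1) ^ m := by
  rw [← Complex.exp_pi_mul_I, ← Complex.exp_int_mul]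
  congr 1; ring

/-- Bessel's inequality for functions on half of a period. -/
lemma summable_sq_norm_integral_mul_exp {p : ℝ → ℂ}
    (hp : MemLp p 2 (volume.restrict (Set.Icc (0 : ℝ) 1))) :
    Summable fun l : ℤ => ‖∫ x in (0 : ℝ)..1, p x * Complex.exp (Complex.I * (Real.pi * l * x))‖ ^ 2 := by
  have hlt : (-1 : ℝ) < 1 := by norm_num
  set P : ℝ → ℂ := Set.indicator (Set.Icc 0 1) p with hP
  have hPm : MemLp P 2 (volume.restrict (Set.Ioc (-1 : ℝ) 1)) :=
    ((memLp_indicator_iff_restrict measurableSet_Icc).2 hp).restrict _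
  have h1 := (hasSum_sq_fourierCoeffOn hlt hPm).summable
  have h2 : ∀ l : ℤ, ‖∫ x in (0 : ℝ)..1, p x * Complex.exp (Complex.I * (Real.pi * l * x))‖ ^ 2 =
      4 * ‖fourierCoeffOn hlt P (-l)‖ ^ 2 := by
    intro l
    have h3 : (∫ x in (-1 : ℝ)..1, fourier (- -l) (x : AddCircle (1 - -1 : ℝ)) • P x) =
        ∫ x in (0 : ℝ)..1, p x * Complex.exp (Complex.I * (Real.pi * l * x)) := by
      have h4 : ∀ x : ℝ, fourier (- -l) (x : AddCircle (1 - -1 : ℝ)) • P x =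
          Set.indicator (Set.Icc 0 1)
            (fun x => p x * Complex.exp (Complex.I * (Real.pi * l * x))) x := by
        intro x
        rw [fourier_coe_apply, hP, Set.indicator_apply, Set.indicator_apply]
        split_ifs
        · rw [smul_eq_mul, mul_comm]
          congr 2
          push_cast; ring
        · simp
      simp only [h4]
      rw [intervalIntegral.integral_of_le (by norm_num), intervalIntegral.integral_of_le (by norm_num),
        ← integral_Icc_eq_integral_Ioc (x := (0 : ℝ)), setIntegral_indicator measurableSet_Icc]
      congr 2
      ext x
      simp only [Set.mem_inter_iff, Set.mem_Ioc, Set.mem_Icc]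
      constructor
      · rintro ⟨-, h⟩; exact h
      · rintro ⟨a, b⟩; exact ⟨⟨by linarith, b⟩, a, b⟩
    rw [fourierCoeffOn_eq_integral, h3, norm_smul, mul_pow]
    norm_num
    ring
  simp only [h2]
  exact ((Equiv.neg ℤ).summable_iff.2 h1).mul_left 4

/-- The Fourier coefficients of `e^{-y|x|}` on `[-1,1]`. -/
noncomputable def expCoeff (y : ℝ) (m : ℤ) : ℝ :=
  y * (1 - (-1) ^ m * Real.exp (-y)) / (y ^ 2 + (Real.pi * m) ^ 2)

lemma abs_neg_one_zpow_mul (m : ℤ) (a : ℝ) : |(-1) ^ m * a| = |a| := by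
  rw [abs_mul, abs_zpow, abs_neg, abs_one, one_zpow, one_mul]

lemma expCoeff_nonneg {y : ℝ} (hy : 0 < y) (m : ℤ) : 0 ≤ expCoeff y m := by
  have h1 := le_abs_self ((-1) ^ m * Real.exp (-y))
  rw [abs_neg_one_zpow_mul, Real.abs_exp] at h1
  have h2 : Real.exp (-y) ≤ 1 := Real.exp_le_one_iff.2 (by linarith)
  exact div_nonneg (mul_nonneg hy.le (by linarith)) (by positivity)

lemma expCoeff_le {y : ℝ} (hy : 0 < y) (m : ℤ) :
    expCoeff y m ≤ 2 * (y / (y ^ 2 + (Real.pi * m) ^ 2)) := by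
  have h1 := neg_abs_le ((-1) ^ m * Real.exp (-y))
  rw [abs_neg_one_zpow_mul, Real.abs_exp] at h1
  have h2 : Real.exp (-y) ≤ 1 := Real.exp_le_one_iff.2 (by linarith)
  rw [expCoeff, ← mul_div_assoc]
  refine div_le_div_of_nonneg_right ?_ (by positivity)
  nlinarith

lemma le_expCoeff {y : ℝ} (hy : 1 ≤ y) (m : ℤ) :
    y / (y ^ 2 + (Real.pi * m) ^ 2) ≤ 2 * expCoeff y m := by
  have h1 := le_abs_self ((-1) ^ m * Real.exp (-y))
  rw [abs_neg_one_zpow_mul, Real.abs_exp] at h1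
  have h2 : Real.exp (-y) ≤ 1 / 2 := by
    rw [Real.exp_neg, inv_eq_one_div]
    have := Real.add_one_le_exp y
    gcongr
    linarith
  rw [expCoeff, ← mul_div_assoc]
  refine div_le_div_of_nonneg_right ?_ (by positivity)
  nlinarith

/-- The coefficients are computed from the primitives of `exp ((± y - I π m) x)` on the two halves
of the interval. -/
lemma fourierCoeffOn_exp_neg_abs {y : ℝ} (hy : 0 < y) (m : ℤ) (hab : (-1 : ℝ) < -1 + 2) :
    fourierCoeffOn hab (fun x => (Real.exp (-y * |x|) : ℂ)) m = expCoeff y m := by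
  rw [fourierCoeffOn_eq_integral]
  have h1 : ∀ x : ℝ, fourier (-m) (x : AddCircle (-1 + 2 - -1 : ℝ)) • (Real.exp (-y * |x|) : ℂ) =
      Complex.exp ((-(Complex.I * (Real.pi * m))) * x) * Complex.exp (-y * |x|) := by
    intro x
    rw [fourier_coe_apply, smul_eq_mul]
    push_cast
    congr 2
    ring
  simp only [h1]
  have hc : Continuous fun x : ℝ => Complex.exp ((-(Complex.I * (Real.pi * m))) * x) *
      Complex.exp (-y * |x|) := by fun_prop
  rw [show (-1 + 2 : ℝ) = 1 by norm_num,
    ← intervalIntegral.integral_add_adjacent_intervals (b := 0) (hc.intervalIntegrable _ _)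
      (hc.intervalIntegrable _ _)]
  have e1 : ∫ x in (-1 : ℝ)..0, Complex.exp ((-(Complex.I * (Real.pi * m))) * x) *
      Complex.exp (-y * |x|) = ∫ x in (-1 : ℝ)..0, Complex.exp ((y - Complex.I * (Real.pi * m)) * x) := by
    refine intervalIntegral.integral_congr fun x hx => ?_
    rw [Set.uIcc_of_le (by norm_num)] at hx
    simp only [abs_of_nonpos hx.2]
    rw [← Complex.exp_add]; congr 1; push_cast; ring
  have e2 : ∫ x in (0 : ℝ)..1, Complex.exp ((-(Complex.I * (Real.pi * m))) * x) *
      Complex.exp (-y * |x|) = ∫ x in (0 : ℝ)..1, Complex.exp ((-y - Complex.I * (Real.pi * m)) * x) := by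
    refine intervalIntegral.integral_congr fun x hx => ?_
    rw [Set.uIcc_of_le (by norm_num)] at hx
    simp only [abs_of_nonneg hx.1]
    rw [← Complex.exp_add]; congr 1; ring
  have n1 : (y - Complex.I * (Real.pi * m) : ℂ) ≠ 0 := fun h => by
    have := congrArg Complex.re h; simp at this; exact hy.ne' this
  have n2 : (-y - Complex.I * (Real.pi * m) : ℂ) ≠ 0 := fun h => by
    have := congrArg Complex.re h; simp at this; exact hy.ne' this
  have n3 : ((y : ℂ) ^ 2 + (Real.pi * m) ^ 2 : ℂ) ≠ 0 := by
    have : (0 : ℝ) < y ^ 2 + (Real.pi * m) ^ 2 := by positivity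
    exact_mod_cast this.ne'
  have g1 := exp_pi_mul_int m
  have g2 : Complex.exp (-(Complex.I * (Real.pi * m))) = (-1) ^ m := by
    rw [Complex.exp_neg, g1, ← inv_zpow, inv_neg, inv_one]
  rw [e1, e2, integral_exp_mul_complex n1, integral_exp_mul_complex n2]
  simp only [Complex.ofReal_neg, Complex.ofReal_one, Complex.ofReal_zero, mul_zero, mul_one,
    Complex.exp_zero, mul_neg, neg_sub]
  rw [sub_eq_add_neg (Complex.I * _) (y : ℂ), sub_eq_add_neg (-(y : ℂ)), Complex.exp_add,
    Complex.exp_add, g1, g2, expCoeff]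
  push_cast
  rw [← sub_eq_add_neg, Complex.real_smul]
  push_cast
  have hI : Complex.I ^ 2 = -1 := Complex.I_sq
  have d1 : (1 - (-1) ^ m * Complex.exp (-(y : ℂ))) / (y - Complex.I * (Real.pi * m)) =
      (1 - (-1) ^ m * Complex.exp (-(y : ℂ))) * (y + Complex.I * (Real.pi * m)) /
        ((y : ℂ) ^ 2 + (Real.pi * m) ^ 2) := by
    rw [div_eq_div_iff n1 n3]
    linear_combination (1 - (-1) ^ m * Complex.exp (-(y : ℂ))) * (Real.pi * m) ^ 2 * hI
  have d2 : (Complex.exp (-(y : ℂ)) * (-1) ^ m - 1) / (-y - Complex.I * (Real.pi * m)) =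
      (1 - (-1) ^ m * Complex.exp (-(y : ℂ))) * (y - Complex.I * (Real.pi * m)) /
        ((y : ℂ) ^ 2 + (Real.pi * m) ^ 2) := by
    rw [div_eq_div_iff n2 n3]
    linear_combination -(1 - (-1) ^ m * Complex.exp (-(y : ℂ))) * (Real.pi * m) ^ 2 * hI
  rw [d1, d2, ← add_div]
  field_simp
  ring

lemma summable_div_sq_add_sq {y : ℝ} (hy : 0 < y) :
    Summable fun m : ℤ => y / (y ^ 2 + (Real.pi * m) ^ 2) := by
  have h1 : Summable fun m : ℤ => y * (1 / (m : ℝ) ^ 2) :=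
    (Real.summable_one_div_int_pow.2 one_lt_two).mul_left y
  refine Summable.of_norm_bounded_eventually h1 ?_
  rw [Filter.eventually_cofinite]
  refine (Set.finite_singleton (0 : ℤ)).subset fun m hm => ?_
  by_contra hm0
  refine hm ?_
  have : (0 : ℝ) < (m : ℝ) ^ 2 := by
    have : (m : ℝ) ≠ 0 := by exact_mod_cast hm0
    positivity
  rw [Real.norm_of_nonneg (by positivity), mul_one_div]
  gcongr
  have h2 : 1 ≤ Real.pi ^ 2 := by nlinarith [Real.pi_gt_three]
  rw [mul_pow]
  nlinarith [mul_le_mul_of_nonneg_right h2 this.le, sq_nonneg y]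

lemma summable_expCoeff {y : ℝ} (hy : 0 < y) : Summable (expCoeff y) :=
  Summable.of_nonneg_of_le (expCoeff_nonneg hy) (expCoeff_le hy) ((summable_div_sq_add_sq hy).mul_left 2)

/-- The Fourier series of the `2`-periodic extension of `e^{-y|x|}`, which is continuous and has
absolutely summable coefficients. At `x = 0` it shows that the nonnegative numbers `expCoeff y m`
have the sum `1`. -/
lemma hasSum_expCoeff_mul_exp {y : ℝ} (hy : 0 < y) {x : ℝ} (hx : x ∈ Set.Ico (0 : ℝ) 1) :
    HasSum (fun m : ℤ => (expCoeff y m : ℂ) * Complex.exp (Complex.I * (Real.pi * m * x)))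
      (Complex.exp (-(y * x))) := by
  have : Fact ((0 : ℝ) < 2) := ⟨two_pos⟩
  let f : C(AddCircle (2 : ℝ), ℂ) := ⟨AddCircle.liftIco 2 (-1) (fun x => (Real.exp (-y * |x|) : ℂ)),
    AddCircle.liftIco_continuous (by norm_num) (by fun_prop)⟩
  have hf : ∀ m, fourierCoeff (⇑f) m = expCoeff y m := fun m => by
    change fourierCoeff (AddCircle.liftIco 2 (-1) _) m = _
    rw [fourierCoeff_liftIco_eq, fourierCoeffOn_exp_neg_abs hy]
  have h1 := has_pointwise_sum_fourier_series_of_summable (f := f) (by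
    rw [show fourierCoeff (⇑f) = fun m => (expCoeff y m : ℂ) from funext hf]
    exact Complex.hasSum_ofReal.2 (summable_expCoeff hy).hasSum |>.summable) (x : AddCircle (2 : ℝ))
  simp only [hf, fourier_coe_apply, smul_eq_mul] at h1
  have h2 : f (x : AddCircle (2 : ℝ)) = Complex.exp (-(y * x)) := by
    have h3 : f (x : AddCircle (2 : ℝ)) = AddCircle.liftIco 2 (-1)
        (fun x => (Real.exp (-y * |x|) : ℂ)) (x : AddCircle (2 : ℝ)) := rfl
    rw [h3, AddCircle.liftIco_coe_apply ⟨by linarith [hx.1], by linarith [hx.2]⟩, abs_of_nonneg hx.1]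
    push_cast
    congr 1; ring
  rw [h2] at h1
  convert h1 using 3 with m
  congr 1
  push_cast; ring

lemma hasSum_expCoeff {y : ℝ} (hy : 0 < y) : HasSum (expCoeff y) 1 := by
  have := hasSum_expCoeff_mul_exp hy (x := 0) (by simp)
  simp only [Complex.ofReal_zero, mul_zero, neg_zero, Complex.exp_zero, mul_one] at this
  exact Complex.hasSum_ofReal.1 (by rwa [Complex.ofReal_one])

/-- Jensen's inequality for the square and a discrete probability distribution. -/
lemma sq_norm_le_tsum_of_hasSum {ι : Type*} {a : ι → ℝ} (ha : ∀ i, 0 ≤ a i) (h1 : HasSum a 1)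
    {C : ι → ℂ} (hC : Summable fun i => a i * ‖C i‖ ^ 2) {F : ℂ}
    (hF : HasSum (fun i => (a i : ℂ) * C i) F) : ‖F‖ ^ 2 ≤ ∑' i, a i * ‖C i‖ ^ 2 := by
  have h2 : Summable fun i => a i * ‖C i‖ := by
    refine Summable.of_nonneg_of_le (fun i => mul_nonneg (ha i) (norm_nonneg _)) (fun i => ?_)
      (h1.summable.add hC)
    nlinarith [ha i, mul_nonneg (ha i) (sq_nonneg (‖C i‖ - 1))]
  have h3 : ‖F‖ ≤ ∑' i, a i * ‖C i‖ := by
    rw [← hF.tsum_eq]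
    refine (norm_tsum_le_tsum_norm ?_).trans (le_of_eq ?_)
    · simpa [abs_of_nonneg (ha _)] using h2
    · simp [abs_of_nonneg (ha _)]
  set t := ∑' i, a i * ‖C i‖ with ht
  have h4 := (hC.hasSum.sub (h2.hasSum.mul_left (2 * t))).add (h1.mul_left (t ^ 2))
  have h5 := h4.nonneg fun i => by
    have := mul_nonneg (ha i) (sq_nonneg (‖C i‖ - t))
    nlinarith
  rw [← ht] at h5
  nlinarith [norm_nonneg F, pow_le_pow_left₀ (norm_nonneg F) h3 2]

/-- Averages of a square summable sequence with weights of bounded column sums. -/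
lemma summable_sq_of_hasSum {a : ℕ → ℤ → ℝ} {s : Set ℕ} (ha : ∀ n ∈ s, ∀ j, 0 ≤ a n j)
    (h1 : ∀ n ∈ s, HasSum (a n) 1) {B : ℝ}
    (hB : ∀ (j : ℤ) (u : Finset ℕ), (∀ n ∈ u, n ∈ s) → ∑ n ∈ u, a n j ≤ B)
    {C : ℤ → ℂ} (hC : Summable fun j => ‖C j‖ ^ 2) {F : ℕ → ℂ}
    (hF : ∀ n ∈ s, HasSum (fun j => (a n j : ℂ) * C j) (F n)) :
    Summable fun n : s => ‖F n‖ ^ 2 := by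
  have ha1 : ∀ n ∈ s, ∀ j, a n j ≤ 1 := fun n hn j =>
    le_hasSum (h1 n hn) j fun i _ => ha n hn i
  have hsum : ∀ n ∈ s, Summable fun j => a n j * ‖C j‖ ^ 2 := fun n hn =>
    Summable.of_nonneg_of_le (fun j => mul_nonneg (ha n hn j) (sq_nonneg _))
      (fun j => mul_le_of_le_one_left (sq_nonneg _) (ha1 n hn j)) hC
  refine summable_of_sum_le (c := ∑' j, B * ‖C j‖ ^ 2) (fun n => sq_nonneg _) fun u => ?_
  calc ∑ n ∈ u, ‖F n‖ ^ 2 ≤ ∑ n ∈ u, ∑' j, a n j * ‖C j‖ ^ 2 :=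
        Finset.sum_le_sum fun n _ =>
          sq_norm_le_tsum_of_hasSum (ha n n.2) (h1 n n.2) (hsum n n.2) (hF n n.2)
    _ = ∑' j, ∑ n ∈ u, a n j * ‖C j‖ ^ 2 := (Summable.tsum_finsetSum fun (n : s) _ => hsum n n.2).symm
    _ ≤ ∑' j, B * ‖C j‖ ^ 2 := by
        refine Summable.tsum_le_tsum (fun j => ?_) (summable_sum fun (n : s) _ => hsum n n.2)
          (hC.mul_left B)
        rw [← Finset.sum_mul]
        refine mul_le_mul_of_nonneg_right ?_ (sq_nonneg _)
        have := hB j (u.map (Function.Embedding.subtype _)) fun n hn => by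
          obtain ⟨m, -, rfl⟩ := Finset.mem_map.1 hn
          exact m.2
        simpa using this

/-- Column sums of the weights `expCoeff (log (A n)) (j - 2 n)`. -/
lemma exists_sum_expCoeff_le {A : ℝ} (hA : 0 < A) : ∃ B : ℝ, ∀ (j : ℤ) (u : Finset ℕ),
    (∀ n ∈ u, 1 ≤ n ∧ 1 ≤ Real.log (A * n)) → ∑ n ∈ u, expCoeff (Real.log (A * n)) (j - 2 * n) ≤ B := by
  have hsm : Summable fun n : ℕ => 4 * Real.sqrt A * (1 / (n : ℝ) ^ (3 / 2 : ℝ)) :=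
    (Real.summable_one_div_nat_rpow.2 (by norm_num)).mul_left _
  set b : ℕ → ℝ := fun n => 4 * Real.sqrt A * (1 / (n : ℝ) ^ (3 / 2 : ℝ)) with hb
  have hb0 : ∀ n, 0 ≤ b n := fun n => by positivity
  -- indices `n` that are far from `j / 2`
  have far : ∀ (j : ℤ) (n : ℕ), 1 ≤ n → 1 ≤ Real.log (A * n) → (n : ℝ) ≤ |((j - 2 * n : ℤ) : ℝ)| →
      expCoeff (Real.log (A * n)) (j - 2 * n) ≤ b n := by
    intro j n hn hy hj
    have hn0 : (0 : ℝ) < n := by exact_mod_cast hn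
    have h1 : Real.log (A * n) ≤ 2 * (Real.sqrt A * Real.sqrt n) := by
      have h2 : A * n = (Real.sqrt A * Real.sqrt n) ^ 2 := by
        rw [mul_pow, Real.sq_sqrt hA.le, Real.sq_sqrt hn0.le]
      have h3 := Real.log_le_sub_one_of_pos (x := Real.sqrt A * Real.sqrt n) (by positivity)
      rw [h2, Real.log_pow]
      push_cast
      linarith
    have h4 : (n : ℝ) ^ 2 = n ^ (3 / 2 : ℝ) * Real.sqrt n := by
      rw [Real.sqrt_eq_rpow, ← Real.rpow_add hn0]
      norm_num
    have hsq : 0 < Real.sqrt n := Real.sqrt_pos.2 hn0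
    refine (expCoeff_le (by linarith) _).trans ?_
    have h5 : (n : ℝ) ^ 2 ≤ Real.log (A * n) ^ 2 + (Real.pi * ((j - 2 * n : ℤ) : ℝ)) ^ 2 := by
      have h6 : (n : ℝ) ^ 2 ≤ ((j - 2 * n : ℤ) : ℝ) ^ 2 := by
        rw [← sq_abs ((j - 2 * n : ℤ) : ℝ)]; gcongr
      have h7 : 1 ≤ Real.pi ^ 2 := by nlinarith [Real.pi_gt_three]
      rw [mul_pow]
      nlinarith [sq_nonneg (Real.log (A * n)), sq_nonneg (((j - 2 * n : ℤ) : ℝ))]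
    calc 2 * (Real.log (A * n) / (Real.log (A * n) ^ 2 + (Real.pi * ((j - 2 * n : ℤ) : ℝ)) ^ 2))
        ≤ 2 * (2 * (Real.sqrt A * Real.sqrt n) / (n : ℝ) ^ 2) := by gcongr
      _ = b n := by rw [h4, hb]; field_simp; norm_num
  -- indices `n` that are close to `j / 2`
  have near : ∀ (j : ℤ) (n : ℕ), 1 ≤ n → 1 ≤ Real.log (A * n) → |((j - 2 * n : ℤ) : ℝ)| < n →
      1 ≤ Real.log (A * j) ∧ expCoeff (Real.log (A * n)) (j - 2 * n) ≤
        36 * expCoeff (Real.log (A * j)) (j - 2 * n) := by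
    intro j n hn hy hj
    have hn0 : (0 : ℝ) < n := by exact_mod_cast hn
    rw [abs_lt] at hj
    push_cast at hj
    have hj1 : (n : ℝ) ≤ j := by linarith [hj.1]
    have hj3 : (j : ℝ) ≤ 3 * n := by linarith [hj.2]
    have h1 : Real.log (A * n) ≤ Real.log (A * j) := Real.log_le_log (by positivity) (by gcongr)
    have h2 : Real.log (A * j) ≤ Real.log (A * n) + 2 := by
      have h3 : Real.log (A * j) ≤ Real.log (3 * (A * n)) :=
        Real.log_le_log (by have := hn0.trans_le hj1; positivity) (by nlinarith)
      rw [Real.log_mul (by norm_num : (3 : ℝ) ≠ 0) (by positivity)] at h3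
      have h4 := Real.log_le_sub_one_of_pos (x := 3) (by norm_num)
      linarith
    set y := Real.log (A * n)
    set Y := Real.log (A * j)
    refine ⟨hy.trans h1, ?_⟩
    have h5 : Y ≤ 3 * y := by linarith
    have hy0 : 0 < y := by linarith
    have hY0 : 0 < Y := by linarith
    set d := (Real.pi * ((j - 2 * n : ℤ) : ℝ)) ^ 2 with hd
    have hd0 : 0 ≤ d := sq_nonneg _
    have h6 := expCoeff_le (y := y) (by linarith) (j - 2 * n)
    have h7 := le_expCoeff (hy.trans h1) (j - 2 * n)
    rw [← hd] at h6 h7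
    have h8 : y / (y ^ 2 + d) ≤ 9 * (Y / (Y ^ 2 + d)) := by
      rw [← mul_div_assoc, div_le_div_iff₀ (by positivity) (by positivity)]
      have e1 : Y ^ 2 ≤ 9 * y ^ 2 := by nlinarith
      have e2 : y * (Y ^ 2 + d) ≤ Y * (9 * y ^ 2 + d) := by gcongr
      nlinarith [mul_nonneg (by linarith : (0 : ℝ) ≤ Y) hd0]
    linarith
  refine ⟨(∑' n, b n) + 36, fun j u hu => ?_⟩
  have hle : ∑ n ∈ u, b n ≤ ∑' n, b n := hsm.sum_le_tsum u fun n _ => hb0 n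
  by_cases hY : 1 ≤ Real.log (A * j)
  · have hY0 : 0 < Real.log (A * j) := by linarith
    have h1 : ∑ n ∈ u, expCoeff (Real.log (A * n)) (j - 2 * n) ≤
        ∑ n ∈ u, (b n + 36 * expCoeff (Real.log (A * j)) (j - 2 * n)) := by
      refine Finset.sum_le_sum fun n hn => ?_
      rcases le_or_gt (n : ℝ) |((j - 2 * n : ℤ) : ℝ)| with h | h
      · have := far j n (hu n hn).1 (hu n hn).2 h
        have := expCoeff_nonneg hY0 (j - 2 * n)
        linarith
      · have := (near j n (hu n hn).1 (hu n hn).2 h).2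
        have := hb0 n
        linarith
    have h2 : ∑ n ∈ u, expCoeff (Real.log (A * j)) (j - 2 * n) ≤ 1 := by
      have inj : Function.Injective fun n : ℕ => j - 2 * (n : ℤ) := fun m n h => by
        simp only at h; omega
      have h3 := sum_le_hasSum (u.map ⟨_, inj⟩) (fun i _ => expCoeff_nonneg hY0 i)
        (hasSum_expCoeff hY0)
      simpa using h3
    rw [Finset.sum_add_distrib, ← Finset.mul_sum u (fun n : ℕ => expCoeff (Real.log (A * j)) (j - 2 * n))]
      at h1
    linarith
  · have h1 : ∑ n ∈ u, expCoeff (Real.log (A * n)) (j - 2 * n) ≤ ∑ n ∈ u, b n := by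
      refine Finset.sum_le_sum fun n hn => ?_
      rcases le_or_gt (n : ℝ) |((j - 2 * n : ℤ) : ℝ)| with h | h
      · exact far j n (hu n hn).1 (hu n hn).2 h
      · exact absurd (near j n (hu n hn).1 (hu n hn).2 h).1 hY
    linarith

lemma hasSum_comp_sub {E : Type*} [AddCommMonoid E] [TopologicalSpace E] {f : ℤ → E} {a : E}
    (h : HasSum f a) (k : ℤ) : HasSum (fun j => f (j - k)) a :=
  (Equiv.subRight k).hasSum_iff.2 h

/-- At `z = 2 π n + b + I y` the decaying factor `e^{-y(1-x)}` is expanded in its Fourier series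
under the integral. The frequencies are shifted by `2 n`, so that only the weights, and not the
integrals in the sum, depend on `n` and `y`: a logarithmic curve is reduced to Fourier coefficients
of one function. -/
lemma hasSum_integral_mul_exp {p : ℝ → ℂ} (hp : IntervalIntegrable p volume 0 1) {y : ℝ} (hy : 0 < y)
    (b : ℝ) (n : ℕ) :
    HasSum (fun j : ℤ => (expCoeff y (j - 2 * n) : ℂ) * ((-1) ^ j * ∫ x in (0 : ℝ)..1,
        (p x * Complex.exp (Complex.I * b * (1 - x : ℝ))) *
          Complex.exp (Complex.I * (Real.pi * (-j : ℤ) * x))))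
      (∫ x in (0 : ℝ)..1, p x * Complex.exp (Complex.I *
        (((2 * Real.pi * n + b : ℝ) : ℂ) + Complex.I * y) * (1 - x : ℝ))) := by
  have hshift : HasSum (fun j : ℤ => expCoeff y (j - 2 * n)) 1 :=
    hasSum_comp_sub (hasSum_expCoeff hy) _
  have hpe : IntervalIntegrable (fun x : ℝ => p x * Complex.exp (Complex.I * b * (1 - x : ℝ)))
      volume 0 1 := hp.mul_continuousOn (by fun_prop)
  have key := intervalIntegral.hasSum_integral_of_dominated_convergence (μ := volume) (a := 0) (b := 1)
    (F := fun (j : ℤ) (x : ℝ) => (expCoeff y (j - 2 * n) : ℂ) * ((-1) ^ j *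
        ((p x * Complex.exp (Complex.I * b * (1 - x : ℝ))) *
          Complex.exp (Complex.I * (Real.pi * (-j : ℤ) * x)))))
    (f := fun x => p x * Complex.exp (Complex.I *
        (((2 * Real.pi * n + b : ℝ) : ℂ) + Complex.I * y) * (1 - x : ℝ)))
    (fun j x => expCoeff y (j - 2 * n) * ‖p x * Complex.exp (Complex.I * b * (1 - x : ℝ))‖)
    (fun j => ?_) (fun j => ?_) ?_ ?_ ?_
  · simpa only [intervalIntegral.integral_const_mul] using key
  · rw [Set.uIoc_of_le zero_le_one]
    have h1 : IntervalIntegrable (fun x : ℝ => (p x * Complex.exp (Complex.I * b * (1 - x : ℝ))) *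
          Complex.exp (Complex.I * (Real.pi * (-j : ℤ) * x))) volume 0 1 :=
      hpe.mul_continuousOn (by fun_prop)
    exact ((h1.const_mul _).const_mul _).aestronglyMeasurable
  · refine Eventually.of_forall fun x _ => le_of_eq ?_
    rw [norm_mul, norm_mul, norm_mul (p x * _), Complex.norm_real,
      Real.norm_of_nonneg (expCoeff_nonneg hy _), norm_zpow, norm_neg, norm_one, one_zpow, one_mul,
      show Complex.I * (Real.pi * (-j : ℤ) * x) = ((Real.pi * (-j : ℤ) * x : ℝ) : ℂ) * Complex.I by
        push_cast; ring, Complex.norm_exp_ofReal_mul_I, mul_one]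
  · exact Eventually.of_forall fun x _ => hshift.summable.mul_right _
  · simp only [tsum_mul_right]
    exact hpe.norm.const_mul _
  · refine Eventually.of_forall fun x hx => ?_
    rw [Set.uIoc_of_le zero_le_one] at hx
    have h1 := hasSum_comp_sub
      (hasSum_expCoeff_mul_exp hy (x := 1 - x) ⟨by linarith [hx.2], by linarith [hx.1]⟩) (2 * n)
    have h2 := h1.mul_left (p x * Complex.exp (Complex.I * b * (1 - x : ℝ)) *
      Complex.exp (-(Complex.I * (2 * Real.pi * n * x))))
    have e0 : Complex.exp (Complex.I * (Real.pi * (2 * n : ℤ))) = 1 := by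
      rw [exp_pi_mul_int, zpow_mul]; simp
    have e4 : p x * Complex.exp (Complex.I * (((2 * Real.pi * n + b : ℝ) : ℂ) + Complex.I * y) *
        (1 - x : ℝ)) = p x * Complex.exp (Complex.I * b * (1 - x : ℝ)) *
        Complex.exp (-(Complex.I * (2 * Real.pi * n * x))) * Complex.exp (-(y * (1 - x : ℝ))) := by
      rw [mul_assoc (p x), mul_assoc (p x)]
      congr 1
      rw [← Complex.exp_add, ← Complex.exp_add, ← mul_one (Complex.exp (_ + _)), ← e0,
        ← Complex.exp_add]
      congr 1
      push_cast
      linear_combination (y : ℂ) * (1 - x) * Complex.I_mul_I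
    rw [e4]
    refine h2.congr_fun fun j => ?_
    have e1 : Complex.exp (Complex.I * (Real.pi * ((j - 2 * n : ℤ) : ℂ) * (1 - x : ℝ))) =
        (-1) ^ j * (Complex.exp (Complex.I * (Real.pi * (-j : ℤ) * x)) *
          Complex.exp (Complex.I * (2 * Real.pi * n * x))) := by
      rw [← exp_pi_mul_int, ← Complex.exp_add, ← Complex.exp_add,
        ← mul_one (Complex.exp (Complex.I * (Real.pi * ((j - 2 * n : ℤ) : ℂ) * (1 - x : ℝ)))), ← e0,
        ← Complex.exp_add]
      congr 1
      push_cast; ring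
    have e2 : Complex.exp (-(Complex.I * (2 * Real.pi * n * x))) *
        Complex.exp (Complex.I * (2 * Real.pi * n * x)) = 1 := by
      rw [← Complex.exp_add]; simp
    rw [e1]
    linear_combination -((expCoeff y (j - 2 * n) : ℂ) * ((-1) ^ j *
      ((p x * Complex.exp (Complex.I * b * (1 - x : ℝ))) *
        Complex.exp (Complex.I * (Real.pi * (-j : ℤ) * x))))) * e2

/-- Exponential integrals at the approximate zeros are square summable: by `hasSum_integral_mul_exp`
they are averages of Fourier coefficients, with weights whose column sums are bounded. -/
lemma summable_sq_norm_integral_leadApprox {p : ℝ → ℂ}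
    (hp : MemLp p 2 (volume.restrict (Set.Icc (0 : ℝ) 1))) {c : ℝ} (hc : c ≠ 0) :
    Summable fun n : ℕ =>
      ‖∫ x in (0 : ℝ)..1, p x * Complex.exp (Complex.I * leadApprox c n * (1 - x : ℝ))‖ ^ 2 := by
  have hA : 0 < 4 * Real.pi * |c| := by positivity
  obtain ⟨B, hB⟩ := exists_sum_expCoeff_le hA
  have hpi := intervalIntegrable_of_memLp hp
  set s : Set ℕ := {n | 1 ≤ n ∧ 1 ≤ Real.log (4 * Real.pi * |c| * n)} with hs
  have hcf : ∀ᶠ n : ℕ in atTop, n ∈ s :=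
    (eventually_ge_atTop 1).and ((Real.tendsto_log_atTop.comp
      (tendsto_natCast_atTop_atTop.const_mul_atTop hA)).eventually_ge_atTop 1)
  have hpe : MemLp (fun x : ℝ => p x * Complex.exp (Complex.I * leadShift c * (1 - x : ℝ))) 2
      (volume.restrict (Set.Icc (0 : ℝ) 1)) := by
    refine hp.of_le ?_ (Eventually.of_forall fun x => le_of_eq ?_)
    · exact hp.aestronglyMeasurable.mul (by fun_prop : Continuous fun x : ℝ =>
        Complex.exp (Complex.I * leadShift c * (1 - x : ℝ))).aestronglyMeasurable
    · rw [norm_mul, show Complex.I * leadShift c * (1 - x : ℝ) =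
        ((leadShift c * (1 - x) : ℝ) : ℂ) * Complex.I by push_cast; ring,
        Complex.norm_exp_ofReal_mul_I, mul_one]
  have h1 := summable_sq_of_hasSum (a := fun n j => expCoeff (Real.log (4 * Real.pi * |c| * n)) (j - 2 * n))
    (s := s) (fun n hn j => expCoeff_nonneg (by linarith [hn.2]) _)
    (fun n hn => hasSum_comp_sub (hasSum_expCoeff (by linarith [hn.2])) _)
    (B := B) hB (C := fun j => (-1) ^ j * ∫ x in (0 : ℝ)..1,
        (p x * Complex.exp (Complex.I * leadShift c * (1 - x : ℝ))) *
          Complex.exp (Complex.I * (Real.pi * (-j : ℤ) * x))) (by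
      have := (Equiv.neg ℤ).summable_iff.2 (summable_sq_norm_integral_mul_exp hpe)
      simpa [Function.comp_def] using this)
    (F := fun n => ∫ x in (0 : ℝ)..1, p x * Complex.exp (Complex.I * leadApprox c n * (1 - x : ℝ)))
    (fun n hn => by
      have := hasSum_integral_mul_exp hpi (y := Real.log (4 * Real.pi * |c| * n))
        (by linarith [hn.2]) (leadShift c) n
      have e : leadApprox c n = ((2 * Real.pi * n + leadShift c : ℝ) : ℂ) +
          Complex.I * (Real.log (4 * Real.pi * |c| * n) : ℝ) := by
        rw [leadApprox, mul_right_comm (4 * Real.pi)]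
      rwa [← e] at this)
  obtain ⟨N, hN⟩ := eventually_atTop.1 hcf
  rw [← summable_nat_add_iff N]
  exact h1.comp_injective (i := fun n : ℕ => (⟨n + N, hN _ (by omega)⟩ : s)) fun m n h => by
    simpa using h

/-- The exponential integral `∫₀¹ p(x) e^{izx} dx`. -/
noncomputable def expIntegral (p : ℝ → ℂ) (z : ℂ) : ℂ :=
  ∫ x in (0 : ℝ)..1, p x * Complex.exp (Complex.I * z * x)

lemma norm_exp_I_mul_mul_le (z : ℂ) {x : ℝ} (hx : x ∈ Set.Icc (0 : ℝ) 1) :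
    ‖Complex.exp (Complex.I * z * x)‖ ≤ max 1 (Real.exp (-z.im)) := by
  have h1 : (Complex.I * z * x).re = -z.im * x := by simp
  rw [Complex.norm_exp, h1]
  rcases le_total 0 z.im with h | h
  · exact le_max_of_le_left (Real.exp_le_one_iff.2 (by nlinarith [hx.1]))
  · exact le_max_of_le_right (Real.exp_le_exp.2 (by nlinarith [hx.2]))

lemma norm_expIntegral_le {p : ℝ → ℂ} (hp : IntervalIntegrable p volume 0 1) (z : ℂ) :
    ‖expIntegral p z‖ ≤ max 1 (Real.exp (-z.im)) * ∫ x in (0 : ℝ)..1, ‖p x‖ :=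
  norm_integral_mul_le hp (by simp) fun _ ht => norm_exp_I_mul_mul_le z ht

/-- The Riemann–Lebesgue lemma, uniformly in the complex plane: `p` is approximated in `L¹` by a smooth
function, for which the integral is integrated by parts. -/
lemma isLittleO_expIntegral {p : ℝ → ℂ} (hp : IntervalIntegrable p volume 0 1) :
    expIntegral p =o[Bornology.cobounded ℂ] fun z => max 1 (Real.exp (-z.im)) := by
  refine IsLittleO.of_bound fun ε hε => ?_
  have hp1 : MemLp p 1 (volume.restrict (Set.Ioc (0 : ℝ) 1)) :=
    memLp_one_iff_integrable.2 ((intervalIntegrable_iff_integrableOn_Ioc_of_le zero_le_one).1 hp)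
  obtain ⟨g, -, hg, hgp⟩ := hp1.exist_eLpNorm_sub_le ENNReal.one_ne_top le_rfl (half_pos hε)
  have hgc : Continuous g := hg.continuous
  have hdg : Continuous (deriv g) := hg.continuous_deriv (by simp)
  have hgi : IntervalIntegrable g volume 0 1 := hgc.intervalIntegrable _ _
  have hdi : IntervalIntegrable (deriv g) volume 0 1 := hdg.intervalIntegrable _ _
  have hsmall : ∫ x in (0 : ℝ)..1, ‖(p - g) x‖ ≤ ε / 2 := by
    rw [intervalIntegral.integral_of_le zero_le_one]
    have h1 : Integrable (p - g) (volume.restrict (Set.Ioc (0 : ℝ) 1)) :=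
      (intervalIntegrable_iff_integrableOn_Ioc_of_le zero_le_one).1 (hp.sub hgi)
    rw [integral_norm_eq_lintegral_enorm h1.aestronglyMeasurable, ← eLpNorm_one_eq_lintegral_enorm]
    exact ENNReal.toReal_le_of_le_ofReal (half_pos hε).le hgp
  set B := ‖g 1‖ + ‖g 0‖ + ∫ x in (0 : ℝ)..1, ‖deriv g x‖ with hB
  filter_upwards [tendsto_norm_cobounded_atTop.eventually_ge_atTop (2 * B / ε),
    eventually_one_le_norm] with z hz hz1
  set m := max 1 (Real.exp (-z.im)) with hm
  have hm1 : 1 ≤ m := le_max_left _ _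
  have hz0 : z ≠ 0 := norm_pos_iff.1 (by linarith)
  have hexp : Continuous fun x : ℝ => Complex.exp (Complex.I * z * x) := by fun_prop
  have e1 : expIntegral p z = expIntegral (p - g) z + expIntegral g z := by
    rw [expIntegral, expIntegral, expIntegral, ← intervalIntegral.integral_add]
    · simp [sub_mul]
    · exact (hp.sub hgi).mul_continuousOn hexp.continuousOn
    · exact hgi.mul_continuousOn hexp.continuousOn
  have e2 : ‖expIntegral (p - g) z‖ ≤ m * ∫ x in (0 : ℝ)..1, ‖(p - g) x‖ :=
    norm_expIntegral_le (hp.sub hgi) z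
  have e3 := integral_primitive_mul_deriv (g := g) (p := deriv g) hdi
    (u := fun x => 1 / (Complex.I * z) * Complex.exp (Complex.I * z * x))
    (du := fun x => Complex.exp (Complex.I * z * x))
    (fun x _ => by
      rw [intervalIntegral.integral_deriv_eq_sub
        (fun y _ => (hg.differentiable (by simp)).differentiableAt) (hdg.intervalIntegrable _ _)]
      ring) (by fun_prop) hexp.continuousOn
    (fun x _ => by
      have h1 : HasDerivAt (fun x : ℝ => Complex.I * z * (x : ℂ)) (Complex.I * z) x := by
        simpa using (Complex.ofRealCLM.hasDerivAt (x := x)).const_mul (Complex.I * z)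
      refine (h1.cexp.const_mul (1 / (Complex.I * z))).congr_deriv ?_
      field_simp) (x := 1) (by simp)
  have e4 : ∫ x in (0 : ℝ)..1, deriv g x * (1 / (Complex.I * z) * Complex.exp (Complex.I * z * x)) =
      1 / (Complex.I * z) * expIntegral (deriv g) z := by
    rw [expIntegral, ← intervalIntegral.integral_const_mul]
    congr 1; ext x; ring
  have e5 : ‖expIntegral g z‖ ≤ B * m / ‖z‖ := by
    have e6 : expIntegral g z = 1 / (Complex.I * z) * (g 1 * Complex.exp (Complex.I * z * (1 : ℝ)) -
        g 0 * Complex.exp (Complex.I * z * (0 : ℝ)) - expIntegral (deriv g) z) := by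
      rw [expIntegral, e3, e4]; ring
    have e7 : ‖1 / (Complex.I * z)‖ = ‖z‖⁻¹ := by simp
    rw [e6, norm_mul, e7, div_eq_inv_mul]
    refine mul_le_mul_of_nonneg_left ?_ (by positivity)
    have n1 := norm_exp_I_mul_mul_le z (x := 1) (by simp)
    have n0 := norm_exp_I_mul_mul_le z (x := 0) (by simp)
    have n2 := norm_expIntegral_le hdi z
    refine (norm_sub_le _ _).trans ((add_le_add (norm_sub_le _ _) n2).trans ?_)
    rw [norm_mul, norm_mul, hB]
    have n3 := mul_le_mul_of_nonneg_left n1 (norm_nonneg (g 1))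
    have n4 := mul_le_mul_of_nonneg_left n0 (norm_nonneg (g 0))
    rw [← hm] at n3 n4 ⊢
    linarith
  have hzp : 0 < ‖z‖ := by linarith
  rw [div_le_iff₀ hε] at hz
  have e7 : B * m / ‖z‖ ≤ ε / 2 * m := by
    rw [div_le_iff₀ hzp]; nlinarith
  have e8 : m * ∫ x in (0 : ℝ)..1, ‖(p - g) x‖ ≤ m * (ε / 2) := by gcongr
  rw [e1, Real.norm_of_nonneg (by linarith : (0 : ℝ) ≤ m)]
  have e9 := norm_add_le (expIntegral (p - g) z) (expIntegral g z)
  linarith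

lemma memLp_reflect {p : ℝ → ℂ} (hp : MemLp p 2 (volume.restrict (Set.Icc (0 : ℝ) 1))) :
    MemLp (fun x => p (1 - x)) 2 (volume.restrict (Set.Icc (0 : ℝ) 1)) := by
  have h1 := (Measure.measurePreserving_sub_left (volume : Measure ℝ) 1).restrict_preimage
    (measurableSet_Icc (a := (0 : ℝ)) (b := 1))
  have h2 : (fun x : ℝ => 1 - x) ⁻¹' Set.Icc 0 1 = Set.Icc 0 1 := by
    simp
  rw [h2] at h1
  exact hp.comp_measurePreserving h1

lemma expIntegral_reflect (p : ℝ → ℂ) (z : ℂ) :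
    expIntegral (fun x => p (1 - x)) z =
      ∫ x in (0 : ℝ)..1, p x * Complex.exp (Complex.I * z * (1 - x : ℝ)) := by
  have := intervalIntegral.integral_comp_sub_left (a := 0) (b := 1)
    (fun x => p x * Complex.exp (Complex.I * z * (1 - x : ℝ))) 1
  simp only [sub_sub_cancel, sub_self, sub_zero] at this
  exact this

lemma expIntegral_neg (p : ℝ → ℂ) (z : ℂ) :
    expIntegral p (-z) = Complex.exp (-(Complex.I * z)) * expIntegral (fun x => p (1 - x)) z := by
  rw [expIntegral_reflect, expIntegral, ← intervalIntegral.integral_const_mul]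
  congr 1
  ext x
  rw [mul_left_comm, ← Complex.exp_add]
  congr 2
  push_cast; ring

lemma integral_mul_sin_eq {p : ℝ → ℂ} (hp : IntervalIntegrable p volume 0 1) (z : ℂ) :
    ∫ x in (0 : ℝ)..1, p x * Complex.sin (z * x) =
      Complex.I / 2 * (expIntegral p (-z) - expIntegral p z) := by
  rw [expIntegral, expIntegral, ← intervalIntegral.integral_sub, ← intervalIntegral.integral_const_mul]
  · congr 1
    ext x
    rw [sin_eq_exp]
    ring_nf
  · exact hp.mul_continuousOn (by fun_prop)
  · exact hp.mul_continuousOn (by fun_prop)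

lemma integral_mul_cos_eq {p : ℝ → ℂ} (hp : IntervalIntegrable p volume 0 1) (z : ℂ) :
    ∫ x in (0 : ℝ)..1, p x * Complex.cos (z * x) =
      1 / 2 * (expIntegral p (-z) + expIntegral p z) := by
  rw [expIntegral, expIntegral, ← intervalIntegral.integral_add, ← intervalIntegral.integral_const_mul]
  · congr 1
    ext x
    rw [Complex.cos]
    ring_nf
  · exact hp.mul_continuousOn (by fun_prop)
  · exact hp.mul_continuousOn (by fun_prop)

/-- Small perturbations of the points where exponential integrals are evaluated. In the first-order
expansion in `w n`, the coefficient is an exponential integral of `x p(x)`, hence `o(1)`. -/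
lemma eventually_norm_expIntegral_add_le {p : ℝ → ℂ} (hp : IntervalIntegrable p volume 0 1)
    {ζ w : ℕ → ℂ} (hζ : Tendsto (fun n => ‖ζ n‖) atTop atTop) (him : ∀ᶠ n in atTop, 0 ≤ (ζ n).im)
    (hw : Tendsto w atTop (𝓝 0)) {ε : ℝ} (hε : 0 < ε) :
    ∀ᶠ n in atTop, ‖expIntegral p (ζ n + w n)‖ ≤ ‖expIntegral p (ζ n)‖ + ε * ‖w n‖ := by
  set N := ∫ x in (0 : ℝ)..1, ‖p x‖ with hN
  have hN0 : 0 ≤ N := intervalIntegral.integral_nonneg zero_le_one fun _ _ => norm_nonneg _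
  have hxp : IntervalIntegrable (fun x : ℝ => p x * x) volume 0 1 :=
    hp.mul_continuousOn (by fun_prop)
  have h1 := ((isLittleO_expIntegral hxp).comp_tendsto (tendsto_norm_atTop_iff_cobounded.1 hζ)).bound
    (half_pos hε)
  have h2 : ∀ᶠ n in atTop, ‖w n‖ < min 1 (ε / (2 * (N + 1))) :=
    hw.norm.eventually_lt_const (by rw [norm_zero]; positivity)
  filter_upwards [h1, him, h2] with n h1 him h2
  simp only [Function.comp] at h1
  have hm : max 1 (Real.exp (-(ζ n).im)) = 1 :=
    max_eq_left (Real.exp_le_one_iff.2 (by linarith))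
  rw [hm, norm_one, mul_one] at h1
  have hw1 : ‖w n‖ ≤ 1 := (h2.trans_le (min_le_left _ _)).le
  have hw2 : ‖w n‖ * (2 * (N + 1)) ≤ ε := by
    have := (h2.trans_le (min_le_right _ _)).le
    rwa [le_div_iff₀ (by positivity)] at this
  have e1 : expIntegral p (ζ n + w n) = expIntegral p (ζ n) +
      Complex.I * w n * expIntegral (fun x : ℝ => p x * x) (ζ n) +
      ∫ x in (0 : ℝ)..1, p x * (Complex.exp (Complex.I * ζ n * x) *
        (Complex.exp (Complex.I * w n * x) - 1 - Complex.I * w n * x)) := by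
    simp only [expIntegral]
    rw [← intervalIntegral.integral_const_mul, ← intervalIntegral.integral_add,
      ← intervalIntegral.integral_add]
    · congr 1
      ext x
      rw [show Complex.I * (ζ n + w n) * x = Complex.I * ζ n * x + Complex.I * w n * x by ring,
        Complex.exp_add]
      ring
    · exact (hp.mul_continuousOn (by fun_prop)).add ((hxp.mul_continuousOn (by fun_prop)).const_mul _)
    · exact hp.mul_continuousOn (by fun_prop)
    · exact hp.mul_continuousOn (by fun_prop)
    · exact (hxp.mul_continuousOn (by fun_prop)).const_mul _
  have e2 : ‖∫ x in (0 : ℝ)..1, p x * (Complex.exp (Complex.I * ζ n * x) *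
        (Complex.exp (Complex.I * w n * x) - 1 - Complex.I * w n * x))‖ ≤ ‖w n‖ ^ 2 * N := by
    refine norm_integral_mul_le hp (by simp) fun x hx => ?_
    have n1 := norm_exp_I_mul_mul_le (ζ n) hx
    rw [hm] at n1
    have n3 : ‖Complex.I * w n * x‖ ≤ ‖w n‖ := by
      rw [norm_mul, norm_mul, Complex.norm_I, one_mul, Complex.norm_real, Real.norm_of_nonneg hx.1]
      exact mul_le_of_le_one_right (norm_nonneg _) hx.2
    have n2 := Complex.norm_exp_sub_one_sub_id_le (n3.trans hw1)
    rw [norm_mul]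
    calc _ ≤ 1 * ‖Complex.I * w n * x‖ ^ 2 := by gcongr
      _ ≤ ‖w n‖ ^ 2 := by rw [one_mul]; gcongr
  rw [e1]
  refine (norm_add_le _ _).trans ((add_le_add (norm_add_le _ _) e2).trans ?_)
  rw [norm_mul, norm_mul, Complex.norm_I, one_mul]
  have h3 : ‖w n‖ * ‖expIntegral (fun x : ℝ => p x * x) (ζ n)‖ ≤ ‖w n‖ * (ε / 2) := by gcongr
  nlinarith [norm_nonneg (w n)]

/-! ### Square summable sequences -/

lemma memlp_two_iff {E : Type*} [NormedAddCommGroup E] {f : ℕ → E} :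
    Memℓp f 2 ↔ Summable fun n => ‖f n‖ ^ 2 := by
  rw [memℓp_gen_iff (by norm_num)]
  norm_num

lemma memlp_two_of_eventually_le {E : Type*} [NormedAddCommGroup E] {f : ℕ → E} {g : ℕ → ℝ}
    (hg : Memℓp g 2) (h : ∀ᶠ n in atTop, ‖f n‖ ≤ g n) : Memℓp f 2 := by
  rw [memlp_two_iff] at hg ⊢
  refine summable_of_isBigO_nat hg (IsBigO.of_bound 1 ?_)
  filter_upwards [h] with n hn
  rw [one_mul, norm_pow, norm_pow, norm_norm, norm_norm]
  exact pow_le_pow_left₀ (norm_nonneg _) (hn.trans (le_abs_self _)) 2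

lemma memlp_two_log_div : Memℓp (fun n : ℕ => Real.log n / n) 2 := by
  rw [memlp_two_iff]
  have h1 : Summable fun n : ℕ => ((n : ℝ) ^ (-(3 / 4) : ℝ)) ^ 2 := by
    have := Real.summable_nat_rpow.2 (by norm_num : (-(3 / 2) : ℝ) < -1)
    refine this.congr fun n => ?_
    rw [← Real.rpow_natCast, ← Real.rpow_mul (Nat.cast_nonneg n)]
    norm_num
  refine summable_of_isBigO_nat h1 ?_
  have h2 : (fun n : ℕ => Real.log n / n) =O[atTop] fun n : ℕ => (n : ℝ) ^ (-(3 / 4) : ℝ) := by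
    have h3 := ((isLittleO_log_rpow_atTop (r := 1 / 4) (by norm_num)).comp_tendsto
      tendsto_natCast_atTop_atTop).isBigO.mul
      (isBigO_refl (fun n : ℕ => (n : ℝ)⁻¹) atTop)
    refine (h3.congr' ?_ ?_)
    · exact Eventually.of_forall fun n => by simp [div_eq_mul_inv]
    · filter_upwards [eventually_gt_atTop 0] with n hn
      have hn' : (0 : ℝ) < n := by exact_mod_cast hn
      simp only [Function.comp]
      rw [← Real.rpow_neg_one, ← Real.rpow_add hn']
      norm_num
  exact (h2.norm_left.pow 2)

lemma memlp_two_one_div : Memℓp (fun n : ℕ => 1 / (n : ℝ)) 2 := by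
  rw [memlp_two_iff]
  refine (Real.summable_one_div_nat_pow.2 one_lt_two).congr fun n => ?_
  rw [norm_div, norm_one, div_pow, one_pow, Real.norm_natCast]

lemma memlp_two_expIntegral_leadApprox {p : ℝ → ℂ}
    (hp : MemLp p 2 (volume.restrict (Set.Icc (0 : ℝ) 1))) {c : ℝ} (hc : c ≠ 0) :
    Memℓp (fun n => expIntegral (fun x => p (1 - x)) (leadApprox c n)) 2 := by
  rw [memlp_two_iff]
  simpa only [expIntegral_reflect] using summable_sq_norm_integral_leadApprox hp hc

lemma memlp_two_expIntegral_pi_mul {p : ℝ → ℂ}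
    (hp : MemLp p 2 (volume.restrict (Set.Icc (0 : ℝ) 1))) :
    Memℓp (fun n : ℕ => expIntegral p ((Real.pi * n : ℝ) : ℂ)) 2 ∧
      Memℓp (fun n : ℕ => expIntegral p (-((Real.pi * n : ℝ) : ℂ))) 2 := by
  have h := summable_sq_norm_integral_mul_exp hp
  constructor
  · rw [memlp_two_iff]
    refine (h.comp_injective (i := fun n : ℕ => (n : ℤ)) Nat.cast_injective).congr fun n => ?_
    simp only [Function.comp, expIntegral]
    push_cast
    simp only [mul_assoc]
  · rw [memlp_two_iff]
    refine (h.comp_injective (i := fun n : ℕ => -(n : ℤ))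
      (neg_injective.comp Nat.cast_injective)).congr fun n => ?_
    simp only [Function.comp, expIntegral]
    push_cast
    simp only [mul_assoc, mul_neg, neg_mul]

/-! ### The characteristic function as a perturbed sine -/

lemma exists_of_eventually_cobounded {P : ℂ → Prop} (h : ∀ᶠ z in Bornology.cobounded ℂ, P z) :
    ∃ K : ℝ, 1 ≤ K ∧ ∀ z, K ≤ ‖z‖ → P z := by
  rw [← comap_norm_atTop, eventually_comap, eventually_atTop] at h
  obtain ⟨K, hK⟩ := h
  exact ⟨max 1 K, le_max_left _ _, fun z hz => hK ‖z‖ ((le_max_right _ _).trans hz) z rfl⟩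

lemma exists_of_isBigO_cobounded {f : ℂ → ℂ} {b : ℂ → ℝ} (hb : ∀ z, 0 ≤ b z)
    (h : f =O[Bornology.cobounded ℂ] b) :
    ∃ A K : ℝ, 0 ≤ A ∧ 1 ≤ K ∧ ∀ z, K ≤ ‖z‖ → ‖f z‖ ≤ A * b z := by
  obtain ⟨A, hA, h⟩ := h.exists_nonneg
  obtain ⟨K, hK, h⟩ := exists_of_eventually_cobounded h.bound
  exact ⟨A, K, hA, hK, fun z hz => by simpa [abs_of_nonneg (hb z)] using h z hz⟩

/-- The one-sided derivative at the endpoints is included: `p` is extended continuously to the real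
line. -/
lemma dq_eq {q p : ℝ → ℝ} (hp : ContinuousOn p (Set.Icc 0 1))
    (hq : ∀ x ∈ Set.Icc (0 : ℝ) 1, q x = q 0 + ∫ t in (0 : ℝ)..x, p t) {x : ℝ}
    (hx : x ∈ Set.Icc (0 : ℝ) 1) : dq q x = p x := by
  set P : ℝ → ℝ := Set.IccExtend zero_le_one ((Set.Icc (0 : ℝ) 1).domRestrict p) with hP
  have hPc : Continuous P := (continuousOn_iff_continuous_domRestrict.1 hp).Icc_extend'
  have hPe : ∀ t ∈ Set.Icc (0 : ℝ) 1, P t = p t := fun t ht => by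
    rw [hP, Set.IccExtend_of_mem _ _ ht]; rfl
  have h1 : HasDerivAt (fun y => q 0 + ∫ t in (0 : ℝ)..y, P t) (P x) x :=
    (intervalIntegral.integral_hasDerivAt_right (hPc.intervalIntegrable _ _)
      (hPc.stronglyMeasurableAtFilter _ _) hPc.continuousAt).const_add (q 0)
  have hqe : ∀ y ∈ Set.Icc (0 : ℝ) 1, q y = q 0 + ∫ t in (0 : ℝ)..y, P t := fun y hy => by
    rw [hq y hy]
    congr 1
    refine intervalIntegral.integral_congr fun t ht => ?_
    rw [Set.uIcc_of_le hy.1] at ht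
    exact (hPe t ⟨ht.1, ht.2.trans hy.2⟩).symm
  rw [dq, ← hPe x hx]
  exact ((h1.hasDerivWithinAt (s := Set.Icc 0 1)).congr hqe (hqe x hx)).derivWithin
    (uniqueDiffOn_Icc zero_lt_one x hx)

/-- The deviation of the normalised characteristic function from `sin z - c z`, where `c = -ω / q(1)`. -/
noncomputable def sinError (q : ℝ → ℝ) (h : ℝ) (z : ℂ) : ℂ :=
  z * (2 / q 1 * charDelta q h (z ^ 2 / 4)) - (Complex.sin z - ((-(omega q / q 1) : ℝ) : ℂ) * z)

lemma norm_integral_mul_sin_le {p : ℝ → ℂ} (hp : IntervalIntegrable p volume 0 1) (z : ℂ) :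
    ‖∫ x in (0 : ℝ)..1, p x * Complex.sin (z * x)‖ ≤ ‖expIntegral p (-z)‖ + ‖expIntegral p z‖ := by
  rw [integral_mul_sin_eq hp, norm_mul]
  have h1 := norm_sub_le (expIntegral p (-z)) (expIntegral p z)
  have h2 : ‖Complex.I / 2‖ = 1 / 2 := by simp
  rw [h2]
  linarith [norm_nonneg (expIntegral p (-z)), norm_nonneg (expIntegral p z)]

lemma norm_integral_mul_cos_le {p : ℝ → ℂ} (hp : IntervalIntegrable p volume 0 1) (z : ℂ) :
    ‖∫ x in (0 : ℝ)..1, p x * Complex.cos (z * x)‖ ≤ ‖expIntegral p (-z)‖ + ‖expIntegral p z‖ := by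
  rw [integral_mul_cos_eq hp, norm_mul]
  have h1 := norm_add_le (expIntegral p (-z)) (expIntegral p z)
  have h2 : ‖(1 / 2 : ℂ)‖ = 1 / 2 := by simp
  rw [h2]
  linarith [norm_nonneg (expIntegral p (-z)), norm_nonneg (expIntegral p z)]

/-- The function `p` is the derivative of `q`. -/
lemma SobolevOne.exists_norm_sinError_le {q : ℝ → ℝ} (hq : SobolevOne q) (hq1 : q 1 ≠ 0) (h : ℝ) :
    ∃ p : ℝ → ℂ, MemLp p 2 (volume.restrict (Set.Icc (0 : ℝ) 1)) ∧ ∃ A K : ℝ, 0 ≤ A ∧ 1 ≤ K ∧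
      ∀ z : ℂ, K ≤ ‖z‖ → ‖sinError q h z‖ ≤
        A * (‖expIntegral p (-z)‖ + ‖expIntegral p z‖ + Real.exp |z.im| / ‖z‖) := by
  obtain ⟨p, hp, hqp⟩ := hq.exists_primitive
  have hpi := intervalIntegrable_of_memLp hp
  have hq1' : (q 1 : ℂ) ≠ 0 := by exact_mod_cast hq1
  obtain ⟨A, K, hA, hK, H⟩ := exists_of_isBigO_cobounded (fun z => (Real.exp_pos _).le)
    (isBigO_charDelta hq.continuousOn h hpi hqp)
  refine ⟨p, hp, (1 + 2 * A) / |q 1|, K, by positivity, hK, fun z hz => ?_⟩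
  have hz0 : 0 < ‖z‖ := by linarith
  have hz0' : z ≠ 0 := norm_pos_iff.1 hz0
  have e1 : sinError q h z = (2 / z * (z ^ 2 * charDelta q h (z ^ 2 / 4) - (z ^ 2 * omega q / 2 +
      q 1 * (z / 2) * Complex.sin z - z / 2 * ∫ t in (0 : ℝ)..1, p t * Complex.sin (z * t))) -
      ∫ t in (0 : ℝ)..1, p t * Complex.sin (z * t)) / q 1 := by
    rw [sinError]
    push_cast
    field_simp
    ring
  have h1 := H z hz
  have h2 := norm_integral_mul_sin_le hpi z
  rw [e1, norm_div, Complex.norm_real, Real.norm_eq_abs,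
    div_mul_eq_mul_div (1 + 2 * A)]
  gcongr
  refine (norm_sub_le _ _).trans ?_
  rw [norm_mul, norm_div, Complex.norm_ofNat]
  have h3 : 2 / ‖z‖ * ‖z ^ 2 * charDelta q h (z ^ 2 / 4) - (z ^ 2 * omega q / 2 +
      q 1 * (z / 2) * Complex.sin z - z / 2 * ∫ t in (0 : ℝ)..1, p t * Complex.sin (z * t))‖ ≤
      2 / ‖z‖ * (A * Real.exp |z.im|) := by gcongr
  have h4 : 2 / ‖z‖ * (A * Real.exp |z.im|) = 2 * A * (Real.exp |z.im| / ‖z‖) := by ring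
  have h5 : 0 ≤ Real.exp |z.im| / ‖z‖ := by positivity
  nlinarith [norm_nonneg (expIntegral p (-z)), norm_nonneg (expIntegral p z)]

/-- With two derivatives the error has a leading term of order `exp |Im z| / z`. Only the
coefficient `Q₁` of `cos z` is needed in general; the constant `K₀` matters, and is identified, for
`ω = 0`. -/
lemma SobolevTwo.exists_norm_sinError_sub_le {q : ℝ → ℝ} (hq : SobolevTwo q)
    (hqc : ContinuousOn q (Set.Icc 0 1)) (hq1 : q 1 ≠ 0) (h : ℝ) :
    ∃ (ρ : ℝ → ℂ) (K₀ : ℂ), MemLp ρ 2 (volume.restrict (Set.Icc (0 : ℝ) 1)) ∧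
      (omega q = 0 → K₀ = 1 / 2 * Q₂ q h) ∧ ∃ A K : ℝ, 0 ≤ A ∧ 1 ≤ K ∧
      ∀ z : ℂ, K ≤ ‖z‖ → ‖sinError q h z - 2 / (q 1 * z) * (1 / 2 * Q₁ q h * Complex.cos z + K₀)‖ ≤
        A * (‖expIntegral ρ (-z)‖ + ‖expIntegral ρ z‖ + Real.exp |z.im| / ‖z‖) / ‖z‖ := by
  obtain ⟨p, hp, hqp⟩ := hq
  have hpc := hp.continuousOn
  have hd1 := dq_eq hpc hqp (x := 1) (by simp)
  have hd0 := dq_eq hpc hqp (x := 0) (by simp)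
  obtain ⟨r, hr, hpr⟩ := hp.exists_primitive
  have hqp' : ∀ x ∈ Set.Icc (0 : ℝ) 1, (q x : ℂ) = q 0 + ∫ t in (0 : ℝ)..x, (p t : ℂ) := fun x hx => by
    rw [hqp x hx, intervalIntegral.integral_ofReal]; push_cast; rfl
  have hq1' : (q 1 : ℂ) ≠ 0 := by exact_mod_cast hq1
  obtain ⟨ρ, K₀, hρ, hK₀, hO⟩ := isBigO_charDelta_sub hqc h hr hpr hqp'
  have hρi := intervalIntegrable_of_memLp hρ
  obtain ⟨A, K, hA, hK, H⟩ := exists_of_isBigO_cobounded (fun z => by positivity) hO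
  refine ⟨ρ, K₀, hρ, fun hω => ?_, 2 * (1 + A) / |q 1|, K, by positivity, hK, fun z hz => ?_⟩
  · rw [hK₀ hω, Q₂, hω, hd0]
    have : ∫ t in (0 : ℝ)..1, (q t : ℂ) ^ 2 = ((∫ t in (0 : ℝ)..1, q t ^ 2 : ℝ) : ℂ) := by
      rw [← intervalIntegral.integral_ofReal]; push_cast; rfl
    rw [this]
    push_cast
    ring
  have hz0 : 0 < ‖z‖ := by linarith
  have hz0' : z ≠ 0 := norm_pos_iff.1 hz0
  have e1 : sinError q h z - 2 / (q 1 * z) * (1 / 2 * Q₁ q h * Complex.cos z + K₀) =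
      2 / q 1 * ((z ^ 2 * charDelta q h (z ^ 2 / 4) - (z ^ 2 * omega q / 2 +
        q 1 * (z / 2) * Complex.sin z +
        1 / 2 * (p 1 - q 1 * omega q - 4 * h * q 1) * Complex.cos z + K₀ +
        ∫ t in (0 : ℝ)..1, ρ t * Complex.cos (z * t))) +
        ∫ t in (0 : ℝ)..1, ρ t * Complex.cos (z * t)) / z := by
    rw [sinError, Q₁, hd1]
    push_cast
    field_simp
    ring
  have h1 := H z hz
  have h2 := norm_integral_mul_cos_le hρi z
  rw [e1, norm_div, norm_mul, norm_div, Complex.norm_ofNat, Complex.norm_real, Real.norm_eq_abs,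
    mul_div_right_comm 2 (1 + A), mul_assoc (2 / |q 1|)]
  gcongr
  refine (norm_add_le _ _).trans ((add_le_add h1 h2).trans ?_)
  have h5 : 0 ≤ Real.exp |z.im| / ‖z‖ := by positivity
  nlinarith [norm_nonneg (expIntegral ρ (-z)), norm_nonneg (expIntegral ρ z),
    mul_nonneg hA (norm_nonneg (expIntegral ρ (-z))), mul_nonneg hA (norm_nonneg (expIntegral ρ z))]

lemma max_one_exp_le (x : ℝ) : max 1 (Real.exp x) ≤ Real.exp |x| :=
  max_le (Real.one_le_exp (abs_nonneg x)) (Real.exp_le_exp.2 (le_abs_self x))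

/-- The normalised characteristic function has the leading term `sin z - c z`. -/
lemma SobolevOne.sinAsymptotics {q : ℝ → ℝ} (hq : SobolevOne q) (hq1 : q 1 ≠ 0) (h : ℝ) :
    SinAsymptotics (fun l => 2 / q 1 * charDelta q h l) (-(omega q / q 1)) := by
  obtain ⟨p, hp, A, K, hA, hK, H⟩ := hq.exists_norm_sinError_le hq1 h
  have hpi := intervalIntegrable_of_memLp hp
  intro ε hε
  have hδ : 0 < ε / (3 * (A + 1)) := by positivity
  obtain ⟨K₁, hK₁, H₁⟩ := exists_of_eventually_cobounded ((isLittleO_expIntegral hpi).bound hδ)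
  refine ⟨max (max K K₁) (3 * (A + 1) / ε), fun z hz => ?_⟩
  have hzK := (le_max_left _ _).trans ((le_max_left _ _).trans hz)
  have hzK₁ := (le_max_right _ _).trans ((le_max_left _ _).trans hz)
  have hz3 := (le_max_right _ _).trans hz
  have hz0 : 0 < ‖z‖ := by linarith
  set M := Real.exp |z.im| with hM
  have hM0 : 0 < M := Real.exp_pos _
  have h1 : ‖expIntegral p z‖ ≤ ε / (3 * (A + 1)) * M := by
    refine (H₁ z hzK₁).trans ?_
    rw [Real.norm_of_nonneg (by positivity)]
    gcongr
    simpa [hM] using max_one_exp_le (-z.im)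
  have h2 : ‖expIntegral p (-z)‖ ≤ ε / (3 * (A + 1)) * M := by
    refine (H₁ (-z) (by rwa [norm_neg])).trans ?_
    rw [Real.norm_of_nonneg (by positivity)]
    gcongr
    simpa [hM] using max_one_exp_le (z.im)
  have h3 : M / ‖z‖ ≤ ε / (3 * (A + 1)) * M := by
    rw [div_le_iff₀ hz0]
    have h4 : 1 ≤ ε / (3 * (A + 1)) * ‖z‖ := by
      rw [div_le_iff₀ hε] at hz3
      rw [div_mul_eq_mul_div, le_div_iff₀ (by positivity)]
      linarith
    nlinarith
  have h5 := H z hzK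
  rw [sinError] at h5
  refine h5.trans ?_
  calc A * (‖expIntegral p (-z)‖ + ‖expIntegral p z‖ + M / ‖z‖)
      ≤ A * (3 * (ε / (3 * (A + 1)) * M)) := by gcongr; linarith
    _ ≤ (A + 1) * (3 * (ε / (3 * (A + 1)) * M)) := by gcongr; linarith
    _ = ε * M := by field_simp

/-! ### Zeros of a perturbation of `sin z - c z` -/

/-- The numbers `leadApprox c n + w n` are, for large `n`, solutions of `sin z - c z + e n = 0` with
small corrections `w n`. -/
def SolvesSin (c : ℝ) (e w : ℕ → ℂ) : Prop :=
  ∀ᶠ n : ℕ in atTop, ‖w n‖ ≤ 1 / 4 ∧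
    Complex.sin (leadApprox c n + w n) - c * (leadApprox c n + w n) + e n = 0

/-- The equation, solved for the growing exponential `exp (-I z)` and divided by its value at
`leadApprox c n`. -/
lemma exp_eq_of_sin_eq {c : ℝ} (hc : c ≠ 0) {n : ℕ} (hn : n ≠ 0) {e w : ℂ}
    (h : Complex.sin (leadApprox c n + w) - c * (leadApprox c n + w) + e = 0) :
    Complex.exp (-(Complex.I * w)) = (leadApprox c n + w) / (2 * Real.pi * n) +
      (Complex.I / 2 * Complex.exp (Complex.I * (leadApprox c n + w)) - e) / (2 * Real.pi * n * c) := by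
  have h1 := half_I_mul_exp_leadApprox_add hc hn w
  rw [sin_eq_exp] at h
  have hc' : (c : ℂ) ≠ 0 := by exact_mod_cast hc
  have hn' : (n : ℂ) ≠ 0 := by exact_mod_cast hn
  have hpi : (Real.pi : ℂ) ≠ 0 := by exact_mod_cast Real.pi_ne_zero
  field_simp
  linear_combination 2 * h - 2 * h1

lemma norm_exp_I_mul_leadApprox_add {c : ℝ} (hc : c ≠ 0) {n : ℕ} (hn : n ≠ 0) {w : ℂ}
    (hw : ‖w‖ ≤ 1 / 4) :
    ‖Complex.exp (Complex.I * (leadApprox c n + w))‖ ≤ 2 / (4 * Real.pi * n * |c|) ∧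
      Real.exp (leadApprox c n + w).im ≤ 2 * (4 * Real.pi * n * |c|) := by
  have h1 := exp_im_leadApprox hc hn
  have h2 := (abs_le.1 ((Complex.abs_im_le_norm w).trans hw))
  have hpos : 0 < 4 * Real.pi * n * |c| := h1 ▸ Real.exp_pos _
  have h3 := exp_quarter_le_two
  constructor
  · rw [norm_exp_I_mul, Complex.add_im, neg_add, Real.exp_add, Real.exp_neg, h1, div_eq_inv_mul]
    gcongr
    exact (Real.exp_le_exp.2 (by linarith [h2.1])).trans h3
  · rw [Complex.add_im, Real.exp_add, h1, mul_comm]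
    gcongr
    exact (Real.exp_le_exp.2 (by linarith [h2.2])).trans h3

lemma eventually_one_le_log : ∀ᶠ n : ℕ in atTop, 1 ≤ Real.log n :=
  (Real.tendsto_log_atTop.comp tendsto_natCast_atTop_atTop).eventually_ge_atTop 1

lemma norm_le_of_exp_sub_one {w : ℂ} (hw : ‖w‖ ≤ 1 / 2) :
    ‖w‖ ≤ 2 * ‖Complex.exp w - 1‖ := by
  have := norm_exp_sub_one_ge (hw.trans (by norm_num))
  nlinarith [norm_nonneg w]

lemma norm_exp_sub_one_le_two_mul {w : ℂ} (hw : ‖w‖ ≤ 1) : ‖Complex.exp w - 1‖ ≤ 2 * ‖w‖ :=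
  Complex.norm_exp_sub_one_le hw

lemma norm_leadApprox_sub_le {c : ℝ} (hc : c ≠ 0) :
    ∃ C : ℝ, 0 ≤ C ∧ ∀ᶠ n : ℕ in atTop, ‖leadApprox c n - 2 * Real.pi * n‖ ≤ C * Real.log n := by
  have hA : 0 < 4 * Real.pi * |c| := by have := Real.pi_pos; have := abs_pos.2 hc; positivity
  refine ⟨|Real.log (4 * Real.pi * |c|)| + 6, by positivity, ?_⟩
  filter_upwards [eventually_one_le_log, eventually_gt_atTop 0] with n hl hn
  have hn' : (0 : ℝ) < n := by exact_mod_cast hn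
  have h1 : leadApprox c n - 2 * Real.pi * n = (leadShift c : ℂ) +
      Complex.I * ((Real.log (4 * Real.pi * |c|) + Real.log n : ℝ) : ℂ) := by
    rw [← Real.log_mul hA.ne' hn'.ne', mul_right_comm (4 * Real.pi) |c| (n : ℝ), leadApprox]
    push_cast; ring
  rw [h1]
  refine (norm_add_le _ _).trans ?_
  rw [norm_mul, Complex.norm_I, one_mul, Complex.norm_real, Complex.norm_real, Real.norm_eq_abs,
    Real.norm_eq_abs, abs_of_nonneg (by linarith [(leadShift_bounds c).1])]
  have h2 := (leadShift_bounds c).2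
  have h3 := abs_add_le (Real.log (4 * Real.pi * |c|)) (Real.log n)
  rw [abs_of_nonneg (by linarith : (0 : ℝ) ≤ Real.log n)] at h3
  nlinarith [abs_nonneg (Real.log (4 * Real.pi * |c|))]

/-- The size of the corrections. -/
lemma SolvesSin.exists_norm_le {c : ℝ} (hc : c ≠ 0) :
    ∃ C : ℝ, 0 ≤ C ∧ ∀ e w : ℕ → ℂ, SolvesSin c e w →
      ∀ᶠ n : ℕ in atTop, ‖w n‖ ≤ C * (Real.log n / n + ‖e n‖ / n) := by
  obtain ⟨C, hC, hL⟩ := norm_leadApprox_sub_le hc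
  have hc0 : 0 < |c| := abs_pos.2 hc
  refine ⟨2 * (C + 1 + 1 / |c|), by positivity, fun e w H => ?_⟩
  filter_upwards [H, hL, eventually_one_le_log, eventually_gt_atTop 0,
    eventually_ge_atTop (⌈1 / |c|⌉₊)] with n hw hL hl hn hnc
  have hn0 : n ≠ 0 := hn.ne'
  have hn' : (0 : ℝ) < n := by exact_mod_cast hn
  have hn1 : (1 : ℝ) ≤ n := by exact_mod_cast hn
  have hpi := Real.pi_gt_three
  have h1 := exp_eq_of_sin_eq hc hn0 hw.2
  have h2 := (norm_exp_I_mul_leadApprox_add hc hn0 hw.1).1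
  have hcn : 1 ≤ |c| * n := by
    have := (Nat.le_ceil (1 / |c|)).trans (by exact_mod_cast hnc : ((⌈1 / |c|⌉₊ : ℕ) : ℝ) ≤ n)
    rwa [div_le_iff₀' hc0] at this
  have h2' : ‖Complex.exp (Complex.I * (leadApprox c n + w n))‖ ≤ 1 := by
    refine h2.trans ?_
    rw [div_le_one (by positivity)]
    nlinarith
  have hn2 : (n : ℂ) ≠ 0 := by exact_mod_cast hn0
  have hpi' : (Real.pi : ℂ) ≠ 0 := by exact_mod_cast Real.pi_ne_zero
  have hnorm2 : ‖(2 * Real.pi * n : ℂ)‖ = 2 * Real.pi * n := by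
    rw [norm_mul, norm_mul, Complex.norm_ofNat, Complex.norm_real, Complex.norm_natCast,
      Real.norm_of_nonneg (by linarith)]
  have e1 : Complex.exp (-(Complex.I * w n)) - 1 =
      ((leadApprox c n - 2 * Real.pi * n) + w n) / (2 * Real.pi * n) +
      (Complex.I / 2 * Complex.exp (Complex.I * (leadApprox c n + w n)) - e n) /
        (2 * Real.pi * n * c) := by
    rw [h1]; field_simp; ring
  have n1 : ‖((leadApprox c n - 2 * Real.pi * n) + w n) / (2 * Real.pi * n)‖ ≤
      (C + 1) * (Real.log n / n) := by
    rw [norm_div, hnorm2, ← mul_div_assoc]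
    have := norm_add_le (leadApprox c n - 2 * Real.pi * n) (w n)
    gcongr
    · linarith [hw.1]
    · nlinarith
  have n2 : ‖(Complex.I / 2 * Complex.exp (Complex.I * (leadApprox c n + w n)) - e n) /
        (2 * Real.pi * n * c)‖ ≤ 1 / |c| * (Real.log n / n + ‖e n‖ / n) := by
    rw [norm_div, norm_mul, hnorm2, Complex.norm_real, Real.norm_eq_abs, ← add_div, div_mul_div_comm,
      one_mul]
    have h3 := norm_sub_le (Complex.I / 2 * Complex.exp (Complex.I * (leadApprox c n + w n))) (e n)
    have h4 : ‖Complex.I / 2 * Complex.exp (Complex.I * (leadApprox c n + w n))‖ ≤ 1 := by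
      rw [norm_mul]; simp only [norm_div, Complex.norm_I, Complex.norm_ofNat]; linarith
    have h5 : |c| * n ≤ 2 * Real.pi * n * |c| := by nlinarith [mul_pos hc0 hn']
    gcongr
    linarith
  have n3 : ‖w n‖ ≤ 2 * ‖Complex.exp (-(Complex.I * w n)) - 1‖ := by
    have := norm_le_of_exp_sub_one (w := -(Complex.I * w n)) (by
      rw [norm_neg, norm_mul, Complex.norm_I]; linarith [hw.1])
    rwa [norm_neg, norm_mul, Complex.norm_I, one_mul] at this
  have n4 := norm_add_le (((leadApprox c n - 2 * Real.pi * n) + w n) / (2 * Real.pi * n))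
    ((Complex.I / 2 * Complex.exp (Complex.I * (leadApprox c n + w n)) - e n) /
        (2 * Real.pi * n * c))
  rw [← e1] at n4
  have n5 : 0 ≤ (C + 1) * (‖e n‖ / n) := by positivity
  calc ‖w n‖ ≤ 2 * ((C + 1) * (Real.log n / n) + 1 / |c| * (Real.log n / n + ‖e n‖ / n)) := by linarith
    _ ≤ 2 * ((C + 1) * (Real.log n / n) + (C + 1) * (‖e n‖ / n) +
        1 / |c| * (Real.log n / n + ‖e n‖ / n)) := by linarith
    _ = _ := by ring

set_option maxHeartbeats 1000000 in
/-- The influence of the perturbation on the corrections, with its leading term: the two equations of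
`exp_eq_of_sin_eq` are subtracted. -/
lemma SolvesSin.exists_norm_sub_le {c : ℝ} (hc : c ≠ 0) :
    ∃ C : ℝ, 0 ≤ C ∧ ∀ e w w' : ℕ → ℂ, SolvesSin c e w → SolvesSin c 0 w' →
      ∀ᶠ n : ℕ in atTop, ‖w n - w' n‖ ≤ C * (‖e n‖ / n) ∧
        ‖w n - w' n + Complex.I * e n / (2 * Real.pi * n * c)‖ ≤
          C * (‖w n - w' n‖ * (‖w n - w' n‖ + ‖w' n‖ + 1 / n)) := by
  have hc0 : 0 < |c| := abs_pos.2 hc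
  refine ⟨4 + 8 / |c|, by positivity, fun e w w' H H' => ?_⟩
  filter_upwards [H, H', eventually_gt_atTop 0, eventually_ge_atTop (⌈1 / |c|⌉₊),
    eventually_ge_atTop 4] with n hw hw' hn hnc hn4
  have hn0 : n ≠ 0 := hn.ne'
  have hn' : (0 : ℝ) < n := by exact_mod_cast hn
  have hn4' : (4 : ℝ) ≤ n := by exact_mod_cast hn4
  have hpi := Real.pi_gt_three
  have h1 := exp_eq_of_sin_eq hc hn0 hw.2
  have h1' := exp_eq_of_sin_eq hc hn0 hw'.2
  have hcn : 1 ≤ |c| * n := by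
    have := (Nat.le_ceil (1 / |c|)).trans (by exact_mod_cast hnc : ((⌈1 / |c|⌉₊ : ℕ) : ℝ) ≤ n)
    rwa [div_le_iff₀' hc0] at this
  have h2' : ‖Complex.exp (Complex.I * (leadApprox c n + w' n))‖ ≤ 1 := by
    refine (norm_exp_I_mul_leadApprox_add hc hn0 hw'.1).1.trans ?_
    rw [div_le_one (by positivity)]
    nlinarith
  have hn2 : (n : ℂ) ≠ 0 := by exact_mod_cast hn0
  have hc2 : (c : ℂ) ≠ 0 := by exact_mod_cast hc
  have hpi' : (Real.pi : ℂ) ≠ 0 := by exact_mod_cast Real.pi_ne_zero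
  have hnorm2 : ‖(2 * Real.pi * n : ℂ)‖ = 2 * Real.pi * n := by
    rw [norm_mul, norm_mul, Complex.norm_ofNat, Complex.norm_real, Complex.norm_natCast,
      Real.norm_of_nonneg (by linarith)]
  set d := w n - w' n with hd
  have hdn : ‖d‖ ≤ 1 / 2 := (norm_sub_le _ _).trans (by linarith [hw.1, hw'.1])
  have hId : ‖-(Complex.I * d)‖ = ‖d‖ := by rw [norm_neg, norm_mul, Complex.norm_I, one_mul]
  have hId' : ‖Complex.I * d‖ = ‖d‖ := by rw [norm_mul, Complex.norm_I, one_mul]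
  have hwd : w n = w' n + d := by rw [hd]; ring
  set X := Complex.exp (-(Complex.I * w' n)) with hX
  set Y := Complex.exp (Complex.I * (leadApprox c n + w' n)) with hY
  have e1 : Complex.exp (-(Complex.I * w n)) = X * Complex.exp (-(Complex.I * d)) := by
    rw [hX, ← Complex.exp_add, hwd]; congr 1; ring
  have e2 : Complex.exp (Complex.I * (leadApprox c n + w n)) = Y * Complex.exp (Complex.I * d) := by
    rw [hY, ← Complex.exp_add, hwd]; congr 1; ring
  rw [e1, e2] at h1
  -- the difference of the two equations
  have e3 : X * (Complex.exp (-(Complex.I * d)) - 1) = d / (2 * Real.pi * n) +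
      Complex.I / 2 * Y * (Complex.exp (Complex.I * d) - 1) / (2 * Real.pi * n * c) -
      e n / (2 * Real.pi * n * c) := by
    rw [mul_sub, h1, mul_one, h1', hwd]
    simp only [Pi.zero_apply]
    field_simp
    ring
  have hX1 : ‖X - 1‖ ≤ 2 * ‖w' n‖ := by
    have := norm_exp_sub_one_le_two_mul (w := -(Complex.I * w' n)) (by
      rw [norm_neg, norm_mul, Complex.norm_I]; linarith [hw'.1])
    rwa [norm_neg, norm_mul, Complex.norm_I, one_mul] at this
  have hXge : 1 / 2 ≤ ‖X‖ := by
    have := norm_sub_norm_le 1 (1 - X)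
    rw [sub_sub_cancel, norm_one, norm_sub_rev] at this
    linarith [hw'.1]
  have hE1 := norm_le_of_exp_sub_one (w := -(Complex.I * d)) (by rw [hId]; exact hdn)
  have hE2 := norm_exp_sub_one_le_two_mul (w := -(Complex.I * d)) (by rw [hId]; linarith)
  have hE3 := norm_exp_sub_one_le_two_mul (w := Complex.I * d) (by rw [hId']; linarith)
  rw [hId] at hE1 hE2
  rw [hId'] at hE3
  have hsmall : ‖d / (2 * Real.pi * n) +
      Complex.I / 2 * Y * (Complex.exp (Complex.I * d) - 1) / (2 * Real.pi * n * c)‖ ≤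
      ‖d‖ * ((1 / 6 + 1 / (6 * |c|)) / n) := by
    refine (norm_add_le _ _).trans ?_
    have g1 : ‖d / (2 * Real.pi * n)‖ ≤ ‖d‖ / (6 * n) := by
      rw [norm_div, hnorm2]
      gcongr
      linarith
    have g2 : ‖Complex.I / 2 * Y * (Complex.exp (Complex.I * d) - 1) / (2 * Real.pi * n * c)‖ ≤
        ‖d‖ / (6 * n * |c|) := by
      rw [norm_div, norm_mul, norm_mul _ (c : ℂ), hnorm2, Complex.norm_real, Real.norm_eq_abs]
      have g3 : ‖Complex.I / 2 * Y‖ ≤ 1 / 2 := by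
        rw [norm_mul]; simp only [norm_div, Complex.norm_I, Complex.norm_ofNat]; linarith
      have g4 : ‖Complex.I / 2 * Y‖ * ‖Complex.exp (Complex.I * d) - 1‖ ≤ 1 / 2 * (2 * ‖d‖) := by
        gcongr
      have g5 : 6 * n * |c| ≤ 2 * Real.pi * n * |c| := by gcongr; linarith
      gcongr
      linarith
    refine (add_le_add g1 g2).trans (le_of_eq ?_)
    field_simp
  have hen : ‖e n / (2 * Real.pi * n * c)‖ ≤ ‖e n‖ / n * (1 / (6 * |c|)) := by
    rw [norm_div, norm_mul _ (c : ℂ), hnorm2, Complex.norm_real, Real.norm_eq_abs]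
    calc ‖e n‖ / (2 * Real.pi * n * |c|) ≤ ‖e n‖ / (6 * n * |c|) := by gcongr; linarith
      _ = _ := by field_simp
  have hdn0 := norm_nonneg d
  have hkey : (1 / 6 + 1 / (6 * |c|)) / n ≤ (1 / 6 + n / 6) / n := by
    have : 1 / (6 * |c|) ≤ n / 6 := by
      rw [div_le_div_iff₀ (by positivity) (by positivity)]
      linarith
    exact div_le_div_of_nonneg_right (by linarith) hn'.le
  have hmain : ‖d‖ ≤ (4 + 8 / |c|) * (‖e n‖ / n) ∧
      (1 / 6 + 1 / (6 * |c|)) / n ≤ (1 / 6 + 1 / (6 * |c|)) * (1 / n) := by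
    refine ⟨?_, le_of_eq (by ring)⟩
    have g6 : ‖X * (Complex.exp (-(Complex.I * d)) - 1)‖ ≤
        ‖d‖ * ((1 / 6 + 1 / (6 * |c|)) / n) + ‖e n‖ / n * (1 / (6 * |c|)) := by
      rw [e3]
      exact (norm_sub_le _ _).trans (add_le_add hsmall hen)
    rw [norm_mul] at g6
    have g7 : 1 / 2 * (‖d‖ / 2) ≤ ‖X‖ * ‖Complex.exp (-(Complex.I * d)) - 1‖ := by
      gcongr
      linarith
    have g8 : (1 / 6 + n / 6) / n ≤ (5 / 24 : ℝ) := by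
      rw [div_le_iff₀ hn']; linarith
    have g9 : ‖d‖ * ((1 / 6 + 1 / (6 * |c|)) / n) ≤ ‖d‖ * (5 / 24) :=
      mul_le_mul_of_nonneg_left (hkey.trans g8) hdn0
    have g10 : (1 : ℝ) / (6 * |c|) = 1 / 6 * (1 / |c|) := by field_simp
    have g11 : (8 : ℝ) / |c| = 8 * (1 / |c|) := by ring
    rw [g10] at g6 g9
    rw [g11]
    have g12 : 0 ≤ ‖e n‖ / n := by positivity
    have g13 : 0 ≤ 1 / |c| := by positivity
    nlinarith [mul_nonneg g12 g13]
  refine ⟨hmain.1, ?_⟩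
  have e4 : d + Complex.I * e n / (2 * Real.pi * n * c) =
      Complex.I * ((d / (2 * Real.pi * n) +
      Complex.I / 2 * Y * (Complex.exp (Complex.I * d) - 1) / (2 * Real.pi * n * c)) -
      (X - 1) * (Complex.exp (-(Complex.I * d)) - 1) -
      (Complex.exp (-(Complex.I * d)) - 1 - -(Complex.I * d))) := by
    linear_combination Complex.I * e3 + d * Complex.I_mul_I
  have hE4 := Complex.norm_exp_sub_one_sub_id_le (x := -(Complex.I * d)) (by rw [hId]; linarith)
  rw [hId] at hE4
  rw [e4, norm_mul, Complex.norm_I, one_mul]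
  have g14 : ‖(X - 1) * (Complex.exp (-(Complex.I * d)) - 1)‖ ≤ 2 * ‖w' n‖ * (2 * ‖d‖) := by
    rw [norm_mul]; gcongr
  refine (norm_sub_le _ _).trans ((add_le_add ((norm_sub_le _ _).trans (add_le_add hsmall g14)) hE4).trans
    ?_)
  have g15 : 0 ≤ ‖d‖ * (‖d‖ + ‖w' n‖ + 1 / n) := by positivity
  have g16 : (1 / 6 + 1 / (6 * |c|)) * (1 / n) ≤ (4 + 8 / |c|) * (1 / n) := by
    have : 1 / (6 * |c|) ≤ 8 / |c| := by
      rw [div_le_div_iff₀ (by positivity) hc0]; nlinarith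
    gcongr
    linarith
  have g17 := mul_le_mul_of_nonneg_left (hmain.2.trans g16) hdn0
  have g18 : 0 ≤ 8 / |c| := by positivity
  have g19 : 0 ≤ 8 / |c| * (‖d‖ * (‖d‖ + ‖w' n‖)) := by positivity
  nlinarith [norm_nonneg (w' n), mul_nonneg hdn0 (norm_nonneg (w' n)), sq_nonneg ‖d‖]

/-! ### Square summability for `ω ≠ 0` -/

lemma natCast_le_norm_leadApprox_add {c : ℝ} (n : ℕ) {w : ℂ} (hw : ‖w‖ ≤ 1 / 4) :
    (n : ℝ) ≤ ‖leadApprox c n + w‖ := by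
  refine le_trans ?_ ((le_abs_self _).trans (Complex.abs_re_le_norm _))
  rw [Complex.add_re, leadApprox_re]
  have h1 := (abs_le.1 ((Complex.abs_re_le_norm w).trans hw)).1
  have h2 := (leadShift_bounds c).1
  have h3 := Real.pi_gt_three
  have h4 : (0 : ℝ) ≤ n := n.cast_nonneg
  nlinarith

lemma eventually_le_norm_leadApprox_add {c : ℝ} {w : ℕ → ℂ} (hw : ∀ᶠ n in atTop, ‖w n‖ ≤ 1 / 4)
    (K : ℝ) : ∀ᶠ n : ℕ in atTop, K ≤ ‖leadApprox c n + w n‖ := by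
  filter_upwards [hw, eventually_ge_atTop ⌈K⌉₊] with n h hn
  exact ((Nat.le_ceil K).trans (by exact_mod_cast hn)).trans (natCast_le_norm_leadApprox_add n h)

lemma eventually_leadApprox_add_im_pos {c : ℝ} (hc : c ≠ 0) {w : ℕ → ℂ}
    (hw : ∀ᶠ n in atTop, ‖w n‖ ≤ 1 / 4) : ∀ᶠ n : ℕ in atTop, 0 < (leadApprox c n + w n).im := by
  filter_upwards [hw, (tendsto_leadApprox_im hc).eventually_ge_atTop 1] with n h hn
  have h1 := (abs_le.1 ((Complex.abs_im_le_norm _).trans h)).1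
  rw [Complex.add_im]; linarith

lemma SolvesSin.eventually_norm_le {c : ℝ} {e w : ℕ → ℂ} (H : SolvesSin c e w) :
    ∀ᶠ n in atTop, ‖w n‖ ≤ 1 / 4 := H.mono fun _ h => h.1

/-- An error of smaller order than `exp |Im z|` is `o(n)` along `leadApprox c n + w n`. -/
lemma tendsto_norm_div_of_leadApprox {c : ℝ} (hc : c ≠ 0) {E : ℂ → ℂ}
    (hE : ∀ ε : ℝ, 0 < ε → ∃ K : ℝ, ∀ z : ℂ, K ≤ ‖z‖ → ‖E z‖ ≤ ε * Real.exp |z.im|)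
    {w : ℕ → ℂ} (hw : ∀ᶠ n in atTop, ‖w n‖ ≤ 1 / 4) :
    Tendsto (fun n : ℕ => ‖E (leadApprox c n + w n)‖ / n) atTop (𝓝 0) := by
  have hA : 0 < 8 * Real.pi * |c| := by have := Real.pi_pos; have := abs_pos.2 hc; positivity
  rw [Metric.tendsto_atTop']
  intro ε hε
  obtain ⟨K, hK⟩ := hE (ε / 2 / (8 * Real.pi * |c|)) (by positivity)
  obtain ⟨N, hN⟩ := eventually_atTop.1 (((eventually_le_norm_leadApprox_add hw K).and
    ((eventually_leadApprox_add_im_pos hc hw).and hw)).and (eventually_gt_atTop 0))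
  refine ⟨N, fun n hn => ?_⟩
  obtain ⟨⟨h1, h2, h3⟩, h4⟩ := hN n hn.le
  have hn' : (0 : ℝ) < n := by exact_mod_cast h4
  have h5 := hK _ h1
  rw [abs_of_pos h2] at h5
  have h6 := (norm_exp_I_mul_leadApprox_add hc h4.ne' h3).2
  rw [Real.dist_eq, sub_zero, abs_of_nonneg (by positivity), div_lt_iff₀ hn']
  calc _ ≤ _ := h5
    _ ≤ ε / 2 / (8 * Real.pi * |c|) * (2 * (4 * Real.pi * n * |c|)) := by gcongr
    _ = ε / 2 * n := by field_simp; ring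
    _ < ε * n := by gcongr; linarith

lemma SolvesSin.tendsto_zero {c : ℝ} (hc : c ≠ 0) {e w : ℕ → ℂ} (H : SolvesSin c e w)
    (he : Tendsto (fun n : ℕ => ‖e n‖ / n) atTop (𝓝 0)) : Tendsto w atTop (𝓝 0) := by
  obtain ⟨C, -, hC⟩ := SolvesSin.exists_norm_le hc
  refine squeeze_zero_norm' (hC e w H) ?_
  have h1 := tendsto_log_pow_div one_pos 1
  simp only [one_mul, pow_one] at h1
  simpa using (h1.add he).const_mul C

/-- The bound for the remainder, sampled along `leadApprox c n + w n` and divided by `n`. The term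
`expIntegral p (-z)` is of the size of `exp (Im z) ~ n` times a square summable sequence. -/
lemma exists_expIntegral_leadApprox_le {p : ℝ → ℂ}
    (hp : MemLp p 2 (volume.restrict (Set.Icc (0 : ℝ) 1))) {c : ℝ} (hc : c ≠ 0) :
    ∃ C : ℝ, 0 ≤ C ∧ ∀ w : ℕ → ℂ, (∀ᶠ n in atTop, ‖w n‖ ≤ 1 / 4) → Tendsto w atTop (𝓝 0) →
      ∀ ε : ℝ, 0 < ε → ∀ᶠ n : ℕ in atTop,
        (‖expIntegral p (-(leadApprox c n + w n))‖ + ‖expIntegral p (leadApprox c n + w n)‖ +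
          Real.exp |(leadApprox c n + w n).im| / ‖leadApprox c n + w n‖) / n ≤
        C * (‖expIntegral (fun x => p (1 - x)) (leadApprox c n)‖ + ε * ‖w n‖ + 1 / n) := by
  have hA : 0 < 8 * Real.pi * |c| := by have := Real.pi_pos; have := abs_pos.2 hc; positivity
  have hpi := intervalIntegrable_of_memLp hp
  have hpr := intervalIntegrable_of_memLp (memLp_reflect hp)
  have hI : 0 ≤ ∫ x in (0 : ℝ)..1, ‖p x‖ :=
    intervalIntegral.integral_nonneg zero_le_one fun _ _ => norm_nonneg _
  refine ⟨8 * Real.pi * |c| + ∫ x in (0 : ℝ)..1, ‖p x‖, by positivity, fun w hw hw0 ε hε => ?_⟩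
  have hζ : Tendsto (fun n => ‖leadApprox c n‖) atTop atTop :=
    tendsto_atTop_mono (fun n => (le_abs_self _).trans (Complex.abs_im_le_norm _))
      (tendsto_leadApprox_im hc)
  filter_upwards [hw, eventually_leadApprox_add_im_pos hc hw, eventually_gt_atTop 0,
    eventually_norm_expIntegral_add_le hpr hζ
      ((tendsto_leadApprox_im hc).eventually_ge_atTop 0) hw0 hε] with n h1 h2 h3 h4
  have hn : (0 : ℝ) < n := by exact_mod_cast h3
  set z := leadApprox c n + w n
  have h5 : Real.exp z.im ≤ 8 * Real.pi * |c| * n :=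
    (norm_exp_I_mul_leadApprox_add hc h3.ne' h1).2.trans_eq (by ring)
  have h6 : n ≤ ‖z‖ := natCast_le_norm_leadApprox_add n h1
  set T := ‖expIntegral (fun x => p (1 - x)) (leadApprox c n)‖ + ε * ‖w n‖
  have hT : 0 ≤ T := by positivity
  have h7 : ‖expIntegral p (-z)‖ ≤ 8 * Real.pi * |c| * n * T := by
    rw [expIntegral_neg, norm_mul, norm_exp_neg_I_mul]
    gcongr
  have h8 : ‖expIntegral p z‖ ≤ ∫ x in (0 : ℝ)..1, ‖p x‖ := by
    refine (norm_expIntegral_le hpi z).trans_eq ?_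
    rw [max_eq_left (Real.exp_le_one_iff.2 (by linarith)), one_mul]
  have h9 : Real.exp |z.im| / ‖z‖ ≤ 8 * Real.pi * |c| := by
    rw [abs_of_pos h2, div_le_iff₀ (hn.trans_le h6)]
    exact h5.trans (by gcongr)
  rw [div_le_iff₀ hn]
  have : (8 * Real.pi * |c| + ∫ x in (0 : ℝ)..1, ‖p x‖) * (T + 1 / n) * n =
      8 * Real.pi * |c| * n * T + (∫ x in (0 : ℝ)..1, ‖p x‖) * (n * T) +
        (8 * Real.pi * |c| + ∫ x in (0 : ℝ)..1, ‖p x‖) := by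
    field_simp
  rw [this]
  have : 0 ≤ (∫ x in (0 : ℝ)..1, ‖p x‖) * (n * T) := by positivity
  linarith

/-- Square summable bound for the corrections and for the errors divided by `n`. -/
lemma SobolevOne.exists_memlp_bound {q : ℝ → ℝ} (hq : SobolevOne q) (hq1 : q 1 ≠ 0) (h : ℝ) {c : ℝ}
    (hc : c ≠ 0) {w : ℕ → ℂ}
    (H : SolvesSin c (fun n => sinError q h (leadApprox c n + w n)) w) :
    Tendsto w atTop (𝓝 0) ∧ ∃ g : ℕ → ℝ, Memℓp g 2 ∧ ∀ᶠ n : ℕ in atTop,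
      ‖w n‖ ≤ g n ∧ ‖sinError q h (leadApprox c n + w n)‖ / n ≤ g n := by
  have hw := H.eventually_norm_le
  have hw0 : Tendsto w atTop (𝓝 0) := by
    refine H.tendsto_zero hc (tendsto_norm_div_of_leadApprox hc (E := sinError q h) (fun ε hε => ?_) hw)
    exact hq.sinAsymptotics hq1 h ε hε
  refine ⟨hw0, ?_⟩
  obtain ⟨p, hp, A, K, hA, -, hAK⟩ := hq.exists_norm_sinError_le hq1 h
  obtain ⟨C, hC, hS⟩ := exists_expIntegral_leadApprox_le hp hc
  obtain ⟨B, hB, hw1⟩ := SolvesSin.exists_norm_le hc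
  set τ : ℕ → ℝ := fun n => Real.log n / n + ‖expIntegral (fun x => p (1 - x)) (leadApprox c n)‖ + 1 / n
  have hτ : Memℓp τ 2 := (memlp_two_log_div.add
    (memlp_two_of_eventually_le (memlp_two_expIntegral_leadApprox hp hc).norm
      (Eventually.of_forall fun n => (norm_norm _).le))).add memlp_two_one_div
  set a := B * (1 + A * C)
  have ha : 0 ≤ a := by positivity
  refine ⟨fun n => (2 * a + A * C * (2 * a + 1)) * τ n, hτ.const_mul _, ?_⟩
  -- With `ε = 1 / (2 a + 1)` the term containing `‖w n‖` on the right is at most `‖w n‖ / 2` and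
  -- can be absorbed.
  filter_upwards [hw1 _ _ H, hS w hw hw0 (1 / (2 * a + 1)) (by positivity),
    eventually_le_norm_leadApprox_add hw K, eventually_gt_atTop 0, eventually_one_le_log] with
    n h1 h2 h3 h4 h5
  have hn : (0 : ℝ) < n := by exact_mod_cast h4
  set L := leadApprox c n
  have hlog : 0 ≤ Real.log n / n := by positivity
  set s := ‖expIntegral (fun x => p (1 - x)) L‖
  have hs : 0 ≤ s := norm_nonneg _
  have hw' := norm_nonneg (w n)
  have h6 : ‖sinError q h (L + w n)‖ / n ≤ A * C * (s + 1 / (2 * a + 1) * ‖w n‖ + 1 / n) := by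
    calc _ ≤ _ := div_le_div_of_nonneg_right (hAK _ h3) hn.le
      _ = A * ((‖expIntegral p (-(L + w n))‖ + ‖expIntegral p (L + w n)‖ +
          Real.exp |(L + w n).im| / ‖L + w n‖) / n) := by ring
      _ ≤ _ := by rw [mul_assoc]; gcongr
  have hτn : τ n = Real.log n / n + s + 1 / n := rfl
  have h1n : 0 ≤ 1 / (n : ℝ) := by positivity
  have hτ0 : 0 ≤ τ n := by rw [hτn]; positivity
  have h7 : ‖w n‖ ≤ a * (τ n + 1 / (2 * a + 1) * ‖w n‖) := by
    have hAC : 0 ≤ A * C := by positivity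
    refine h1.trans ?_
    have hδ : 0 ≤ 1 / (2 * a + 1) * ‖w n‖ := by positivity
    calc _ ≤ B * (Real.log n / n + A * C * (s + 1 / (2 * a + 1) * ‖w n‖ + 1 / n)) := by gcongr
      _ ≤ B * ((1 + A * C) * (τ n + 1 / (2 * a + 1) * ‖w n‖)) := by
        refine mul_le_mul_of_nonneg_left ?_ hB
        rw [hτn]
        nlinarith [mul_nonneg hAC hlog]
      _ = _ := by rw [← mul_assoc]
  have h8 : a * (1 / (2 * a + 1) * ‖w n‖) ≤ 1 / 2 * ‖w n‖ := by
    rw [← mul_assoc]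
    gcongr
    rw [mul_one_div, div_le_div_iff₀ (by positivity) two_pos]; linarith
  have h9 : ‖w n‖ ≤ 2 * a * τ n := by nlinarith
  have hAC : 0 ≤ A * C := by positivity
  constructor
  · refine h9.trans ?_
    gcongr
    have : 0 ≤ A * C * (2 * a + 1) := by positivity
    linarith
  · have h10 : 1 / (2 * a + 1) * ‖w n‖ ≤ ‖w n‖ := by
      refine mul_le_of_le_one_left hw' ?_
      rw [div_le_one (by positivity)]; linarith
    calc _ ≤ _ := h6
      _ ≤ A * C * (τ n + 2 * a * τ n) := mul_le_mul_of_nonneg_left (by linarith) hAC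
      _ ≤ _ := by nlinarith [mul_nonneg ha hτ0]

lemma SolvesSin.exists_memlp_bound_zero {c : ℝ} (hc : c ≠ 0) {w : ℕ → ℂ} (H : SolvesSin c 0 w) :
    ∃ g : ℕ → ℝ, Memℓp g 2 ∧ ∀ᶠ n : ℕ in atTop, ‖w n‖ ≤ g n := by
  obtain ⟨B, -, hw⟩ := SolvesSin.exists_norm_le hc
  refine ⟨_, memlp_two_log_div.const_mul B, ?_⟩
  filter_upwards [hw _ _ H] with n hn
  simpa using hn

/-- The solutions of the perturbed and of the unperturbed equation differ by a square summable
sequence. -/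
lemma SobolevOne.memlp_sub {q : ℝ → ℝ} (hq : SobolevOne q) (hq1 : q 1 ≠ 0) (h : ℝ) {c : ℝ}
    (hc : c ≠ 0) {w w' : ℕ → ℂ}
    (H : SolvesSin c (fun n => sinError q h (leadApprox c n + w n)) w) (H' : SolvesSin c 0 w') :
    Memℓp (fun n => w n - w' n) 2 := by
  obtain ⟨-, g, hg, hgw⟩ := hq.exists_memlp_bound hq1 h hc H
  obtain ⟨g', hg', hgw'⟩ := H'.exists_memlp_bound_zero hc
  refine memlp_two_of_eventually_le (hg.add hg') ?_
  filter_upwards [hgw, hgw'] with n h1 h2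
  exact (norm_sub_le _ _).trans (add_le_add h1.1 h2)

/-- For potentials in `W_2^2` the error tends to `-I * Q₁ * c / q 1` up to a square summable
sequence. -/
lemma SobolevTwo.exists_memlp_sinError {q : ℝ → ℝ} (hq2 : SobolevTwo q) (hq : SobolevOne q)
    (hq1 : q 1 ≠ 0) (h : ℝ) {c : ℝ} (hc : c ≠ 0) {w : ℕ → ℂ}
    (H : SolvesSin c (fun n => sinError q h (leadApprox c n + w n)) w) :
    ∃ g : ℕ → ℝ, Memℓp g 2 ∧ ∀ᶠ n : ℕ in atTop,
      ‖sinError q h (leadApprox c n + w n) + Complex.I * Q₁ q h * c / q 1‖ ≤ g n := by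
  have hw := H.eventually_norm_le
  obtain ⟨hw0, g, hg, hgw⟩ := hq.exists_memlp_bound hq1 h hc H
  obtain ⟨p, K₀, hp, -, A, K, hA, -, hAK⟩ := hq2.exists_norm_sinError_sub_le hq.continuousOn hq1 h
  obtain ⟨C, hC, hS⟩ := exists_expIntegral_leadApprox_le hp hc
  have hq1' : (q 1 : ℂ) ≠ 0 := by exact_mod_cast hq1
  set a := ‖(Q₁ q h : ℂ) / q 1‖
  set b := ‖2 * K₀ / (q 1 : ℂ)‖
  set d := 2 / (4 * Real.pi * |c|)
  have hd : 0 ≤ d := by have := Real.pi_pos; positivity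
  have hmem : Memℓp (fun n : ℕ => A * C * (‖expIntegral (fun x => p (1 - x)) (leadApprox c n)‖ +
      g n + 1 / n) + a * (g n + d * (1 / n)) + b * (1 / n)) 2 := by
    have h1 := memlp_two_of_eventually_le (memlp_two_expIntegral_leadApprox hp hc).norm
      (Eventually.of_forall fun n => (norm_norm _).le)
    exact ((((h1.add hg).add memlp_two_one_div).const_mul _).add
      ((hg.add (memlp_two_one_div.const_mul d)).const_mul a)).add (memlp_two_one_div.const_mul b)
  refine ⟨_, hmem, ?_⟩
  filter_upwards [H, hgw, hS w hw hw0 1 one_pos,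
    eventually_le_norm_leadApprox_add hw K, eventually_gt_atTop 0] with n h1 h2 h3 h4 h5
  have hn : (1 : ℝ) ≤ n := by exact_mod_cast h5
  have hn0 : (0 : ℝ) < n := by linarith
  have hnz : n ≤ ‖leadApprox c n + w n‖ := natCast_le_norm_leadApprox_add n h1.1
  have hexp := (norm_exp_I_mul_leadApprox_add hc h5.ne' h1.1).1
  have hrem := hAK _ h4
  replace h1 := h1.2
  replace h2 := h2
  set z := leadApprox c n + w n
  set e := sinError q h z
  have hz : z ≠ 0 := norm_pos_iff.1 (hn0.trans_le hnz)
  have hcos : Complex.cos z = -Complex.I * (c * z - e) + Complex.exp (Complex.I * z) := by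
    rw [mul_comm Complex.I z, Complex.exp_mul_I]
    linear_combination -Complex.I * h1
  -- the growing part of `cos z` is `-I * sin z = -I * (c * z - e)`
  have hid : e + Complex.I * Q₁ q h * c / q 1 =
      (e - 2 / (q 1 * z) * (1 / 2 * Q₁ q h * Complex.cos z + K₀)) +
        (Q₁ q h / q 1 * ((Complex.I * e + Complex.exp (Complex.I * z)) / z) +
          2 * K₀ / q 1 / z) := by
    rw [hcos]; field_simp; ring
  rw [hid]
  have hB : ‖e - 2 / (q 1 * z) * (1 / 2 * Q₁ q h * Complex.cos z + K₀)‖ ≤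
      A * C * (‖expIntegral (fun x => p (1 - x)) (leadApprox c n)‖ + g n + 1 / n) := by
    refine hrem.trans ?_
    rw [mul_div_assoc, mul_assoc]
    refine mul_le_mul_of_nonneg_left ?_ hA
    calc _ ≤ (‖expIntegral p (-z)‖ + ‖expIntegral p z‖ + Real.exp |z.im| / ‖z‖) / n := by
          gcongr
      _ ≤ _ := h3
      _ ≤ _ := by rw [one_mul]; gcongr; exact h2.1
  have hM : ‖Q₁ q h / q 1 * ((Complex.I * e + Complex.exp (Complex.I * z)) / z)‖ ≤
      a * (g n + d * (1 / n)) := by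
    rw [norm_mul]
    refine mul_le_mul_of_nonneg_left ?_ (norm_nonneg _)
    rw [norm_div]
    have h6 : ‖Complex.I * e + Complex.exp (Complex.I * z)‖ ≤ ‖e‖ + d := by
      refine (norm_add_le _ _).trans ?_
      rw [norm_mul, Complex.norm_I, one_mul]
      gcongr
      refine hexp.trans ?_
      rw [mul_right_comm (4 * Real.pi), ← div_div]
      exact div_le_self hd hn
    calc _ ≤ (‖e‖ + d) / n := by gcongr
      _ = ‖e‖ / n + d * (1 / n) := by ring
      _ ≤ _ := by gcongr; exact h2.2
  have hL : ‖2 * K₀ / q 1 / z‖ ≤ b * (1 / n) := by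
    rw [norm_div, div_eq_mul_one_div]
    gcongr
  exact (norm_add_le _ _).trans ((add_le_add hB ((norm_add_le _ _).trans (add_le_add hM hL))).trans_eq
    (by ring))

lemma exists_bound_of_memlp {g : ℕ → ℝ} (hg : Memℓp g 2) : ∃ M : ℝ, 0 ≤ M ∧ ∀ n, g n ≤ M := by
  have h1 := (memlp_two_iff.1 hg).tendsto_atTop_zero
  obtain ⟨M, hM⟩ := h1.bddAbove_range
  refine ⟨|M| + 1, by positivity, fun n => ?_⟩
  have h2 : ‖g n‖ ^ 2 ≤ M := hM ⟨n, rfl⟩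
  have h3 := le_abs_self M
  rw [Real.norm_eq_abs, sq_abs] at h2
  nlinarith [sq_nonneg (g n - 1), abs_nonneg M]

/-- The second term of the asymptotics for `ω ≠ 0`, from the limit of the error
(`exists_memlp_sinError`) and its linear influence on the correction (`exists_norm_sub_le`). -/
lemma SobolevTwo.memlp_natCast_mul {q : ℝ → ℝ} (hq2 : SobolevTwo q) (hq : SobolevOne q)
    (hq1 : q 1 ≠ 0) (h : ℝ) {c : ℝ} (hc : c ≠ 0) {w w' : ℕ → ℂ}
    (H : SolvesSin c (fun n => sinError q h (leadApprox c n + w n)) w) (H' : SolvesSin c 0 w') :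
    Memℓp (fun n : ℕ => n * (w n - w' n + Q₁ q h / (2 * Real.pi * n * q 1))) 2 := by
  obtain ⟨-, g, hg, hgw⟩ := hq.exists_memlp_bound hq1 h hc H
  obtain ⟨g', hg', hgw'⟩ := H'.exists_memlp_bound_zero hc
  obtain ⟨γ, hγ, hγe⟩ := hq2.exists_memlp_sinError hq hq1 h hc H
  obtain ⟨C, hC, hsub⟩ := SolvesSin.exists_norm_sub_le hc
  obtain ⟨M, hM, hγM⟩ := exists_bound_of_memlp hγ
  have hq1' : (q 1 : ℂ) ≠ 0 := by exact_mod_cast hq1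
  have hc' : (c : ℂ) ≠ 0 := by exact_mod_cast hc
  have hpi : (Real.pi : ℂ) ≠ 0 := by exact_mod_cast Real.pi_ne_zero
  set a := ‖Complex.I * Q₁ q h * c / q 1‖
  have ha : 0 ≤ a := norm_nonneg _
  set b := ‖Complex.I / (2 * Real.pi * c : ℂ)‖
  have hmem : Memℓp (fun n : ℕ => C * (C * (M + a)) * ((g n + g' n) + g' n + 1 / n) + b * γ n) 2 :=
    ((((hg.add hg').add hg').add memlp_two_one_div).const_mul _).add (hγ.const_mul b)
  refine memlp_two_of_eventually_le hmem ?_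
  filter_upwards [hgw, hgw', hγe, hsub _ _ _ H H', eventually_gt_atTop 0] with n h1 h2 h3 h4 h5
  have hn0 : (0 : ℝ) < n := by exact_mod_cast h5
  have hn' : (n : ℂ) ≠ 0 := by exact_mod_cast h5.ne'
  obtain ⟨h6, h7⟩ := h4
  replace h1 := h1.1
  set e := sinError q h (leadApprox c n + w n)
  have he : ‖e‖ ≤ M + a := by
    have : e = (e + Complex.I * Q₁ q h * c / q 1) - Complex.I * Q₁ q h * c / q 1 := by ring
    rw [this]
    exact (norm_sub_le _ _).trans (add_le_add (h3.trans (hγM n)) le_rfl)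
  have hd : ‖w n - w' n‖ ≤ C * (M + a) / n := by
    refine h6.trans ?_
    rw [mul_div_assoc]; gcongr
  have hid : (n : ℂ) * (w n - w' n + Q₁ q h / (2 * Real.pi * n * q 1)) =
      n * (w n - w' n + Complex.I * e / (2 * Real.pi * n * c)) -
        Complex.I / (2 * Real.pi * c) * (e + Complex.I * Q₁ q h * c / q 1) := by
    field_simp
    linear_combination (Q₁ q h * c : ℂ) * Complex.I_sq
  rw [hid]
  refine (norm_sub_le _ _).trans ?_
  rw [norm_mul, norm_mul (Complex.I / (2 * Real.pi * c : ℂ)), Complex.norm_natCast]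
  refine add_le_add ?_ (mul_le_mul_of_nonneg_left h3 (norm_nonneg _))
  calc _ ≤ n * (C * (‖w n - w' n‖ * (‖w n - w' n‖ + ‖w' n‖ + 1 / n))) := by gcongr
    _ ≤ n * (C * (C * (M + a) / n * (g n + g' n + g' n + 1 / n))) := by
      have h8 := (norm_sub_le (w n) (w' n)).trans (add_le_add h1 h2)
      have h9 : ‖w n - w' n‖ + ‖w' n‖ + 1 / n ≤ g n + g' n + g' n + 1 / n := by linarith
      gcongr
    _ = _ := by field_simp

/-! ### The roots of `sin z = c z` -/

/-- The correction solves `exp (-I w) = 1 + (leadApprox c n - 2 π n) / (2 π n) + O(log n / n ^ 2)`,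
and `exp (-I w) - 1` may be replaced by `-I w`. -/
lemma SolvesSin.exists_norm_neg_I_mul_sub_le {c : ℝ} (hc : c ≠ 0) {w : ℕ → ℂ}
    (H : SolvesSin c 0 w) : ∃ C : ℝ, 0 ≤ C ∧ ∀ᶠ n : ℕ in atTop,
      ‖w n - Complex.I * (leadApprox c n - 2 * Real.pi * n) / (2 * Real.pi * n)‖ ≤
        C * (Real.log n ^ 2 / (n : ℝ) ^ 2) := by
  obtain ⟨B, hB, hw⟩ := SolvesSin.exists_norm_le hc
  have hpi := Real.pi_gt_three
  have hpi' : (Real.pi : ℂ) ≠ 0 := by exact_mod_cast Real.pi_ne_zero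
  have hc0 : 0 < |c| := abs_pos.2 hc
  have hc' : (c : ℂ) ≠ 0 := by exact_mod_cast hc
  refine ⟨B ^ 2 + B + 1 / |c| ^ 2, by positivity, ?_⟩
  filter_upwards [H, hw _ _ H, eventually_gt_atTop 0, eventually_one_le_log] with n h1 h2 h3 h4
  have hn : (0 : ℝ) < n := by exact_mod_cast h3
  have hn1 : (1 : ℝ) ≤ n := by exact_mod_cast h3
  have hn' : (n : ℂ) ≠ 0 := by exact_mod_cast h3.ne'
  simp only [Pi.zero_apply, norm_zero, zero_div, add_zero] at h2
  have h5 := exp_eq_of_sin_eq hc h3.ne' h1.2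
  have h6 := (norm_exp_I_mul_leadApprox_add hc h3.ne' h1.1).1
  rw [Pi.zero_apply, sub_zero] at h5
  set E := Complex.exp (Complex.I * (leadApprox c n + w n))
  set l := Real.log n
  have h7 : ‖Complex.exp (-(Complex.I * w n)) - 1 - -(Complex.I * w n)‖ ≤ ‖w n‖ ^ 2 := by
    have := Complex.norm_exp_sub_one_sub_id_le (x := -(Complex.I * w n))
      (by rw [norm_neg, norm_mul, Complex.norm_I, one_mul]; linarith [h1.1])
    rwa [norm_neg, norm_mul, Complex.norm_I, one_mul] at this
  have hid : w n - Complex.I * (leadApprox c n - 2 * Real.pi * n) / (2 * Real.pi * n) =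
      -Complex.I * (Complex.exp (-(Complex.I * w n)) - 1 - -(Complex.I * w n)) +
        (Complex.I * w n / (2 * Real.pi * n) - E / (4 * Real.pi * n * c)) := by
    rw [h5]
    field_simp
    linear_combination (16 * w n * c * Real.pi * n + 4 * E) * Complex.I_sq
  rw [hid]
  have h8 : ‖w n‖ ^ 2 ≤ B ^ 2 * (l ^ 2 / (n : ℝ) ^ 2) := by
    refine (pow_le_pow_left₀ (norm_nonneg _) h2 2).trans_eq ?_
    rw [mul_pow, div_pow]
  have h9 : ‖Complex.I * w n / (2 * Real.pi * n)‖ ≤ B * (l ^ 2 / (n : ℝ) ^ 2) := by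
    rw [norm_div, norm_mul, Complex.norm_I, one_mul]
    have : ‖(2 * Real.pi * n : ℂ)‖ = 2 * Real.pi * n := by
      rw [norm_mul, norm_mul, Complex.norm_real, Complex.norm_natCast, Complex.norm_two,
        Real.norm_of_nonneg Real.pi_pos.le]
    rw [this]
    calc _ ≤ (B * (l / n)) / n := by gcongr; nlinarith
      _ = B * (l / (n : ℝ) ^ 2) := by field_simp
      _ ≤ _ := by gcongr; nlinarith
  have h10 : ‖E / (4 * Real.pi * n * c)‖ ≤ 1 / |c| ^ 2 * (l ^ 2 / (n : ℝ) ^ 2) := by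
    rw [norm_div]
    have : ‖(4 * Real.pi * n * c : ℂ)‖ = 4 * Real.pi * n * |c| := by
      rw [norm_mul, norm_mul, norm_mul, Complex.norm_real, Complex.norm_real, Complex.norm_natCast,
        Real.norm_of_nonneg Real.pi_pos.le, Real.norm_eq_abs]
      norm_num
    rw [this]
    calc _ ≤ 2 / (4 * Real.pi * n * |c|) / (4 * Real.pi * n * |c|) := by gcongr
      _ = 2 / (16 * Real.pi ^ 2) * (1 / |c| ^ 2 * (1 / (n : ℝ) ^ 2)) := by field_simp; norm_num
      _ ≤ 1 * (1 / |c| ^ 2 * (1 / (n : ℝ) ^ 2)) := by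
        gcongr
        rw [div_le_one (by positivity)]; nlinarith
      _ ≤ _ := by
        rw [one_mul]; gcongr; nlinarith
  refine (norm_add_le _ _).trans ?_
  rw [norm_mul, norm_neg, Complex.norm_I, one_mul]
  have := norm_sub_le (Complex.I * w n / (2 * Real.pi * n)) (E / (4 * Real.pi * n * c))
  linarith

/-- The correction is `I (leadApprox c n - 2 π n) / (2 π n) + O(log² n / n²)`, and the real and the
imaginary part are read off, with `log (4 π n |c|) = log (2 n π) - log a` for `a = 1 / (2 |c|)`. -/
lemma SolvesSin.logAsymptotics {c : ℝ} (hc : c ≠ 0) {w μ : ℕ → ℂ} (H : SolvesSin c 0 w)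
    (hμ : ∀ᶠ n in atTop, μ n = (leadApprox c n + w n) / 2) :
    LogAsymptotics (leadShift c / (2 * Real.pi)) (1 / (2 * |c|)) μ := by
  obtain ⟨C, hC, h⟩ := H.exists_norm_neg_I_mul_sub_le hc
  have hc0 : 0 < |c| := abs_pos.2 hc
  have hpi := Real.pi_pos
  have key : ∀ᶠ n : ℕ in atTop, μ n - ((((n + leadShift c / (2 * Real.pi)) * Real.pi
      - (Real.log (2 * n * Real.pi) - Real.log (1 / (2 * |c|))) / (4 * n * Real.pi) : ℝ) : ℂ) +
      Complex.I * ((1 / 2 * (Real.log (2 * n * Real.pi) - Real.log (1 / (2 * |c|)) +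
        leadShift c / (2 * Real.pi) / n) : ℝ) : ℂ)) =
      1 / 2 * (w n - Complex.I * (leadApprox c n - 2 * Real.pi * n) / (2 * Real.pi * n)) := by
    filter_upwards [hμ, eventually_gt_atTop 0] with n h1 h2
    have hn : (0 : ℝ) < n := by exact_mod_cast h2
    have hn' : (n : ℂ) ≠ 0 := by exact_mod_cast h2.ne'
    have hpi' : (Real.pi : ℂ) ≠ 0 := by exact_mod_cast Real.pi_ne_zero
    have h3 : Real.log (2 * n * Real.pi) - Real.log (1 / (2 * |c|)) =
        Real.log (4 * Real.pi * n * |c|) := by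
      rw [← Real.log_div (by positivity) (by positivity)]
      congr 1; field_simp; norm_num
    rw [h3, h1, leadApprox]
    push_cast
    field_simp
    linear_combination (4 * Real.log (4 * Real.pi * n * |c|) : ℂ) * Complex.I_sq
  have hle : ∀ᶠ n : ℕ in atTop, ‖μ n - ((((n + leadShift c / (2 * Real.pi)) * Real.pi
      - (Real.log (2 * n * Real.pi) - Real.log (1 / (2 * |c|))) / (4 * n * Real.pi) : ℝ) : ℂ) +
      Complex.I * ((1 / 2 * (Real.log (2 * n * Real.pi) - Real.log (1 / (2 * |c|)) +
        leadShift c / (2 * Real.pi) / n) : ℝ) : ℂ))‖ ≤ C * ‖Real.log n ^ 2 / (n : ℝ) ^ 2‖ := by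
    filter_upwards [key, h] with n h1 h2
    rw [h1, norm_mul, Real.norm_of_nonneg (by positivity)]
    refine le_trans ?_ h2
    refine mul_le_of_le_one_left (norm_nonneg _) ?_
    norm_num
  constructor
  · refine IsBigO.of_bound C (hle.mono fun n hn => le_trans ?_ hn)
    rw [Real.norm_eq_abs]
    refine le_trans (le_of_eq ?_) (Complex.abs_re_le_norm _)
    simp only [Complex.sub_re, Complex.add_re, Complex.ofReal_re, Complex.mul_re, Complex.I_re,
      Complex.I_im, Complex.ofReal_im]
    congr 1; ring
  · refine IsBigO.of_bound C (hle.mono fun n hn => le_trans ?_ hn)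
    rw [Real.norm_eq_abs]
    refine le_trans (le_of_eq ?_) (Complex.abs_im_le_norm _)
    simp only [Complex.sub_im, Complex.add_im, Complex.ofReal_re, Complex.mul_im, Complex.I_re,
      Complex.I_im, Complex.ofReal_im]
    congr 1; ring

/-! ### Square summability for `ω = 0` -/

lemma natCast_le_norm_pi_mul_add {n : ℕ} (hn : 0 < n) {w : ℂ} (hw : ‖w‖ ≤ 1 / 4) :
    (n : ℝ) ≤ ‖((Real.pi * n : ℝ) : ℂ) + w‖ := by
  refine le_trans ?_ ((le_abs_self _).trans (Complex.abs_re_le_norm _))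
  rw [Complex.add_re, Complex.ofReal_re]
  have h1 := (abs_le.1 ((Complex.abs_re_le_norm w).trans hw)).1
  have h3 := Real.pi_gt_three
  have h4 : (1 : ℝ) ≤ n := by exact_mod_cast hn
  nlinarith

lemma eventually_le_norm_pi_mul_add {w : ℕ → ℂ} (hw : ∀ᶠ n in atTop, ‖w n‖ ≤ 1 / 4)
    (K : ℝ) : ∀ᶠ n : ℕ in atTop, K ≤ ‖((Real.pi * n : ℝ) : ℂ) + w n‖ := by
  filter_upwards [hw, eventually_ge_atTop ⌈K⌉₊, eventually_gt_atTop 0] with n h hn h0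
  exact ((Nat.le_ceil K).trans (by exact_mod_cast hn)).trans (natCast_le_norm_pi_mul_add h0 h)

lemma exp_abs_im_pi_mul_add_le (n : ℕ) {w : ℂ} (hw : ‖w‖ ≤ 1 / 4) :
    Real.exp |(((Real.pi * n : ℝ) : ℂ) + w).im| ≤ 2 := by
  rw [Complex.add_im, Complex.ofReal_im, zero_add]
  exact (Real.exp_le_exp.2 ((Complex.abs_im_le_norm w).trans hw)).trans exp_quarter_le_two

/-- The bound for the remainder, sampled along `π n + w n`. -/
lemma exists_memlp_expIntegral_pi_mul_le {p : ℝ → ℂ}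
    (hp : MemLp p 2 (volume.restrict (Set.Icc (0 : ℝ) 1))) :
    ∃ τ : ℕ → ℝ, Memℓp τ 2 ∧ (∀ n, 0 ≤ τ n) ∧ ∀ w : ℕ → ℂ, (∀ᶠ n in atTop, ‖w n‖ ≤ 1 / 4) →
      Tendsto w atTop (𝓝 0) → ∀ ε : ℝ, 0 < ε → ∀ᶠ n : ℕ in atTop,
        ‖expIntegral p (-(((Real.pi * n : ℝ) : ℂ) + w n))‖ +
          ‖expIntegral p (((Real.pi * n : ℝ) : ℂ) + w n)‖ +
          Real.exp |(((Real.pi * n : ℝ) : ℂ) + w n).im| / ‖((Real.pi * n : ℝ) : ℂ) + w n‖ ≤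
        τ n + ε * ‖w n‖ := by
  obtain ⟨h1, h2⟩ := memlp_two_expIntegral_pi_mul hp
  have hnorm : ∀ f : ℕ → ℂ, Memℓp f 2 → Memℓp (fun n => ‖f n‖) 2 := fun f hf =>
    memlp_two_of_eventually_le hf.norm (Eventually.of_forall fun n => (norm_norm _).le)
  refine ⟨fun n => ‖expIntegral p (-((Real.pi * n : ℝ) : ℂ))‖ +
      ‖expIntegral p ((Real.pi * n : ℝ) : ℂ)‖ + 2 * (1 / n),
    ((hnorm _ h2).add (hnorm _ h1)).add (memlp_two_one_div.const_mul 2), fun n => by positivity,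
    fun w hw hw0 ε hε => ?_⟩
  have hI := intervalIntegrable_of_memLp hp
  have hζ : Tendsto (fun n : ℕ => ‖((Real.pi * n : ℝ) : ℂ)‖) atTop atTop := by
    refine (tendsto_const_mul_natCast Real.pi_pos).congr fun n => ?_
    rw [Complex.norm_real, Real.norm_of_nonneg (by have := Real.pi_pos; positivity)]
  have hζ' : Tendsto (fun n : ℕ => ‖-((Real.pi * n : ℝ) : ℂ)‖) atTop atTop := by
    simpa only [norm_neg] using hζ
  have hw0' : Tendsto (fun n => -w n) atTop (𝓝 0) := by simpa using hw0.neg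
  filter_upwards [hw, eventually_gt_atTop 0,
    eventually_norm_expIntegral_add_le hI hζ (Eventually.of_forall fun n => by simp) hw0
      (half_pos hε),
    eventually_norm_expIntegral_add_le hI hζ' (Eventually.of_forall fun n => by simp) hw0'
      (half_pos hε)] with n h3 h4 h5 h6
  have hn : (0 : ℝ) < n := by exact_mod_cast h4
  rw [norm_neg, ← neg_add] at h6
  have h7 : Real.exp |(((Real.pi * n : ℝ) : ℂ) + w n).im| / ‖((Real.pi * n : ℝ) : ℂ) + w n‖ ≤
      2 * (1 / n) := by
    rw [mul_one_div]
    exact div_le_div₀ two_pos.le (exp_abs_im_pi_mul_add_le n h3) hn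
      (natCast_le_norm_pi_mul_add h4 h3)
  linarith

lemma norm_sin_sub_self_le {w : ℂ} (hw : ‖w‖ ≤ 1) : ‖Complex.sin w - w‖ ≤ ‖w‖ ^ 2 := by
  have h1 := Complex.norm_exp_sub_one_sub_id_le (x := -(Complex.I * w)) (by simpa using hw)
  have h2 := Complex.norm_exp_sub_one_sub_id_le (x := Complex.I * w) (by simpa using hw)
  rw [norm_neg] at h1
  rw [norm_mul Complex.I w, Complex.norm_I, one_mul] at h1 h2
  have hid : Complex.sin w - w = Complex.I / 2 *
      ((Complex.exp (-(Complex.I * w)) - 1 - -(Complex.I * w)) -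
        (Complex.exp (Complex.I * w) - 1 - Complex.I * w)) := by
    rw [sin_eq_exp]; linear_combination (-w) * Complex.I_sq
  rw [hid, norm_mul, norm_div, Complex.norm_I, Complex.norm_two]
  have := norm_sub_le (Complex.exp (-(Complex.I * w)) - 1 - -(Complex.I * w))
    (Complex.exp (Complex.I * w) - 1 - Complex.I * w)
  linarith

lemma norm_one_sub_cos_le {w : ℂ} (hw : ‖w‖ ≤ 1) : ‖1 - Complex.cos w‖ ≤ ‖w‖ := by
  have h1 := Complex.norm_exp_sub_one_sub_id_le (x := -(Complex.I * w)) (by simpa using hw)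
  have h2 := Complex.norm_exp_sub_one_sub_id_le (x := Complex.I * w) (by simpa using hw)
  rw [norm_neg] at h1
  rw [norm_mul Complex.I w, Complex.norm_I, one_mul] at h1 h2
  have hid : 1 - Complex.cos w = -(1 / 2 : ℂ) *
      ((Complex.exp (-(Complex.I * w)) - 1 - -(Complex.I * w)) +
        (Complex.exp (Complex.I * w) - 1 - Complex.I * w)) := by
    rw [Complex.cos, show -w * Complex.I = -(Complex.I * w) by ring, mul_comm w]; ring
  rw [hid, norm_mul, norm_neg, norm_div, norm_one, Complex.norm_two]
  have := norm_add_le (Complex.exp (-(Complex.I * w)) - 1 - -(Complex.I * w))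
    (Complex.exp (Complex.I * w) - 1 - Complex.I * w)
  nlinarith [norm_nonneg w]

/-- First term of the asymptotics for `ω = 0`. -/
lemma SobolevOne.memlp_of_sin_add_eq_zero {q : ℝ → ℝ} (hq : SobolevOne q) (hq1 : q 1 ≠ 0)
    (h : ℝ) {w : ℕ → ℂ}
    (H : ∀ᶠ n : ℕ in atTop, ‖w n‖ ≤ 1 / 4 ∧ Complex.sin (((Real.pi * n : ℝ) : ℂ) + w n) +
      sinError q h (((Real.pi * n : ℝ) : ℂ) + w n) = 0) :
    Tendsto w atTop (𝓝 0) ∧ Memℓp w 2 := by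
  have hw : ∀ᶠ n in atTop, ‖w n‖ ≤ 1 / 4 := H.mono fun _ h => h.1
  have hle : ∀ᶠ n : ℕ in atTop,
      ‖w n‖ ≤ 4 / 3 * ‖sinError q h (((Real.pi * n : ℝ) : ℂ) + w n)‖ := by
    filter_upwards [H] with n hn
    have h1 := norm_sin_ge (hn.1.trans (by norm_num))
    have h2 : ‖Complex.sin (w n)‖ = ‖sinError q h (((Real.pi * n : ℝ) : ℂ) + w n)‖ := by
      rw [eq_neg_of_add_eq_zero_right hn.2, norm_neg, sin_pi_mul_add, norm_mul, norm_pow, norm_neg,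
        norm_one, one_pow, one_mul]
    linarith
  have hw0 : Tendsto w atTop (𝓝 0) := by
    rw [Metric.tendsto_atTop']
    intro ε hε
    obtain ⟨K, hK⟩ := hq.sinAsymptotics hq1 h (ε / 4) (by positivity)
    obtain ⟨N, hN⟩ := eventually_atTop.1 ((eventually_le_norm_pi_mul_add hw K).and (hle.and hw))
    refine ⟨N, fun n hn => ?_⟩
    obtain ⟨h1, h2, h3⟩ := hN n hn.le
    have h4 : ‖sinError q h (((Real.pi * n : ℝ) : ℂ) + w n)‖ ≤ _ := hK _ h1
    have h5 := exp_abs_im_pi_mul_add_le n h3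
    have h6 : ε / 4 * Real.exp |(((Real.pi * n : ℝ) : ℂ) + w n).im| ≤ ε / 4 * 2 := by gcongr
    rw [dist_zero_right]
    linarith
  refine ⟨hw0, ?_⟩
  obtain ⟨p, hp, A, K, hA, -, hAK⟩ := hq.exists_norm_sinError_le hq1 h
  obtain ⟨τ, hτ, -, hτw⟩ := exists_memlp_expIntegral_pi_mul_le hp
  refine memlp_two_of_eventually_le (hτ.const_mul (4 * A)) ?_
  -- With `ε = 1 / (2 (A + 1))` the terms containing `‖w n‖` on the right can be absorbed.
  filter_upwards [hle, hτw w hw hw0 (1 / (2 * (A + 1))) (by positivity),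
    eventually_le_norm_pi_mul_add hw K] with n h1 h2 h3
  have h4 := hAK _ h3
  have h5 := mul_le_mul_of_nonneg_left h2 hA
  have h6 : A * (1 / (2 * (A + 1)) * ‖w n‖) ≤ 1 / 2 * ‖w n‖ := by
    rw [← mul_assoc]
    gcongr
    rw [mul_one_div, div_le_div_iff₀ (by positivity) two_pos]; linarith
  linarith

/-- Second term of the asymptotics for `ω = 0`. -/
lemma SobolevTwo.memlp_natCast_mul_of_sin_add_eq_zero {q : ℝ → ℝ} (hq2 : SobolevTwo q)
    (hq : SobolevOne q) (hq1 : q 1 ≠ 0) (hω : omega q = 0) (h : ℝ) {w : ℕ → ℂ}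
    (H : ∀ᶠ n : ℕ in atTop, ‖w n‖ ≤ 1 / 4 ∧ Complex.sin (((Real.pi * n : ℝ) : ℂ) + w n) +
      sinError q h (((Real.pi * n : ℝ) : ℂ) + w n) = 0) :
    Memℓp (fun n : ℕ => n * (w n + (Q₁ q h + (-1) ^ n * Q₂ q h) / (q 1 * Real.pi * n))) 2 := by
  have hw : ∀ᶠ n in atTop, ‖w n‖ ≤ 1 / 4 := H.mono fun _ h => h.1
  obtain ⟨hw0, hmw⟩ := hq.memlp_of_sin_add_eq_zero hq1 h H
  obtain ⟨p, K₀, hp, hK₀, A, K, hA, -, hAK⟩ := hq2.exists_norm_sinError_sub_le hq.continuousOn hq1 h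
  rw [hK₀ hω] at hAK
  obtain ⟨τ, hτ, hτ0, hτw⟩ := exists_memlp_expIntegral_pi_mul_le hp
  obtain ⟨M, hM, hτM⟩ := exists_bound_of_memlp hτ
  have hq1' : (q 1 : ℂ) ≠ 0 := by exact_mod_cast hq1
  have hpi : (Real.pi : ℂ) ≠ 0 := by exact_mod_cast Real.pi_ne_zero
  set a₁ := ‖(Q₁ q h : ℂ) / q 1‖
  set a₂ := ‖(Q₂ q h : ℂ) / q 1‖
  have ha₁ : 0 ≤ a₁ := norm_nonneg _
  have ha₂ : 0 ≤ a₂ := norm_nonneg _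
  set B := 4 / 3 * (2 * a₁ + a₂ + A * (M + 1))
  have hB : 0 ≤ B := by positivity
  have hmw' : Memℓp (fun n => ‖w n‖) 2 :=
    memlp_two_of_eventually_le hmw.norm (Eventually.of_forall fun n => (norm_norm _).le)
  refine memlp_two_of_eventually_le
    ((hmw'.const_mul (B + (2 * a₁ + a₂))).add ((hτ.add hmw').const_mul A)) ?_
  filter_upwards [H, hτw w hw hw0 1 one_pos, eventually_le_norm_pi_mul_add hw K,
    eventually_gt_atTop 0] with n h1 h2 h3 h4
  obtain ⟨hwn, h1⟩ := h1
  have hn : (0 : ℝ) < n := by exact_mod_cast h4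
  have hn1 : (1 : ℝ) ≤ n := by exact_mod_cast h4
  have hn' : (n : ℂ) ≠ 0 := by exact_mod_cast h4.ne'
  have hnz := natCast_le_norm_pi_mul_add h4 hwn
  have h5 := hAK _ h3
  have hcos := cos_pi_mul_add n (w n)
  rw [sin_pi_mul_add] at h1
  obtain ⟨z, hz⟩ : ∃ z, z = ((Real.pi * n : ℝ) : ℂ) + w n := ⟨_, rfl⟩
  rw [← hz] at h1 h2 h5 hcos hnz
  set e := sinError q h z
  have hz0 : z ≠ 0 := norm_pos_iff.1 (hn.trans_le hnz)
  obtain ⟨s, hs⟩ : ∃ s : ℂ, s = (-1) ^ n := ⟨_, rfl⟩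
  have hss : s * s = 1 := by rw [hs, ← mul_pow]; norm_num
  have hsn : ‖s‖ = 1 := by rw [hs, norm_pow, norm_neg, norm_one, one_pow]
  rw [← hs] at h1 hcos ⊢
  set r := e - 2 / (q 1 * z) * (1 / 2 * Q₁ q h * Complex.cos z + 1 / 2 * Q₂ q h)
  have hr : ‖r‖ ≤ A * (τ n + ‖w n‖) / n := by
    refine h5.trans ?_
    rw [one_mul] at h2
    exact div_le_div₀ (by have := hτ0 n; positivity) (by gcongr) hn hnz
  have hsin : Complex.sin (w n) = -(1 / z * (Q₁ q h / q 1 * Complex.cos (w n) +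
      s * (Q₂ q h / q 1))) - s * r := by
    have he : e = r + 2 / (q 1 * z) * (1 / 2 * Q₁ q h * Complex.cos z + 1 / 2 * Q₂ q h) := by
      simp only [r]; ring
    rw [he, hcos] at h1
    have h6 : Complex.sin (w n) = s * (s * Complex.sin (w n)) := by rw [← mul_assoc, hss, one_mul]
    rw [h6, eq_neg_of_add_eq_zero_left h1]
    field_simp
    linear_combination (-(Q₁ q h : ℂ) * Complex.cos (w n)) * hss
  have hw1 : ‖w n‖ ≤ 1 := hwn.trans (by norm_num)
  have hc1 := norm_one_sub_cos_le hw1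
  have hc2 : ‖Complex.cos (w n)‖ ≤ 2 := by
    have := norm_sub_le (1 : ℂ) (1 - Complex.cos (w n))
    rw [sub_sub_cancel, norm_one] at this
    linarith
  -- the corrections are `O(1 / n)`
  have hwB : ‖w n‖ ≤ B / n := by
    have h6 := norm_sin_ge hw1
    have h7 : ‖Complex.sin (w n)‖ ≤ (2 * a₁ + a₂) / n + A * (M + 1) / n := by
      rw [hsin]
      refine (norm_sub_le _ _).trans (add_le_add ?_ ?_)
      · rw [norm_neg, norm_mul, norm_div, norm_one, one_div_mul_eq_div]
        refine div_le_div₀ (by positivity) ?_ hn hnz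
        refine (norm_add_le _ _).trans ?_
        rw [norm_mul, norm_mul, hsn, one_mul, mul_comm 2]
        gcongr
      · rw [norm_mul, hsn, one_mul]
        refine hr.trans ?_
        gcongr
        exact hτM n
    rw [← add_div] at h7
    have : B / n = 4 / 3 * ((2 * a₁ + a₂ + A * (M + 1)) / n) := by simp only [B]; ring
    linarith
  have hid : (n : ℂ) * (w n + (Q₁ q h + s * Q₂ q h) / (q 1 * Real.pi * n)) =
      -(n * (Complex.sin (w n) - w n)) +
        (n / z) * (w n / (Real.pi * n) * (Q₁ q h / q 1 + s * (Q₂ q h / q 1)) +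
          Q₁ q h / q 1 * (1 - Complex.cos (w n))) - n * (s * r) := by
    rw [hsin]
    have hz' : w n = z - Real.pi * n := by rw [hz]; push_cast; ring
    have : w n / (Real.pi * n) = z / (Real.pi * n) - 1 := by rw [hz']; field_simp
    rw [this]
    field_simp
    ring
  rw [hid]
  have t1 : ‖-(n * (Complex.sin (w n) - w n))‖ ≤ B * ‖w n‖ := by
    rw [norm_neg, norm_mul, Complex.norm_natCast]
    calc _ ≤ n * ‖w n‖ ^ 2 := by gcongr; exact norm_sin_sub_self_le hw1
      _ = n * ‖w n‖ * ‖w n‖ := by ring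
      _ ≤ n * (B / n) * ‖w n‖ := by gcongr
      _ = _ := by field_simp
  have t2 : ‖(n / z) * (w n / (Real.pi * n) * (Q₁ q h / q 1 + s * (Q₂ q h / q 1)) +
      Q₁ q h / q 1 * (1 - Complex.cos (w n)))‖ ≤ (2 * a₁ + a₂) * ‖w n‖ := by
    rw [norm_mul]
    have h6 : ‖(n : ℂ) / z‖ ≤ 1 := by
      rw [norm_div, Complex.norm_natCast, div_le_one (norm_pos_iff.2 hz0)]; exact hnz
    refine (mul_le_of_le_one_left (norm_nonneg _) h6).trans ?_
    refine (norm_add_le _ _).trans ?_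
    have h7 : ‖w n / (Real.pi * n : ℂ)‖ ≤ ‖w n‖ := by
      rw [norm_div, norm_mul, Complex.norm_real, Complex.norm_natCast,
        Real.norm_of_nonneg Real.pi_pos.le]
      exact div_le_self (norm_nonneg _) (by nlinarith [Real.pi_gt_three])
    have h8 : ‖(Q₁ q h : ℂ) / q 1 + s * (Q₂ q h / q 1)‖ ≤ a₁ + a₂ := by
      refine (norm_add_le _ _).trans ?_
      rw [norm_mul, hsn, one_mul]
    rw [norm_mul, norm_mul]
    calc _ ≤ ‖w n‖ * (a₁ + a₂) + a₁ * ‖w n‖ := by gcongr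
      _ = _ := by ring
  have t3 : ‖n * (s * r)‖ ≤ A * (τ n + ‖w n‖) := by
    rw [norm_mul, norm_mul, hsn, one_mul, Complex.norm_natCast]
    calc _ ≤ n * (A * (τ n + ‖w n‖) / n) := by gcongr
      _ = _ := by field_simp
  have h9 := (norm_sub_le (-(n * (Complex.sin (w n) - w n)) +
        (n / z) * (w n / (Real.pi * n) * (Q₁ q h / q 1 + s * (Q₂ q h / q 1)) +
          Q₁ q h / q 1 * (1 - Complex.cos (w n)))) (n * (s * r))).trans
    (add_le_add (norm_add_le _ _) le_rfl)
  refine h9.trans ?_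
  change _ ≤ (B + (2 * a₁ + a₂)) * ‖w n‖ + A * (τ n + ‖w n‖)
  linarith

/-! ### Square roots of numbered zeros -/

lemma csqrt_eq_zero {l : ℂ} : csqrt l = 0 ↔ l = 0 := by
  rw [← sq_eq_zero_iff, csqrt_sq]

lemma csqrt_quadrant {l : ℂ} (hl : 0 ≤ l.im) : 0 ≤ (csqrt l).re ∧ 0 ≤ (csqrt l).im := by
  by_cases h0 : l = 0
  · rw [csqrt_eq_zero.2 h0]; simp
  have h1 : Complex.log l * (1 / 2) = ((Real.log ‖l‖ / 2 : ℝ) : ℂ) + (l.arg / 2 : ℝ) * Complex.I := by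
    rw [Complex.log]; push_cast; ring
  have h2 : 0 ≤ l.arg := Complex.arg_nonneg_iff.2 hl
  have h3 := Complex.arg_le_pi l
  have hpi := Real.pi_pos
  rw [csqrt, Complex.cpow_def_of_ne_zero h0, h1, Complex.exp_add, ← Complex.ofReal_exp,
    Complex.re_ofReal_mul, Complex.im_ofReal_mul, Complex.exp_ofReal_mul_I_re,
    Complex.exp_ofReal_mul_I_im]
  exact ⟨mul_nonneg (Real.exp_pos _).le (Real.cos_nonneg_of_mem_Icc ⟨by linarith, by linarith⟩),
    mul_nonneg (Real.exp_pos _).le (Real.sin_nonneg_of_nonneg_of_le_pi (by linarith) (by linarith))⟩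

lemma csqrt_conj {l : ℂ} (hl : l.im ≠ 0) : csqrt (conj l) = conj (csqrt l) := by
  have h1 : l.arg ≠ Real.pi := fun h => hl (Complex.arg_eq_pi_iff.1 h).2
  have h2 : conj (1 / 2 : ℂ) = 1 / 2 := by rw [map_div₀, map_one, Complex.conj_ofNat]
  rw [csqrt, csqrt, Complex.conj_cpow _ _ h1, h2]

/-- Every `l ≠ 0` has the two square roots `± csqrt l`, which are to be counted once each. -/
lemma count_csqrt_add_count_neg (s : Set ℕ) (u : ℕ → ℂ) {z : ℂ} (hz : z ≠ 0) :
    count s (fun n => csqrt (u n)) z + count s (fun n => -csqrt (u n)) z = count s u (z ^ 2) := by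
  rw [count, count, count, ← Set.encard_union_eq]
  · congr 1
    ext n
    simp only [Set.mem_union, Set.mem_ofPred_eq]
    rw [← and_or_left, neg_eq_iff_eq_neg, ← sq_eq_sq_iff_eq_or_eq_neg, csqrt_sq]
  · rw [Set.disjoint_left]
    rintro n ⟨-, h1⟩ ⟨-, h2⟩
    rw [h1, neg_eq_iff_add_eq_zero, ← two_mul] at h2
    exact hz ((mul_eq_zero.1 h2).resolve_left two_ne_zero)

lemma count_csqrt_zero (s : Set ℕ) (u : ℕ → ℂ) :
    count s (fun n => csqrt (u n)) 0 = count s u 0 ∧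
      count s (fun n => -csqrt (u n)) 0 = count s u 0 := by
  simp only [count, neg_eq_zero, csqrt_eq_zero, and_self]

lemma count_ne_zero {s : Set ℕ} {u : ℕ → ℂ} {z : ℂ} : count s u z ≠ 0 ↔ ∃ n ∈ s, u n = z := by
  rw [count, Set.encard_ne_zero]
  exact Iff.rfl

lemma analyticOrderAt_const_mul {a : ℂ} (ha : a ≠ 0) {f : ℂ → ℂ} (hf : Differentiable ℂ f) (z : ℂ) :
    analyticOrderAt (fun l => a * f l) z = analyticOrderAt f z := by
  have h1 : analyticOrderAt (fun _ : ℂ => a) z = 0 := analyticAt_const.analyticOrderAt_eq_zero.2 ha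
  rw [show (fun l => a * f l) = (fun _ => a) * f from rfl,
    analyticOrderAt_mul analyticAt_const (hf.analyticAt z), h1, zero_add]

lemma analyticOrderAt_comp_sq (f : ℂ → ℂ) {z : ℂ} (hz : z ≠ 0) :
    analyticOrderAt (fun k => f (k ^ 2)) z = analyticOrderAt f (z ^ 2) := by
  have hg : AnalyticAt ℂ (fun k : ℂ => k ^ 2) z := by fun_prop
  refine analyticOrderAt_comp_of_deriv_ne_zero (f := f) hg ?_
  simpa using hz

lemma analyticOrderAt_comp_sq_zero {f : ℂ → ℂ} (hf : Differentiable ℂ f) :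
    analyticOrderAt (fun k => f (k ^ 2)) 0 = analyticOrderAt f 0 * 2 := by
  have hg : AnalyticAt ℂ (fun k : ℂ => k ^ 2) 0 := by fun_prop
  have h0 : (0 : ℂ) ^ 2 = 0 := by simp
  have h1 := AnalyticAt.analyticOrderAt_comp (f := f) (g := fun k : ℂ => k ^ 2) (z₀ := 0)
    (hf.analyticAt _) hg
  simp only [h0] at h1
  refine h1.trans ?_
  congr 1
  have h2 : (fun k : ℂ => k ^ 2 - 0) = (id : ℂ → ℂ) ^ 2 := by ext k; simp
  rw [h2, analyticOrderAt_pow analyticAt_id, analyticOrderAt_id]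
  norm_num

lemma memlp_two_of_eventually_eq_const_mul {f g : ℕ → ℂ} (a : ℂ) (hg : Memℓp g 2)
    (h : ∀ᶠ n in atTop, f n = a * g n) : Memℓp f 2 :=
  memlp_two_of_eventually_le (hg.const_mul a).norm (h.mono fun n hn => by rw [hn])

/-! ### Numbering of the zeros of the leading function and of the eigenvalues -/

/-- The leading function is, up to the factor `4 I k q 1`, the function `S - c` at `k ^ 2`, where
`z * S (z ^ 2 / 4) = sin z`. -/
lemma g₁_eq {q : ℝ → ℝ} (hq1 : q 1 ≠ 0) {S : ℂ → ℂ} (hS : IsSinc S) (k : ℂ) :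
    g₁ q k = 4 * Complex.I * q 1 * (k * (S (k ^ 2) - ((-(omega q / q 1) : ℝ) : ℂ))) := by
  have h1 := hS.2 (2 * k)
  rw [show (2 * k) ^ 2 / 4 = k ^ 2 by ring, sin_eq_exp] at h1
  have hq1' : (q 1 : ℂ) ≠ 0 := by exact_mod_cast hq1
  have h2 : 2 * Complex.I * k = Complex.I * (2 * k) := by ring
  have h3 : -2 * Complex.I * k = -(Complex.I * (2 * k)) := by ring
  rw [g₁, h2, h3]
  generalize Complex.exp (-(Complex.I * (2 * k))) = a at h1 ⊢
  generalize Complex.exp (Complex.I * (2 * k)) = b at h1 ⊢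
  push_cast
  field_simp
  linear_combination (-2 * Complex.I * q 1) * h1 - (q 1 : ℂ) * (a - b) * Complex.I_sq

lemma IsSinc.conj {S : ℂ → ℂ} (hS : IsSinc S) (l : ℂ) : S (conj l) = conj (S l) := by
  obtain ⟨z, rfl⟩ := exists_sq_div_four_eq l
  have h4 : conj (z ^ 2 / 4) = conj z ^ 2 / 4 := by
    rw [map_div₀, map_pow]
    congr 1
    exact Complex.conj_ofNat 4
  rw [h4]
  by_cases hz : z = 0
  · have h1 := hS.deriv_eq 0
    simp only [ne_eq, OfNat.ofNat_ne_zero, not_false_eq_true, zero_pow, zero_div, zero_mul, add_zero,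
      Complex.cos_zero] at h1
    simp [hz, h1]
  · have h1 := hS.2 (conj z)
    rw [Complex.sin_conj, ← hS.2 z, map_mul] at h1
    exact mul_left_cancel₀ ((map_ne_zero _).2 hz) h1

lemma starIndices_eq (q : ℝ → ℝ) :
    starIndices q = {n | unpaired (-(omega q / q 1)) ≤ n} := by
  have h1 : q 1 / omega q < 0 ↔ 0 < -(omega q / q 1) := by
    rw [neg_pos, ← inv_div, inv_lt_zero]
  ext n
  simp only [starIndices, Set.mem_ofPred_eq, unpaired, h1]
  split_ifs with h <;> simp [h]

/-- Apart from the simple factor `k`, the zeros of `g₁` are the square roots of the zeros of `S -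
c`. A zero of `S - c` at `0` gives a zero of twice its order, in agreement with counting `csqrt 0`
and `-csqrt 0` separately. -/
lemma numbersLeadingZeros_csqrt {q : ℝ → ℝ} (hq1 : q 1 ≠ 0) {S : ℂ → ℂ} (hS : IsSinc S)
    {u v : ℕ → ℂ}
    (h : ∀ z, analyticOrderAt (fun l => S l - ((-(omega q / q 1) : ℝ) : ℂ)) z =
      count Set.univ u z + count (starIndices q) v z)
    (hu : ∀ n, 0 ≤ (u n).im) (hv : ∀ n, v n = conj (u n) ∨ ((u n).im = 0 ∧ (v n).im = 0)) :
    NumbersLeadingZeros q (fun n => csqrt (u n)) fun n => csqrt (v n) := by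
  have hG : Differentiable ℂ fun l => S l - ((-(omega q / q 1) : ℝ) : ℂ) := hS.1.sub_const _
  have hG2 : Differentiable ℂ fun k : ℂ => S (k ^ 2) - ((-(omega q / q 1) : ℝ) : ℂ) :=
    (hS.1.comp (differentiable_pow 2)).sub_const _
  have hid : Differentiable ℂ fun k : ℂ => k := differentiable_id
  have ha : 4 * Complex.I * (q 1 : ℂ) ≠ 0 := by simp [hq1]
  have hg : ∀ z, analyticOrderAt (g₁ q) z = analyticOrderAt (fun k : ℂ => k) z +
      analyticOrderAt (fun k : ℂ => S (k ^ 2) - ((-(omega q / q 1) : ℝ) : ℂ)) z := by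
    intro z
    rw [funext (g₁_eq hq1 hS)]
    refine (analyticOrderAt_const_mul ha (hid.mul hG2) z).trans ?_
    exact analyticOrderAt_mul (hid.analyticAt z) (hG2.analyticAt z)
  refine ⟨fun z => ?_, fun n => csqrt_quadrant (hu n), fun n _ => ?_⟩
  · rw [hg z]
    by_cases hz : z = 0
    · subst hz
      have h1 : analyticOrderAt (fun k : ℂ => k) 0 = 1 := analyticOrderAt_id
      rw [h1, analyticOrderAt_comp_sq_zero hG, h, (count_csqrt_zero _ u).1, (count_csqrt_zero _ u).2,
        (count_csqrt_zero _ v).1, (count_csqrt_zero _ v).2, if_pos rfl]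
      ring
    · have h1 : analyticOrderAt (fun k : ℂ => k) z = 0 :=
        (hid.analyticAt z).analyticOrderAt_eq_zero.2 hz
      rw [h1, analyticOrderAt_comp_sq (fun l => S l - ((-(omega q / q 1) : ℝ) : ℂ)) hz, h, if_neg hz, zero_add, add_zero,
        ← count_csqrt_add_count_neg _ u hz, ← count_csqrt_add_count_neg _ v hz, add_assoc, add_assoc,
        add_assoc]
  · simp only [csqrt_sq]
    rcases hv n with h1 | h1
    · by_cases h2 : (u n).im = 0
      · right
        rw [h1, Complex.conj_im, h2]; simp
      · left
        rw [h1, csqrt_conj h2]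
    · exact Or.inr h1

lemma numbersEigenvalues_of_order {q : ℝ → ℝ} (hq : ContinuousOn q (Set.Icc 0 1)) (hq1 : q 1 ≠ 0)
    (h : ℝ) {s t : Set ℕ} {u v : ℕ → ℂ}
    (H : ∀ z, analyticOrderAt (fun l => 2 / q 1 * charDelta q h l) z = count s u z + count t v z) :
    NumbersEigenvalues q h s t u v := by
  have hd := differentiable_charDelta hq h
  have ha : 2 / (q 1 : ℂ) ≠ 0 := by simp [hq1]
  have H' : ∀ z, analyticOrderAt (charDelta q h) z = count s u z + count t v z := fun z => by
    rw [← H z, analyticOrderAt_const_mul ha hd]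
  refine ⟨fun z => ?_, H'⟩
  rw [isTransmissionEigenvalue_iff hq, ← (hd.analyticAt z).analyticOrderAt_ne_zero, H' z,
    ← count_ne_zero, ← count_ne_zero, Ne, add_eq_zero, not_and_or]

lemma solvesSin_of_csqrt {Φ E : ℂ → ℂ} {c : ℝ}
    (hE : ∀ z, z * Φ (z ^ 2 / 4) = Complex.sin z - c * z + E z) {u w : ℕ → ℂ}
    (h : ∀ᶠ n : ℕ in atTop, Φ (u n) = 0 ∧ ‖w n‖ ≤ 1 / 4 ∧
      csqrt (u n) = (leadApprox c n + w n) / 2) :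
    SolvesSin c (fun n => E (leadApprox c n + w n)) w := by
  filter_upwards [h] with n hn
  refine ⟨hn.2.1, ?_⟩
  have h1 : (leadApprox c n + w n) ^ 2 / 4 = u n := by
    rw [← csqrt_sq (u n), hn.2.2]; ring
  rw [← hE, h1, hn.1, mul_zero]

/-- The numberings for `ω ≠ 0`: the eigenvalues and the squares of the zeros of `g₁` are, up to
finitely many, the zeros near the same numbers `leadApprox c n / 2`. -/
theorem exists_numbering_of_omega_ne_zero {q : ℝ → ℝ} (h : ℝ) (hq : SobolevOne q) (hq1 : q 1 ≠ 0)
    (hω : omega q ≠ 0) {c : ℝ} (hcq : c = -(omega q / q 1)) :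
    ∃ μ μs lam lams w w' : ℕ → ℂ, NumbersLeadingZeros q μ μs ∧
      NumbersEigenvalues q h Set.univ (starIndices q) lam lams ∧
      (∀ n, lams n = conj (lam n) ∨ ((lam n).im = 0 ∧ (lams n).im = 0)) ∧
      SolvesSin c (fun n => sinError q h (leadApprox c n + w n)) w ∧ SolvesSin c 0 w' ∧
      ∀ᶠ n in atTop, csqrt (lam n) = (leadApprox c n + w n) / 2 ∧
        μ n = (leadApprox c n + w' n) / 2 := by
  have hc : c ≠ 0 := by rw [hcq]; simp [hω, hq1]
  obtain ⟨S, hS⟩ := exists_isSinc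
  have hG : Differentiable ℂ fun l => S l - (c : ℂ) := hS.1.sub_const _
  have hGz : ∀ z, z * (S (z ^ 2 / 4) - (c : ℂ)) = Complex.sin z - c * z + 0 := fun z => by
    rw [mul_sub, hS.2]; ring
  have HG : SinAsymptotics (fun l => S l - (c : ℂ)) c := fun ε hε => ⟨0, fun z _ => by
    rw [hGz, add_zero, sub_self, norm_zero]; positivity⟩
  obtain ⟨u, v, w', h1, h2, h3, h4⟩ := HG.exists_numbering hS hG
    (fun z => by rw [hS.conj, map_sub, Complex.conj_ofReal]) hc
  have hd := differentiable_charDelta hq.continuousOn h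
  obtain ⟨U, V, w, h5, -, h7, h8⟩ :=
    (hcq ▸ hq.sinAsymptotics hq1 h : SinAsymptotics _ c).exists_numbering hS (hd.const_mul _)
    (fun z => by
      rw [map_mul, charDelta_conj hq.continuousOn, map_div₀, Complex.conj_ofReal, Complex.conj_ofNat])
    hc
  have hst : starIndices q = {n | unpaired c ≤ n} := hcq ▸ starIndices_eq q
  rw [← hst] at h1 h5
  refine ⟨fun n => csqrt (u n), fun n => csqrt (v n), U, V, w, w',
    numbersLeadingZeros_csqrt hq1 hS (hcq ▸ h1) h2 h3,
    numbersEigenvalues_of_order hq.continuousOn hq1 h h5, h7,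
    solvesSin_of_csqrt (Φ := fun l => 2 / q 1 * charDelta q h l) (E := sinError q h)
      (fun z => ?_) h8,
    solvesSin_of_csqrt (Φ := fun l => S l - (c : ℂ)) (E := 0) hGz h4, ?_⟩
  · rw [sinError, ← hcq]; ring
  · filter_upwards [h4, h8] with n h9 h10
    exact ⟨h10.2.2, h9.2.2⟩

/-- The numbering for `ω = 0`. -/
theorem exists_numbering_of_omega_eq_zero {q : ℝ → ℝ} (h : ℝ) (hq : SobolevOne q) (hq1 : q 1 ≠ 0)
    (hω : omega q = 0) :
    ∃ lam w : ℕ → ℂ, NumbersEigenvalues q h {n | 1 ≤ n} ∅ lam lam ∧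
      (∀ᶠ n : ℕ in atTop, ‖w n‖ ≤ 1 / 4 ∧ Complex.sin (((Real.pi * n : ℝ) : ℂ) + w n) +
        sinError q h (((Real.pi * n : ℝ) : ℂ) + w n) = 0) ∧
      ∀ᶠ n : ℕ in atTop, csqrt (lam n) = (((Real.pi * n : ℝ) : ℂ) + w n) / 2 := by
  have hd := differentiable_charDelta hq.continuousOn h
  obtain ⟨S, hS⟩ := exists_isSinc
  have H := hq.sinAsymptotics hq1 h
  rw [hω, zero_div, neg_zero] at H
  obtain ⟨u, w, h1, h2⟩ := H.exists_numbering_zero hS (hd.const_mul _)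
  refine ⟨u, w, numbersEigenvalues_of_order hq.continuousOn hq1 h fun z => ?_, ?_,
    h2.mono fun n hn => hn.2.2⟩
  · rw [h1, show count ∅ u z = 0 by simp [count], add_zero]
  · filter_upwards [h2] with n hn
    refine ⟨hn.2.1, ?_⟩
    have h3 : (((Real.pi * n : ℝ) : ℂ) + w n) ^ 2 / 4 = u n := by
      rw [← csqrt_sq (u n), hn.2.2]; ring
    rw [sinError, h3, hn.1, hω]
    simp

end TransmissionProblem

theorem theorem4p1 (q : ℝ → ℝ) (h : ℝ) (hq : TransmissionProblem.SobolevOne q) (hq1 : q 1 ≠ 0) :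
    (TransmissionProblem.omega q ≠ 0 →
      ∃ μ μs lam lams : ℕ → ℂ,
        TransmissionProblem.NumbersLeadingZeros q μ μs ∧
        (q 1 / TransmissionProblem.omega q < 0 →
          TransmissionProblem.LogAsymptotics (1 / 4)
            (-(q 1 / (2 * TransmissionProblem.omega q))) μ) ∧
        (0 < q 1 / TransmissionProblem.omega q →
          TransmissionProblem.LogAsymptotics (3 / 4)
            (q 1 / (2 * TransmissionProblem.omega q)) μ) ∧
        TransmissionProblem.NumbersEigenvalues q h Set.univ
          (TransmissionProblem.starIndices q) lam lams ∧
        (∀ n ∈ TransmissionProblem.starIndices q, lams n = (starRingEnd ℂ) (lam n) ∨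
          ((lam n).im = 0 ∧ (lams n).im = 0)) ∧
        (∃ ε : ℕ → ℂ, Memℓp ε 2 ∧
          ∀ n, TransmissionProblem.csqrt (lam n) = μ n + ε n) ∧
        (TransmissionProblem.SobolevTwo q →
          ∃ β : ℕ → ℂ, Memℓp β 2 ∧ ∀ n : ℕ, 1 ≤ n →
            TransmissionProblem.csqrt (lam n) =
              μ n - TransmissionProblem.Q₁ q h / (4 * n * Real.pi * q 1) + β n / n)) ∧
    (TransmissionProblem.omega q = 0 →
      ∃ lam : ℕ → ℂ,
        TransmissionProblem.NumbersEigenvalues q h {n | 1 ≤ n} ∅ lam lam ∧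
        (∃ α : ℕ → ℂ, Memℓp α 2 ∧ ∀ n : ℕ, 1 ≤ n →
          TransmissionProblem.csqrt (lam n) = n * Real.pi / 2 + α n) ∧
        (TransmissionProblem.SobolevTwo q →
          ∃ κ : ℕ → ℂ, Memℓp κ 2 ∧ ∀ n : ℕ, 1 ≤ n →
            TransmissionProblem.csqrt (lam n) =
              n * Real.pi / 2
                - (TransmissionProblem.Q₁ q h + (-1) ^ n * TransmissionProblem.Q₂ q h)
                    / (2 * q 1 * n * Real.pi)
                + κ n / n)) := by
  open TransmissionProblem in
  constructor
  · intro hω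
    obtain ⟨c, hcq⟩ : ∃ c : ℝ, c = -(omega q / q 1) := ⟨_, rfl⟩
    have hc : c ≠ 0 := by rw [hcq]; simp [hω, hq1]
    obtain ⟨μ, μs, lam, lams, w, w', h1, h2, h3, h4, h5, h6⟩ :=
      exists_numbering_of_omega_ne_zero h hq hq1 hω hcq
    -- `leadShift c / (2 * π)` is `θ`, and `1 / (2 * |c|)` is `a`.
    have hlog := h5.logAsymptotics hc (h6.mono fun n hn => hn.2)
    have hpi : Real.pi ≠ 0 := Real.pi_ne_zero
    -- `ε` and `β` are defined by their equations, so that only square summability is left, which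
    -- finitely many indices do not affect.
    refine ⟨μ, μs, lam, lams, h1, fun hneg => ?_, fun hpos => ?_, h2, fun n _ => h3 n,
      ⟨fun n => csqrt (lam n) - μ n, ?_, fun n => by ring⟩, fun hq2 =>
      ⟨fun n => n * (csqrt (lam n) - μ n + Q₁ q h / (4 * n * Real.pi * q 1)), ?_, fun n hn => ?_⟩⟩
    · have hc0 : 0 < c := by
        rw [hcq, neg_pos, ← inv_div, inv_lt_zero]; exact hneg
      have e1 : leadShift c / (2 * Real.pi) = 1 / 4 := by
        rw [leadShift, if_pos hc0]; field_simp; norm_num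
      have e2 : 1 / (2 * |c|) = -(q 1 / (2 * omega q)) := by
        rw [abs_of_pos hc0, hcq]; field_simp
      rwa [e1, e2] at hlog
    · have hc0 : c < 0 := by
        rw [hcq, neg_lt_zero, ← inv_div, inv_pos]; exact hpos
      have e1 : leadShift c / (2 * Real.pi) = 3 / 4 := by
        rw [leadShift, if_neg hc0.not_gt]; field_simp; norm_num
      have e2 : 1 / (2 * |c|) = q 1 / (2 * omega q) := by
        rw [abs_of_neg hc0, hcq]; field_simp
      rwa [e1, e2] at hlog
    · refine memlp_two_of_eventually_eq_const_mul (1 / 2) (hq.memlp_sub hq1 h hc h4 h5) ?_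
      filter_upwards [h6] with n hn
      rw [hn.1, hn.2]; ring
    · refine memlp_two_of_eventually_eq_const_mul (1 / 2)
        (hq2.memlp_natCast_mul hq hq1 h hc h4 h5) ?_
      filter_upwards [h6] with n hn
      rw [hn.1, hn.2]; ring
    · have hn' : (n : ℂ) ≠ 0 := by exact_mod_cast (Nat.one_le_iff_ne_zero.1 hn)
      rw [mul_div_cancel_left₀ _ hn']; ring
  · intro hω
    obtain ⟨lam, w, h1, h2, h3⟩ := exists_numbering_of_omega_eq_zero h hq hq1 hω
    refine ⟨lam, h1, ⟨fun n => csqrt (lam n) - n * Real.pi / 2, ?_, fun n _ => by ring⟩, fun hq2 =>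
      ⟨fun n => n * (csqrt (lam n) - n * Real.pi / 2 +
        (Q₁ q h + (-1) ^ n * Q₂ q h) / (2 * q 1 * n * Real.pi)), ?_, fun n hn => ?_⟩⟩
    · refine memlp_two_of_eventually_eq_const_mul (1 / 2) (hq.memlp_of_sin_add_eq_zero hq1 h h2).2 ?_
      filter_upwards [h3] with n hn
      rw [hn]; push_cast; ring
    · refine memlp_two_of_eventually_eq_const_mul (1 / 2)
        (hq2.memlp_natCast_mul_of_sin_add_eq_zero hq hq1 hω h h2) ?_
      filter_upwards [h3] with n hn
      rw [hn]; push_cast; ring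
    · have hn' : (n : ℂ) ≠ 0 := by exact_mod_cast (Nat.one_le_iff_ne_zero.1 hn)
      rw [mul_div_cancel_left₀ _ hn']; ring
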